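/- Let $0<T<\infty$, $\Omega=\{(x,t): 0\le x<\infty,\ 0\le t<T\}$, and let $u\in C^3(\Omega;\mathbb R)$ solve the Degasperis–Procesi equation $u_t-u_{txx}+3u_x+4uu_x-3u_xu_{xx}-uu_{xxx}=0$ in $\Omega$. Assume that $|u|,|u_x|,|u_{xx}|\le h(x)$ on $\Omega$ for some non-increasing integrable $h:[0,\infty)\to\mathbb R$. Put $q^3=u-u_{xx}+1$, $\omega=e^{2\pi i/3}$, $\lambda=\frac{1}{3\sqrt3}(k^3+k^{-3})$ and, for $j=1,2,3$, $$l_j(k)=\tfrac1{\sqrt3}\Bigl(\omega^jk+\tfrac1{\omega^jk}\Bigr),\qquad z_j(k)=\sqrt3\,\frac{(\omega^jk)^2+(\omega^jk)^{-2}}{k^3+k^{-3}},\qquad P(k)=\begin{pmatrix}1&1&1\\ l_1&l_2&l_3\\ l_1^2&l_2^2&l_3^2\end{pmatrix},$$ $\mathcal L=\mathrm{diag}(l_1,l_2,l_3)$, $\mathcal Z=\mathrm{diag}(z_1,z_2,z_3)$, $$V_1=P^{-1}\begin{pmatrix}0&0&0\\0&0&0\\ \lambda(q^3-1)&0&0\end{pmatrix}P,\qquad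 V_2=P^{-1}\begin{pmatrix}u_x&-u&0\\u&0&-u\\u_x-\lambda uq^3&0&-u_x\end{pmatrix}P .$$ Let $D_1,\dots,D_{18}\subset\mathbb C\setminus\{0\}$ be the sets on which $\mathrm{Re}\,l_1,\mathrm{Re}\,l_2,\mathrm{Re}\,l_3$ and $\mathrm{Re}\,z_1,\mathrm{Re}\,z_2,\mathrm{Re}\,z_3$ are strictly ordered as follows (an entry $abc\,|\,def$ means $\mathrm{Re}\,l_a<\mathrm{Re}\,l_b<\mathrm{Re}\,l_c$ and $\mathrm{Re}\,z_d<\mathrm{Re}\,z_e<\mathrm{Re}\,z_f$), for $n=1,\dots,18$ in this order: $123|123$, $132|132$, $312|312$, $321|321$, $231|231$, $213|213$, $123|213$, $123|132$, $132|123$, $132|312$, $312|132$, $312|321$, $321|312$, $321|231$, $231|321$, $231|213$, $213|231$, $213|123$. For $(x,t)\in\Omega$ let $\gamma_1,\gamma_2$ be the contours from $(0,T)$, respectively $(0,0)$, along $x=0$ to $(0,t)$ and then horizontally to $(x,t)$, and let $\gamma_3$ be the horizontal contour from $(\infty,t)$ to $(x,t)$. Put $\gamma^n_{ij}=\gamma_3$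 if $\mathrm{Re}\,l_i\ge\mathrm{Re}\,l_j$ on $D_n$; otherwise $\gamma^n_{ij}=\gamma_2$ if $\mathrm{Re}\,z_i<\mathrm{Re}\,z_j$ on $D_n$ and $\gamma^n_{ij}=\gamma_1$ if $\mathrm{Re}\,z_i\ge\mathrm{Re}\,z_j$ on $D_n$. The $n$-th eigenfunction at $k$ is a solution $\Phi_n(\cdot,\cdot,k):\Omega\to\mathbb C^{3\times3}$ of the Lax pair $\Phi_x-[\mathcal L,\Phi]=V_1\Phi$, $\Phi_t-[\mathcal Z,\Phi]=V_2\Phi$ that satisfies, with absolutely convergent integrals, for all $(x,t)\in\Omega$ and $i,j=1,2,3$, $$(\Phi_n)_{ij}(x,t,k)=\delta_{ij}+\int_{\gamma^n_{ij}}e^{(l_i-l_j)(x-x')+(z_i-z_j)(t-t')}\bigl((V_1\,dx'+V_2\,dt')\Phi_n\bigr)_{ij}(x',t',k).\qquad(*)$$ For solutions of the Lax pair the one-form in $(*)$ is closed, so that $(*)$ can be posed on the boundary $\{t=0\}\cup\{x=0\}$ of $\Omega$, a curve that contains the paths from the base points $(0,T)$, $(0,0)$, $(\infty,0)$ to all of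 its points; let $f_n(k)$ be the Fredholm determinant of the resulting linear integral equation (defined by its Fredholm series). Let $E=\{0\}\cup\{k: k^6=1\}$, $\mathcal K=\{k:k^6=-1\}$ (the zeros of $\lambda$, where the $z_j$ have poles), and $Z_n=\{k\in\bar D_n\setminus(E\cup\mathcal K): f_n(k)=0\}$, the closure being taken in $\mathbb C$. Then for each $n=1,\dots,18$: 1. $Z_n$ is relatively closed in $\bar D_n\setminus E$ and has no accumulation point in $D_n$; more generally it has no accumulation point $k\in\bar D_n$ with $k^3\notin\mathbb R$. If moreover $|u|,|u_x|,|u_{xx}|\le Ce^{-\delta x}$ on $\Omega$ for some $C$ and some $\delta>0$, then $Z_n$ has no accumulation point in $\bar D_n\setminus E$. 2. For every $k\in\bar D_n\setminus(E\cup\mathcal K\cup Z_n)$ there is exactly one $n$-th eigenfunction $\Phi_n(\cdot,\cdot,k)$ on $\Omega$. 3. For each fixed $(x,t)\in\Omega$, $k\mapsto\Phi_n(x,t,k)$ is analytic in $D_n\setminus Z_n$, extends continuously to $\bar D_n\setminus(E\cup Z_n)$ (in particular to the points of $\mathcal K\cap\bar D_n$), and the extension is bounded away from $\{0,\infty\}\cup\{k:k^6=1\}\cup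 Z_n$, that is, on every compact subset of $\bar D_n\setminus(E\cup Z_n)$. -/

import Mathlib

open Set Filter Topology MeasureTheory

noncomputable section

namespace DP

/-! ### The Degasperis–Procesi equation on the half-line (with `κ = 1`) -/

/-- The half-line domain `{(x, t) : 0 ≤ x < ∞, 0 ≤ t < T}`. -/
def Omega (T : ℝ) : Set (ℝ × ℝ) := Ici 0 ×ˢ Ico 0 T

/-- Partial derivative in `x` (one-sided on the boundary `x = 0`). -/
def dx (f : ℝ → ℝ → ℝ) (x t : ℝ) : ℝ := derivWithin (fun y => f y t) (Ici 0) x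

/-- Partial derivative in `t` (one-sided at `t = 0`). -/
def dt (T : ℝ) (f : ℝ → ℝ → ℝ) (x t : ℝ) : ℝ := derivWithin (fun s => f x s) (Ico 0 T) t

/-- `q³ = u - u_xx + 1`; only the cube of `q` enters below. -/
def qCubed (u : ℝ → ℝ → ℝ) (x t : ℝ) : ℝ := u x t - dx (dx u) x t + 1

/-- `|u|`, `|u_x|`, `|u_xx|` are bounded by `h x` on the half-line domain. -/
def BoundedBy (T : ℝ) (u : ℝ → ℝ → ℝ) (h : ℝ → ℝ) : Prop :=
  ∀ x t, (x, t) ∈ Omega T →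
    |u x t| ≤ h x ∧ |dx u x t| ≤ h x ∧ |dx (dx u) x t| ≤ h x

/-- A classical solution of
`u_t - u_txx + 3 u_x + 4 u u_x - 3 u_x u_xx - u u_xxx = 0` in the half-line domain, which together
with `u_x` and `u_xx` decays as `x → ∞` at an integrable rate, uniformly in `t`. -/
structure IsSolution (T : ℝ) (u : ℝ → ℝ → ℝ) : Prop where
  smooth : ContDiffOn ℝ 3 (fun p : ℝ × ℝ => u p.1 p.2) (Omega T)
  equation : ∀ x t, (x, t) ∈ Omega T →
    dt T u x t - dt T (dx (dx u)) x t + 3 * dx u x t + 4 * u x t * dx u x t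
      - 3 * dx u x t * dx (dx u) x t - u x t * dx (dx (dx u)) x t = 0
  decay : ∃ h : ℝ → ℝ, AntitoneOn h (Ici 0) ∧ IntegrableOn h (Ici 0) ∧ BoundedBy T u h

/-- Exponential decay as `x → ∞`, uniformly in `t`. -/
def ExpDecay (T : ℝ) (u : ℝ → ℝ → ℝ) : Prop :=
  ∃ C δ : ℝ, 0 < δ ∧ BoundedBy T u (fun x => C * Real.exp (-δ * x))

/-! ### The Lax pair.  The index `j = 1, 2, 3` is represented by `0, 1, 2 : Fin 3`. -/

/-- `ω = exp(2πi/3)`. -/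
def omega : ℂ := Complex.exp (2 * Real.pi * Complex.I / 3)

def lam (k : ℂ) : ℂ := (k ^ 3 + 1 / k ^ 3) / (3 * (Real.sqrt 3 : ℂ))

def l (k : ℂ) (j : Fin 3) : ℂ :=
  (omega ^ (j.val + 1) * k + 1 / (omega ^ (j.val + 1) * k)) / (Real.sqrt 3 : ℂ)

def z (k : ℂ) (j : Fin 3) : ℂ :=
  (Real.sqrt 3 : ℂ) * (((omega ^ (j.val + 1) * k) ^ 2 + 1 / (omega ^ (j.val + 1) * k) ^ 2)
    / (k ^ 3 + 1 / k ^ 3))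

def P (k : ℂ) : Matrix (Fin 3) (Fin 3) ℂ := Matrix.of fun i j => l k j ^ i.val

def V₁ (u : ℝ → ℝ → ℝ) (k : ℂ) (x t : ℝ) : Matrix (Fin 3) (Fin 3) ℂ :=
  (P k)⁻¹ * !![0, 0, 0; 0, 0, 0; lam k * ((qCubed u x t : ℂ) - 1), 0, 0] * P k

def V₂ (u : ℝ → ℝ → ℝ) (k : ℂ) (x t : ℝ) : Matrix (Fin 3) (Fin 3) ℂ :=
  (P k)⁻¹ *
    !![(dx u x t : ℂ), -(u x t : ℂ), 0;
       (u x t : ℂ), 0, -(u x t : ℂ);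
       (dx u x t : ℂ) - lam k * (u x t : ℂ) * (qCubed u x t : ℂ), 0, -(dx u x t : ℂ)] * P k

/-- The matrix `[diag a, M]`. -/
def bracket (a : Fin 3 → ℂ) (M : Matrix (Fin 3) (Fin 3) ℂ) : Matrix (Fin 3) (Fin 3) ℂ :=
  Matrix.diagonal a * M - M * Matrix.diagonal a

/-- `Φ` solves `Φ_x - [ℒ, Φ] = V₁ Φ`, `Φ_t - [𝒵, Φ] = V₂ Φ` in the half-line domain
(derivatives of the entries; one-sided on the boundary). -/
def SolvesLax (T : ℝ) (u : ℝ → ℝ → ℝ) (k : ℂ) (Φ : ℝ → ℝ → Matrix (Fin 3) (Fin 3) ℂ) : Prop :=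
  ∀ x t, (x, t) ∈ Omega T → ∀ i j,
    HasDerivWithinAt (fun y => Φ y t i j)
      ((bracket (l k) (Φ x t) + V₁ u k x t * Φ x t) i j) (Ici 0) x ∧
    HasDerivWithinAt (fun s => Φ x s i j)
      ((bracket (z k) (Φ x t) + V₂ u k x t * Φ x t) i j) (Ico 0 T) t

/-! ### The sets `D₁, …, D₁₈` (indexed by `0, …, 17 : Fin 18`) -/

/-- Increasing order of `Re l₁, Re l₂, Re l₃` on each of the eighteen sets. -/
def lOrder : Fin 18 → Fin 3 → Fin 3 :=
  ![![0, 1, 2], ![0, 2, 1], ![2, 0, 1], ![2, 1, 0], ![1, 2, 0], ![1, 0, 2],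
    ![0, 1, 2], ![0, 1, 2], ![0, 2, 1], ![0, 2, 1], ![2, 0, 1], ![2, 0, 1],
    ![2, 1, 0], ![2, 1, 0], ![1, 2, 0], ![1, 2, 0], ![1, 0, 2], ![1, 0, 2]]

/-- Increasing order of `Re z₁, Re z₂, Re z₃` on each of the eighteen sets. -/
def zOrder : Fin 18 → Fin 3 → Fin 3 :=
  ![![0, 1, 2], ![0, 2, 1], ![2, 0, 1], ![2, 1, 0], ![1, 2, 0], ![1, 0, 2],
    ![1, 0, 2], ![0, 2, 1], ![0, 1, 2], ![2, 0, 1], ![0, 2, 1], ![2, 1, 0],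
    ![2, 0, 1], ![1, 2, 0], ![2, 1, 0], ![1, 0, 2], ![1, 2, 0], ![0, 1, 2]]

/-- The set `D_n`.  The points `0` and the zeros of `λ`, where the formulas for `l` or `z` are
singular, do not belong to it: all three junk values coincide there. -/
def D (n : Fin 18) : Set ℂ :=
  {k | ((l k (lOrder n 0)).re < (l k (lOrder n 1)).re ∧
        (l k (lOrder n 1)).re < (l k (lOrder n 2)).re) ∧
       ((z k (zOrder n 0)).re < (z k (zOrder n 1)).re ∧
        (z k (zOrder n 1)).re < (z k (zOrder n 2)).re)}

/-- The finite exceptional points: `0` and the sixth roots of unity. -/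
def exceptional : Set ℂ := {0} ∪ {k | k ^ 6 = 1}

/-- The six zeros `K_j = exp(πij/3 - πi/6)` of `λ`, where `z` has poles. -/
def lamZeros : Set ℂ := {k | k ^ 6 = -1}

/-! ### The contours and the integral equation -/

/-- The three contours ending at `(x, t)`.
`one`: from `(0, T)` along `x = 0` to `(0, t)`, then horizontally to `(x, t)`;
`two`: from `(0, 0)` along `x = 0` to `(0, t)`, then horizontally to `(x, t)`;
`three`: from `(∞, t)` horizontally to `(x, t)`. -/
inductive Contour
  | one
  | two
  | three

/-- `i` stands before `j` in the list `σ`. -/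
def Precedes (σ : Fin 3 → Fin 3) (i j : Fin 3) : Prop := ∃ a b, a < b ∧ σ a = i ∧ σ b = j

open Classical in
/-- The contour `γⁿ_ij`: on `D_n`, `Re l_i < Re l_j` means that `i` precedes `j` in the order of
the `Re l`'s, and likewise for the `Re z`'s. -/
def contour (n : Fin 18) (i j : Fin 3) : Contour :=
  if Precedes (lOrder n) i j then
    if Precedes (zOrder n) i j then Contour.two else Contour.one
  else Contour.three

/-- The integral of the one-form `A dx' + B dt'` along the contour `c` ending at `(x, t)`. -/
def lineIntegral (T : ℝ) (A B : ℝ → ℝ → ℂ) (x t : ℝ) : Contour → ℂ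
  | Contour.one => (∫ t' in T..t, B 0 t') + ∫ x' in (0 : ℝ)..x, A x' t
  | Contour.two => (∫ t' in (0 : ℝ)..t, B 0 t') + ∫ x' in (0 : ℝ)..x, A x' t
  | Contour.three => -∫ x' in Ioi x, A x' t

/-- Absolute convergence of the preceding integral. -/
def LineIntegrable (T : ℝ) (A B : ℝ → ℝ → ℂ) (x t : ℝ) : Contour → Prop
  | Contour.one => IntervalIntegrable (B 0) volume T t ∧
      IntervalIntegrable (fun x' => A x' t) volume 0 x
  | Contour.two => IntervalIntegrable (B 0) volume 0 t ∧
      IntervalIntegrable (fun x' => A x' t) volume 0 x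
  | Contour.three => IntegrableOn (fun x' => A x' t) (Ioi x)

/-- The `(i, j)` entry of the matrix obtained by applying `exp(x ad ℒ + t ad 𝒵)` to `M`. -/
def conjEntry (k : ℂ) (x t : ℝ) (M : Matrix (Fin 3) (Fin 3) ℂ) (i j : Fin 3) : ℂ :=
  Complex.exp ((l k i - l k j) * x + (z k i - z k j) * t) * M i j

/-- `Φ` is an `n`-th eigenfunction at the spectral parameter `k`: a solution of the Lax pair that
satisfies the mixed-contour integral equation at every point of the half-line domain. -/
structure IsEigenfunction (T : ℝ) (u : ℝ → ℝ → ℝ) (n : Fin 18) (k : ℂ)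
    (Φ : ℝ → ℝ → Matrix (Fin 3) (Fin 3) ℂ) : Prop where
  lax : SolvesLax T u k Φ
  integrable : ∀ x t, (x, t) ∈ Omega T → ∀ i j,
    LineIntegrable T
      (fun x' t' => conjEntry k (x - x') (t - t') (V₁ u k x' t' * Φ x' t') i j)
      (fun x' t' => conjEntry k (x - x') (t - t') (V₂ u k x' t' * Φ x' t') i j)
      x t (contour n i j)
  equation : ∀ x t, (x, t) ∈ Omega T → ∀ i j,
    Φ x t i j = (1 : Matrix (Fin 3) (Fin 3) ℂ) i j + lineIntegral T
      (fun x' t' => conjEntry k (x - x') (t - t') (V₁ u k x' t' * Φ x' t') i j)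
      (fun x' t' => conjEntry k (x - x') (t - t') (V₂ u k x' t' * Φ x' t') i j)
      x t (contour n i j)

/-! ### The Fredholm determinant

Since the one-form in the integral equation is closed for solutions of the Lax pair, the equation
can be posed on the boundary of the half-line domain, on which every contour runs inside that
boundary.  We parametrize the boundary by `s ∈ (-T, ∞)`: `s ≥ 0` is the point `(s, 0)` and `s < 0`
is the point `(0, -s)`.  The base points `(0, T)`, `(0, 0)`, `(∞, 0)` of the three contours are
`s = -T`, `s = 0`, `s = ∞`. -/

/-- The Fredholm determinant `det (1 - K)` of the integral operator with kernel `K` on the measure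
space `(X, μ)`, given by its Fredholm series. -/
def fredholmDet {X : Type*} [MeasurableSpace X] (μ : Measure X) (K : X → X → ℂ) : ℂ :=
  ∑' m : ℕ, ((-1 : ℂ) ^ m / (m.factorial : ℂ)) *
    ∫ p : Fin m → X, (Matrix.of fun a b => K (p a) (p b)).det ∂(Measure.pi fun _ => μ)

/-- The coefficient of the one-form `V₁ dx + V₂ dt` along the boundary. -/
def boundaryV (u : ℝ → ℝ → ℝ) (k : ℂ) (s : ℝ) : Matrix (Fin 3) (Fin 3) ℂ :=
  if 0 ≤ s then V₁ u k s 0 else -V₂ u k 0 (-s)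

/-- The signed indicator of the part of the boundary between the base point of the contour and the
point `s`: the integral of `f` from the base point to `s` is `∫ s' > -T, orient c s s' * f s'`. -/
def orient (c : Contour) (s s' : ℝ) : ℂ :=
  match c with
  | Contour.one => if s' ≤ s then 1 else 0
  | Contour.two => if 0 ≤ s' ∧ s' ≤ s then 1 else if s ≤ s' ∧ s' ≤ 0 then -1 else 0
  | Contour.three => if s ≤ s' then -1 else 0

/-- The kernel of the integral equation for the `j`-th column of `Φ_n` on the boundary; the second
component of a point of `ℝ × Fin 3` is the row index. -/
def kernel (u : ℝ → ℝ → ℝ) (n : Fin 18) (k : ℂ) (j : Fin 3) (p p' : ℝ × Fin 3) : ℂ :=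
  orient (contour n p.2 j) p.1 p'.1 *
    conjEntry k (max p.1 0 - max p'.1 0) (max (-p.1) 0 - max (-p'.1) 0)
      (Matrix.of fun i _ => boundaryV u k p'.1 i p'.2) p.2 j

/-- The Fredholm determinant of the `n`-th integral equation.  The equation decouples into its
three columns, so that the determinant is the product of those of the columns. -/
def eigenDet (T : ℝ) (u : ℝ → ℝ → ℝ) (n : Fin 18) (k : ℂ) : ℂ :=
  ∏ j : Fin 3, fredholmDet ((volume.restrict (Ioi (-T))).prod Measure.count) (kernel u n k j)

/-- The set `{k_j}`: the zeros of the Fredholm determinant in the closure of `D_n`. -/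
def detZeros (T : ℝ) (u : ℝ → ℝ → ℝ) (n : Fin 18) : Set ℂ :=
  {k | k ∈ closure (D n) ∧ k ∉ exceptional ∧ k ∉ lamZeros ∧ eigenDet T u n k = 0}

end DP

end

noncomputable section

namespace DP

/-! ### Hadamard's inequality -/

/-! Each column of an eigenfunction is determined by its values on the boundary, parametrized by s
in (-T, ∞). On `closure (D n)` the choice of contours keeps the spatial exponentials bounded, and t
stays in a finite interval, so the boundary kernel K(p, p') is dominated by an integrable weight of
p' alone. Hadamard's inequality then bounds all Fredholm series bordered by a row and a column,
locally uniformly in the spectral parameter. Two identities carry the linear theory: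
`Dom.bSeries_row` shows that the first series M divided by the determinant d solves y = e + K y, and
`Dom.fredholmDet_mul_eq` shows that every bounded solution satisfies d y = M.

Existence and uniqueness are reduced to the boundary by `ColSol`: a bounded solution of the Lax pair
with prescribed behavior at the base points of its contours. `IsEigenfunction.colSol` and
`isEigenfunction_of_colSol` pass between eigenfunctions and such columns. If d ≠ 0, Fredholm's
solution satisfies the x-equation on t = 0 and the t-equation on x = 0 (`Field.colY_spec`). It is
continued into the domain by the propagator of the x-equation, and `compatibility`, whose zero
curvature hypothesis is the Degasperis–Procesi equation (`lax_zero_curvature`), yields the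
t-equation everywhere (`IsSolution.colSol`). Conversely d y = M fixes the boundary values, and the
x-equation fixes the rest (`IsEigenfunction.unique`).

The decisive analytic fact is that d tends to 1 at a zero K of λ in `closure (D n)`. There V₁
vanishes and V₂ couples only the middle row with the two outer rows, while the difference of the
corresponding z's blows up. By a Riemann–Lebesgue argument (`Field.tendsto_integral_pulse`) every
composition of the kernel with itself or with its border tends to zero pointwise, and this suffices
for the Fredholm series to collapse to its zeroth term (`tendsto_bSeries_sub_corner`). The
exponentials are not bounded near K as they stand. Conjugation by a scalar exponential changes no
determinant (`fredholmDet_shift`), and a reference row chosen by finite inspection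
(`exists_reference`) makes them bounded.

The determinant is analytic on the sector with strict order of the Re l's, away from its only zero K
of λ. Every `D n` has K in its closure (`exists_lamZero`) and the punctured sector is connected, so
d does not vanish identically and its zeros are isolated there. Under exponential decay a spatial
gauge extends analyticity across the bounding rays.

The same collapse gives the limit 1 of the eigenfunction at K. For columns without a contour from
(0, 0) the gauge may control M at t = 0 only. Such columns are invariant under time shifts
(`ColSol.shift`), which turns any t into an initial time. -/

open scoped ComplexOrder in
lemma det_sq_le_of_entry_le_one {N : ℕ} (A : Matrix (Fin N) (Fin N) ℂ) (hA : ∀ a b, ‖A a b‖ ≤ 1) :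
    ‖A.det‖ ^ 2 ≤ (N : ℝ) ^ N := by
  rcases Nat.eq_zero_or_pos N with rfl | hN
  · simp
  have hpsd := Matrix.posSemidef_conjTranspose_mul_self A
  have hH := hpsd.isHermitian
  set ev := hH.eigenvalues with hev
  have hev0 : ∀ i, 0 ≤ ev i := fun i => hpsd.eigenvalues_nonneg i
  have hdet : ‖A.det‖ ^ 2 = ∏ i, ev i := by
    have h := hH.det_eq_prod_eigenvalues
    rw [Matrix.det_mul, Matrix.det_conjTranspose] at h
    have h2 : ((‖A.det‖ ^ 2 : ℝ) : ℂ) = ((∏ i, ev i : ℝ) : ℂ) := by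
      push_cast
      rw [← Complex.conj_mul']
      exact h
    exact_mod_cast h2
  have htr : ∑ i, ev i ≤ (N : ℝ) ^ 2 := by
    have h := hH.trace_eq_sum_eigenvalues
    have h2 : (Matrix.trace (A.conjTranspose * A)) = ((∑ i, ∑ j, ‖A j i‖ ^ 2 : ℝ) : ℂ) := by
      simp only [Matrix.trace, Matrix.diag, Matrix.mul_apply, Matrix.conjTranspose_apply]
      push_cast
      refine Finset.sum_congr rfl fun i _ => Finset.sum_congr rfl fun j _ => ?_
      rw [← Complex.conj_mul']
      rfl
    rw [h2] at h
    have h3 : ∑ i, ev i = ∑ i, ∑ j, ‖A j i‖ ^ 2 := by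
      refine Complex.ofReal_injective (h.trans ?_).symm
      push_cast
      rfl
    rw [h3]
    calc ∑ i, ∑ j, ‖A j i‖ ^ 2 ≤ ∑ _i : Fin N, ∑ _j : Fin N, (1 : ℝ) := by
          refine Finset.sum_le_sum fun i _ => Finset.sum_le_sum fun j _ => ?_
          exact pow_le_one₀ (norm_nonneg _) (hA _ _)
      _ = (N : ℝ) ^ 2 := by simp [sq]
  have hNpos : (0 : ℝ) < N := by exact_mod_cast hN
  -- The arithmetic–geometric mean inequality for the eigenvalues of AᴴA: their product is the
  -- squared modulus of the determinant, their sum is the trace, at most N².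
  have h := Real.geom_mean_le_arith_mean_weighted Finset.univ (fun _ : Fin N => (1 / N : ℝ)) ev
    (fun _ _ => by positivity) (by simp; field_simp) (fun i _ => hev0 i)
  have h1 : ∏ i, ev i ^ (1 / N : ℝ) = (∏ i, ev i) ^ (1 / N : ℝ) :=
    Real.finsetProd_rpow _ _ (fun i _ => hev0 i) _
  rw [h1, ← Finset.mul_sum] at h
  have h2 : (∏ i, ev i) ^ (1 / N : ℝ) ≤ N := by
    refine h.trans ?_
    calc (1 / N : ℝ) * ∑ i, ev i ≤ (1 / N : ℝ) * (N : ℝ) ^ 2 := by gcongr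
      _ = N := by field_simp
  rw [hdet]
  have hp0 : 0 ≤ ∏ i, ev i := Finset.prod_nonneg fun i _ => hev0 i
  calc ∏ i, ev i = ((∏ i, ev i) ^ (1 / N : ℝ)) ^ N := by
        rw [← Real.rpow_natCast, ← Real.rpow_mul hp0]
        field_simp
        simp
    _ ≤ (N : ℝ) ^ N := by gcongr

/-- Hadamard's inequality for a matrix whose columns are bounded by `c`. -/
lemma norm_det_le_of_col_le {N : ℕ} (A : Matrix (Fin N) (Fin N) ℂ) (c : Fin N → ℝ)
    (hA : ∀ a b, ‖A a b‖ ≤ c b) : ‖A.det‖ ≤ √((N : ℝ) ^ N) * ∏ b, c b := by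
  -- A column with bound zero vanishes and has to be split off before the columns are scaled to
  -- entries of norm at most one.
  by_cases hc : ∃ b, c b = 0
  · obtain ⟨b, hb⟩ := hc
    rw [Matrix.det_eq_zero_of_column_eq_zero b fun a => norm_le_zero_iff.1 (hb ▸ hA a b),
      Finset.prod_eq_zero (Finset.mem_univ b) hb]
    simp
  push Not at hc
  rcases Nat.eq_zero_or_pos N with rfl | hN
  · simp
  have a0 : Fin N := ⟨0, hN⟩
  have hc0 : ∀ b, 0 < c b := fun b =>
    lt_of_le_of_ne ((norm_nonneg _).trans (hA a0 b)) (Ne.symm (hc b))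
  have hfac : A = (Matrix.of fun a b => A a b / (c b : ℂ)) * Matrix.diagonal fun b => (c b : ℂ) := by
    ext a b
    rw [Matrix.mul_diagonal, Matrix.of_apply,
      div_mul_cancel₀ _ (by exact_mod_cast hc b)]
  rw [hfac, Matrix.det_mul, Matrix.det_diagonal, norm_mul, norm_prod]
  have h1 := det_sq_le_of_entry_le_one (Matrix.of fun a b => A a b / (c b : ℂ)) (by
    intro a b
    rw [Matrix.of_apply, norm_div, Complex.norm_real, Real.norm_of_nonneg (hc0 b).le,
      div_le_one (hc0 b)]
    exact hA a b)
  have h2 : ∏ b, ‖(c b : ℂ)‖ = ∏ b, c b := by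
    refine Finset.prod_congr rfl fun b _ => ?_
    rw [Complex.norm_real, Real.norm_of_nonneg (hc0 b).le]
  rw [h2]
  gcongr
  · exact Finset.prod_nonneg fun b _ => (hc0 b).le
  · exact Real.le_sqrt_of_sq_le h1

/-- The coefficients of the majorant of a Fredholm series. -/
def hadCoef (m : ℕ) : ℝ := √(((m + 1 : ℕ) : ℝ) ^ (m + 1)) / m.factorial

lemma hadCoef_nonneg (m : ℕ) : 0 ≤ hadCoef m := by unfold hadCoef; positivity

/-- From n^n ≤ eⁿ n! with n = m + 1, Hadamard's square root costs only √(m!) up to geometric and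
linear factors, so that half of the factorial in the denominator survives. -/
lemma summable_hadCoef (W : ℝ) : Summable fun m => hadCoef m * W ^ m := by
  have hfac : ∀ m : ℕ, ((m + 1 : ℕ) : ℝ) ^ (m + 1) ≤
      Real.exp 1 ^ (m + 1) * (m + 1).factorial := by
    intro m
    have h := Real.pow_div_factorial_le_exp ((m + 1 : ℕ) : ℝ) (by positivity) (m + 1)
    rw [div_le_iff₀ (by positivity)] at h
    rwa [← Real.exp_nat_mul, mul_one]
  have hb : ∀ m : ℕ, ‖hadCoef m * W ^ m‖ ≤
      (Real.exp 1) ^ (m + 1) * (m + 1) * (|W| ^ m / √(m.factorial)) := by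
    intro m
    have hf : (0 : ℝ) < m.factorial := by positivity
    have he : (1 : ℝ) ≤ Real.exp 1 ^ (m + 1) := one_le_pow₀ (Real.one_le_exp zero_le_one)
    have h1 : √(((m + 1 : ℕ) : ℝ) ^ (m + 1)) ≤
        Real.exp 1 ^ (m + 1) * (m + 1) * √(m.factorial) := by
      refine Real.sqrt_le_iff.2 ⟨by positivity, (hfac m).trans ?_⟩
      rw [mul_pow, Real.sq_sqrt hf.le, Nat.factorial_succ]
      push_cast
      rw [← mul_assoc]
      gcongr
      · have : (1 : ℝ) ≤ Real.exp 1 ^ (m + 1) * (m + 1) :=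
          one_le_mul_of_one_le_of_one_le he (by linarith [(Nat.cast_nonneg m : (0 : ℝ) ≤ m)])
        nlinarith
    rw [norm_mul, norm_pow, Real.norm_eq_abs W, Real.norm_of_nonneg (hadCoef_nonneg m), hadCoef]
    calc √(((m + 1 : ℕ) : ℝ) ^ (m + 1)) / m.factorial * |W| ^ m
        ≤ (Real.exp 1 ^ (m + 1) * (m + 1) * √(m.factorial)) / m.factorial * |W| ^ m := by gcongr
      _ = _ := by
        have : (m.factorial : ℝ) = √(m.factorial) * √(m.factorial) := (Real.mul_self_sqrt hf.le).symm
        have h0 : √(m.factorial : ℝ) ≠ 0 := by positivity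
        rw [show (Real.exp 1 ^ (m + 1) * (m + 1) * √(m.factorial : ℝ)) / (m.factorial : ℝ)
          = (Real.exp 1 ^ (m + 1) * (m + 1)) / √(m.factorial : ℝ) by
            rw [div_eq_div_iff hf.ne' h0, mul_assoc, ← this]]
        ring
  refine Summable.of_norm_bounded ?_ hb
  -- Positivity of V keeps the terms nonzero, as the ratio test requires. Since |W| may vanish, the
  -- comparison is made with V = |W| + 1.
  have hmain : ∀ V : ℝ, 0 < V →
      Summable fun m : ℕ => (Real.exp 1) ^ (m + 1) * (m + 1) * (V ^ m / √(m.factorial)) := by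
    intro V hV
    refine summable_of_ratio_test_tendsto_lt_one (l := 0) one_pos
      (Eventually.of_forall fun m => by positivity) ?_
    have h2 : Tendsto (fun m : ℕ => (2 * Real.exp 1 * V) / √((m : ℝ) + 1)) atTop (𝓝 0) := by
      refine Tendsto.div_atTop tendsto_const_nhds ?_
      exact Real.tendsto_sqrt_atTop.comp
        (tendsto_atTop_add_const_right _ _ tendsto_natCast_atTop_atTop)
    refine squeeze_zero (fun m => by positivity) (fun m => ?_) h2
    rw [Real.norm_of_nonneg (by positivity), Real.norm_of_nonneg (by positivity), Nat.factorial_succ]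
    push_cast
    rw [Real.sqrt_mul (by positivity)]
    have hs : 0 < √((m : ℝ) + 1) := by positivity
    have hs2 : 0 < √(m.factorial : ℝ) := by positivity
    rw [div_le_div_iff₀ (by positivity) hs]
    have e1 : Real.exp 1 ^ (m + 1 + 1) * ((m : ℝ) + 1 + 1) *
        (V ^ (m + 1) / (√((m : ℝ) + 1) * √(m.factorial : ℝ))) * √((m : ℝ) + 1)
        = (Real.exp 1 ^ (m + 1) * V ^ m / √(m.factorial : ℝ)) * (Real.exp 1 * V) * (m + 1 + 1) := by
      field_simp
      ring
    have e2 : 2 * Real.exp 1 * V * (Real.exp 1 ^ (m + 1) * ((m : ℝ) + 1) *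
        (V ^ m / √(m.factorial : ℝ)))
        = (Real.exp 1 ^ (m + 1) * V ^ m / √(m.factorial : ℝ)) * (Real.exp 1 * V) * (2 * (m + 1)) := by
      ring
    rw [e1, e2]
    gcongr
    linarith [(Nat.cast_nonneg m : (0 : ℝ) ≤ m)]
  refine Summable.of_nonneg_of_le (fun m => by positivity) (fun m => ?_)
    (hmain (|W| + 1) (by positivity))
  gcongr
  linarith

/-! ### Bordered Fredholm determinants -/

section Fredholm

variable {X : Type*}

/-- The Fredholm matrix of the kernel `K` bordered by the row `r` and the column `e`. -/
def bMat {m : ℕ} (α : ℂ) (r e : X → ℂ) (K : X → X → ℂ) (p : Fin m → X) :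
    Matrix (Fin (m + 1)) (Fin (m + 1)) ℂ :=
  Matrix.of (Fin.cons (Fin.cons α fun b => r (p b))
    (fun a => Fin.cons (e (p a)) fun b => K (p a) (p b)))

variable {m : ℕ} {α : ℂ} {r e : X → ℂ} {K : X → X → ℂ}

@[simp] lemma bMat_zero_zero (p : Fin m → X) : bMat α r e K p 0 0 = α := rfl
@[simp] lemma bMat_zero_succ (p : Fin m → X) (b) : bMat α r e K p 0 (Fin.succ b) = r (p b) := rfl
@[simp] lemma bMat_succ_zero (p : Fin m → X) (a) : bMat α r e K p (Fin.succ a) 0 = e (p a) := rfl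
@[simp] lemma bMat_succ_succ (p : Fin m → X) (a b) :
    bMat α r e K p (Fin.succ a) (Fin.succ b) = K (p a) (p b) := rfl

lemma bMat_transpose (p : Fin m → X) :
    (bMat α r e K p).transpose = bMat α e r (fun x y => K y x) p := by
  ext a b
  refine Fin.cases ?_ (fun a => ?_) a <;> refine Fin.cases ?_ (fun b => ?_) b <;> rfl

lemma det_bMat_zero (p : Fin 0 → X) : (bMat α r e K p).det = α := by
  rw [Matrix.det_fin_one]; rfl

/-- Expansion of a bordered determinant along the bordering row. -/
lemma det_bMat_row (p : Fin (m + 1) → X) :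
    (bMat α r e K p).det = α * (Matrix.of fun a b => K (p a) (p b)).det
      - ∑ b, r (p b) * (bMat (e (p b)) (K (p b)) e K (fun c => p (b.succAbove c))).det := by
  rw [Matrix.det_succ_row_zero, Fin.sum_univ_succ, sub_eq_add_neg, ← Finset.sum_neg_distrib]
  congr 1
  · simp only [Fin.val_zero, pow_zero, one_mul, bMat_zero_zero]
    congr 2
  · refine Finset.sum_congr rfl fun b _ => ?_
    set N := (bMat α r e K p).submatrix Fin.succ (b.succ.succAbove) with hN
    -- The cofactor of r (p b) is again a bordered matrix once its row belonging to p b is cycled to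
    -- the top. The sign (-1)^b of the cycle against the Laplace sign (-1)^(b+1) leaves the minus
    -- sign of the expansion.
    have h : bMat (e (p b)) (K (p b)) e K (fun c => p (b.succAbove c)) =
        N.submatrix b.cycleRange.symm id := by
      ext a c
      have h1 : b.succ.succAbove (0 : Fin (m + 1)) = 0 := Fin.succ_succAbove_zero b
      refine Fin.cases ?_ (fun a => ?_) a <;> refine Fin.cases ?_ (fun c => ?_) c <;>
        simp [hN, Fin.cycleRange_symm_zero, Fin.cycleRange_symm_succ]
    rw [h, Matrix.det_permute, Equiv.Perm.sign_symm, Fin.sign_cycleRange]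
    simp only [bMat_zero_succ, Fin.val_succ, pow_succ]
    push_cast
    ring

/-- Expansion of a bordered determinant along the bordering column. -/
lemma det_bMat_col (p : Fin (m + 1) → X) :
    (bMat α r e K p).det = α * (Matrix.of fun a b => K (p a) (p b)).det
      - ∑ a, e (p a) * (bMat (r (p a)) r (fun x => K x (p a)) K
        (fun c => p (a.succAbove c))).det := by
  rw [← Matrix.det_transpose, bMat_transpose, det_bMat_row]
  congr 1
  · rw [← Matrix.det_transpose]; rfl
  · refine Finset.sum_congr rfl fun a _ => ?_
    rw [← Matrix.det_transpose, bMat_transpose]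

/-- Through the trivial border, all estimates for bordered series also apply to the Fredholm
determinant. -/
lemma det_bMat_one_zero_zero (p : Fin m → X) :
    (bMat 1 (fun _ => 0) (fun _ => 0) K p).det = (Matrix.of fun a b => K (p a) (p b)).det := by
  rcases m with _ | m
  · rw [det_bMat_zero]; simp
  · rw [det_bMat_row]; simp

/-- Conjugation of the kernel by a nowhere vanishing function. -/
lemma det_bMat_conj (p : Fin m → X) (φ : X → ℂ) (hφ : ∀ x, φ x ≠ 0) (c : ℂ) :
    (bMat (c * α) (fun x => c * r x * (φ x)⁻¹) (fun x => φ x * e x)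
      (fun x y => φ x * K x y * (φ y)⁻¹) p).det = c * (bMat α r e K p).det := by
  have h : bMat (c * α) (fun x => c * r x * (φ x)⁻¹) (fun x => φ x * e x)
      (fun x y => φ x * K x y * (φ y)⁻¹) p =
      Matrix.diagonal (Fin.cons c fun a => φ (p a)) * bMat α r e K p *
        Matrix.diagonal (Fin.cons 1 fun a => (φ (p a))⁻¹) := by
    ext a b
    rw [Matrix.mul_diagonal, Matrix.diagonal_mul]
    refine Fin.cases ?_ (fun a => ?_) a <;> refine Fin.cases ?_ (fun b => ?_) b <;> simp
  rw [h, Matrix.det_mul, Matrix.det_mul, Matrix.det_diagonal, Matrix.det_diagonal,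
    Fin.prod_univ_succ, Fin.prod_univ_succ]
  simp only [Fin.cons_zero, Fin.cons_succ, one_mul]
  rw [Finset.prod_inv_distrib]
  have : ∏ a, φ (p a) ≠ 0 := Finset.prod_ne_zero_iff.2 fun a _ => hφ _
  field_simp

/-- The bordered determinant is additive in the bordering column. -/
lemma det_bMat_add (p : Fin m → X) (α' : ℂ) (e' : X → ℂ) :
    (bMat (α + α') r (fun x => e x + e' x) K p).det =
      (bMat α r e K p).det + (bMat α' r e' K p).det := by
  rw [Matrix.det_succ_column_zero, Matrix.det_succ_column_zero (bMat α r e K p),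
    Matrix.det_succ_column_zero (bMat α' r e' K p), ← Finset.sum_add_distrib]
  refine Finset.sum_congr rfl fun a _ => ?_
  have h1 : (bMat (α + α') r (fun x => e x + e' x) K p).submatrix a.succAbove Fin.succ =
      (bMat α r e K p).submatrix a.succAbove Fin.succ := by
    ext i j
    simp only [Matrix.submatrix_apply]
    refine Fin.cases ?_ (fun a => ?_) (a.succAbove i) <;> rfl
  have h2 : (bMat α' r e' K p).submatrix a.succAbove Fin.succ =
      (bMat α r e K p).submatrix a.succAbove Fin.succ := by
    ext i j
    simp only [Matrix.submatrix_apply]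
    refine Fin.cases ?_ (fun a => ?_) (a.succAbove i) <;> rfl
  rw [h1, h2]
  refine Fin.cases ?_ (fun a => ?_) a
  · simp; ring
  · simp; ring

end Fredholm

set_option linter.unusedSectionVars false

/-! ### Bordered Fredholm series and their majorants -/

section Fredholm

variable {X : Type*} [MeasurableSpace X]

/-- The `m`-th term of the bordered Fredholm series. -/
def bTerm (μ : Measure X) (α : ℂ) (r e : X → ℂ) (K : X → X → ℂ) (m : ℕ) : ℂ :=
  ((-1 : ℂ) ^ m / (m.factorial : ℂ)) *
    ∫ p : Fin m → X, (bMat α r e K p).det ∂(Measure.pi fun _ => μ)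

/-- The Fredholm series of the kernel `K` bordered by the row `r` and the column `e`. -/
def bSeries (μ : Measure X) (α : ℂ) (r e : X → ℂ) (K : X → X → ℂ) : ℂ :=
  ∑' m : ℕ, bTerm μ α r e K m

/-- The kernel, the bordering row and the bordering column are measurable and dominated by the
weight `w` and the constant `C`. -/
structure Dom (w : X → ℝ) (C : ℝ) (α : ℂ) (r e : X → ℂ) (K : X → X → ℂ) : Prop where
  norm_corner : ‖α‖ ≤ C
  norm_row : ∀ x, ‖r x‖ ≤ w x
  norm_col : ∀ x, ‖e x‖ ≤ C
  norm_kernel : ∀ x y, ‖K x y‖ ≤ w y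
  meas_row : Measurable r
  meas_col : Measurable e
  meas_kernel : Measurable (Function.uncurry K)

lemma measurable_det {Y : Type*} [MeasurableSpace Y] {N : ℕ}
    (A : Y → Matrix (Fin N) (Fin N) ℂ) (hA : ∀ a b, Measurable fun y => A y a b) :
    Measurable fun y => (A y).det := by
  simp only [Matrix.det_apply]
  refine Finset.measurable_fun_sum _ fun σ _ => ?_
  exact (Finset.measurable_fun_prod _ fun i _ => hA _ _).const_smul _

lemma measurable_det_bMat {Y : Type*} [MeasurableSpace Y] {m : ℕ} {α : Y → ℂ} {r e : Y → X → ℂ}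
    {K : X → X → ℂ} {p : Y → Fin m → X} (hp : Measurable p) (hα : Measurable α)
    (hr : Measurable (Function.uncurry r)) (he : Measurable (Function.uncurry e))
    (hK : Measurable (Function.uncurry K)) :
    Measurable fun y => (bMat (α y) (r y) (e y) K (p y)).det := by
  have hp' : ∀ a, Measurable fun y => p y a := fun a => (measurable_pi_apply a).comp hp
  refine measurable_det _ fun a b => ?_
  refine Fin.cases ?_ (fun a => ?_) a <;> refine Fin.cases ?_ (fun b => ?_) b
  · simpa using hα
  · exact hr.comp (measurable_id.prodMk (hp' b))
  · exact he.comp (measurable_id.prodMk (hp' a))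
  · exact hK.comp ((hp' a).prodMk (hp' b))

variable {μ : Measure X} {w : X → ℝ} {C : ℝ} {α : ℂ} {r e : X → ℂ} {K : X → X → ℂ} {m : ℕ}

/-- Hadamard's inequality is used by columns: the bordering column costs C and the column of p b
costs w (p b). This is why a bound in the second variable of the kernel is enough. -/
lemma norm_det_bMat_le (hα : ‖α‖ ≤ C) (hr : ∀ x, ‖r x‖ ≤ w x) (he : ∀ x, ‖e x‖ ≤ C)
    (hK : ∀ x y, ‖K x y‖ ≤ w y) (p : Fin m → X) :
    ‖(bMat α r e K p).det‖ ≤ √(((m + 1 : ℕ) : ℝ) ^ (m + 1)) * (C * ∏ b, w (p b)) := by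
  have h := norm_det_le_of_col_le (bMat α r e K p) (Fin.cons C fun b => w (p b)) (by
    intro a b
    refine Fin.cases ?_ (fun a => ?_) a <;> refine Fin.cases ?_ (fun b => ?_) b
    · simpa using hα
    · simpa using hr _
    · simpa using he _
    · simpa using hK _ _)
  rwa [Fin.prod_univ_succ] at h

lemma Dom.const_nonneg (h : Dom w C α r e K) : 0 ≤ C := (norm_nonneg _).trans h.norm_corner

lemma Dom.weight_nonneg (h : Dom w C α r e K) (x : X) : 0 ≤ w x :=
  (norm_nonneg _).trans (h.norm_row x)

lemma Dom.measurable_det (h : Dom w C α r e K) (m : ℕ) :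
    Measurable fun p : Fin m → X => (bMat α r e K p).det :=
  measurable_det_bMat (Y := Fin m → X) (r := fun _ => r) (e := fun _ => e) measurable_id
    measurable_const (h.meas_row.comp measurable_snd) (h.meas_col.comp measurable_snd) h.meas_kernel

lemma Dom.norm_det_le (h : Dom w C α r e K) (p : Fin m → X) :
    ‖(bMat α r e K p).det‖ ≤ √(((m + 1 : ℕ) : ℝ) ^ (m + 1)) * (C * ∏ b, w (p b)) :=
  norm_det_bMat_le h.norm_corner h.norm_row h.norm_col h.norm_kernel p

/-- The determinant series is the one with trivial border. -/
lemma Dom.trivial_border (h : Dom w C α r e K) : Dom w 1 1 (fun _ => 0) (fun _ => 0) K :=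
  ⟨by simp, fun x => by simpa using h.weight_nonneg x, fun x => by simp, h.norm_kernel,
    measurable_const, measurable_const, h.meas_kernel⟩

/-- The same kernel and column, bordered by the row of the kernel at `x`. -/
lemma Dom.at_point (h : Dom w C α r e K) (x : X) : Dom w C (e x) (K x) e K :=
  ⟨h.norm_col x, h.norm_kernel x, h.norm_col, h.norm_kernel,
    h.meas_kernel.comp measurable_prodMk_left, h.meas_col, h.meas_kernel⟩

lemma fredholmDet_eq_bSeries : fredholmDet μ K = bSeries μ 1 (fun _ => 0) (fun _ => 0) K := by
  unfold fredholmDet bSeries bTerm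
  simp only [det_bMat_one_zero_zero]

variable [SigmaFinite μ]

lemma integrable_prod_weight (hw : Integrable w μ) (m : ℕ) :
    Integrable (fun p : Fin m → X => ∏ b, w (p b)) (Measure.pi fun _ => μ) :=
  Integrable.fintype_prod (f := fun _ : Fin m => w) fun _ => hw

lemma Dom.integrable_det (h : Dom w C α r e K) (hw : Integrable w μ) (m : ℕ) :
    Integrable (fun p : Fin m → X => (bMat α r e K p).det) (Measure.pi fun _ => μ) := by
  refine Integrable.mono' ((((integrable_prod_weight hw m).const_mul C).const_mul _))
    (h.measurable_det m).aestronglyMeasurable (Eventually.of_forall fun p => h.norm_det_le p)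

lemma Dom.norm_bTerm_le (h : Dom w C α r e K) (hw : Integrable w μ) (m : ℕ) :
    ‖bTerm μ α r e K m‖ ≤ C * (hadCoef m * (∫ x, w x ∂μ) ^ m) := by
  unfold bTerm
  rw [norm_mul]
  have h1 : ‖∫ p : Fin m → X, (bMat α r e K p).det ∂(Measure.pi fun _ => μ)‖ ≤
      √(((m + 1 : ℕ) : ℝ) ^ (m + 1)) * (C * (∫ x, w x ∂μ) ^ m) := by
    refine (norm_integral_le_of_norm_le
      ((((integrable_prod_weight hw m).const_mul C).const_mul _))
      (Eventually.of_forall fun p => h.norm_det_le p)).trans (le_of_eq ?_)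
    rw [integral_const_mul, integral_const_mul]
    have := integral_fintype_prod_eq_pow (ι := Fin m) (μ := μ) w
    rw [Fintype.card_fin] at this
    rw [this]
  have h2 : ‖(-1 : ℂ) ^ m / (m.factorial : ℂ)‖ = 1 / m.factorial := by
    rw [norm_div, norm_pow, norm_neg, norm_one, one_pow, Complex.norm_natCast]
  rw [h2]
  refine (mul_le_mul_of_nonneg_left h1 (by positivity)).trans (le_of_eq ?_)
  rw [hadCoef]
  ring

lemma summable_bound (C W : ℝ) : Summable fun m => C * (hadCoef m * W ^ m) :=
  (summable_hadCoef W).mul_left C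

lemma Dom.summable (h : Dom w C α r e K) (hw : Integrable w μ) :
    Summable fun m => bTerm μ α r e K m :=
  Summable.of_norm_bounded (summable_bound C _) (h.norm_bTerm_le hw)

/-- The majorant of the Fredholm series. -/
def majorant (W : ℝ) : ℝ := ∑' m, hadCoef m * W ^ m

lemma Dom.norm_bSeries_le (h : Dom w C α r e K) (hw : Integrable w μ) :
    ‖bSeries μ α r e K‖ ≤ C * majorant (∫ x, w x ∂μ) := by
  rw [majorant, ← tsum_mul_left]
  exact tsum_of_norm_bounded (summable_bound C _).hasSum (h.norm_bTerm_le hw)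

/-! ### Fredholm's identities -/

/-- The value does not depend on b, so the m + 1 terms of a determinant expansion have equal
integrals. The resulting factor m + 1 lowers the factorial of the series. -/
lemma integral_remove (b : Fin (m + 1)) (G : X × (Fin m → X) → ℂ) :
    ∫ p : Fin (m + 1) → X, G (p b, fun c => p (b.succAbove c)) ∂(Measure.pi fun _ => μ) =
      ∫ y, G y ∂(μ.prod (Measure.pi fun _ => μ)) :=
  (measurePreserving_piFinSuccAbove (fun _ : Fin (m + 1) => μ) b).integral_comp' G

lemma integrable_remove (b : Fin (m + 1)) (G : X × (Fin m → X) → ℂ)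
    (hG : Integrable G (μ.prod (Measure.pi fun _ => μ))) :
    Integrable (fun p : Fin (m + 1) → X => G (p b, fun c => p (b.succAbove c)))
      (Measure.pi fun _ => μ) :=
  (measurePreserving_piFinSuccAbove (fun _ : Fin (m + 1) => μ) b).integrable_comp_emb
    (MeasurableEquiv.measurableEmbedding _) |>.2 hG

lemma integrable_pointed_weight (hw : Integrable w μ) (m : ℕ) (c : ℝ) :
    Integrable (fun y : X × (Fin m → X) => w y.1 * (c * ∏ b, w (y.2 b)))
      (μ.prod (Measure.pi fun _ => μ)) :=
  Integrable.mul_prod hw ((integrable_prod_weight hw m).const_mul c)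

lemma Dom.meas_pointed (h : Dom w C α r e K) (m : ℕ) :
    Measurable fun y : X × (Fin m → X) => (bMat (e y.1) (K y.1) e K y.2).det :=
  measurable_det_bMat (Y := X × (Fin m → X)) (r := fun y => K y.1) (e := fun _ => e) measurable_snd
    (h.meas_col.comp measurable_fst)
    (h.meas_kernel.comp ((measurable_fst.comp measurable_fst).prodMk measurable_snd))
    (h.meas_col.comp measurable_snd) h.meas_kernel

lemma Dom.meas_pointed_col (h : Dom w C α r e K) (m : ℕ) :
    Measurable fun y : X × (Fin m → X) => (bMat (r y.1) r (fun x => K x y.1) K y.2).det :=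
  measurable_det_bMat (Y := X × (Fin m → X)) (r := fun _ => r) (e := fun y x => K x y.1)
    measurable_snd (h.meas_row.comp measurable_fst) (h.meas_row.comp measurable_snd)
    (h.meas_kernel.comp (measurable_snd.prodMk (measurable_fst.comp measurable_fst))) h.meas_kernel

lemma Dom.integrable_row (h : Dom w C α r e K) (hw : Integrable w μ) (m : ℕ) :
    Integrable (fun y : X × (Fin m → X) => r y.1 * (bMat (e y.1) (K y.1) e K y.2).det)
      (μ.prod (Measure.pi fun _ => μ)) := by
  refine Integrable.mono' (integrable_pointed_weight hw m (√(((m + 1 : ℕ) : ℝ) ^ (m + 1)) * C))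
    ((h.meas_row.comp measurable_fst).mul (h.meas_pointed m)).aestronglyMeasurable
    (Eventually.of_forall fun y => ?_)
  rw [norm_mul, mul_assoc]
  exact mul_le_mul (h.norm_row _) ((h.at_point y.1).norm_det_le y.2) (norm_nonneg _)
    (h.weight_nonneg _)

lemma Dom.integrable_col (h : Dom w C α r e K) (hw : Integrable w μ) (m : ℕ) :
    Integrable (fun y : X × (Fin m → X) => e y.1 * (bMat (r y.1) r (fun x => K x y.1) K y.2).det)
      (μ.prod (Measure.pi fun _ => μ)) := by
  refine Integrable.mono' (integrable_pointed_weight hw m (√(((m + 1 : ℕ) : ℝ) ^ (m + 1)) * C))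
    ((h.meas_col.comp measurable_fst).mul (h.meas_pointed_col m)).aestronglyMeasurable
    (Eventually.of_forall fun y => ?_)
  rw [norm_mul]
  have h1 := norm_det_bMat_le (h.norm_row y.1) h.norm_row (fun x => h.norm_kernel x y.1)
    h.norm_kernel y.2
  calc ‖e y.1‖ * ‖(bMat (r y.1) r (fun x => K x y.1) K y.2).det‖
      ≤ C * (√(((m + 1 : ℕ) : ℝ) ^ (m + 1)) * (w y.1 * ∏ b, w (y.2 b))) :=
        mul_le_mul (h.norm_col _) h1 (norm_nonneg _) h.const_nonneg
    _ = _ := by ring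

lemma coef_succ (m : ℕ) : ((-1 : ℂ) ^ (m + 1) / ((m + 1).factorial : ℂ)) * (m + 1) =
    -((-1 : ℂ) ^ m / (m.factorial : ℂ)) := by
  have h1 : ((m : ℂ) + 1) ≠ 0 := by exact_mod_cast Nat.succ_ne_zero m
  have h2 : (m.factorial : ℂ) ≠ 0 := by exact_mod_cast m.factorial_ne_zero
  rw [Nat.factorial_succ]
  push_cast
  field_simp
  ring

/-- The expansion `det_bMat_row`, integrated: the m + 1 summands contribute equally, and by
`coef_succ` this factor turns the coefficient of order m + 1 into minus that of order m, which
cancels the sign of the expansion. -/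
lemma Dom.bTerm_row (h : Dom w C α r e K) (hw : Integrable w μ) (m : ℕ) :
    bTerm μ α r e K (m + 1) = α * bTerm μ 1 (fun _ => 0) (fun _ => 0) K (m + 1)
      + ∫ q, r q * bTerm μ (e q) (K q) e K m ∂μ := by
  have hI := h.integrable_row hw m
  have e1 : ∫ p : Fin (m + 1) → X, (bMat α r e K p).det ∂(Measure.pi fun _ => μ) =
      α * ∫ p : Fin (m + 1) → X, (Matrix.of fun a b => K (p a) (p b)).det ∂(Measure.pi fun _ => μ)
      - (m + 1) * ∫ q, ∫ p : Fin m → X, r q * (bMat (e q) (K q) e K p).det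
        ∂(Measure.pi fun _ => μ) ∂μ := by
    simp_rw [det_bMat_row]
    have hdet := h.trivial_border.integrable_det hw (m + 1)
    simp only [det_bMat_one_zero_zero] at hdet
    rw [integral_sub (hdet.const_mul α)
      (integrable_finsetSum _ fun b _ => integrable_remove b _ hI), integral_const_mul,
      integral_finsetSum _ fun b _ => integrable_remove b _ hI]
    congr 1
    rw [Finset.sum_congr rfl fun b _ => integral_remove (μ := μ) b
      fun y : X × (Fin m → X) => r y.1 * (bMat (e y.1) (K y.1) e K y.2).det]
    rw [Finset.sum_const, Finset.card_univ, Fintype.card_fin, nsmul_eq_mul, integral_prod _ hI]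
    push_cast
    rfl
  unfold bTerm
  simp only [det_bMat_one_zero_zero]
  rw [e1, mul_sub, ← mul_assoc _ ((m : ℂ) + 1), coef_succ]
  simp_rw [integral_const_mul, mul_left_comm (r _)]
  rw [integral_const_mul]
  ring

lemma Dom.integrable_row_mul_col (h : Dom w C α r e K) (hw : Integrable w μ) :
    Integrable (fun q => r q * e q) μ := by
  refine Integrable.mono' (hw.mul_const C) (h.meas_row.mul h.meas_col).aestronglyMeasurable
    (Eventually.of_forall fun q => ?_)
  rw [norm_mul]
  exact mul_le_mul (h.norm_row _) (h.norm_col _) (norm_nonneg _) (h.weight_nonneg _)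

/-- The variable q occurs only in the bordering column, corner included, and the determinant is
linear in that column. The integration against e can therefore be performed inside it. -/
lemma Dom.integral_det_col (h : Dom w C α r e K) (hw : Integrable w μ) (p : Fin m → X) :
    ∫ q, e q * (bMat (r q) r (fun x => K x q) K p).det ∂μ =
      (bMat (∫ q, r q * e q ∂μ) r (fun x => ∫ q, K x q * e q ∂μ) K p).det := by
  rw [Matrix.det_succ_column_zero]
  simp_rw [Matrix.det_succ_column_zero (bMat (r _) r (fun x => K x _) K p), Finset.mul_sum]
  have hsub : ∀ (a : Fin (m + 1)) (α₁ α₂ : ℂ) (e₁ e₂ : X → ℂ),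
      (bMat α₁ r e₁ K p).submatrix a.succAbove Fin.succ =
      (bMat α₂ r e₂ K p).submatrix a.succAbove Fin.succ := by
    intro a α₁ α₂ e₁ e₂
    ext i j
    simp only [Matrix.submatrix_apply]
    refine Fin.cases ?_ (fun a => ?_) (a.succAbove i) <;> rfl
  have hterm : ∀ a : Fin (m + 1), ∀ q, e q * ((-1) ^ (a : ℕ) *
      bMat (r q) r (fun x => K x q) K p a 0 *
      ((bMat (r q) r (fun x => K x q) K p).submatrix a.succAbove Fin.succ).det) =
      (bMat (r q) r (fun x => K x q) K p a 0 * e q) * ((-1) ^ (a : ℕ) *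
      ((bMat 0 r (fun _ => 0) K p).submatrix a.succAbove Fin.succ).det) := by
    intro a q
    rw [hsub a (r q) 0 _ (fun _ => 0)]
    ring
  simp_rw [hterm]
  rw [integral_finsetSum]
  · refine Finset.sum_congr rfl fun a _ => ?_
    rw [integral_mul_const, hsub a (∫ q, r q * e q ∂μ) 0 (fun x => ∫ q, K x q * e q ∂μ) fun _ => 0]
    refine Fin.cases ?_ (fun a => ?_) a
    · simp only [bMat_zero_zero]; ring
    · simp only [bMat_succ_zero]; ring
  · intro a _
    refine Integrable.mul_const ?_ _
    refine Fin.cases ?_ (fun a => ?_) a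
    · simpa using h.integrable_row_mul_col hw
    · simpa using (h.at_point (p a)).integrable_row_mul_col hw

/-- The counterpart of `Dom.bTerm_row` for the column: lowering the order replaces the inhomogeneity
e by K e and leaves the row as it is. -/
lemma Dom.bTerm_col (h : Dom w C α r e K) (hw : Integrable w μ) (m : ℕ) :
    bTerm μ α r e K (m + 1) = α * bTerm μ 1 (fun _ => 0) (fun _ => 0) K (m + 1)
      + bTerm μ (∫ q, r q * e q ∂μ) r (fun x => ∫ q, K x q * e q ∂μ) K m := by
  have hI := h.integrable_col hw m
  have e1 : ∫ p : Fin (m + 1) → X, (bMat α r e K p).det ∂(Measure.pi fun _ => μ) =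
      α * ∫ p : Fin (m + 1) → X, (Matrix.of fun a b => K (p a) (p b)).det ∂(Measure.pi fun _ => μ)
      - (m + 1) * ∫ p : Fin m → X, ∫ q, e q * (bMat (r q) r (fun x => K x q) K p).det ∂μ
        ∂(Measure.pi fun _ => μ) := by
    simp_rw [det_bMat_col]
    have hdet := h.trivial_border.integrable_det hw (m + 1)
    simp only [det_bMat_one_zero_zero] at hdet
    rw [integral_sub (hdet.const_mul α)
      (integrable_finsetSum _ fun b _ => integrable_remove b _ hI), integral_const_mul,
      integral_finsetSum _ fun b _ => integrable_remove b _ hI]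
    congr 1
    rw [Finset.sum_congr rfl fun b _ => integral_remove (μ := μ) b
      fun y : X × (Fin m → X) => e y.1 * (bMat (r y.1) r (fun x => K x y.1) K y.2).det]
    rw [Finset.sum_const, Finset.card_univ, Fintype.card_fin, nsmul_eq_mul,
      integral_prod_symm _ hI]
    push_cast
    rfl
  unfold bTerm
  simp only [det_bMat_one_zero_zero]
  rw [e1, mul_sub, ← mul_assoc _ ((m : ℂ) + 1), coef_succ]
  simp_rw [h.integral_det_col hw]
  ring

lemma bTerm_zero : bTerm μ α r e K 0 = α := by
  unfold bTerm
  simp [measureReal_def]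

/-- Expansion of the bordered series along the row. -/
theorem Dom.bSeries_row (h : Dom w C α r e K) (hw : Integrable w μ) :
    Integrable (fun q => r q * bSeries μ (e q) (K q) e K) μ ∧
    bSeries μ α r e K = α * fredholmDet μ K + ∫ q, r q * bSeries μ (e q) (K q) e K ∂μ := by
  have hmeas : ∀ m, Measurable fun q => bTerm μ (e q) (K q) e K m := fun m =>
    ((h.meas_pointed m).stronglyMeasurable.integral_prod_right
      (ν := Measure.pi fun _ : Fin m => μ)).measurable.const_mul _
  have hbound : ∀ m q, ‖r q * bTerm μ (e q) (K q) e K m‖ ≤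
      w q * (C * (hadCoef m * (∫ x, w x ∂μ) ^ m)) := fun m q => by
    rw [norm_mul]
    exact mul_le_mul (h.norm_row q) ((h.at_point q).norm_bTerm_le hw m) (norm_nonneg _)
      (h.weight_nonneg q)
  have hInt : ∀ m, Integrable (fun q => r q * bTerm μ (e q) (K q) e K m) μ := fun m =>
    Integrable.mono' (hw.mul_const _) (h.meas_row.mul (hmeas m)).aestronglyMeasurable
      (Eventually.of_forall (hbound m))
  have hsum : Summable fun m => ∫ q, ‖r q * bTerm μ (e q) (K q) e K m‖ ∂μ := by
    refine Summable.of_nonneg_of_le (fun m => integral_nonneg fun q => norm_nonneg _)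
      (fun m => ?_) ((summable_bound C (∫ x, w x ∂μ)).mul_left (∫ x, w x ∂μ))
    refine (integral_mono (hInt m).norm (hw.mul_const _) (hbound m)).trans (le_of_eq ?_)
    rw [integral_mul_const]
  have hpt : ∀ q, ∑' m, r q * bTerm μ (e q) (K q) e K m = r q * bSeries μ (e q) (K q) e K :=
    fun q => tsum_mul_left
  have hS := hasSum_integral_of_summable_integral_norm hInt hsum
  simp_rw [hpt] at hS
  constructor
  · refine Integrable.mono' (hw.mul_const (C * majorant (∫ x, w x ∂μ))) ?_
      (Eventually.of_forall fun q => ?_)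
    · refine (h.meas_row.mul ?_).aestronglyMeasurable
      refine measurable_of_tendsto_metrizable (f := fun N q =>
        ∑ m ∈ Finset.range N, bTerm μ (e q) (K q) e K m)
        (fun N => Finset.measurable_fun_sum _ fun m _ => hmeas m) ?_
      rw [tendsto_pi_nhds]
      exact fun q => ((h.at_point q).summable hw).hasSum.tendsto_sum_nat
    · rw [norm_mul]
      exact mul_le_mul (h.norm_row q) ((h.at_point q).norm_bSeries_le hw) (norm_nonneg _)
        (h.weight_nonneg q)
  -- The zeroth terms are the corners α and 1; the other terms are matched one order apart by
  -- `Dom.bTerm_row`.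
  · have hf := h.trivial_border.summable hw
    rw [fredholmDet_eq_bSeries]
    unfold bSeries at *
    rw [(h.summable hw).tsum_eq_zero_add, hf.tsum_eq_zero_add, bTerm_zero, bTerm_zero]
    simp_rw [h.bTerm_row hw]
    rw [Summable.tsum_add (((summable_nat_add_iff 1).2 hf).mul_left α) hS.summable, tsum_mul_left,
      hS.tsum_eq]
    ring

/-- A bounded solution of `y = e + K y` is determined by the Fredholm series. -/
theorem Dom.fredholmDet_mul_eq {y : X → ℂ} {C' : ℝ} (h : Dom w C α r e K) (hw : Integrable w μ)
    (hy : Measurable y) (hyb : ∀ x, ‖y x‖ ≤ C')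
    (hyK : ∀ x, y x = e x + ∫ q, K x q * y q ∂μ) (x : X) :
    fredholmDet μ K * y x = bSeries μ (e x) (K x) e K := by
  have hC' : 0 ≤ C' := (norm_nonneg _).trans (hyb x)
  -- The series with inhomogeneity y is evaluated twice. Expansion along the column gives y x times
  -- the determinant plus the series of K y; linearity applied to y = e + K y gives the series of e
  -- plus the series of K y. The common term cancels.
  have hy' : Dom w C' (y x) (K x) y K :=
    ⟨hyb x, h.norm_kernel x, hyb, h.norm_kernel, h.meas_kernel.comp measurable_prodMk_left, hy,
      h.meas_kernel⟩
  have he := h.at_point x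
  have hd : Dom w (C' + C) (∫ q, K x q * y q ∂μ) (K x) (fun z => ∫ q, K z q * y q ∂μ) K := by
    have e1 : ∀ z, ∫ q, K z q * y q ∂μ = y z - e z := fun z => by rw [hyK z]; simp
    have e2 : ∀ z, ‖y z - e z‖ ≤ C' + C := fun z =>
      (norm_sub_le _ _).trans (add_le_add (hyb z) (h.norm_col z))
    simp_rw [e1]
    exact ⟨e2 x, h.norm_kernel x, e2, h.norm_kernel, h.meas_kernel.comp measurable_prodMk_left,
      hy.sub h.meas_col, h.meas_kernel⟩
  have hadd : ∀ m, bTerm μ (y x) (K x) y K m = bTerm μ (e x) (K x) e K m +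
      bTerm μ (∫ q, K x q * y q ∂μ) (K x) (fun z => ∫ q, K z q * y q ∂μ) K m := by
    intro m
    unfold bTerm
    rw [← mul_add, ← integral_add (he.integrable_det hw m) (hd.integrable_det hw m)]
    simp_rw [← det_bMat_add]
    rw [← hyK x]
    have : (fun z => e z + ∫ q, K z q * y q ∂μ) = y := (funext hyK).symm
    rw [this]
  have hf := h.trivial_border.summable hw
  have hsy := hy'.summable hw
  have hse := he.summable hw
  have hsd := hd.summable hw
  have e1 : bSeries μ (y x) (K x) y K = y x * fredholmDet μ K +
      bSeries μ (∫ q, K x q * y q ∂μ) (K x) (fun z => ∫ q, K z q * y q ∂μ) K := by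
    rw [fredholmDet_eq_bSeries]
    unfold bSeries
    rw [hsy.tsum_eq_zero_add, hf.tsum_eq_zero_add, bTerm_zero, bTerm_zero]
    simp_rw [hy'.bTerm_col hw]
    rw [Summable.tsum_add (((summable_nat_add_iff 1).2 hf).mul_left _) hsd, tsum_mul_left]
    ring
  have e2 : bSeries μ (y x) (K x) y K = bSeries μ (e x) (K x) e K +
      bSeries μ (∫ q, K x q * y q ∂μ) (K x) (fun z => ∫ q, K z q * y q ∂μ) K := by
    unfold bSeries
    simp_rw [hadd]
    rw [Summable.tsum_add hse hsd]
  have := e1.symm.trans e2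
  linear_combination this

end Fredholm

set_option linter.unusedSectionVars false

/-! ### Dependence of Fredholm series on a parameter -/

section Parameter

variable {X : Type*} [MeasurableSpace X] {μ : Measure X} [SigmaFinite μ] {w : X → ℝ} {C : ℝ}

lemma tendsto_det {ι : Type*} {F : Filter ι} {N : ℕ} {A : ι → Matrix (Fin N) (Fin N) ℂ}
    {A₀ : Matrix (Fin N) (Fin N) ℂ} (h : ∀ a b, Tendsto (fun k => A k a b) F (𝓝 (A₀ a b))) :
    Tendsto (fun k => (A k).det) F (𝓝 A₀.det) := by
  simp only [Matrix.det_apply]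
  exact tendsto_finsetSum _ fun σ _ => (tendsto_finsetProd _ fun i _ => h _ _).const_smul _

lemma tendsto_bMat_apply {ι : Type*} {F : Filter ι} {m : ℕ} {α : ι → ℂ} {r e : ι → X → ℂ}
    {K : ι → X → X → ℂ} {α₀ : ℂ} {r₀ e₀ : X → ℂ} {K₀ : X → X → ℂ}
    (hα : Tendsto α F (𝓝 α₀)) (hr : ∀ x, Tendsto (fun k => r k x) F (𝓝 (r₀ x)))
    (he : ∀ x, Tendsto (fun k => e k x) F (𝓝 (e₀ x)))
    (hK : ∀ x y, Tendsto (fun k => K k x y) F (𝓝 (K₀ x y))) (p : Fin m → X) (a b) :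
    Tendsto (fun k => bMat (α k) (r k) (e k) (K k) p a b) F (𝓝 (bMat α₀ r₀ e₀ K₀ p a b)) := by
  refine Fin.cases ?_ (fun a => ?_) a <;> refine Fin.cases ?_ (fun b => ?_) b
  · exact hα
  · exact hr _
  · exact he _
  · exact hK _ _

/-- Fredholm series are continuous in a parameter. -/
theorem tendsto_bSeries {ι : Type*} {F : Filter ι} [F.IsCountablyGenerated]
    {α : ι → ℂ} {r e : ι → X → ℂ} {K : ι → X → X → ℂ} {α₀ : ℂ} {r₀ e₀ : X → ℂ} {K₀ : X → X → ℂ}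
    (hw : Integrable w μ) (hdom : ∀ᶠ k in F, Dom w C (α k) (r k) (e k) (K k))
    (hα : Tendsto α F (𝓝 α₀)) (hr : ∀ x, Tendsto (fun k => r k x) F (𝓝 (r₀ x)))
    (he : ∀ x, Tendsto (fun k => e k x) F (𝓝 (e₀ x)))
    (hK : ∀ x y, Tendsto (fun k => K k x y) F (𝓝 (K₀ x y))) :
    Tendsto (fun k => bSeries μ (α k) (r k) (e k) (K k)) F (𝓝 (bSeries μ α₀ r₀ e₀ K₀)) := by
  refine tendsto_tsum_of_dominated_convergence (summable_bound C (∫ x, w x ∂μ)) (fun m => ?_)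
    (hdom.mono fun k hk m => hk.norm_bTerm_le hw m)
  refine Tendsto.const_mul _ ?_
  refine tendsto_integral_filter_of_dominated_convergence
    (fun p : Fin m → X => √(((m + 1 : ℕ) : ℝ) ^ (m + 1)) * (C * ∏ b, w (p b)))
    (hdom.mono fun k hk => (hk.measurable_det m).aestronglyMeasurable)
    (hdom.mono fun k hk => Eventually.of_forall fun p => hk.norm_det_le p)
    (((integrable_prod_weight hw m).const_mul C).const_mul _)
    (Eventually.of_forall fun p => tendsto_det (tendsto_bMat_apply hα hr he hK p))

/-- Cauchy's estimate on small circles bounds the derivative in k by a multiple of the same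
dominating function, so domination of G alone suffices. -/
lemma differentiableOn_integral_of_dominated {Y : Type*} [MeasurableSpace Y] {ν : Measure Y}
    {U : Set ℂ} (hU : IsOpen U) {G : ℂ → Y → ℂ} {bound : Y → ℝ} (hb : Integrable bound ν)
    (hm : ∀ k ∈ U, AEStronglyMeasurable (G k) ν) (hG : ∀ k ∈ U, ∀ y, ‖G k y‖ ≤ bound y)
    (hd : ∀ y, DifferentiableOn ℂ (fun k => G k y) U) :
    DifferentiableOn ℂ (fun k => ∫ y, G k y ∂ν) U := by
  intro k₀ hk₀
  obtain ⟨R, hR, hball⟩ := Metric.isOpen_iff.1 hU k₀ hk₀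
  have hR2 : (0 : ℝ) < R / 2 := by positivity
  have hsub : ∀ k ∈ Metric.ball k₀ (R / 2), Metric.closedBall k (R / 4) ⊆ U := by
    intro k hk z hz
    refine hball ?_
    have h1 := Metric.mem_ball.1 hk
    have h2 := Metric.mem_closedBall.1 hz
    refine Metric.mem_ball.2 ((dist_triangle z k k₀).trans_lt ?_)
    linarith
  have hderiv : ∀ y, ∀ k ∈ Metric.ball k₀ (R / 2),
      HasDerivAt (fun k => G k y) (deriv (fun k => G k y) k) k := fun y k hk =>
    ((hd y).differentiableAt (hU.mem_nhds (hsub k hk (Metric.mem_closedBall_self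
      (by positivity))))).hasDerivAt
  -- The derivative is measurable in y as the limit of difference quotients along a fixed sequence
  -- of increments.
  have hmeas : AEStronglyMeasurable (fun y => deriv (fun k => G k y) k₀) ν := by
    have hseq : Tendsto (fun n : ℕ => (R / 4 : ℝ) / ((n : ℝ) + 1)) atTop (𝓝 0) :=
      Tendsto.div_atTop tendsto_const_nhds
        (tendsto_atTop_add_const_right _ _ tendsto_natCast_atTop_atTop)
    have hpos : ∀ n : ℕ, (0 : ℝ) < (R / 4 : ℝ) / ((n : ℝ) + 1) := fun n => by positivity
    have hseqC : Tendsto (fun n : ℕ => (((R / 4 : ℝ) / ((n : ℝ) + 1) : ℝ) : ℂ)) atTop (𝓝[≠] 0) := by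
      refine tendsto_nhdsWithin_iff.2 ⟨?_, Eventually.of_forall fun n => ?_⟩
      · have := (Complex.continuous_ofReal.tendsto 0).comp hseq
        rw [Complex.ofReal_zero] at this
        exact this
      · simp only [mem_compl_iff, mem_singleton_iff, Complex.ofReal_eq_zero]
        exact (hpos n).ne'
    refine aestronglyMeasurable_of_tendsto_ae atTop
      (f := fun (n : ℕ) y => (((R / 4 : ℝ) / ((n : ℝ) + 1) : ℝ) : ℂ)⁻¹ *
        (G (k₀ + (((R / 4 : ℝ) / ((n : ℝ) + 1) : ℝ) : ℂ)) y - G k₀ y)) (fun n => ?_)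
      (Eventually.of_forall fun y => ?_)
    · refine ((hm _ (hball ?_)).sub (hm _ hk₀)).const_mul _
      rw [Metric.mem_ball, dist_self_add_left, Complex.norm_real,
        Real.norm_of_nonneg (hpos n).le]
      have : (R / 4 : ℝ) / ((n : ℝ) + 1) ≤ R / 4 :=
        div_le_self (by positivity) (by linarith [(Nat.cast_nonneg n : (0 : ℝ) ≤ n)])
      linarith
    · exact (hasDerivAt_iff_tendsto_slope_zero.1
        (hderiv y k₀ (Metric.mem_ball_self hR2))).comp hseqC
  refine (hasDerivAt_integral_of_dominated_loc_of_deriv_le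
    (Metric.ball_mem_nhds k₀ hR2) ?_ ?_ (F' := fun k y => deriv (fun k => G k y) k) hmeas
    (bound := fun y => bound y / (R / 4))
    (Eventually.of_forall fun y k hk => ?_) (hb.div_const _)
    (Eventually.of_forall hderiv)).2.differentiableAt.differentiableWithinAt
  · exact eventually_of_mem (hU.mem_nhds hk₀) fun k hk => hm k hk
  · exact hb.mono' (hm _ hk₀) (Eventually.of_forall (hG k₀ hk₀))
  · refine Complex.norm_deriv_le_of_forall_mem_sphere_norm_le (by positivity) ?_ fun z hz =>
      hG z (hsub k hk (Metric.sphere_subset_closedBall hz)) y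
    exact ((hd y).mono (by
      rw [closure_ball _ (by positivity)]
      exact hsub k hk)).diffContOnCl

lemma differentiableOn_det {N : ℕ} {U : Set ℂ} {A : ℂ → Matrix (Fin N) (Fin N) ℂ}
    (h : ∀ a b, DifferentiableOn ℂ (fun k => A k a b) U) :
    DifferentiableOn ℂ (fun k => (A k).det) U := by
  simp only [Matrix.det_apply]
  refine DifferentiableOn.fun_sum fun σ _ => DifferentiableOn.const_smul ?_ _
  exact DifferentiableOn.fun_finsetProd fun i _ => h _ _

/-- Fredholm series are holomorphic in a parameter. -/
theorem differentiableOn_bSeries {U : Set ℂ} (hU : IsOpen U)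
    {α : ℂ → ℂ} {r e : ℂ → X → ℂ} {K : ℂ → X → X → ℂ}
    (hw : Integrable w μ) (hdom : ∀ k ∈ U, Dom w C (α k) (r k) (e k) (K k))
    (hα : DifferentiableOn ℂ α U) (hr : ∀ x, DifferentiableOn ℂ (fun k => r k x) U)
    (he : ∀ x, DifferentiableOn ℂ (fun k => e k x) U)
    (hK : ∀ x y, DifferentiableOn ℂ (fun k => K k x y) U) :
    DifferentiableOn ℂ (fun k => bSeries μ (α k) (r k) (e k) (K k)) U := by
  refine Complex.differentiableOn_tsum_of_summable_norm (summable_bound C (∫ x, w x ∂μ)) (fun m => ?_) hU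
    fun m k hk => (hdom k hk).norm_bTerm_le hw m
  refine DifferentiableOn.const_mul ?_ _
  refine differentiableOn_integral_of_dominated hU
    (((integrable_prod_weight hw m).const_mul C).const_mul _)
    (fun k hk => ((hdom k hk).measurable_det m).aestronglyMeasurable)
    (fun k hk p => (hdom k hk).norm_det_le p) fun p => differentiableOn_det fun a b => ?_
  refine Fin.cases ?_ (fun a => ?_) a <;> refine Fin.cases ?_ (fun b => ?_) b
  · exact hα
  · exact hr _
  · exact he _
  · exact hK _ _

/-! ### Invariance -/

lemma bSeries_conj {μ : Measure X} {α : ℂ} {r e : X → ℂ} {K : X → X → ℂ} (φ : X → ℂ) (hφ : ∀ x, φ x ≠ 0) (c : ℂ) :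
    bSeries μ (c * α) (fun x => c * r x * (φ x)⁻¹) (fun x => φ x * e x)
      (fun x y => φ x * K x y * (φ y)⁻¹) = c * bSeries μ α r e K := by
  unfold bSeries bTerm
  simp_rw [det_bMat_conj _ φ hφ c, integral_const_mul]
  rw [← tsum_mul_left]
  congr 1
  funext m
  ring

/-- For almost every p all coordinates lie in S, because the coordinate maps pull null sets back to
null sets. The integrands of every order then agree almost everywhere. -/
lemma bSeries_congr {S : Set X} (hS : ∀ᵐ x ∂μ, x ∈ S) {α : ℂ} {r e r' e' : X → ℂ}
    {K K' : X → X → ℂ} (hr : ∀ x ∈ S, r x = r' x) (he : ∀ x ∈ S, e x = e' x)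
    (hK : ∀ x ∈ S, ∀ y ∈ S, K x y = K' x y) :
    bSeries μ α r e K = bSeries μ α r' e' K' := by
  unfold bSeries bTerm
  congr 1
  funext m
  congr 1
  refine integral_congr_ae ?_
  have h : ∀ᵐ p : Fin m → X ∂(Measure.pi fun _ => μ), ∀ a, p a ∈ S :=
    eventually_all.2 fun a => Measure.tendsto_eval_ae_ae.eventually hS
  filter_upwards [h] with p hp
  congr 1
  ext a b
  refine Fin.cases ?_ (fun a => ?_) a <;> refine Fin.cases ?_ (fun b => ?_) b
  · rfl
  · exact hr _ (hp b)
  · exact he _ (hp a)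
  · exact hK _ (hp a) _ (hp b)

/-- The Fredholm determinant of a strictly triangular kernel is `1`. -/
lemma fredholmDet_of_strict {K : X → X → ℂ} (τ : X → ℝ) (hK : ∀ x y, K x y ≠ 0 → τ y < τ x) :
    fredholmDet μ K = 1 := by
  unfold fredholmDet
  rw [tsum_eq_single 0]
  · simp [measureReal_def]
  · intro m hm
    have hz : ∀ p : Fin m → X, (Matrix.of fun a b => K (p a) (p b)).det = 0 := by
      intro p
      rw [Matrix.det_apply]
      refine Finset.sum_eq_zero fun σ _ => ?_
      have : Nonempty (Fin m) := ⟨⟨0, Nat.pos_of_ne_zero hm⟩⟩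
      -- If all factors of the term of σ were nonzero, τ (p a) < τ (p (σ a)) would hold at the
      -- minimizer a, although p a itself has the form p (σ a') and competes in the minimum.
      obtain ⟨a, ha⟩ := Finite.exists_min fun a : Fin m => τ (p (σ a))
      have : ∃ b, K (p (σ b)) (p b) = 0 := by
        by_contra hne
        push Not at hne
        have h1 := hK _ _ (hne a)
        have h2 := ha (σ.symm a)
        rw [Equiv.apply_symm_apply] at h2
        exact absurd h1 (not_lt.2 h2)
      obtain ⟨b, hb⟩ := this
      rw [Finset.prod_eq_zero (Finset.mem_univ b) (by simpa using hb), smul_zero]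
    simp [hz]

/-! ### Weak limits -/

/-- If only the row and the column of index `d` depend on the integration variable, the integral
of the determinant is small as soon as the pairings of that row and that column are. -/
lemma tendsto_integral_det_zero {ι : Type*} {F : Filter ι} {N : ℕ} (d : Fin N)
    {A : ι → X → Matrix (Fin N) (Fin N) ℂ} {B : ℝ}
    (hA : ∀ k q q' a b, a ≠ d → b ≠ d → A k q a b = A k q' a b)
    (hB : ∀ᶠ k in F, ∀ q a b, a ≠ d → b ≠ d → ‖A k q a b‖ ≤ B)
    (hInt : ∀ᶠ k in F, ∀ a b, a ≠ d → b ≠ d → Integrable (fun q => A k q a d * A k q d b) μ)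
    (hintd : ∀ᶠ k in F, Integrable (fun q => A k q d d) μ)
    (hlim : ∀ a b, a ≠ d → b ≠ d → Tendsto (fun k => ∫ q, A k q a d * A k q d b ∂μ) F (𝓝 0))
    (hlimd : Tendsto (fun k => ∫ q, A k q d d ∂μ) F (𝓝 0)) :
    Tendsto (fun k => ∫ q, (A k q).det ∂μ) F (𝓝 0) := by
  rcases isEmpty_or_nonempty X with hX | ⟨⟨q₀⟩⟩
  · simpa [Measure.eq_zero_of_isEmpty μ] using! tendsto_const_nhds
  have hcol : ∀ (σ : Equiv.Perm (Fin N)) {i f : Fin N}, σ f = d → i ≠ f → σ i ≠ d :=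
    fun σ i f hf hi h => hi (σ.injective (h.trans hf.symm))
  have key : ∀ σ : Equiv.Perm (Fin N), (∀ᶠ k in F, Integrable (fun q => ∏ i, A k q (σ i) i) μ) ∧
      Tendsto (fun k => ∫ q, ∏ i, A k q (σ i) i ∂μ) F (𝓝 0) := by
    intro σ
    -- If σ fixes d, the variable q enters through the diagonal entry alone. Otherwise exactly two
    -- factors contain q, one from column d and one from row d, and their product is one of the
    -- pairings assumed to tend to zero.
    by_cases hσ : σ d = d
    · have hprod : ∀ k q, ∏ i, A k q (σ i) i =
          A k q d d * ∏ i ∈ Finset.univ.erase d, A k q₀ (σ i) i := by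
        intro k q
        rw [← Finset.mul_prod_erase _ _ (Finset.mem_univ d), hσ]
        congr 1
        refine Finset.prod_congr rfl fun i hi => hA _ _ _ _ _
          (hcol σ hσ (Finset.ne_of_mem_erase hi)) (Finset.ne_of_mem_erase hi)
      simp_rw [hprod]
      refine ⟨hintd.mono fun k hk => hk.mul_const _, ?_⟩
      simp_rw [integral_mul_const]
      refine hlimd.zero_mul_isBoundedUnder_le ?_
      refine isBoundedUnder_of_eventually_le (a := ∏ i ∈ Finset.univ.erase d, B) ?_
      filter_upwards [hB] with k hk
      simp only [Function.comp_apply, norm_prod]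
      exact Finset.prod_le_prod (fun _ _ => norm_nonneg _) fun i hi => hk _ _ _
        (hcol σ hσ (Finset.ne_of_mem_erase hi)) (Finset.ne_of_mem_erase hi)
    · set f := σ.symm d with hf
      have hσf : σ f = d := by simp [hf]
      have hfd : f ≠ d := fun h => hσ (h ▸ hσf)
      have hprod : ∀ k q, ∏ i, A k q (σ i) i =
          (A k q (σ d) d * A k q d f) * ∏ i ∈ (Finset.univ.erase d).erase f, A k q₀ (σ i) i := by
        intro k q
        rw [← Finset.mul_prod_erase _ _ (Finset.mem_univ d),
          ← Finset.mul_prod_erase (Finset.univ.erase d) _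
            (Finset.mem_erase.2 ⟨hfd, Finset.mem_univ f⟩), hσf, mul_assoc]
        congr 2
        refine Finset.prod_congr rfl fun i hi => hA _ _ _ _ _
          (hcol σ hσf (Finset.ne_of_mem_erase hi))
          (Finset.ne_of_mem_erase (Finset.mem_of_mem_erase hi))
      simp_rw [hprod]
      refine ⟨hInt.mono fun k hk => (hk _ _ hσ hfd).mul_const _, ?_⟩
      simp_rw [integral_mul_const]
      refine (hlim _ _ hσ hfd).zero_mul_isBoundedUnder_le ?_
      refine isBoundedUnder_of_eventually_le
        (a := ∏ i ∈ (Finset.univ.erase d).erase f, B) ?_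
      filter_upwards [hB] with k hk
      simp only [Function.comp_apply, norm_prod]
      exact Finset.prod_le_prod (fun _ _ => norm_nonneg _) fun i hi => hk _ _ _
        (hcol σ hσf (Finset.ne_of_mem_erase hi))
        (Finset.ne_of_mem_erase (Finset.mem_of_mem_erase hi))
  simp_rw [Matrix.det_apply']
  have h1 : ∀ᶠ k in F, ∫ q, ∑ σ : Equiv.Perm (Fin N),
      ((Equiv.Perm.sign σ : ℤ) : ℂ) * ∏ i, A k q (σ i) i ∂μ =
      ∑ σ : Equiv.Perm (Fin N), ((Equiv.Perm.sign σ : ℤ) : ℂ) * ∫ q, ∏ i, A k q (σ i) i ∂μ := by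
    have h2 : ∀ᶠ k in F, ∀ σ : Equiv.Perm (Fin N), Integrable (fun q => ∏ i, A k q (σ i) i) μ :=
      eventually_all.2 fun σ => (key σ).1
    filter_upwards [h2] with k hk
    refine (integral_finsetSum _ fun σ _ => (hk σ).const_mul _).trans ?_
    exact Finset.sum_congr rfl fun σ _ => integral_const_mul _ _
  refine Tendsto.congr' (h1.mono fun k hk => hk.symm) ?_
  rw [show (0 : ℂ) = ∑ σ : Equiv.Perm (Fin N), ((Equiv.Perm.sign σ : ℤ) : ℂ) * (0 : ℂ) by simp]
  exact tendsto_finsetSum _ fun σ _ => (key σ).2.const_mul _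

/-- If the compositions of the kernel with itself and with the border tend weakly to zero, then
the Fredholm series is asymptotic to its zeroth term. -/
theorem tendsto_bSeries_sub_corner {ι : Type*} {F : Filter ι} [F.IsCountablyGenerated]
    {α : ι → ℂ} {r e : ι → X → ℂ} {K : ι → X → X → ℂ}
    (hw : Integrable w μ) (hdom : ∀ᶠ k in F, Dom w C (α k) (r k) (e k) (K k))
    (hre : Tendsto (fun k => ∫ q, r k q * e k q ∂μ) F (𝓝 0))
    (hrK : ∀ y, Tendsto (fun k => ∫ q, r k q * K k q y ∂μ) F (𝓝 0))
    (hKe : ∀ x, Tendsto (fun k => ∫ q, K k x q * e k q ∂μ) F (𝓝 0))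
    (hKK : ∀ x y, Tendsto (fun k => ∫ q, K k x q * K k q y ∂μ) F (𝓝 0))
    (htr : Tendsto (fun k => ∫ q, K k q q ∂μ) F (𝓝 0)) :
    Tendsto (fun k => bSeries μ (α k) (r k) (e k) (K k) - α k) F (𝓝 0) := by
  have hterm : ∀ m, Tendsto (fun k => bTerm μ (α k) (r k) (e k) (K k) (m + 1)) F (𝓝 0) := by
    intro m
    rw [show (0 : ℂ) = ((-1 : ℂ) ^ (m + 1) / ((m + 1).factorial : ℂ)) * 0 by simp]
    refine Tendsto.const_mul _ ?_
    -- One integration point q is singled out. With the others fixed, only one row and one column of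
    -- the matrix depend on q, so `tendsto_integral_det_zero` applies to the inner integral;
    -- dominated convergence takes care of the outer one.
    set M : ι → X × (Fin m → X) → ℂ := fun k y =>
      (bMat (α k) (r k) (e k) (K k) (Fin.cons y.1 y.2 : Fin (m + 1) → X)).det with hM
    have hcons : ∀ p : Fin (m + 1) → X,
        (Fin.cons (p 0) (fun c : Fin m => p (Fin.succAbove 0 c)) : Fin (m + 1) → X) = p := by
      intro p
      ext i
      refine Fin.cases ?_ (fun i => ?_) i <;> simp
    have e1 : ∀ k, ∫ p : Fin (m + 1) → X, (bMat (α k) (r k) (e k) (K k) p).det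
        ∂(Measure.pi fun _ => μ) = ∫ y, M k y ∂(μ.prod (Measure.pi fun _ => μ)) := by
      intro k
      rw [← integral_remove (0 : Fin (m + 1))]
      simp only [hM, hcons]
    have hcm : Measurable fun y : X × (Fin m → X) => (Fin.cons y.1 y.2 : Fin (m + 1) → X) := by
      refine measurable_pi_iff.2 fun i => ?_
      refine Fin.cases ?_ (fun i => ?_) i
      · simpa using measurable_fst
      · exact (measurable_pi_apply i).comp measurable_snd
    have hMm : ∀ᶠ k in F, Measurable (M k) := hdom.mono fun k hk =>
      (hk.measurable_det (m + 1)).comp hcm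
    set c : ℝ := √(((m + 1 + 1 : ℕ) : ℝ) ^ (m + 1 + 1)) * C
    have hMb : ∀ᶠ k in F, ∀ y, ‖M k y‖ ≤ w y.1 * (c * ∏ b, w (y.2 b)) := hdom.mono fun k hk y => by
      refine (hk.norm_det_le _).trans (le_of_eq ?_)
      rw [Fin.prod_univ_succ]
      simp only [Fin.cons_zero, Fin.cons_succ, c]
      ring
    have hMi : ∀ᶠ k in F, Integrable (M k) (μ.prod (Measure.pi fun _ => μ)) := by
      filter_upwards [hMm, hMb] with k h1 h2
      exact (integrable_pointed_weight hw m c).mono' h1.aestronglyMeasurable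
        (Eventually.of_forall h2)
    have e2 : ∀ᶠ k in F, ∫ p : Fin (m + 1) → X, (bMat (α k) (r k) (e k) (K k) p).det
        ∂(Measure.pi fun _ => μ) = ∫ p : Fin m → X, ∫ q, M k (q, p) ∂μ ∂(Measure.pi fun _ => μ) :=
      hMi.mono fun k hk => (e1 k).trans (integral_prod_symm _ hk)
    refine Tendsto.congr' (e2.mono fun k hk => hk.symm) ?_
    rw [show (0 : ℂ) = ∫ p : Fin m → X, (0 : ℂ) ∂(Measure.pi fun _ => μ) by simp]
    refine tendsto_integral_filter_of_dominated_convergence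
      (fun p : Fin m → X => (∫ q, w q ∂μ) * (c * ∏ b, w (p b))) ?_ ?_
      (((integrable_prod_weight hw m).const_mul c).const_mul _)
      (Eventually.of_forall fun p => ?_)
    · filter_upwards [hMm] with k hk
      exact (hk.stronglyMeasurable.integral_prod_left').aestronglyMeasurable
    · filter_upwards [hMb] with k hk
      refine Eventually.of_forall fun p => ?_
      refine (norm_integral_le_of_norm_le (hw.mul_const (c * ∏ b, w (p b)))
        (Eventually.of_forall fun q => hk (q, p))).trans (le_of_eq ?_)
      rw [integral_mul_const]
    · set A : ι → X → Matrix (Fin (m + 1 + 1)) (Fin (m + 1 + 1)) ℂ := fun k q =>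
        bMat (α k) (r k) (e k) (K k) (Fin.cons q p : Fin (m + 1) → X) with hAdef
      have hcase : ∀ a : Fin (m + 1 + 1), a ≠ Fin.succ 0 →
          a = 0 ∨ ∃ j : Fin m, a = Fin.succ (Fin.succ j) := by
        intro a ha
        rcases Fin.eq_zero_or_eq_succ a with h | ⟨b, rfl⟩
        · exact Or.inl h
        · rcases Fin.eq_zero_or_eq_succ b with h | ⟨c, rfl⟩
          · exact absurd (by rw [h]) ha
          · exact Or.inr ⟨c, rfl⟩
      set B : ℝ := C + ∑ b, w (p b)
      have hw0 : ∀ᶠ k in F, ∀ x, 0 ≤ w x := hdom.mono fun k hk => hk.weight_nonneg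
      have hentry : ∀ᶠ k in F, ∀ q a b, a ≠ Fin.succ 0 → b ≠ Fin.succ 0 → ‖A k q a b‖ ≤ B := by
        filter_upwards [hdom, hw0] with k hk hw0 q a b ha hb
        have hle : ∀ j, w (p j) ≤ B := fun j => by
          have := Finset.single_le_sum (fun i _ => hw0 (p i)) (Finset.mem_univ j)
          linarith [hk.const_nonneg]
        have hCB : C ≤ B := by
          have := Finset.sum_nonneg fun i (_ : i ∈ Finset.univ) => hw0 (p i)
          linarith
        rcases hcase a ha with rfl | ⟨i, rfl⟩ <;> rcases hcase b hb with rfl | ⟨j, rfl⟩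
        · exact hk.norm_corner.trans hCB
        · exact (hk.norm_row _).trans (hle j)
        · exact (hk.norm_col _).trans hCB
        · exact (hk.norm_kernel _ _).trans (hle j)
      refine tendsto_integral_det_zero (Fin.succ 0) (A := A) (B := B) ?_ hentry ?_ ?_ ?_ ?_
      · intro k q q' a b ha hb
        rcases hcase a ha with rfl | ⟨i, rfl⟩ <;> rcases hcase b hb with rfl | ⟨j, rfl⟩ <;> rfl
      · filter_upwards [hdom] with k hk a b ha hb
        have hD : ∀ j, Dom w (w (p j)) (r k (p j)) (r k) (fun x => K k x (p j)) (K k) := fun j =>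
          ⟨hk.norm_row _, hk.norm_row, fun x => hk.norm_kernel _ _, hk.norm_kernel, hk.meas_row,
            hk.meas_kernel.comp measurable_prodMk_right, hk.meas_kernel⟩
        rcases hcase a ha with rfl | ⟨i, rfl⟩ <;> rcases hcase b hb with rfl | ⟨j, rfl⟩
        · exact hk.integrable_row_mul_col hw
        · exact (hD j).integrable_row_mul_col hw
        · exact (hk.at_point (p i)).integrable_row_mul_col hw
        · exact ((hD j).at_point (p i)).integrable_row_mul_col hw
      · filter_upwards [hdom] with k hk
        exact hw.mono' (hk.meas_kernel.comp (measurable_id.prodMk measurable_id)).aestronglyMeasurable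
          (Eventually.of_forall fun q => hk.norm_kernel q q)
      · intro a b ha hb
        rcases hcase a ha with rfl | ⟨i, rfl⟩ <;> rcases hcase b hb with rfl | ⟨j, rfl⟩
        · exact hre
        · exact hrK (p j)
        · exact hKe (p i)
        · exact hKK (p i) (p j)
      · exact htr
  have hsum : ∀ᶠ k in F, bSeries μ (α k) (r k) (e k) (K k) - α k =
      ∑' m, bTerm μ (α k) (r k) (e k) (K k) (m + 1) := by
    filter_upwards [hdom] with k hk
    rw [bSeries, (hk.summable hw).tsum_eq_zero_add, bTerm_zero]
    ring
  refine Tendsto.congr' (hsum.mono fun k hk => hk.symm) ?_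
  rw [show (0 : ℂ) = ∑' _ : ℕ, (0 : ℂ) by simp]
  exact tendsto_tsum_of_dominated_convergence
    ((summable_nat_add_iff 1).2 (summable_bound C (∫ x, w x ∂μ))) hterm
    (hdom.mono fun k hk m => hk.norm_bTerm_le hw (m + 1))

end Parameter

/-! ### Algebra of the spectral functions -/

lemma omega_eq : omega = -1 / 2 + (Real.sqrt 3 : ℂ) / 2 * Complex.I := by
  unfold omega
  have h : (2 * Real.pi * Complex.I / 3 : ℂ) = ((2 * Real.pi / 3 : ℝ) : ℂ) * Complex.I := by
    push_cast; ring
  rw [h, Complex.exp_mul_I, ← Complex.ofReal_cos, ← Complex.ofReal_sin]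
  have h2 : 2 * Real.pi / 3 = Real.pi - Real.pi / 3 := by ring
  rw [h2, Real.cos_pi_sub, Real.sin_pi_sub, Real.cos_pi_div_three, Real.sin_pi_div_three]
  push_cast
  ring

lemma sqrt_three_sq : (Real.sqrt 3 : ℂ) ^ 2 = 3 := by
  rw [← Complex.ofReal_pow, Real.sq_sqrt (by norm_num)]
  norm_num

lemma sqrt_three_ne_zero : (Real.sqrt 3 : ℂ) ≠ 0 := by
  intro h
  have := sqrt_three_sq
  rw [h] at this
  norm_num at this

lemma omega_sq_add : omega ^ 2 = -1 - omega := by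
  rw [omega_eq]
  linear_combination (1 / 4 * Complex.I ^ 2) * sqrt_three_sq + 3 / 4 * Complex.I_sq

lemma omega_cube : omega ^ 3 = 1 := by
  linear_combination (omega - 1) * omega_sq_add

lemma omega_ne_zero : omega ≠ 0 := Complex.exp_ne_zero _

variable {k : ℂ}

/-- The l's are the eigenvalues of the companion matrix in the x-equation with vanishing potential,
whose characteristic equation is l³ - l = λ. -/
lemma l_cube (hk : k ≠ 0) (i : Fin 3) : l k i ^ 3 = l k i + lam k := by
  have h3 := sqrt_three_sq
  have h3' := sqrt_three_ne_zero
  have ha : omega ^ (i.val + 1) * k ≠ 0 := mul_ne_zero (pow_ne_zero _ omega_ne_zero) hk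
  have hc : (omega ^ (i.val + 1) * k) ^ 3 = k ^ 3 := by
    rw [mul_pow, ← pow_mul, mul_comm (i.val + 1) 3, pow_mul, omega_cube, one_pow, one_mul]
  unfold l lam
  rw [← hc]
  set a := omega ^ (i.val + 1) * k
  have hs3 : (Real.sqrt 3 : ℂ) ^ 3 = 3 * (Real.sqrt 3 : ℂ) := by rw [pow_succ, h3]
  rw [div_pow, hs3]
  field_simp
  ring_nf

lemma omega_rel : omega ^ 2 + omega + 1 = 0 := by linear_combination omega_sq_add

lemma div_sqrt_three (x : ℂ) : x / (Real.sqrt 3 : ℂ) = Real.sqrt 3 / 3 * x := by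
  rw [div_eq_iff sqrt_three_ne_zero]
  linear_combination -x / 3 * sqrt_three_sq

lemma l_zero (k : ℂ) : l k 0 = Real.sqrt 3 / 3 * (omega * k + omega ^ 2 * k⁻¹) := by
  have h3' := sqrt_three_ne_zero
  have ho : omega⁻¹ = omega ^ 2 := by
    rw [inv_eq_iff_eq_inv, eq_comm, inv_eq_iff_eq_inv]
    field_simp [omega_ne_zero]
    exact omega_cube
  simp only [l, Fin.val_zero, zero_add, pow_one, one_div, mul_inv, ho]
  exact div_sqrt_three _

lemma l_one (k : ℂ) : l k 1 = Real.sqrt 3 / 3 * (omega ^ 2 * k + omega * k⁻¹) := by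
  have h3' := sqrt_three_ne_zero
  have ho : (omega ^ 2)⁻¹ = omega := by
    field_simp [omega_ne_zero]
    exact omega_cube.symm
  simp only [l, Fin.val_one, Nat.reduceAdd, one_div, mul_inv, ho]
  exact div_sqrt_three _

lemma l_two (k : ℂ) : l k 2 = Real.sqrt 3 / 3 * (k + k⁻¹) := by
  have h3' := sqrt_three_ne_zero
  simp only [l, Fin.val_two, Nat.reduceAdd, one_div, omega_cube, one_mul]
  exact div_sqrt_three _

/-- Formally the difference of two cubics divided by l i - l j. The direct verification is valid
also when the two values coincide, which is the case exploited in `l_ne`. -/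
lemma l_pair (hk : k ≠ 0) {i j : Fin 3} (hij : i ≠ j) :
    l k i ^ 2 + l k i * l k j + l k j ^ 2 = 1 := by
  have hc : k * k⁻¹ = 1 := mul_inv_cancel₀ hk
  have h01 : l k 0 ^ 2 + l k 0 * l k 1 + l k 1 ^ 2 = 1 := by
    rw [l_zero, l_one]
    set κ := k⁻¹
    set w := omega
    linear_combination ((w * k + w ^ 2 * κ) ^ 2 + (w * k + w ^ 2 * κ) * (w ^ 2 * k + w * κ) +
      (w ^ 2 * k + w * κ) ^ 2) / 9 * sqrt_three_sq + (k ^ 2 * w ^ 2 + κ ^ 2 * w ^ 2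
      + k * κ * (w ^ 2 + 3 * w - 3)) / 3 * omega_rel + hc
  have h02 : l k 0 ^ 2 + l k 0 * l k 2 + l k 2 ^ 2 = 1 := by
    rw [l_zero, l_two]
    set κ := k⁻¹
    set w := omega
    linear_combination ((w * k + w ^ 2 * κ) ^ 2 + (w * k + w ^ 2 * κ) * (k + κ) +
      (k + κ) ^ 2) / 9 * sqrt_three_sq + (k ^ 2 + κ ^ 2 * (w ^ 2 - w + 1)
      + k * κ * (2 * w - 1)) / 3 * omega_rel + hc
  have h12 : l k 1 ^ 2 + l k 1 * l k 2 + l k 2 ^ 2 = 1 := by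
    rw [l_one, l_two]
    set κ := k⁻¹
    set w := omega
    linear_combination ((w ^ 2 * k + w * κ) ^ 2 + (w ^ 2 * k + w * κ) * (k + κ) +
      (k + κ) ^ 2) / 9 * sqrt_three_sq + (κ ^ 2 + k ^ 2 * (w ^ 2 - w + 1)
      + k * κ * (2 * w - 1)) / 3 * omega_rel + hc
  fin_cases i <;> fin_cases j <;> simp at hij ⊢
  · exact h01
  · exact h02
  · linear_combination h01
  · exact h12
  · linear_combination h02
  · linear_combination h12

/-- The discriminant factor `3 l² - 1`. -/
def den (k : ℂ) (i : Fin 3) : ℂ := 3 * l k i ^ 2 - 1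

lemma omega_pow_mul_pow_six (k : ℂ) (i : Fin 3) : (omega ^ (i.val + 1) * k) ^ 6 = k ^ 6 := by
  rw [mul_pow, ← pow_mul, mul_comm (i.val + 1) 6, pow_mul,
    show omega ^ 6 = 1 by rw [show (6 : ℕ) = 3 * 2 by norm_num, pow_mul, omega_cube, one_pow],
    one_pow, one_mul]

/-- With a = ω^(i+1) k, the equation 3 l² = 1 becomes a⁴ + a² + 1 = 0, and this polynomial divides
a⁶ - 1 = k⁶ - 1. -/
lemma den_ne_zero (hk : k ≠ 0) (hk6 : k ^ 6 ≠ 1) (i : Fin 3) : den k i ≠ 0 := by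
  intro h
  have ha : omega ^ (i.val + 1) * k ≠ 0 := mul_ne_zero (pow_ne_zero _ omega_ne_zero) hk
  have h6 := omega_pow_mul_pow_six k i
  unfold den l at h
  set a := omega ^ (i.val + 1) * k
  have h3 : 3 * ((a + 1 / a) / (Real.sqrt 3 : ℂ)) ^ 2 = (a + 1 / a) ^ 2 := by
    rw [div_pow, sqrt_three_sq]; ring
  rw [h3] at h
  have h4 : a ^ 4 + a ^ 2 + 1 = 0 := by
    field_simp at h
    linear_combination h
  apply hk6
  rw [← h6]
  linear_combination (a ^ 2 - 1) * h4

lemma l_ne (hk : k ≠ 0) (hk6 : k ^ 6 ≠ 1) {i j : Fin 3} (hij : i ≠ j) : l k i ≠ l k j := by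
  intro h
  refine den_ne_zero hk hk6 j ?_
  have := l_pair hk hij
  rw [h] at this
  unfold den
  linear_combination this

/-- Lagrange interpolation: since the l's have sum 0 and pair sum -1, the product of X - l m over m
≠ i is X² + l i X + (l i² - 1), with value `den k i` at l i. Its normalized coefficients form row i.
-/
lemma P_inv (hk : k ≠ 0) (hk6 : k ^ 6 ≠ 1) :
    (P k)⁻¹ = Matrix.of fun i => ![(l k i ^ 2 - 1) / den k i, l k i / den k i, 1 / den k i] := by
  refine Matrix.inv_eq_left_inv ?_
  ext i j
  rw [Matrix.mul_apply, Fin.sum_univ_three]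
  have hd := den_ne_zero hk hk6 i
  simp only [Matrix.of_apply, P, Matrix.cons_val_zero, Matrix.cons_val_one, Matrix.cons_val,
    Fin.val_zero, Fin.val_one, Fin.val_two, pow_zero, pow_one, mul_one]
  rw [Matrix.one_apply]
  split_ifs with h
  · subst h
    field_simp
    unfold den
    ring
  · field_simp
    linear_combination l_pair hk h

lemma P_inv_mul (hk : k ≠ 0) (hk6 : k ^ 6 ≠ 1) : (P k)⁻¹ * P k = 1 := by
  rw [P_inv hk hk6]
  ext i j
  rw [Matrix.mul_apply, Fin.sum_univ_three]
  have hd := den_ne_zero hk hk6 i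
  simp only [Matrix.of_apply, P, Matrix.cons_val_zero, Matrix.cons_val_one, Matrix.cons_val,
    Fin.val_zero, Fin.val_one, Fin.val_two, pow_zero, pow_one, mul_one]
  rw [Matrix.one_apply]
  split_ifs with h
  · subst h
    field_simp
    unfold den
    ring
  · field_simp
    linear_combination l_pair hk h

lemma P_mul_inv (hk : k ≠ 0) (hk6 : k ^ 6 ≠ 1) : P k * (P k)⁻¹ = 1 :=
  mul_eq_one_comm.1 (P_inv_mul hk hk6)

lemma V₁_apply (hk : k ≠ 0) (hk6 : k ^ 6 ≠ 1) (u : ℝ → ℝ → ℝ) (x t : ℝ) (i j : Fin 3) :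
    V₁ u k x t i j = lam k * ((u x t : ℂ) - (dx (dx u) x t : ℂ)) / den k i := by
  unfold V₁
  rw [P_inv hk hk6]
  simp only [Matrix.mul_apply, Fin.sum_univ_three, Matrix.of_apply, P, Matrix.cons_val_zero,
    Matrix.cons_val_one, Matrix.cons_val, Fin.val_zero, pow_zero, qCubed]
  push_cast
  ring

lemma V₂_apply (hk : k ≠ 0) (hk6 : k ^ 6 ≠ 1) (u : ℝ → ℝ → ℝ) (x t : ℝ) (i j : Fin 3) :
    V₂ u k x t i j = ((l k i ^ 2 - 1) * (dx u x t - u x t * l k j)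
      + l k i * (u x t * (1 - l k j ^ 2))
      + (dx u x t * (1 - l k j ^ 2) - lam k * u x t * (u x t - dx (dx u) x t + 1))) / den k i := by
  unfold V₂
  rw [P_inv hk hk6]
  simp only [Matrix.mul_apply, Fin.sum_univ_three, Matrix.of_apply, P, Matrix.cons_val_zero,
    Matrix.cons_val_one, Matrix.cons_val, Fin.val_zero, Fin.val_one, Fin.val_two, pow_zero, pow_one,
    qCubed]
  push_cast
  ring

lemma lam_eq_zero_iff (hk : k ≠ 0) : lam k = 0 ↔ k ^ 6 = -1 := by
  have h3' := sqrt_three_ne_zero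
  unfold lam
  rw [div_eq_zero_iff, or_iff_left (by simp [h3'])]
  constructor
  · intro h
    field_simp at h
    linear_combination h
  · intro h
    field_simp
    linear_combination h

lemma l_mul_eq (hk : k ≠ 0) (i : Fin 3) : l k i * (l k i ^ 2 - 1) = lam k := by
  linear_combination l_cube hk i

lemma l_ne_zero (hk : k ≠ 0) (hK : k ^ 6 ≠ -1) (i : Fin 3) : l k i ≠ 0 := by
  intro h
  apply hK
  rw [← lam_eq_zero_iff hk, ← l_mul_eq hk i, h, zero_mul]

lemma z_mul_lam (hk : k ≠ 0) (hK : k ^ 6 ≠ -1) (i : Fin 3) :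
    z k i * lam k = l k i ^ 2 - 2 / 3 := by
  have h3' := sqrt_three_ne_zero
  have hl : k ^ 3 + 1 / k ^ 3 ≠ 0 := by
    intro h
    apply hK
    rw [← lam_eq_zero_iff hk, lam, h, zero_div]
  have ha : omega ^ (i.val + 1) * k ≠ 0 := mul_ne_zero (pow_ne_zero _ omega_ne_zero) hk
  unfold z lam l
  set a := omega ^ (i.val + 1) * k
  rw [div_pow, sqrt_three_sq]
  have : (Real.sqrt 3 : ℂ) * ((a ^ 2 + 1 / a ^ 2) / (k ^ 3 + 1 / k ^ 3)) *
      ((k ^ 3 + 1 / k ^ 3) / (3 * (Real.sqrt 3 : ℂ))) = (a ^ 2 + 1 / a ^ 2) / 3 := by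
    generalize k ^ 3 + 1 / k ^ 3 = b at hl
    generalize a ^ 2 + 1 / a ^ 2 = c
    field_simp
  rw [this]
  field_simp
  ring

/-- From z λ = l² - 2/3 and λ / l = l² - 1, the difference z - 1/l equals 1/(3λ) for every index.
Near a zero of λ the z's are therefore compared through 1/l, which is singular for the middle row
only. -/
lemma z_sub (hk : k ≠ 0) (hK : k ^ 6 ≠ -1) (i j : Fin 3) :
    z k i - z k j = (l k i)⁻¹ - (l k j)⁻¹ := by
  have hl : lam k ≠ 0 := fun h => hK ((lam_eq_zero_iff hk).1 h)
  have hi := l_ne_zero hk hK i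
  have hj := l_ne_zero hk hK j
  have h1 : ∀ i, l k i ≠ 0 → (l k i)⁻¹ * lam k = l k i ^ 2 - 1 := fun i hi => by
    rw [← l_mul_eq hk i, inv_mul_cancel_left₀ hi]
  apply mul_right_cancel₀ hl
  rw [sub_mul, sub_mul, z_mul_lam hk hK, z_mul_lam hk hK, h1 i hi, h1 j hj]
  ring

/-! ### Continuity and holomorphy in `k` -/

lemma differentiableAt_l (hk : k ≠ 0) (j : Fin 3) : DifferentiableAt ℂ (fun k => l k j) k := by
  unfold l
  have ha : omega ^ (j.val + 1) * k ≠ 0 := mul_ne_zero (pow_ne_zero _ omega_ne_zero) hk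
  fun_prop (disch := assumption)

lemma differentiableAt_lam (hk : k ≠ 0) : DifferentiableAt ℂ lam k := by
  unfold lam
  have ha : k ^ 3 ≠ 0 := pow_ne_zero _ hk
  fun_prop (disch := assumption)

lemma differentiableAt_z (hk : k ≠ 0) (hK : k ^ 6 ≠ -1) (j : Fin 3) :
    DifferentiableAt ℂ (fun k => z k j) k := by
  unfold z
  have ha : (omega ^ (j.val + 1) * k) ^ 2 ≠ 0 :=
    pow_ne_zero _ (mul_ne_zero (pow_ne_zero _ omega_ne_zero) hk)
  have hb : k ^ 3 ≠ 0 := pow_ne_zero _ hk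
  have hl : k ^ 3 + 1 / k ^ 3 ≠ 0 := by
    intro h
    apply hK
    rw [← lam_eq_zero_iff hk, lam, h, zero_div]
  fun_prop (disch := assumption)

lemma differentiableAt_den (hk : k ≠ 0) (j : Fin 3) : DifferentiableAt ℂ (fun k => den k j) k := by
  unfold den
  exact (((differentiableAt_l hk j).pow 2).const_mul 3).sub_const 1

lemma re_l (k : ℂ) (i : Fin 3) :
    (l k i).re = (1 + 1 / Complex.normSq k) / Real.sqrt 3 * (omega ^ (i.val + 1) * k).re := by
  have hn : Complex.normSq (omega ^ (i.val + 1) * k) = Complex.normSq k := by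
    have : Complex.normSq omega = 1 := by
      have h : (Complex.normSq omega) ^ 3 = 1 := by rw [← map_pow, omega_cube, map_one]
      exact (pow_eq_one_iff_of_nonneg (Complex.normSq_nonneg _) (by norm_num)).1 h
    rw [map_mul, map_pow, this, one_pow, one_mul]
  unfold l
  rw [Complex.div_ofReal_re, Complex.add_re, one_div, Complex.inv_re, hn]
  ring

/-! ### Orders and contours -/

instance (σ : Fin 3 → Fin 3) (i j : Fin 3) : Decidable (Precedes σ i j) := by
  unfold Precedes; infer_instance

lemma lOrder_total (n : Fin 18) (i j : Fin 3) (h : i ≠ j) :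
    Precedes (lOrder n) i j ∨ Precedes (lOrder n) j i := by
  revert n i j; decide

lemma lOrder_irrefl (n : Fin 18) (i : Fin 3) : ¬Precedes (lOrder n) i i := by
  revert n i; decide

lemma lOrder_cases (n : Fin 18) (i : Fin 3) :
    i = lOrder n 0 ∨ i = lOrder n 1 ∨ i = lOrder n 2 := by
  revert n i; decide

lemma lOrder_ne (n : Fin 18) :
    lOrder n 0 ≠ lOrder n 1 ∧ lOrder n 0 ≠ lOrder n 2 ∧ lOrder n 1 ≠ lOrder n 2 := by
  revert n; decide

/-- Relative to the order of the `Re l`'s, only the middle element moves in the order of the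
`Re z`'s. -/
lemma zOrder_cases (n : Fin 18) :
    (zOrder n 0 = lOrder n 0 ∧ zOrder n 1 = lOrder n 1 ∧ zOrder n 2 = lOrder n 2) ∨
    (zOrder n 0 = lOrder n 1 ∧ zOrder n 1 = lOrder n 0 ∧ zOrder n 2 = lOrder n 2) ∨
    (zOrder n 0 = lOrder n 0 ∧ zOrder n 1 = lOrder n 2 ∧ zOrder n 2 = lOrder n 1) := by
  revert n; decide

lemma contour_one {n : Fin 18} {i j : Fin 3} (h : Precedes (lOrder n) i j)
    (h' : ¬Precedes (zOrder n) i j) : contour n i j = Contour.one := by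
  rw [contour, if_pos h, if_neg h']

lemma contour_two {n : Fin 18} {i j : Fin 3} (h : Precedes (lOrder n) i j)
    (h' : Precedes (zOrder n) i j) : contour n i j = Contour.two := by
  rw [contour, if_pos h, if_pos h']

lemma contour_three {n : Fin 18} {i j : Fin 3} (h : ¬Precedes (lOrder n) i j) :
    contour n i j = Contour.three := by
  rw [contour, if_neg h]

lemma contour_self (n : Fin 18) (j : Fin 3) : contour n j j = Contour.three :=
  contour_three (lOrder_irrefl n j)

/-- The pairs of rows for which the difference of the `Re z`'s stays bounded at the zeros of `λ` in
the closure of `D n`. -/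
def Near (n : Fin 18) (i c : Fin 3) : Prop :=
  i = c ∨ (i ≠ lOrder n 1 ∧ c ≠ lOrder n 1) ∨ zOrder n 1 = lOrder n 1

instance (n : Fin 18) (i c : Fin 3) : Decidable (Near n i c) := by
  unfold Near; infer_instance

/-- The reference row of the `j`-th column: up to bounded quantities, the rows integrated towards
increasing `t` have smaller `Re z`, and the rows integrated towards decreasing `t` have larger
`Re z`. -/
lemma exists_reference (n : Fin 18) (j : Fin 3) : ∃ c : Fin 3,
    (∀ i, ¬(Precedes (lOrder n) i j ∧ ¬Precedes (zOrder n) i j) →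
      Precedes (zOrder n) i c ∨ Near n i c) ∧
    (∀ i, Precedes (lOrder n) i j → ¬Precedes (zOrder n) i j →
      Precedes (zOrder n) c i ∨ Near n i c) ∧
    ((∀ i, ¬(Precedes (lOrder n) i j ∧ Precedes (zOrder n) i j)) ∨ Near n j c) := by
  revert n j; decide

/-! ### The sets `D n` -/

variable {k : ℂ} {n : Fin 18}

lemma strict_of_precedes {f : Fin 3 → ℝ} {σ : Fin 3 → Fin 3} (h01 : f (σ 0) < f (σ 1))
    (h12 : f (σ 1) < f (σ 2)) {i j : Fin 3} (h : Precedes σ i j) : f i < f j := by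
  obtain ⟨a, b, hab, rfl, rfl⟩ := h
  fin_cases a <;> fin_cases b <;> simp at hab ⊢
  · exact h01
  · exact h01.trans h12
  · exact h12

lemma D_re_l (hk : k ∈ D n) {i j : Fin 3} (h : Precedes (lOrder n) i j) :
    (l k i).re < (l k j).re :=
  strict_of_precedes (f := fun i => (l k i).re) hk.1.1 hk.1.2 h

lemma D_re_z (hk : k ∈ D n) {i j : Fin 3} (h : Precedes (zOrder n) i j) :
    (z k i).re < (z k j).re :=
  strict_of_precedes (f := fun i => (z k i).re) hk.2.1 hk.2.2 h

/-- The sector on which the `Re l`'s have the order that belongs to `D n`. -/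
def sector (n : Fin 18) : Set ℂ :=
  {k | ∀ i j, Precedes (lOrder n) i j → (l k i).re < (l k j).re}

lemma D_subset_sector (n : Fin 18) : D n ⊆ sector n := fun _ hk _ _ h => D_re_l hk h

/-- The condition means that k² is a cube root of unity. Then k⁻¹ is k times a cube root of unity,
and two of the three sums defining the l's coincide. -/
lemma exists_l_eq_of_pow_six (hk6 : k ^ 6 = 1) : ∃ i j : Fin 3, i ≠ j ∧ l k i = l k j := by
  have hk : k ≠ 0 := by rintro rfl; norm_num at hk6
  have hc : k⁻¹ * k = 1 := inv_mul_cancel₀ hk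
  have h : (k ^ 2 - 1) * ((k ^ 2 - omega) * (k ^ 2 - omega ^ 2)) = 0 := by
    linear_combination hk6 + (-k ^ 4 - k ^ 2 * omega + k ^ 2) * omega_rel +
      (k ^ 2 - 1) * omega_cube + k ^ 2 * omega * omega_rel
  rcases mul_eq_zero.1 h with h | h
  · refine ⟨0, 1, by decide, ?_⟩
    rw [l_zero, l_one]
    have : k⁻¹ = k := by linear_combination (-k⁻¹) * h + k * hc
    rw [this]; ring
  rcases mul_eq_zero.1 h with h | h
  · refine ⟨1, 2, by decide, ?_⟩
    rw [l_one, l_two]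
    have : k⁻¹ = omega ^ 2 * k := by
      linear_combination (-omega ^ 2 * k⁻¹) * h + omega ^ 2 * k * hc - k⁻¹ * omega_cube
    rw [this]
    linear_combination (Real.sqrt 3 / 3 * k) * omega_cube
  · refine ⟨0, 2, by decide, ?_⟩
    rw [l_zero, l_two]
    have : k⁻¹ = omega * k := by
      linear_combination (-omega * k⁻¹) * h + omega * k * hc - k⁻¹ * omega_cube
    rw [this]
    linear_combination (Real.sqrt 3 / 3 * k) * omega_cube

lemma sector_ne_zero (hk : k ∈ sector n) : k ≠ 0 := by
  rintro rfl
  have h : Precedes (lOrder n) (lOrder n 0) (lOrder n 1) := ⟨0, 1, by decide, rfl, rfl⟩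
  have := hk _ _ h
  -- Division by zero gives zero, so all three l's vanish at k = 0 and no strict inequality is
  -- possible.
  simp [l] at this

lemma sector_pow_six (hk : k ∈ sector n) : k ^ 6 ≠ 1 := by
  intro h6
  obtain ⟨i, j, hij, h⟩ := exists_l_eq_of_pow_six h6
  rcases lOrder_total n i j hij with h' | h'
  · exact (hk _ _ h').ne (by rw [h])
  · exact (hk _ _ h').ne (by rw [h])

lemma D_pow_six (hk : k ∈ D n) : k ^ 6 ≠ -1 := by
  intro h6
  have hk0 := sector_ne_zero (D_subset_sector n hk)
  have h0 : k ^ 3 + 1 / k ^ 3 = 0 := by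
    field_simp
    linear_combination h6
  -- At a zero of λ the quotient defining z has denominator zero, so all z's have the value 0 and
  -- cannot be strictly ordered.
  have := hk.2.1
  simp only [z, h0, div_zero, mul_zero, lt_self_iff_false] at this

lemma isOpen_sector (n : Fin 18) : IsOpen (sector n) := by
  rw [isOpen_iff_mem_nhds]
  intro k hk
  have hk0 := sector_ne_zero hk
  have hc : ∀ i, ContinuousAt (fun k => (l k i).re) k := fun i =>
    Complex.continuous_re.continuousAt.comp (differentiableAt_l hk0 i).continuousAt
  exact eventually_all.2 fun i => eventually_all.2 fun j => by
    by_cases h : Precedes (lOrder n) i j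
    · exact ((hc i).eventually_lt (hc j) (hk i j h)).mono fun w hw _ => hw
    · exact Eventually.of_forall fun w hw => absurd hw h

lemma closure_D_re_l (hk : k ∈ closure (D n)) (hk0 : k ≠ 0) {i j : Fin 3}
    (h : Precedes (lOrder n) i j) : (l k i).re ≤ (l k j).re := by
  have : (𝓝[D n] k).NeBot := mem_closure_iff_nhdsWithin_neBot.1 hk
  have hc : ∀ i, Tendsto (fun k => (l k i).re) (𝓝[D n] k) (𝓝 (l k i).re) := fun i =>
    (Complex.continuous_re.continuousAt.comp (differentiableAt_l hk0 i).continuousAt).tendsto.mono_left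
      nhdsWithin_le_nhds
  exact le_of_tendsto_of_tendsto (hc i) (hc j)
    (eventually_of_mem self_mem_nhdsWithin fun w hw => (D_re_l hw h).le)

lemma closure_D_re_z (hk : k ∈ closure (D n)) (hk0 : k ≠ 0) (hK : k ^ 6 ≠ -1) {i j : Fin 3}
    (h : Precedes (zOrder n) i j) : (z k i).re ≤ (z k j).re := by
  have : (𝓝[D n] k).NeBot := mem_closure_iff_nhdsWithin_neBot.1 hk
  have hc : ∀ i, Tendsto (fun k => (z k i).re) (𝓝[D n] k) (𝓝 (z k i).re) := fun i =>
    (Complex.continuous_re.continuousAt.comp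
      (differentiableAt_z hk0 hK i).continuousAt).tendsto.mono_left nhdsWithin_le_nhds
  exact le_of_tendsto_of_tendsto (hc i) (hc j)
    (eventually_of_mem self_mem_nhdsWithin fun w hw => (D_re_z hw h).le)

lemma normSq_omega : Complex.normSq omega = 1 := by
  have h : (Complex.normSq omega) ^ 3 = 1 := by rw [← map_pow, omega_cube, map_one]
  exact (pow_eq_one_iff_of_nonneg (Complex.normSq_nonneg _) (by norm_num)).1 h

/-- If Re l i = Re l j, the points ω^(i+1) k and ω^(j+1) k have equal modulus and equal real part.
Being different, they are complex conjugates, so their common cube k³ is real. -/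
lemma mem_sector_of_closure (hk : k ∈ closure (D n)) (him : (k ^ 3).im ≠ 0) : k ∈ sector n := by
  have hk0 : k ≠ 0 := by rintro rfl; simp at him
  have hk6 : k ^ 6 ≠ 1 := by
    intro h
    have h2 : (k ^ 3 - 1) * (k ^ 3 + 1) = 0 := by linear_combination h
    rcases mul_eq_zero.1 h2 with h3 | h3
    · rw [show k ^ 3 = 1 by linear_combination h3] at him; simp at him
    · rw [show k ^ 3 = -1 by linear_combination h3] at him; simp at him
  intro i j hij
  refine lt_of_le_of_ne (closure_D_re_l hk hk0 hij) fun heq => him ?_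
  have hne : i ≠ j := by rintro rfl; exact lOrder_irrefl n _ hij
  have hfac : 0 < (1 + 1 / Complex.normSq k) / Real.sqrt 3 := by
    have := Complex.normSq_nonneg k
    positivity
  rw [re_l, re_l] at heq
  have hre : (omega ^ (i.val + 1) * k).re = (omega ^ (j.val + 1) * k).re :=
    mul_left_cancel₀ hfac.ne' heq
  have hn : ∀ i : Fin 3, Complex.normSq (omega ^ (i.val + 1) * k) = Complex.normSq k := fun i => by
    rw [map_mul, map_pow, normSq_omega, one_pow, one_mul]
  have hcube : ∀ i : Fin 3, (omega ^ (i.val + 1) * k) ^ 3 = k ^ 3 := fun i => by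
    rw [mul_pow, ← pow_mul, mul_comm (i.val + 1) 3, pow_mul, omega_cube, one_pow, one_mul]
  have hl : omega ^ (i.val + 1) * k ≠ omega ^ (j.val + 1) * k := fun h =>
    l_ne hk0 hk6 hne (by simp only [l, h])
  have hi := hn i
  have hj := hn j
  have h3i := hcube i
  have h3j := hcube j
  generalize omega ^ (i.val + 1) * k = a at *
  generalize omega ^ (j.val + 1) * k = b at *
  rw [Complex.normSq_apply] at hi hj
  have him2 : (a.im - b.im) * (a.im + b.im) = 0 := by
    rw [hre] at hi
    linear_combination hi - hj
  rcases mul_eq_zero.1 him2 with h | h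
  · exact absurd (Complex.ext hre (by linarith)) hl
  · have hconj : b = (starRingEnd ℂ) a := Complex.ext (by simp [hre]) (by simp; linarith)
    have : (starRingEnd ℂ) (k ^ 3) = k ^ 3 := by
      rw [← h3i, map_pow, ← hconj, h3j, h3i]
    exact Complex.conj_eq_iff_im.1 this

/-- Here k³ = ± i, so the zeros of λ stay off the rays on which two of the Re l's coincide. -/
lemma im_cube_ne_zero_of_pow_six (h6 : k ^ 6 = -1) : (k ^ 3).im ≠ 0 := by
  intro h
  have h2 : k ^ 3 = ((k ^ 3).re : ℂ) := Complex.ext rfl (by simpa using h)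
  have h3 : (((k ^ 3).re ^ 2 : ℝ) : ℂ) = ((-1 : ℝ) : ℂ) := by
    push_cast
    rw [← h2]
    linear_combination h6
  have h4 : (k ^ 3).re ^ 2 = -1 := Complex.ofReal_injective h3
  nlinarith [sq_nonneg (k ^ 3).re]

/-! ### Points with prescribed values of the `l`'s -/

/-- Fourier inversion on the group of cube roots of unity: the l's determine k, and the formula
motivates `pointOf`. -/
lemma sqrt_three_mul_eq (k : ℂ) :
    Real.sqrt 3 * k = omega ^ 2 * l k 0 + omega * l k 1 + l k 2 := by
  rw [l_zero, l_one, l_two]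
  linear_combination (-Real.sqrt 3 / 3 * (2 * k + omega * k⁻¹)) * omega_cube
    - (Real.sqrt 3 / 3 * k⁻¹) * omega_rel

/-- The point at which the `l`'s take the values `a`. -/
def pointOf (a : Fin 3 → ℂ) : ℂ := (omega ^ 2 * a 0 + omega * a 1 + a 2) / Real.sqrt 3

/-- The two conditions are Vieta's relations for l³ - l = λ with λ left free. Points with a desired
configuration of the l's can thus be constructed by choosing a triple. -/
lemma l_pointOf {a : Fin 3 → ℂ} (hs : a 0 + a 1 + a 2 = 0)
    (hp : a 0 * a 1 + a 1 * a 2 + a 0 * a 2 = -1) :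
    pointOf a ≠ 0 ∧ ∀ j, l (pointOf a) j = a j := by
  have h3 := sqrt_three_sq
  have h3' := sqrt_three_ne_zero
  -- The Fourier combination with ω and ω² exchanged is the inverse of `pointOf a`.
  have hmul : pointOf a * ((omega * a 0 + omega ^ 2 * a 1 + a 2) / Real.sqrt 3) = 1 := by
    unfold pointOf
    rw [div_mul_div_comm, ← sq, h3, div_eq_one_iff_eq (by norm_num)]
    linear_combination (a 0 ^ 2 + a 1 ^ 2 + omega * a 0 * a 1) * omega_cube +
      (a 0 * a 1 + a 1 * a 2 + a 0 * a 2) * omega_rel + (a 0 + a 1 + a 2) * hs - 3 * hp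
  have hinv : (pointOf a)⁻¹ = (omega * a 0 + omega ^ 2 * a 1 + a 2) / Real.sqrt 3 :=
    inv_eq_of_mul_eq_one_right hmul
  refine ⟨left_ne_zero_of_mul_eq_one hmul, fun j => ?_⟩
  fin_cases j
  · change l (pointOf a) 0 = a 0
    rw [l_zero, hinv, pointOf]
    field_simp
    linear_combination (2 * a 0 + omega * a 1) * omega_cube + (a 1 + a 2) * omega_rel - hs
  · change l (pointOf a) 1 = a 1
    rw [l_one, hinv, pointOf]
    field_simp
    linear_combination (2 * a 1 + omega * a 0) * omega_cube + (a 0 + a 2) * omega_rel - hs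
  · change l (pointOf a) 2 = a 2
    rw [l_two, hinv, pointOf]
    field_simp
    linear_combination (a 0 + a 1) * omega_rel - hs

variable {k : ℂ} {n : Fin 18}

/-! ### The zeros of `λ` in the sectors -/

/-- For λ = 0 the cubic is l (l² - 1) = 0, and the strict order of the real parts leaves a single
assignment of the roots -1, 0, 1. -/
lemma l_of_pow_six (hk : k ∈ sector n) (h6 : k ^ 6 = -1) :
    l k (lOrder n 0) = -1 ∧ l k (lOrder n 1) = 0 ∧ l k (lOrder n 2) = 1 := by
  have hk0 := sector_ne_zero hk
  have hv : ∀ i, l k i = 0 ∨ l k i = 1 ∨ l k i = -1 := by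
    intro i
    have h := l_mul_eq hk0 i
    rw [(lam_eq_zero_iff hk0).2 h6] at h
    rcases mul_eq_zero.1 h with h | h
    · exact Or.inl h
    · have h2 : (l k i - 1) * (l k i + 1) = 0 := by linear_combination h
      rcases mul_eq_zero.1 h2 with h | h
      · exact Or.inr (Or.inl (by linear_combination h))
      · exact Or.inr (Or.inr (by linear_combination h))
  have h01 := hk _ _ (⟨0, 1, by decide, rfl, rfl⟩ : Precedes (lOrder n) (lOrder n 0) (lOrder n 1))
  have h12 := hk _ _ (⟨1, 2, by decide, rfl, rfl⟩ : Precedes (lOrder n) (lOrder n 1) (lOrder n 2))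
  rcases hv (lOrder n 0) with h0 | h0 | h0 <;> rcases hv (lOrder n 1) with h1 | h1 | h1 <;>
    rcases hv (lOrder n 2) with h2 | h2 | h2 <;> rw [h0, h1] at h01 <;> rw [h1, h2] at h12 <;>
    first | (exfalso; norm_num at h01; done) | (exfalso; norm_num at h12; done) |
      exact ⟨h0, h1, h2⟩

/-- The values of the l's at such a point are forced by the order and determine the point. A sector
therefore contains at most one zero of λ, so only one puncture has to be considered in the identity
theorem. -/
lemma eq_of_pow_six {k' : ℂ} (hk : k ∈ sector n) (h6 : k ^ 6 = -1) (hk' : k' ∈ sector n)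
    (h6' : k' ^ 6 = -1) : k = k' := by
  obtain ⟨a0, a1, a2⟩ := l_of_pow_six hk h6
  obtain ⟨b0, b1, b2⟩ := l_of_pow_six hk' h6'
  have h : ∀ i, l k i = l k' i := by
    intro i
    rcases lOrder_cases n i with rfl | rfl | rfl
    · rw [a0, b0]
    · rw [a1, b1]
    · rw [a2, b2]
  have h1 := sqrt_three_mul_eq k
  rw [h, h, h, ← sqrt_three_mul_eq k'] at h1
  exact mul_left_cancel₀ sqrt_three_ne_zero h1

/-- By `re_l`, all Re l's carry the same positive factor in front of the real parts of ω^j k, so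
each condition cuts out a half-plane. -/
lemma convex_sector (n : Fin 18) : Convex ℝ (sector n) := by
  have h : sector n = ⋂ i, ⋂ j, ⋂ _ : Precedes (lOrder n) i j,
      {k : ℂ | (omega ^ (i.val + 1) * k).re < (omega ^ (j.val + 1) * k).re} := by
    ext k
    have hfac : 0 < (1 + 1 / Complex.normSq k) / Real.sqrt 3 := by
      have := Complex.normSq_nonneg k
      positivity
    simp only [sector, mem_ofPred_eq, mem_iInter, re_l, mul_lt_mul_iff_right₀ hfac]
  rw [h]
  refine convex_iInter fun i => convex_iInter fun j => convex_iInter fun _ => ?_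
  have h2 : {k : ℂ | (omega ^ (i.val + 1) * k).re < (omega ^ (j.val + 1) * k).re} =
      {k : ℂ | ((omega ^ (i.val + 1) - omega ^ (j.val + 1)) * k).re < 0} := by
    ext k
    simp only [mem_ofPred_eq, sub_mul, Complex.sub_re, sub_neg]
  rw [h2]
  exact convex_halfSpace_lt
    ⟨fun x y => by simp [mul_add], fun c x => by simp; ring⟩ 0

/-- The complement of c is covered by the intersections of S with the four open half-planes bounded
by the horizontal and vertical lines through c. These are convex, and consecutive ones share a
corner of a small square around c. -/
lemma isPreconnected_convex_diff_singleton {S : Set ℂ} (hS : Convex ℝ S) (hO : IsOpen S) {c : ℂ}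
    (hc : c ∈ S) : IsPreconnected (S \ {c}) := by
  obtain ⟨R, hR, hball⟩ := Metric.isOpen_iff.1 hO c hc
  have hmem : ∀ a b : ℝ, |a| ≤ R / 4 → |b| ≤ R / 4 → c + (a + b * Complex.I) ∈ S := by
    intro a b ha hb
    refine hball ?_
    rw [Metric.mem_ball, dist_self_add_left]
    refine (norm_add_le _ _).trans_lt ?_
    rw [norm_mul, Complex.norm_I, mul_one, Complex.norm_real, Complex.norm_real, Real.norm_eq_abs,
      Real.norm_eq_abs]
    linarith
  have hR4 : |R / 4| ≤ R / 4 := by rw [abs_of_pos (by positivity)]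
  have hR4' : |-(R / 4)| ≤ R / 4 := by rw [abs_neg]; exact hR4
  set A := S ∩ {x : ℂ | c.re < x.re}
  set B := S ∩ {x : ℂ | c.im < x.im}
  set A' := S ∩ {x : ℂ | x.re < c.re}
  set B' := S ∩ {x : ℂ | x.im < c.im}
  have hA : IsPreconnected A := (hS.inter (convex_halfSpace_re_gt _)).isPreconnected
  have hB : IsPreconnected B := (hS.inter (convex_halfSpace_im_gt _)).isPreconnected
  have hA' : IsPreconnected A' := (hS.inter (convex_halfSpace_re_lt _)).isPreconnected
  have hB' : IsPreconnected B' := (hS.inter (convex_halfSpace_im_lt _)).isPreconnected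
  have hR' : 0 < R / 4 := by positivity
  have h1 : IsPreconnected (A ∪ B) := by
    refine hA.union (c + ((R / 4 : ℝ) + (R / 4 : ℝ) * Complex.I)) ⟨hmem _ _ hR4 hR4, ?_⟩
      ⟨hmem _ _ hR4 hR4, ?_⟩ hB <;> simp [hR]
  have h2 : IsPreconnected (A ∪ B ∪ A') := by
    refine h1.union (c + ((-(R / 4) : ℝ) + (R / 4 : ℝ) * Complex.I))
      (Or.inr ⟨hmem _ _ hR4' hR4, ?_⟩) ⟨hmem _ _ hR4' hR4, ?_⟩ hA' <;> simp [hR]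
  have h3 : IsPreconnected (A ∪ B ∪ A' ∪ B') := by
    refine h2.union (c + ((-(R / 4) : ℝ) + (-(R / 4) : ℝ) * Complex.I))
      (Or.inr ⟨hmem _ _ hR4' hR4', ?_⟩) ⟨hmem _ _ hR4' hR4', ?_⟩ hB' <;> simp [hR]
  convert h3 using 1
  ext x
  constructor
  · rintro ⟨hx, hne⟩
    have : x.re ≠ c.re ∨ x.im ≠ c.im := by
      by_contra h
      push Not at h
      exact hne (Complex.ext h.1 h.2)
    rcases this with h | h
    · rcases lt_or_gt_of_ne h with h | h
      · exact Or.inl (Or.inr ⟨hx, h⟩)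
      · exact Or.inl (Or.inl (Or.inl ⟨hx, h⟩))
    · rcases lt_or_gt_of_ne h with h | h
      · exact Or.inr ⟨hx, h⟩
      · exact Or.inl (Or.inl (Or.inr ⟨hx, h⟩))
  · rintro (((h | h) | h) | h)
    · exact ⟨h.1, fun e => (lt_irrefl _ (e ▸ h.2 : c.re < c.re))⟩
    · exact ⟨h.1, fun e => (lt_irrefl _ (e ▸ h.2 : c.im < c.im))⟩
    · exact ⟨h.1, fun e => (lt_irrefl _ (e ▸ h.2 : c.re < c.re))⟩
    · exact ⟨h.1, fun e => (lt_irrefl _ (e ▸ h.2 : c.im < c.im))⟩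

/-! ### Every `D n` reaches a zero of `λ` -/

lemma sum_lOrder (n : Fin 18) (a : Fin 3 → ℂ) :
    a 0 + a 1 + a 2 = a (lOrder n 0) + a (lOrder n 1) + a (lOrder n 2) ∧
    a 0 * a 1 + a 1 * a 2 + a 0 * a 2 = a (lOrder n 0) * a (lOrder n 1)
      + a (lOrder n 1) * a (lOrder n 2) + a (lOrder n 0) * a (lOrder n 2) := by
  fin_cases n <;> simp [lOrder] <;> constructor <;> ring

/-- The triple with given entries in the order of the `Re l`'s. -/
def triple (n : Fin 18) (lo mid hi : ℂ) (j : Fin 3) : ℂ :=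
  if j = lOrder n 0 then lo else if j = lOrder n 1 then mid else hi

lemma triple_apply (n : Fin 18) (lo mid hi : ℂ) :
    triple n lo mid hi (lOrder n 0) = lo ∧ triple n lo mid hi (lOrder n 1) = mid ∧
      triple n lo mid hi (lOrder n 2) = hi := by
  obtain ⟨h1, h2, h3⟩ := lOrder_ne n
  simp [triple, h1.symm, h2.symm, h3.symm]

lemma l_pointOf_triple {lo mid hi : ℂ} (n : Fin 18) (hs : lo + mid + hi = 0)
    (hp : lo * mid + mid * hi + lo * hi = -1) :
    pointOf (triple n lo mid hi) ≠ 0 ∧ l (pointOf (triple n lo mid hi)) (lOrder n 0) = lo ∧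
      l (pointOf (triple n lo mid hi)) (lOrder n 1) = mid ∧
      l (pointOf (triple n lo mid hi)) (lOrder n 2) = hi := by
  obtain ⟨t0, t1, t2⟩ := triple_apply n lo mid hi
  obtain ⟨e1, e2⟩ := sum_lOrder n (triple n lo mid hi)
  rw [t0, t1, t2] at e1 e2
  obtain ⟨h0, hl⟩ := l_pointOf (e1.trans hs) (e2.trans hp)
  exact ⟨h0, by rw [hl, t0], by rw [hl, t1], by rw [hl, t2]⟩

lemma mem_D_of_inv (hk : k ≠ 0) (hK : k ^ 6 ≠ -1)
    (h01 : (l k (lOrder n 0)).re < (l k (lOrder n 1)).re)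
    (h12 : (l k (lOrder n 1)).re < (l k (lOrder n 2)).re)
    (z01 : (l k (zOrder n 0))⁻¹.re < (l k (zOrder n 1))⁻¹.re)
    (z12 : (l k (zOrder n 1))⁻¹.re < (l k (zOrder n 2))⁻¹.re) : k ∈ D n := by
  have hz : ∀ i j, (l k i)⁻¹.re < (l k j)⁻¹.re → (z k i).re < (z k j).re := by
    intro i j h
    have := congrArg Complex.re (z_sub hk hK i j)
    rw [Complex.sub_re, Complex.sub_re] at this
    linarith
  exact ⟨⟨h01, h12⟩, hz _ _ z01, hz _ _ z12⟩

/-- A curve in `D n` along which the middle `l` is `c s`, where `c² = q` is real. -/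
def path (n : Fin 18) (c : ℂ) (q s : ℝ) : ℂ :=
  pointOf (triple n ((-(c * s) - (√(4 - 3 * q * s ^ 2) : ℝ)) / 2) (c * s)
    ((-(c * s) + (√(4 - 3 * q * s ^ 2) : ℝ)) / 2))

/-- The outer entries are the roots of X² + c s X + (c s)² - 1, whose discriminant 4 - 3 q s² is
real because c² is. -/
lemma path_spec {c : ℂ} {q s : ℝ} (n : Fin 18) (hc : c ^ 2 = q) (hq : 0 ≤ 4 - 3 * q * s ^ 2) :
    path n c q s ≠ 0 ∧
    l (path n c q s) (lOrder n 0) = (-(c * s) - (√(4 - 3 * q * s ^ 2) : ℝ)) / 2 ∧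
    l (path n c q s) (lOrder n 1) = c * s ∧
    l (path n c q s) (lOrder n 2) = (-(c * s) + (√(4 - 3 * q * s ^ 2) : ℝ)) / 2 := by
  refine l_pointOf_triple n (by ring) ?_
  have h : ((√(4 - 3 * q * s ^ 2) : ℝ) : ℂ) ^ 2 = 4 - 3 * q * s ^ 2 := by
    rw [← Complex.ofReal_pow, Real.sq_sqrt hq]
    push_cast
    ring
  linear_combination (-1 / 4) * h - 3 / 4 * s ^ 2 * hc

lemma path_pow_six {c : ℂ} {q s : ℝ} (n : Fin 18) (hc : c ^ 2 = q) (hq : |q| ≤ 1) (hc0 : c ≠ 0)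
    (hs : 0 < s) (hs1 : s < 1 / 2) : path n c q s ^ 6 ≠ -1 := by
  have hq' : 0 ≤ 4 - 3 * q * s ^ 2 := by
    have := (abs_le.1 hq).2
    nlinarith [sq_nonneg s]
  obtain ⟨h0, -, h1, -⟩ := path_spec n hc hq'
  rw [Ne, ← lam_eq_zero_iff h0, ← l_mul_eq h0 (lOrder n 1), h1]
  refine mul_ne_zero (mul_ne_zero hc0 (by exact_mod_cast hs.ne')) fun h => ?_
  have h2 : ((q * s ^ 2 : ℝ) : ℂ) = ((1 : ℝ) : ℂ) := by
    push_cast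
    linear_combination h - s ^ 2 * hc
  have h3 : q * s ^ 2 = 1 := Complex.ofReal_injective h2
  have := (abs_le.1 hq).2
  nlinarith [sq_nonneg s]

lemma tendsto_path (n : Fin 18) (c : ℂ) (q : ℝ) :
    Tendsto (path n c q) (𝓝[>] 0) (𝓝 (path n c q 0)) := by
  have : Continuous (path n c q) := by
    unfold path pointOf
    have ht : ∀ j, Continuous fun s : ℝ => triple n ((-(c * s) - (√(4 - 3 * q * s ^ 2) : ℝ)) / 2)
        (c * s) ((-(c * s) + (√(4 - 3 * q * s ^ 2) : ℝ)) / 2) j := by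
      intro j
      unfold triple
      split_ifs <;> fun_prop
    have := ht 0
    have := ht 1
    have := ht 2
    fun_prop
  exact (this.tendsto 0).mono_left nhdsWithin_le_nhds

/-- On `path` the middle l equals c s and λ tends to zero with s. The direction c places Re (1/l) of
the middle row relative to the outer rows: between them for c = i, below both for c = -1, above both
for c = 1. These are the three cases of `zOrder_cases`. -/
lemma exists_lamZero (n : Fin 18) : ∃ K, K ^ 6 = -1 ∧ K ∈ closure (D n) := by
  suffices h : ∃ (c : ℂ) (q : ℝ), c ^ 2 = q ∧ |q| ≤ 1 ∧ c ≠ 0 ∧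
      ∀ s : ℝ, 0 < s → s < 1 / 2 → path n c q s ∈ D n by
    obtain ⟨c, q, hc, hq, hc0, hD⟩ := h
    refine ⟨path n c q 0, ?_, mem_closure_of_tendsto (tendsto_path n c q) ?_⟩
    · obtain ⟨h0, -, h1, -⟩ := path_spec (s := 0) n hc (by norm_num)
      rw [← lam_eq_zero_iff h0, ← l_mul_eq h0 (lOrder n 1), h1]
      simp
    · filter_upwards [Ioo_mem_nhdsGT (show (0 : ℝ) < 1 / 2 by norm_num)] with s hs
      exact hD s hs.1 hs.2
  -- With ρ the square root, 3 s < ρ is what keeps the middle value ∓ s strictly between the outer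
  -- ones. It amounts to 12 s² < 4 and holds for s < 1/2.
  have hρ : ∀ s : ℝ, 0 < s → s < 1 / 2 → 3 * s < √(4 - 3 * 1 * s ^ 2) := fun s h0 h1 =>
    Real.lt_sqrt_of_sq_lt (by nlinarith)
  have hρ' : ∀ s : ℝ, 0 < √(4 - 3 * (-1) * s ^ 2) := fun s => Real.sqrt_pos.2 (by nlinarith)
  rcases zOrder_cases n with ⟨z0, z1, z2⟩ | ⟨z0, z1, z2⟩ | ⟨z0, z1, z2⟩
  · refine ⟨Complex.I, -1, by simp, by simp, Complex.I_ne_zero, fun s h0 h1 => ?_⟩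
    obtain ⟨hk, hlo, hmid, hhi⟩ := path_spec (s := s) n (c := Complex.I) (q := -1) (by simp)
      (by nlinarith)
    have hK := path_pow_six n (c := Complex.I) (q := -1) (by simp) (by simp) Complex.I_ne_zero h0 h1
    have hr := hρ' s
    generalize √(4 - 3 * (-1) * s ^ 2) = ρ at *
    have e1 : (l (path n Complex.I (-1) s) (lOrder n 0)).re = -ρ / 2 := by
      rw [hlo]; simp
    have e2 : (l (path n Complex.I (-1) s) (lOrder n 1)).re = 0 := by
      rw [hmid]; simp
    have e3 : (l (path n Complex.I (-1) s) (lOrder n 2)).re = ρ / 2 := by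
      rw [hhi]; simp
    have hns : ∀ i, 0 < Complex.normSq (l (path n Complex.I (-1) s) i) := fun i =>
      Complex.normSq_pos.2 (l_ne_zero hk hK i)
    refine mem_D_of_inv hk hK (by rw [e1, e2]; linarith) (by rw [e2, e3]; linarith) ?_ ?_
    · rw [z0, z1, Complex.inv_re, Complex.inv_re, e1, e2, zero_div]
      exact div_neg_of_neg_of_pos (by linarith) (hns _)
    · rw [z1, z2, Complex.inv_re, Complex.inv_re, e2, e3, zero_div]
      exact div_pos (by linarith) (hns _)
  · refine ⟨-1, 1, by simp, by simp, by simp, fun s h0 h1 => ?_⟩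
    obtain ⟨hk, hlo, hmid, hhi⟩ := path_spec (s := s) n (c := -1) (q := 1) (by simp)
      (by nlinarith)
    have hK := path_pow_six n (c := -1) (q := 1) (by simp) (by simp) (by simp) h0 h1
    have hr := hρ s h0 h1
    generalize √(4 - 3 * 1 * s ^ 2) = ρ at *
    have e1 : l (path n (-1) 1 s) (lOrder n 0) = ((s - ρ) / 2 : ℝ) := by
      rw [hlo]; push_cast; ring
    have e2 : l (path n (-1) 1 s) (lOrder n 1) = (-s : ℝ) := by
      rw [hmid]; push_cast; ring
    have e3 : l (path n (-1) 1 s) (lOrder n 2) = ((s + ρ) / 2 : ℝ) := by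
      rw [hhi]; push_cast; ring
    refine mem_D_of_inv hk hK ?_ ?_ ?_ ?_
    · rw [e1, e2, Complex.ofReal_re, Complex.ofReal_re]; linarith
    · rw [e2, e3, Complex.ofReal_re, Complex.ofReal_re]; linarith
    · rw [z0, z1, e1, e2, ← Complex.ofReal_inv, ← Complex.ofReal_inv, Complex.ofReal_re,
        Complex.ofReal_re]
      exact (inv_lt_inv_of_neg (by linarith) (by linarith)).2 (by linarith)
    · rw [z1, z2, e1, e3, ← Complex.ofReal_inv, ← Complex.ofReal_inv, Complex.ofReal_re,
        Complex.ofReal_re]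
      exact (inv_lt_zero.2 (by linarith)).trans (inv_pos.2 (by linarith))
  · refine ⟨1, 1, by simp, by simp, by simp, fun s h0 h1 => ?_⟩
    obtain ⟨hk, hlo, hmid, hhi⟩ := path_spec (s := s) n (c := 1) (q := 1) (by simp)
      (by nlinarith)
    have hK := path_pow_six n (c := 1) (q := 1) (by simp) (by simp) (by simp) h0 h1
    have hr := hρ s h0 h1
    generalize √(4 - 3 * 1 * s ^ 2) = ρ at *
    have e1 : l (path n 1 1 s) (lOrder n 0) = ((-s - ρ) / 2 : ℝ) := by
      rw [hlo]; push_cast; ring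
    have e2 : l (path n 1 1 s) (lOrder n 1) = (s : ℝ) := by
      rw [hmid]; ring
    have e3 : l (path n 1 1 s) (lOrder n 2) = ((-s + ρ) / 2 : ℝ) := by
      rw [hhi]; push_cast; ring
    refine mem_D_of_inv hk hK ?_ ?_ ?_ ?_
    · rw [e1, e2, Complex.ofReal_re, Complex.ofReal_re]; linarith
    · rw [e2, e3, Complex.ofReal_re, Complex.ofReal_re]; linarith
    · rw [z0, z1, e1, e3, ← Complex.ofReal_inv, ← Complex.ofReal_inv, Complex.ofReal_re,
        Complex.ofReal_re]
      exact (inv_lt_zero.2 (by linarith)).trans (inv_pos.2 (by linarith))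
    · rw [z1, z2, e2, e3, ← Complex.ofReal_inv, ← Complex.ofReal_inv, Complex.ofReal_re,
        Complex.ofReal_re]
      exact (inv_lt_inv₀ (by linarith) h0).2 (by linarith)

/-! ### Approach to a zero of `λ` -/

variable {K : ℂ}

lemma eventually_pow_six_ne (hK : K ^ 6 = -1) (S : Set ℂ) :
    ∀ᶠ w in 𝓝[S \ {K}] K, w ≠ 0 ∧ w ^ 6 ≠ 1 ∧ w ^ 6 ≠ -1 := by
  have hK0 : K ≠ 0 := by rintro rfl; norm_num at hK
  have h1 : ∀ᶠ w in 𝓝 K, w ≠ 0 := isOpen_ne.mem_nhds hK0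
  have h2 : ∀ᶠ w in 𝓝 K, w ^ 6 ≠ 1 := by
    have : ContinuousAt (fun w : ℂ => w ^ 6) K := by fun_prop
    exact this.eventually_ne (by rw [hK]; norm_num)
  have h3 : ∀ᶠ w in 𝓝[≠] K, w ^ 6 ≠ -1 := by
    -- The zeros of w⁶ + 1 are simple, hence isolated.
    have hd : HasDerivAt (fun w : ℂ => w ^ 6) (6 * K ^ 5) K := by
      simpa using hasDerivAt_pow 6 K
    have := hd.eventually_ne (c := (-1 : ℂ)) (by simp [hK0])
    exact this
  have h4 : 𝓝[S \ {K}] K ≤ 𝓝[≠] K := nhdsWithin_mono _ fun x hx => hx.2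
  exact (h1.filter_mono nhdsWithin_le_nhds).and
    ((h2.filter_mono nhdsWithin_le_nhds).and (h3.filter_mono h4))

lemma lamZero_mem_sector (hK : K ^ 6 = -1) (hKD : K ∈ closure (D n)) : K ∈ sector n :=
  mem_sector_of_closure hKD (im_cube_ne_zero_of_pow_six hK)

lemma tendsto_l (hK : K ≠ 0) (S : Set ℂ) (i : Fin 3) :
    Tendsto (fun w => l w i) (𝓝[S] K) (𝓝 (l K i)) :=
  (differentiableAt_l hK i).continuousAt.tendsto.mono_left nhdsWithin_le_nhds

lemma zOrder_extremes (n : Fin 18) (h : zOrder n 1 = lOrder n 1) :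
    zOrder n 0 = lOrder n 0 ∧ zOrder n 2 = lOrder n 2 := by
  revert n; decide

/-- Near a zero of `λ` the difference of the `Re z`'s of the rows in `Near` is bounded. -/
lemma eventually_near (hK : K ^ 6 = -1) (hKD : K ∈ closure (D n)) :
    ∀ᶠ w in 𝓝[closure (D n) \ {K}] K, ∀ i c, Near n i c → |(z w i).re - (z w c).re| ≤ 3 := by
  have hsec := lamZero_mem_sector hK hKD
  have hK0 := sector_ne_zero hsec
  obtain ⟨h0, h1, h2⟩ := l_of_pow_six hsec hK
  -- Differences of the z's are differences of the 1/l's. For the outer rows these tend to 1 - (-1)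
  -- = 2, so 3 is an eventual bound; a middle row that is also in the middle of the z-order is
  -- trapped between them.
  have hinv : Tendsto (fun w => (l w (lOrder n 2))⁻¹ - (l w (lOrder n 0))⁻¹)
      (𝓝[closure (D n) \ {K}] K) (𝓝 2) := by
    have e1 := (tendsto_l hK0 (closure (D n) \ {K}) (lOrder n 2)).inv₀ (by rw [h2]; norm_num)
    have e2 := (tendsto_l hK0 (closure (D n) \ {K}) (lOrder n 0)).inv₀ (by rw [h0]; norm_num)
    have := e1.sub e2
    rw [h0, h2] at this
    norm_num at this
    exact this
  have hb : ∀ᶠ w in 𝓝[closure (D n) \ {K}] K,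
      ‖(l w (lOrder n 2))⁻¹ - (l w (lOrder n 0))⁻¹‖ < 3 :=
    hinv.norm.eventually_lt_const (by norm_num)
  filter_upwards [hb, eventually_pow_six_ne hK (closure (D n)), self_mem_nhdsWithin] with w hw hw6 hwD
  have hz2 : |(z w (lOrder n 2)).re - (z w (lOrder n 0)).re| ≤ 3 := by
    rw [← Complex.sub_re, z_sub hw6.1 hw6.2.2]
    exact (Complex.abs_re_le_norm _).trans hw.le
  have hmid : zOrder n 1 = lOrder n 1 → (z w (lOrder n 0)).re ≤ (z w (lOrder n 1)).re ∧
      (z w (lOrder n 1)).re ≤ (z w (lOrder n 2)).re := by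
    intro h
    have hA : zOrder n 0 = lOrder n 0 ∧ zOrder n 2 = lOrder n 2 := zOrder_extremes n h
    exact ⟨closure_D_re_z hwD.1 hw6.1 hw6.2.2 ⟨0, 1, by decide, hA.1, h⟩,
      closure_D_re_z hwD.1 hw6.1 hw6.2.2 ⟨1, 2, by decide, h, hA.2⟩⟩
  obtain ⟨b1, b2⟩ := abs_le.1 hz2
  intro i c hic
  rcases hic with rfl | ⟨hi, hc⟩ | h
  · simp
  · rcases lOrder_cases n i with rfl | rfl | rfl <;> rcases lOrder_cases n c with rfl | rfl | rfl <;>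
      first | exact absurd rfl hi | exact absurd rfl hc | (rw [abs_le]; constructor <;> linarith)
  · obtain ⟨m1, m2⟩ := hmid h
    rcases lOrder_cases n i with rfl | rfl | rfl <;> rcases lOrder_cases n c with rfl | rfl | rfl <;>
      (rw [abs_le]; constructor <;> linarith)

/-- The middle `z` separates from the other ones at a zero of `λ`. -/
lemma tendsto_norm_z_sub (hK : K ^ 6 = -1) (hKD : K ∈ closure (D n)) {i : Fin 3}
    (hi : i ≠ lOrder n 1) :
    Tendsto (fun w => ‖z w i - z w (lOrder n 1)‖) (𝓝[closure (D n) \ {K}] K) atTop := by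
  have hsec := lamZero_mem_sector hK hKD
  have hK0 := sector_ne_zero hsec
  obtain ⟨h0, h1, h2⟩ := l_of_pow_six hsec hK
  have hev := eventually_pow_six_ne hK (closure (D n))
  have hli : l K i ≠ 0 := by
    rcases lOrder_cases n i with rfl | rfl | rfl
    · rw [h0]; norm_num
    · exact absurd rfl hi
    · rw [h2]; norm_num
  have e1 : Tendsto (fun w => ‖(l w (lOrder n 1))⁻¹‖) (𝓝[closure (D n) \ {K}] K) atTop := by
    simp_rw [norm_inv]
    refine Tendsto.inv_tendsto_nhdsGT_zero (tendsto_nhdsWithin_iff.2 ⟨?_, ?_⟩)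
    · have := (tendsto_l hK0 (closure (D n) \ {K}) (lOrder n 1)).norm
      rwa [h1, norm_zero] at this
    · filter_upwards [hev] with w hw
      exact norm_pos_iff.2 (l_ne_zero hw.1 hw.2.2 _)
  have e2 : Tendsto (fun w => ‖(l w i)⁻¹‖) (𝓝[closure (D n) \ {K}] K) (𝓝 ‖(l K i)⁻¹‖) :=
    ((tendsto_l hK0 _ i).inv₀ hli).norm
  have e3 := e1.atTop_add e2.neg
  refine tendsto_atTop_mono' _ ?_ e3
  filter_upwards [hev] with w hw
  rw [z_sub hw.1 hw.2.2, norm_sub_rev]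
  have := norm_sub_norm_le ((l w (lOrder n 1))⁻¹) ((l w i)⁻¹)
  linarith

/-! ### Smoothness of the partial derivatives -/

lemma uniqueDiffOn_Omega (T : ℝ) : UniqueDiffOn ℝ (Omega T) :=
  (uniqueDiffOn_Ici 0).prod (uniqueDiffOn_Ico 0 T)

lemma mem_Omega {T x t : ℝ} : (x, t) ∈ Omega T ↔ 0 ≤ x ∧ 0 ≤ t ∧ t < T := by
  simp [Omega]

variable {T : ℝ} {f : ℝ → ℝ → ℝ}

lemma hasDerivWithinAt_dx (hf : DifferentiableOn ℝ (fun p : ℝ × ℝ => f p.1 p.2) (Omega T))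
    {x t : ℝ} (hp : (x, t) ∈ Omega T) :
    HasDerivWithinAt (fun y => f y t) (dx f x t) (Ici 0) x ∧
    dx f x t = fderivWithin ℝ (fun p : ℝ × ℝ => f p.1 p.2) (Omega T) (x, t) (1, 0) := by
  have h1 := (hf (x, t) hp).hasFDerivWithinAt
  have h2 : HasDerivWithinAt (fun y : ℝ => ((y, t) : ℝ × ℝ)) ((1, 0) : ℝ × ℝ) (Ici 0) x :=
    ((hasDerivAt_id x).prodMk (hasDerivAt_const x t)).hasDerivWithinAt
  have hm : MapsTo (fun y : ℝ => ((y, t) : ℝ × ℝ)) (Ici 0) (Omega T) := fun y hy =>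
    mem_Omega.2 ⟨hy, (mem_Omega.1 hp).2⟩
  have h3 : HasDerivWithinAt (fun y => f y t)
      (fderivWithin ℝ (fun p : ℝ × ℝ => f p.1 p.2) (Omega T) (x, t) (1, 0)) (Ici 0) x :=
    HasFDerivWithinAt.comp_hasDerivWithinAt (l := fun p : ℝ × ℝ => f p.1 p.2) (t := Omega T)
      x h1 h2 hm
  have h4 : dx f x t = _ := h3.derivWithin (uniqueDiffOn_Ici 0 x (mem_Omega.1 hp).1)
  exact ⟨h4 ▸ h3, h4⟩

lemma hasDerivWithinAt_dt (hf : DifferentiableOn ℝ (fun p : ℝ × ℝ => f p.1 p.2) (Omega T))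
    {x t : ℝ} (hp : (x, t) ∈ Omega T) :
    HasDerivWithinAt (fun s => f x s) (dt T f x t) (Ico 0 T) t ∧
    dt T f x t = fderivWithin ℝ (fun p : ℝ × ℝ => f p.1 p.2) (Omega T) (x, t) (0, 1) := by
  have h1 := (hf (x, t) hp).hasFDerivWithinAt
  have h2 : HasDerivWithinAt (fun s : ℝ => ((x, s) : ℝ × ℝ)) ((0, 1) : ℝ × ℝ) (Ico 0 T) t :=
    ((hasDerivAt_const t x).prodMk (hasDerivAt_id t)).hasDerivWithinAt
  have hm : MapsTo (fun s : ℝ => ((x, s) : ℝ × ℝ)) (Ico 0 T) (Omega T) := fun s hs =>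
    mem_Omega.2 ⟨(mem_Omega.1 hp).1, hs⟩
  have h3 : HasDerivWithinAt (fun s => f x s)
      (fderivWithin ℝ (fun p : ℝ × ℝ => f p.1 p.2) (Omega T) (x, t) (0, 1)) (Ico 0 T) t :=
    HasFDerivWithinAt.comp_hasDerivWithinAt (l := fun p : ℝ × ℝ => f p.1 p.2) (t := Omega T)
      t h1 h2 hm
  have h4 : dt T f x t = _ := h3.derivWithin (uniqueDiffOn_Ico 0 T t (mem_Omega.1 hp).2)
  exact ⟨h4 ▸ h3, h4⟩

lemma contDiffOn_dx {m : ℕ}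
    (hf : ContDiffOn ℝ (m + 1 : ℕ) (fun p : ℝ × ℝ => f p.1 p.2) (Omega T)) :
    ContDiffOn ℝ m (fun p : ℝ × ℝ => dx f p.1 p.2) (Omega T) := by
  have hd : DifferentiableOn ℝ (fun p : ℝ × ℝ => f p.1 p.2) (Omega T) :=
    hf.differentiableOn (by simp)
  have h := (hf.fderivWithin (m := m) (uniqueDiffOn_Omega T) (by norm_cast)).clm_apply
    (contDiffOn_const (c := ((1, 0) : ℝ × ℝ)))
  exact h.congr fun p hp => (hasDerivWithinAt_dx hd (x := p.1) (t := p.2) hp).2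

lemma contDiffOn_dt {m : ℕ}
    (hf : ContDiffOn ℝ (m + 1 : ℕ) (fun p : ℝ × ℝ => f p.1 p.2) (Omega T)) :
    ContDiffOn ℝ m (fun p : ℝ × ℝ => dt T f p.1 p.2) (Omega T) := by
  have hd : DifferentiableOn ℝ (fun p : ℝ × ℝ => f p.1 p.2) (Omega T) :=
    hf.differentiableOn (by simp)
  have h := (hf.fderivWithin (m := m) (uniqueDiffOn_Omega T) (by norm_cast)).clm_apply
    (contDiffOn_const (c := ((0, 1) : ℝ × ℝ)))
  exact h.congr fun p hp => (hasDerivWithinAt_dt hd (x := p.1) (t := p.2) hp).2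

/-! ### The regularity and decay that enter the integral equations -/

/-- The properties of `u` on which the analysis of the integral equations depends. -/
structure Field (T : ℝ) (u : ℝ → ℝ → ℝ) (h : ℝ → ℝ) : Prop where
  pos : 0 < T
  cont : ContinuousOn (fun p : ℝ × ℝ => u p.1 p.2) (Omega T)
  cont_dx : ContinuousOn (fun p : ℝ × ℝ => dx u p.1 p.2) (Omega T)
  cont_dxx : ContinuousOn (fun p : ℝ × ℝ => dx (dx u) p.1 p.2) (Omega T)
  bound : BoundedBy T u h
  anti : AntitoneOn h (Ici 0)
  int : IntegrableOn h (Ici 0)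
  smooth : ContDiffOn ℝ 1 (fun t => u 0 t) (Ico 0 T)
  smooth_dx : ContDiffOn ℝ 1 (fun t => dx u 0 t) (Ico 0 T)

lemma IsSolution.contDiffOn_dx_dx {u : ℝ → ℝ → ℝ} (hu : IsSolution T u) :
    ContDiffOn ℝ 2 (fun p : ℝ × ℝ => dx u p.1 p.2) (Omega T) ∧
    ContDiffOn ℝ 1 (fun p : ℝ × ℝ => dx (dx u) p.1 p.2) (Omega T) := by
  have h3 : ContDiffOn ℝ ((2 + 1 : ℕ) : WithTop ℕ∞) (fun p : ℝ × ℝ => u p.1 p.2) (Omega T) :=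
    hu.smooth
  have h2 := contDiffOn_dx h3
  have h1 := contDiffOn_dx (m := 1) h2
  exact ⟨h2, h1⟩

lemma IsSolution.field {u : ℝ → ℝ → ℝ} {h : ℝ → ℝ} (hT : 0 < T) (hu : IsSolution T u)
    (hb : BoundedBy T u h) (ha : AntitoneOn h (Ici 0)) (hi : IntegrableOn h (Ici 0)) :
    Field T u h := by
  obtain ⟨h2, h1⟩ := hu.contDiffOn_dx_dx
  have hmap : ContDiffOn ℝ 1 (fun t : ℝ => ((0, t) : ℝ × ℝ)) (Ico 0 T) := by fun_prop
  have hm : MapsTo (fun t : ℝ => ((0, t) : ℝ × ℝ)) (Ico 0 T) (Omega T) := fun t ht =>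
    mem_Omega.2 ⟨le_rfl, ht⟩
  exact ⟨hT, hu.smooth.continuousOn, h2.continuousOn, h1.continuousOn, hb, ha, hi,
    (hu.smooth.of_le (by norm_num)).comp hmap hm, (h2.of_le (by norm_num)).comp hmap hm⟩

/-- The time shift of a field. -/
lemma Field.shift {u : ℝ → ℝ → ℝ} {h : ℝ → ℝ} (hF : Field T u h) {τ : ℝ} (hτ : 0 ≤ τ)
    (hτT : τ < T) : Field (T - τ) (fun x t => u x (t + τ)) h := by
  have hm : MapsTo (fun p : ℝ × ℝ => ((p.1, p.2 + τ) : ℝ × ℝ)) (Omega (T - τ)) (Omega T) := by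
    intro p hp
    obtain ⟨h1, h2, h3⟩ := mem_Omega.1 hp
    exact mem_Omega.2 ⟨h1, by linarith, by linarith⟩
  have hc : ContinuousOn (fun p : ℝ × ℝ => ((p.1, p.2 + τ) : ℝ × ℝ)) (Omega (T - τ)) := by fun_prop
  have hm1 : MapsTo (fun t : ℝ => t + τ) (Ico 0 (T - τ)) (Ico 0 T) := fun t ht =>
    ⟨by linarith [ht.1], by linarith [ht.2]⟩
  have hc1 : ContDiffOn ℝ 1 (fun t : ℝ => t + τ) (Ico 0 (T - τ)) := by fun_prop
  exact ⟨by linarith, hF.cont.comp hc hm, hF.cont_dx.comp hc hm, hF.cont_dxx.comp hc hm,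
    fun x t hp => hF.bound x (t + τ) (hm hp), hF.anti, hF.int, hF.smooth.comp hc1 hm1,
    hF.smooth_dx.comp hc1 hm1⟩

/-! ### Bounds and regularity of V₁ and V₂ -/

section Weights

variable {u : ℝ → ℝ → ℝ} {h : ℝ → ℝ} {k : ℂ}

lemma Field.h_nonneg (hF : Field T u h) {x : ℝ} (hx : 0 ≤ x) : 0 ≤ h x :=
  (abs_nonneg _).trans (hF.bound x 0 (mem_Omega.2 ⟨hx, le_rfl, hF.pos⟩)).1

lemma Field.h_le (hF : Field T u h) {x : ℝ} (hx : 0 ≤ x) : h x ≤ h 0 :=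
  hF.anti (mem_Ici.2 le_rfl) hx hx

/-- Monotonicity and nonnegativity give x h(x) ≤ ∫ h, so integrability forces decay. -/
lemma Field.tendsto_h (hF : Field T u h) : Tendsto h atTop (𝓝 0) := by
  have hI : ∀ x, 0 < x → h x ≤ (∫ y in Ici 0, h y) / x := by
    intro x hx
    rw [le_div_iff₀ hx]
    have h1 : ∫ _ in Ioc 0 x, h x ≤ ∫ y in Ioc 0 x, h y := by
      refine setIntegral_mono_on (by simp) (hF.int.mono_set fun y hy => hy.1.le)
        measurableSet_Ioc fun y hy => hF.anti (mem_Ici.2 hy.1.le) (mem_Ici.2 hx.le) hy.2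
    have h2 : ∫ y in Ioc 0 x, h y ≤ ∫ y in Ici 0, h y := by
      refine setIntegral_mono_set hF.int ?_ (Eventually.of_forall fun y hy => hy.1.le)
      filter_upwards [ae_restrict_mem measurableSet_Ici] with y hy
      exact hF.h_nonneg hy
    have h3 : ∫ _ in Ioc 0 x, h x = h x * x := by
      rw [setIntegral_const]
      simp [measureReal_def, hx.le, mul_comm]
    linarith
  refine squeeze_zero' ?_ ?_ (tendsto_const_nhds.div_atTop tendsto_id (a := ∫ y in Ici 0, h y))
  · filter_upwards [eventually_ge_atTop 0] with x hx using hF.h_nonneg hx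
  · filter_upwards [eventually_gt_atTop 0] with x hx using hI x hx

/-- The constant in the bounds of `V₁` and `V₂` by the decay rate. -/
def vConst (H : ℝ) (k : ℂ) : ℝ := ∑ i, ∑ j,
  (2 * ‖lam k‖ + (‖l k i ^ 2 - 1‖ * (1 + ‖l k j‖) + ‖l k i‖ * ‖1 - l k j ^ 2‖ + ‖1 - l k j ^ 2‖
    + ‖lam k‖ * (2 * H + 1))) / ‖den k i‖

lemma vConst_nonneg {H : ℝ} (hH : 0 ≤ H) (k : ℂ) : 0 ≤ vConst H k := by
  unfold vConst
  positivity

lemma continuousAt_vConst (H : ℝ) (hk : k ≠ 0) (hk6 : k ^ 6 ≠ 1) :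
    ContinuousAt (vConst H) k := by
  unfold vConst
  refine tendsto_finsetSum _ fun i _ => tendsto_finsetSum _ fun j _ => ?_
  have hl : ∀ i, ContinuousAt (fun k => l k i) k := fun i => (differentiableAt_l hk i).continuousAt
  have hlam : ContinuousAt lam k := (differentiableAt_lam hk).continuousAt
  have hden : ContinuousAt (fun k => den k i) k := (differentiableAt_den hk i).continuousAt
  have hi := hl i
  have hj := hl j
  change ContinuousAt _ k
  have h0 : ‖den k i‖ ≠ 0 := norm_ne_zero_iff.2 (den_ne_zero hk hk6 i)
  fun_prop (disch := assumption)

lemma le_vConst {H : ℝ} (hH : 0 ≤ H) (k : ℂ) (i j : Fin 3) :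
    (2 * ‖lam k‖ + (‖l k i ^ 2 - 1‖ * (1 + ‖l k j‖) + ‖l k i‖ * ‖1 - l k j ^ 2‖ + ‖1 - l k j ^ 2‖
      + ‖lam k‖ * (2 * H + 1))) / ‖den k i‖ ≤ vConst H k := by
  unfold vConst
  refine le_trans ?_ (Finset.single_le_sum (f := fun i => ∑ j, (2 * ‖lam k‖ +
    (‖l k i ^ 2 - 1‖ * (1 + ‖l k j‖) + ‖l k i‖ * ‖1 - l k j ^ 2‖ + ‖1 - l k j ^ 2‖
    + ‖lam k‖ * (2 * H + 1))) / ‖den k i‖) (fun i _ => by positivity) (Finset.mem_univ i))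
  exact Finset.single_le_sum (f := fun j => (2 * ‖lam k‖ +
    (‖l k i ^ 2 - 1‖ * (1 + ‖l k j‖) + ‖l k i‖ * ‖1 - l k j ^ 2‖ + ‖1 - l k j ^ 2‖
    + ‖lam k‖ * (2 * H + 1))) / ‖den k i‖) (fun j _ => by positivity) (Finset.mem_univ j)

lemma Field.norm_V₁_le (hF : Field T u h) (hk : k ≠ 0) (hk6 : k ^ 6 ≠ 1) {x t : ℝ}
    (hp : (x, t) ∈ Omega T) (i j : Fin 3) : ‖V₁ u k x t i j‖ ≤ vConst (h 0) k * h x := by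
  obtain ⟨b1, b2, b3⟩ := hF.bound x t hp
  have hx := (mem_Omega.1 hp).1
  have hh := hF.h_nonneg hx
  have hH : 0 ≤ h 0 := hF.h_nonneg le_rfl
  rw [V₁_apply hk hk6, norm_div, norm_mul]
  have h1 : ‖(u x t : ℂ) - (dx (dx u) x t : ℂ)‖ ≤ 2 * h x := by
    refine (norm_sub_le _ _).trans ?_
    rw [Complex.norm_real, Complex.norm_real, Real.norm_eq_abs, Real.norm_eq_abs]
    linarith
  refine le_trans ?_ (mul_le_mul_of_nonneg_right (le_vConst hH k i j) hh)
  rw [div_mul_eq_mul_div]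
  refine div_le_div_of_nonneg_right ?_ (norm_nonneg _)
  have : 0 ≤ (‖l k i ^ 2 - 1‖ * (1 + ‖l k j‖) + ‖l k i‖ * ‖1 - l k j ^ 2‖ + ‖1 - l k j ^ 2‖
      + ‖lam k‖ * (2 * h 0 + 1)) * h x := by positivity
  nlinarith [mul_le_mul_of_nonneg_left h1 (norm_nonneg (lam k))]

lemma Field.norm_V₂_le (hF : Field T u h) (hk : k ≠ 0) (hk6 : k ^ 6 ≠ 1) {x t : ℝ}
    (hp : (x, t) ∈ Omega T) (i j : Fin 3) : ‖V₂ u k x t i j‖ ≤ vConst (h 0) k * h x := by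
  obtain ⟨b1, b2, b3⟩ := hF.bound x t hp
  have hx := (mem_Omega.1 hp).1
  have hh := hF.h_nonneg hx
  have hH : 0 ≤ h 0 := hF.h_nonneg le_rfl
  have hle := hF.h_le hx
  rw [V₂_apply hk hk6, norm_div]
  have n1 : ‖(u x t : ℂ)‖ ≤ h x := by rwa [Complex.norm_real, Real.norm_eq_abs]
  have n2 : ‖(dx u x t : ℂ)‖ ≤ h x := by rwa [Complex.norm_real, Real.norm_eq_abs]
  have n3 : ‖(dx (dx u) x t : ℂ)‖ ≤ h x := by rwa [Complex.norm_real, Real.norm_eq_abs]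
  generalize (u x t : ℂ) = a at *
  generalize (dx u x t : ℂ) = b at *
  generalize (dx (dx u) x t : ℂ) = c at *
  have m1 : ‖(l k i ^ 2 - 1) * (b - a * l k j)‖ ≤ ‖l k i ^ 2 - 1‖ * (1 + ‖l k j‖) * h x := by
    rw [norm_mul, mul_assoc]
    gcongr
    refine (norm_sub_le _ _).trans ?_
    rw [norm_mul]
    nlinarith [mul_le_mul_of_nonneg_right n1 (norm_nonneg (l k j))]
  have m2 : ‖l k i * (a * (1 - l k j ^ 2))‖ ≤ ‖l k i‖ * ‖1 - l k j ^ 2‖ * h x := by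
    rw [norm_mul, norm_mul, mul_assoc, mul_comm ‖a‖]
    gcongr
  have m3 : ‖b * (1 - l k j ^ 2)‖ ≤ ‖1 - l k j ^ 2‖ * h x := by
    rw [norm_mul, mul_comm]
    gcongr
  have m4 : ‖lam k * a * (a - c + 1)‖ ≤ ‖lam k‖ * (2 * h 0 + 1) * h x := by
    rw [norm_mul, norm_mul, mul_assoc, mul_assoc, mul_comm ‖a‖]
    gcongr
    refine (norm_add_le _ _).trans ?_
    rw [norm_one]
    linarith [norm_sub_le a c]
  refine le_trans ?_ (mul_le_mul_of_nonneg_right (le_vConst hH k i j) hh)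
  rw [div_mul_eq_mul_div]
  gcongr
  have m5 := norm_add_le ((l k i ^ 2 - 1) * (b - a * l k j) + l k i * (a * (1 - l k j ^ 2)))
    (b * (1 - l k j ^ 2) - lam k * a * (a - c + 1))
  have m6 := norm_add_le ((l k i ^ 2 - 1) * (b - a * l k j)) (l k i * (a * (1 - l k j ^ 2)))
  have m7 := norm_sub_le (b * (1 - l k j ^ 2)) (lam k * a * (a - c + 1))
  have m8 : 0 ≤ 2 * ‖lam k‖ * h x := by positivity
  linarith

/-! ### Continuity of the coefficients -/

lemma Field.continuousOn_V₁ (hF : Field T u h) (hk : k ≠ 0) (hk6 : k ^ 6 ≠ 1) (i j : Fin 3) :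
    ContinuousOn (fun p : ℝ × ℝ => V₁ u k p.1 p.2 i j) (Omega T) := by
  simp_rw [V₁_apply hk hk6]
  have h1 : ContinuousOn (fun p : ℝ × ℝ => (u p.1 p.2 : ℂ)) (Omega T) :=
    Complex.continuous_ofReal.comp_continuousOn hF.cont
  have h2 : ContinuousOn (fun p : ℝ × ℝ => (dx (dx u) p.1 p.2 : ℂ)) (Omega T) :=
    Complex.continuous_ofReal.comp_continuousOn hF.cont_dxx
  exact (continuousOn_const.mul (h1.sub h2)).div_const _

lemma Field.continuousOn_V₂ (hF : Field T u h) (hk : k ≠ 0) (hk6 : k ^ 6 ≠ 1) (i j : Fin 3) :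
    ContinuousOn (fun p : ℝ × ℝ => V₂ u k p.1 p.2 i j) (Omega T) := by
  simp_rw [V₂_apply hk hk6]
  have h1 : ContinuousOn (fun p : ℝ × ℝ => (u p.1 p.2 : ℂ)) (Omega T) :=
    Complex.continuous_ofReal.comp_continuousOn hF.cont
  have h3 : ContinuousOn (fun p : ℝ × ℝ => (dx u p.1 p.2 : ℂ)) (Omega T) :=
    Complex.continuous_ofReal.comp_continuousOn hF.cont_dx
  have h2 : ContinuousOn (fun p : ℝ × ℝ => (dx (dx u) p.1 p.2 : ℂ)) (Omega T) :=
    Complex.continuous_ofReal.comp_continuousOn hF.cont_dxx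
  fun_prop

lemma continuousOn_slice_x {F : ℝ × ℝ → ℂ} (hF : ContinuousOn F (Omega T)) {t : ℝ}
    (ht : t ∈ Ico 0 T) : ContinuousOn (fun x => F (x, t)) (Ici 0) :=
  hF.comp (by fun_prop) fun _ hx => mem_Omega.2 ⟨hx, ht⟩

lemma continuousOn_slice_t {F : ℝ × ℝ → ℂ} (hF : ContinuousOn F (Omega T)) {x : ℝ}
    (hx : 0 ≤ x) : ContinuousOn (fun t => F (x, t)) (Ico 0 T) :=
  hF.comp (by fun_prop) fun _ ht => mem_Omega.2 ⟨hx, ht⟩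

lemma differentiableAt_V₁ (u : ℝ → ℝ → ℝ) (x t : ℝ) (i j : Fin 3) (hk : k ≠ 0)
    (hk6 : k ^ 6 ≠ 1) : DifferentiableAt ℂ (fun k => V₁ u k x t i j) k := by
  have hev : (fun k => V₁ u k x t i j) =ᶠ[𝓝 k]
      fun k => lam k * ((u x t : ℂ) - (dx (dx u) x t : ℂ)) / den k i := by
    have h1 : ∀ᶠ w in 𝓝 k, w ≠ 0 := isOpen_ne.mem_nhds hk
    have h2 : ∀ᶠ w in 𝓝 k, w ^ 6 ≠ 1 :=
      ContinuousAt.eventually_ne (by fun_prop : ContinuousAt (fun w : ℂ => w ^ 6) k) hk6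
    filter_upwards [h1, h2] with w hw1 hw2 using V₁_apply hw1 hw2 u x t i j
  refine DifferentiableAt.congr_of_eventuallyEq ?_ hev
  exact ((differentiableAt_lam hk).mul_const _).div (differentiableAt_den hk i)
    (den_ne_zero hk hk6 i)

lemma differentiableAt_V₂ (u : ℝ → ℝ → ℝ) (x t : ℝ) (i j : Fin 3) (hk : k ≠ 0)
    (hk6 : k ^ 6 ≠ 1) : DifferentiableAt ℂ (fun k => V₂ u k x t i j) k := by
  have hev : (fun k => V₂ u k x t i j) =ᶠ[𝓝 k]
      fun k => ((l k i ^ 2 - 1) * (dx u x t - u x t * l k j)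
      + l k i * (u x t * (1 - l k j ^ 2))
      + (dx u x t * (1 - l k j ^ 2) - lam k * u x t * (u x t - dx (dx u) x t + 1))) / den k i := by
    have h1 : ∀ᶠ w in 𝓝 k, w ≠ 0 := isOpen_ne.mem_nhds hk
    have h2 : ∀ᶠ w in 𝓝 k, w ^ 6 ≠ 1 :=
      ContinuousAt.eventually_ne (by fun_prop : ContinuousAt (fun w : ℂ => w ^ 6) k) hk6
    filter_upwards [h1, h2] with w hw1 hw2 using V₂_apply hw1 hw2 u x t i j
  refine DifferentiableAt.congr_of_eventuallyEq ?_ hev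
  have a1 := differentiableAt_l hk i
  have a2 := differentiableAt_l hk j
  have a3 := differentiableAt_lam hk
  have a4 := differentiableAt_den hk i
  have a5 := den_ne_zero hk hk6 i
  fun_prop (disch := assumption)

end Weights

/-! ### Integral kernels along a curve -/

/-- The `x`-coordinate of the boundary point with parameter `s`. -/
def bx (s : ℝ) : ℝ := max s 0

/-- The `t`-coordinate of the boundary point with parameter `s`. -/
def bt (s : ℝ) : ℝ := max (-s) 0

lemma bx_of_nonneg {s : ℝ} (hs : 0 ≤ s) : bx s = s := max_eq_left hs

lemma bx_of_nonpos {s : ℝ} (hs : s ≤ 0) : bx s = 0 := max_eq_right hs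

lemma bt_of_nonneg {s : ℝ} (hs : 0 ≤ s) : bt s = 0 := max_eq_right (by linarith)

lemma bt_of_nonpos {s : ℝ} (hs : s ≤ 0) : bt s = -s := max_eq_left (by linarith)

lemma bx_nonneg (s : ℝ) : 0 ≤ bx s := le_max_right _ _

lemma bt_nonneg (s : ℝ) : 0 ≤ bt s := le_max_right _ _

lemma bt_lt {T s : ℝ} (hT : 0 < T) (hs : -T < s) : bt s < T := max_lt (by linarith) hT

lemma bx_mono : Monotone bx := fun _ _ h => max_le_max_right 0 h

lemma bt_anti : Antitone bt := fun _ _ h => max_le_max_right 0 (neg_le_neg h)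

lemma continuous_bx : Continuous bx := continuous_id.max continuous_const

lemma continuous_bt : Continuous bt := continuous_neg.max continuous_const

/-- The kernel with signed indicators `o`, exponents `a`, `b` and coefficient matrix `V`; the second
component of a point of `ℝ × Fin 3` is the row index. -/
def gKer (o : Fin 3 → ℝ → ℝ → ℂ) (V : ℝ → Matrix (Fin 3) (Fin 3) ℂ) (a b : Fin 3 → ℂ)
    (p p' : ℝ × Fin 3) : ℂ :=
  o p.2 p.1 p'.1 * Complex.exp (a p.2 * (bx p.1 - bx p'.1 : ℝ) + b p.2 * (bt p.1 - bt p'.1 : ℝ))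
    * V p'.1 p.2 p'.2

open Classical in
/-- The inhomogeneous term: the `j`-th unit vector, transported by the exponentials. -/
def gCol (S : Set ℝ) (a b : Fin 3 → ℂ) (j : Fin 3) (p : ℝ × Fin 3) : ℂ :=
  if p.1 ∈ S ∧ p.2 = j then Complex.exp (a p.2 * (bx p.1 : ℝ) + b p.2 * (bt p.1 : ℝ)) else 0

/-- The first Fredholm series of the equation with kernel `gKer` and inhomogeneous term `gCol`. -/
def gM (μ : Measure (ℝ × Fin 3)) (o : Fin 3 → ℝ → ℝ → ℂ) (V : ℝ → Matrix (Fin 3) (Fin 3) ℂ)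
    (S : Set ℝ) (a b : Fin 3 → ℂ) (j : Fin 3) (p : ℝ × Fin 3) : ℂ :=
  bSeries μ (gCol S a b j p) (gKer o V a b p) (gCol S a b j) (gKer o V a b)

variable {μ : Measure (ℝ × Fin 3)} {o : Fin 3 → ℝ → ℝ → ℂ} {V : ℝ → Matrix (Fin 3) (Fin 3) ℂ}
  {S : Set ℝ} {a b : Fin 3 → ℂ} {j : Fin 3}

/-- The change of gauge by `exp(-(g x + g' t))`. -/
def gauge (g g' : ℂ) (p : ℝ × Fin 3) : ℂ :=
  Complex.exp (-(g * (bx p.1 : ℝ) + g' * (bt p.1 : ℝ)))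

lemma gauge_ne_zero (g g' : ℂ) (p : ℝ × Fin 3) : gauge g g' p ≠ 0 := Complex.exp_ne_zero _

lemma gKer_shift (g g' : ℂ) (p p' : ℝ × Fin 3) :
    gKer o V (fun i => a i - g) (fun i => b i - g') p p' =
      gauge g g' p * gKer o V a b p p' * (gauge g g' p')⁻¹ := by
  unfold gKer gauge
  rw [← Complex.exp_neg]
  have : Complex.exp ((a p.2 - g) * (bx p.1 - bx p'.1 : ℝ) + (b p.2 - g') * (bt p.1 - bt p'.1 : ℝ))
      = Complex.exp (-(g * (bx p.1 : ℝ) + g' * (bt p.1 : ℝ)))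
        * Complex.exp (a p.2 * (bx p.1 - bx p'.1 : ℝ) + b p.2 * (bt p.1 - bt p'.1 : ℝ))
        * Complex.exp (-(-(g * (bx p'.1 : ℝ) + g' * (bt p'.1 : ℝ)))) := by
    rw [← Complex.exp_add, ← Complex.exp_add]
    congr 1
    push_cast
    ring
  rw [this]
  ring

lemma gCol_shift (g g' : ℂ) (p : ℝ × Fin 3) :
    gCol S (fun i => a i - g) (fun i => b i - g') j p = gauge g g' p * gCol S a b j p := by
  unfold gCol gauge
  split_ifs
  · rw [← Complex.exp_add]
    congr 1
    ring
  · simp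

/-- Subtracting the same g and g' from all exponents is conjugation of the kernel by `gauge`, which
rescales the unknown pointwise. This freedom is used to make unbounded exponentials bounded. -/
lemma gM_shift (g g' : ℂ) (p : ℝ × Fin 3) :
    gM μ o V S (fun i => a i - g) (fun i => b i - g') j p = gauge g g' p * gM μ o V S a b j p := by
  unfold gM
  rw [← bSeries_conj (gauge g g') (gauge_ne_zero g g'), gCol_shift]
  congr 1
  · funext q; exact gKer_shift g g' p q
  · funext q; exact gCol_shift g g' q
  · funext q q'; exact gKer_shift g g' q q'

lemma fredholmDet_shift (g g' : ℂ) :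
    fredholmDet μ (gKer o V (fun i => a i - g) (fun i => b i - g')) =
      fredholmDet μ (gKer o V a b) := by
  rw [fredholmDet_eq_bSeries, fredholmDet_eq_bSeries]
  have h := bSeries_conj (μ := μ) (α := 1) (r := fun _ => 0) (e := fun _ => 0)
    (K := gKer o V a b) (gauge g g') (gauge_ne_zero g g') 1
  simp only [mul_one, mul_zero, zero_mul, one_mul] at h
  rw [← h]
  congr 1
  funext q q'
  exact gKer_shift g g' q q'

lemma measurable_of_fin {Y : Type*} [MeasurableSpace Y] {F : Y × Fin 3 → ℂ}
    (hF : ∀ i, Measurable fun y => F (y, i)) : Measurable F :=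
  measurable_from_prod_countable_left hF

lemma measurable_gKer (ho : ∀ i, Measurable (Function.uncurry (o i)))
    (hV : ∀ i i', Measurable fun s => V s i i') (a b : Fin 3 → ℂ) :
    Measurable (Function.uncurry (gKer o V a b)) := by
  have h : ∀ i i' : Fin 3, Measurable fun q : ℝ × ℝ => gKer o V a b (q.1, i) (q.2, i') := by
    intro i i'
    unfold gKer
    have h1 : Continuous fun q : ℝ × ℝ => Complex.exp (a i * (bx q.1 - bx q.2 : ℝ)
        + b i * (bt q.1 - bt q.2 : ℝ)) := by
      have := continuous_bx
      have := continuous_bt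
      fun_prop
    exact ((ho i).mul h1.measurable).mul ((hV i i').comp measurable_snd)
  have h2 : Measurable fun q : ((ℝ × ℝ) × Fin 3) × Fin 3 =>
      gKer o V a b (q.1.1.1, q.1.2) (q.1.1.2, q.2) :=
    measurable_of_fin fun i' => measurable_of_fin fun i => h i i'
  have h3 : Measurable fun q : (ℝ × Fin 3) × (ℝ × Fin 3) =>
      ((((q.1.1, q.2.1), q.1.2), q.2.2) : ((ℝ × ℝ) × Fin 3) × Fin 3) := by fun_prop
  exact h2.comp h3

lemma measurable_gCol (hS : MeasurableSet S) (a b : Fin 3 → ℂ) (j : Fin 3) :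
    Measurable (gCol S a b j) := by
  refine measurable_of_fin fun i => ?_
  unfold gCol
  have h1 : Continuous fun s : ℝ => Complex.exp (a i * (bx s : ℝ) + b i * (bt s : ℝ)) := by
    have := continuous_bx
    have := continuous_bt
    fun_prop
  exact Measurable.ite (hS.inter (MeasurableSet.const (i = j))) h1.measurable measurable_const

lemma gDom {ρ : ℝ → ℝ} {C : ℝ} (ho : ∀ i, Measurable (Function.uncurry (o i)))
    (hV : ∀ i i', Measurable fun s => V s i i') (hS : MeasurableSet S)
    (hK : ∀ p p', ‖gKer o V a b p p'‖ ≤ ρ p'.1) (hC : ∀ p, ‖gCol S a b j p‖ ≤ C)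
    (p : ℝ × Fin 3) :
    Dom (fun p => ρ p.1) C (gCol S a b j p) (gKer o V a b p) (gCol S a b j) (gKer o V a b) :=
  ⟨hC p, hK p, hC, hK, (measurable_gKer ho hV a b).comp measurable_prodMk_left,
    measurable_gCol hS a b j, measurable_gKer ho hV a b⟩

/-! ### Pointwise dependence on parameters -/

lemma tendsto_gKer {ι : Type*} {F : Filter ι} {V' : ι → ℝ → Matrix (Fin 3) (Fin 3) ℂ}
    {a' b' : ι → Fin 3 → ℂ} (hV : ∀ s i i', Tendsto (fun w => V' w s i i') F (𝓝 (V s i i')))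
    (ha : ∀ i, Tendsto (fun w => a' w i) F (𝓝 (a i)))
    (hb : ∀ i, Tendsto (fun w => b' w i) F (𝓝 (b i))) (p p' : ℝ × Fin 3) :
    Tendsto (fun w => gKer o (V' w) (a' w) (b' w) p p') F (𝓝 (gKer o V a b p p')) := by
  unfold gKer
  refine Tendsto.mul (Tendsto.const_mul _ ?_) (hV _ _ _)
  exact (Complex.continuous_exp.tendsto _).comp
    (((ha _).mul_const _).add ((hb _).mul_const _))

lemma tendsto_gCol {ι : Type*} {F : Filter ι} {a' b' : ι → Fin 3 → ℂ}
    (ha : ∀ i, Tendsto (fun w => a' w i) F (𝓝 (a i)))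
    (hb : ∀ i, Tendsto (fun w => b' w i) F (𝓝 (b i))) (p : ℝ × Fin 3) :
    Tendsto (fun w => gCol S (a' w) (b' w) j p) F (𝓝 (gCol S a b j p)) := by
  unfold gCol
  split_ifs
  · exact (Complex.continuous_exp.tendsto _).comp
      (((ha _).mul_const _).add ((hb _).mul_const _))
  · exact tendsto_const_nhds

lemma differentiableOn_gKer {U : Set ℂ} {V' : ℂ → ℝ → Matrix (Fin 3) (Fin 3) ℂ}
    {a' b' : ℂ → Fin 3 → ℂ} (hV : ∀ s i i', DifferentiableOn ℂ (fun w => V' w s i i') U)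
    (ha : ∀ i, DifferentiableOn ℂ (fun w => a' w i) U)
    (hb : ∀ i, DifferentiableOn ℂ (fun w => b' w i) U) (p p' : ℝ × Fin 3) :
    DifferentiableOn ℂ (fun w => gKer o (V' w) (a' w) (b' w) p p') U := by
  unfold gKer
  exact (((((ha _).mul_const _).add ((hb _).mul_const _)).cexp).const_mul _).mul (hV _ _ _)

lemma differentiableOn_gCol {U : Set ℂ} {a' b' : ℂ → Fin 3 → ℂ}
    (ha : ∀ i, DifferentiableOn ℂ (fun w => a' w i) U)
    (hb : ∀ i, DifferentiableOn ℂ (fun w => b' w i) U) (p : ℝ × Fin 3) :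
    DifferentiableOn ℂ (fun w => gCol S (a' w) (b' w) j p) U := by
  unfold gCol
  split_ifs
  · exact (((ha _).mul_const _).add ((hb _).mul_const _)).cexp
  · exact differentiableOn_const _

/-! ### Integration over a curve with three rows -/

/-- The measure on the curve with parameter set `R`, with three rows. -/
def rowMeasure (R : Set ℝ) : Measure (ℝ × Fin 3) := (volume.restrict R).prod Measure.count

instance (R : Set ℝ) : SigmaFinite (rowMeasure R) := by unfold rowMeasure; infer_instance

lemma ae_rowMeasure {R : Set ℝ} (hR : MeasurableSet R) : ∀ᵐ p ∂(rowMeasure R), p.1 ∈ R := by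
  unfold rowMeasure
  exact Measure.quasiMeasurePreserving_fst.ae (ae_restrict_mem hR)

lemma integrable_rowMeasure {R : Set ℝ} {F : ℝ × Fin 3 → ℂ} (hF : Integrable F (rowMeasure R))
    (i : Fin 3) : IntegrableOn (fun s => F (s, i)) R := by
  unfold rowMeasure at hF
  have h := hF.prod_left_ae
  rw [Measure.ae_count_iff] at h
  exact h i

lemma integral_rowMeasure {R : Set ℝ} {F : ℝ × Fin 3 → ℂ} (hF : Integrable F (rowMeasure R)) :
    ∫ p, F p ∂(rowMeasure R) = ∑ i, ∫ s in R, F (s, i) := by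
  unfold rowMeasure at hF ⊢
  rw [integral_prod_symm _ hF, integral_count]

lemma integrable_weight {R : Set ℝ} {ρ : ℝ → ℝ} (hρ : IntegrableOn ρ R) :
    Integrable (fun p : ℝ × Fin 3 => ρ p.1) (rowMeasure R) := by
  unfold rowMeasure
  exact hρ.comp_fst _

/-! ### The kernel on the boundary of the domain -/

open Classical in
/-- The signed indicators of the contours of the `j`-th column, cut off to the boundary. -/
def bo (T : ℝ) (n : Fin 18) (j i : Fin 3) (s s' : ℝ) : ℂ :=
  if -T < s then orient (contour n i j) s s' else 0

/-- The coefficient of the one-form along the boundary, cut off to the boundary. -/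
def bV (T : ℝ) (u : ℝ → ℝ → ℝ) (k : ℂ) (s : ℝ) : Matrix (Fin 3) (Fin 3) ℂ :=
  if 0 ≤ s then V₁ u k s 0 else if -T < s then -V₂ u k 0 (-s) else 0

lemma bV_of_nonneg (T : ℝ) (u : ℝ → ℝ → ℝ) (k : ℂ) {s : ℝ} (hs : 0 ≤ s) :
    bV T u k s = V₁ u k s 0 := if_pos hs

lemma bV_of_neg {T : ℝ} (u : ℝ → ℝ → ℝ) (k : ℂ) {s : ℝ} (hs : s < 0) (hT : -T < s) :
    bV T u k s = -V₂ u k 0 (-s) := by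
  unfold bV
  rw [if_neg (not_le.2 hs), if_pos hT]

lemma bV_of_le {T : ℝ} (hT : 0 < T) (u : ℝ → ℝ → ℝ) (k : ℂ) {s : ℝ} (hs : s ≤ -T) :
    bV T u k s = 0 := by
  unfold bV
  rw [if_neg (by linarith), if_neg (not_lt.2 hs)]

/-- The exponents of the `j`-th column. -/
def lDiff (k : ℂ) (j i : Fin 3) : ℂ := l k i - l k j

/-- The exponents of the `j`-th column. -/
def zDiff (k : ℂ) (j i : Fin 3) : ℂ := z k i - z k j

@[simp] lemma lDiff_self (k : ℂ) (j : Fin 3) : lDiff k j j = 0 := sub_self _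

@[simp] lemma zDiff_self (k : ℂ) (j : Fin 3) : zDiff k j j = 0 := sub_self _

/-- The kernel of the `j`-th column on the boundary. -/
def bKer (T : ℝ) (u : ℝ → ℝ → ℝ) (n : Fin 18) (k : ℂ) (j : Fin 3) : ℝ × Fin 3 → ℝ × Fin 3 → ℂ :=
  gKer (bo T n j) (bV T u k) (lDiff k j) (zDiff k j)

/-- The Fredholm determinant of the `j`-th column. -/
def colDet (T : ℝ) (u : ℝ → ℝ → ℝ) (n : Fin 18) (k : ℂ) (j : Fin 3) : ℂ :=
  fredholmDet (rowMeasure (Ioi (-T))) (bKer T u n k j)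

/-- The first Fredholm series of the `j`-th column. -/
def colM (T : ℝ) (u : ℝ → ℝ → ℝ) (n : Fin 18) (k : ℂ) (j : Fin 3) (p : ℝ × Fin 3) : ℂ :=
  gM (rowMeasure (Ioi (-T))) (bo T n j) (bV T u k) (Ioi (-T)) (lDiff k j) (zDiff k j) j p

lemma kernel_eq_bKer {T : ℝ} (u : ℝ → ℝ → ℝ) (n : Fin 18) (k : ℂ) (j : Fin 3) {p p' : ℝ × Fin 3}
    (hp : -T < p.1) (hp' : -T < p'.1) : kernel u n k j p p' = bKer T u n k j p p' := by
  have hV : boundaryV u k p'.1 = bV T u k p'.1 := by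
    unfold boundaryV bV
    rw [if_pos hp']
  unfold kernel bKer gKer conjEntry bo
  rw [hV, if_pos hp, Matrix.of_apply, mul_assoc]
  rfl

/-- The cut-offs in `bo` and `bV` alter the kernel only on a null set. They make the domination hold
at every point, as `Dom` requires, and not merely almost everywhere. -/
lemma eigenDet_eq (T : ℝ) (u : ℝ → ℝ → ℝ) (n : Fin 18) (k : ℂ) :
    eigenDet T u n k = ∏ j, colDet T u n k j := by
  unfold eigenDet colDet
  refine Finset.prod_congr rfl fun j _ => ?_
  change fredholmDet (rowMeasure (Ioi (-T))) _ = _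
  rw [fredholmDet_eq_bSeries, fredholmDet_eq_bSeries]
  exact bSeries_congr (S := {p : ℝ × Fin 3 | -T < p.1}) (ae_rowMeasure (R := Ioi (-T)) measurableSet_Ioi)
    (fun _ _ => rfl) (fun _ _ => rfl) fun p hp p' hp' => kernel_eq_bKer u n k j hp hp'

lemma measurable_orient (c : Contour) : Measurable (Function.uncurry (orient c)) := by
  have m1 : MeasurableSet {q : ℝ × ℝ | q.2 ≤ q.1} := measurableSet_le measurable_snd measurable_fst
  have m2 : MeasurableSet {q : ℝ × ℝ | q.1 ≤ q.2} := measurableSet_le measurable_fst measurable_snd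
  have m3 : MeasurableSet {q : ℝ × ℝ | 0 ≤ q.2} := measurableSet_le measurable_const measurable_snd
  have m4 : MeasurableSet {q : ℝ × ℝ | q.2 ≤ 0} := measurableSet_le measurable_snd measurable_const
  cases c
  · exact Measurable.ite m1 measurable_const measurable_const
  · exact Measurable.ite (m3.inter m1) measurable_const
      (Measurable.ite (m2.inter m4) measurable_const measurable_const)
  · exact Measurable.ite m2 measurable_const measurable_const

lemma measurable_bo (T : ℝ) (n : Fin 18) (j i : Fin 3) :
    Measurable (Function.uncurry (bo T n j i)) :=
  Measurable.ite (measurableSet_lt measurable_const measurable_fst)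
    (measurable_orient (contour n i j)) measurable_const

variable {T : ℝ} {u : ℝ → ℝ → ℝ} {h : ℝ → ℝ} {k : ℂ} {n : Fin 18} {j : Fin 3}

lemma measurable_boundary {F G : ℝ → ℂ} (hF : ContinuousOn F (Ici 0))
    (hG : ContinuousOn G (Ico 0 T)) :
    Measurable fun s => if 0 ≤ s then F s else if -T < s then G (-s) else 0 := by
  have h2 : ContinuousOn (fun s => G (-s)) (Ioo (-T) 0) :=
    hG.comp continuous_neg.continuousOn fun s hs => ⟨by linarith [hs.2], by linarith [hs.1]⟩
  have e : (fun s => if 0 ≤ s then F s else if -T < s then G (-s) else 0) = fun s =>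
      (Ici 0).piecewise F (fun _ => 0) s
        + (Ioo (-T) 0).piecewise (fun s => G (-s)) (fun _ => 0) s := by
    funext s
    by_cases hs : 0 ≤ s
    · simp [hs, piecewise, not_lt.2 hs]
    · by_cases hs' : -T < s
      · simp [hs, piecewise, not_le.1 hs, hs']
      · simp [hs, piecewise, hs']
  rw [e]
  exact (hF.measurable_piecewise continuousOn_const measurableSet_Ici).add
    (h2.measurable_piecewise continuousOn_const measurableSet_Ioo)

lemma Field.measurable_bV (hF : Field T u h) (hk : k ≠ 0) (hk6 : k ^ 6 ≠ 1) (i i' : Fin 3) :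
    Measurable fun s => bV T u k s i i' := by
  have h1 : ContinuousOn (fun s => V₁ u k s 0 i i') (Ici 0) :=
    continuousOn_slice_x (hF.continuousOn_V₁ hk hk6 i i') ⟨le_rfl, hF.pos⟩
  have h2 : ContinuousOn (fun t => -V₂ u k 0 t i i') (Ico 0 T) :=
    (continuousOn_slice_t (hF.continuousOn_V₂ hk hk6 i i') le_rfl).neg
  have e : (fun s => bV T u k s i i') = fun s => if 0 ≤ s then V₁ u k s 0 i i'
      else if -T < s then -V₂ u k 0 (-s) i i' else 0 := by
    funext s
    unfold bV
    split_ifs <;> rfl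
  rw [e]
  exact measurable_boundary h1 h2

lemma Field.norm_bV_le (hF : Field T u h) (hk : k ≠ 0) (hk6 : k ^ 6 ≠ 1) (s : ℝ) (i i' : Fin 3) :
    ‖bV T u k s i i'‖ ≤ vConst (h 0) k * h (bx s) := by
  have h0 : 0 ≤ vConst (h 0) k * h (bx s) :=
    mul_nonneg (vConst_nonneg (hF.h_nonneg le_rfl) k) (hF.h_nonneg (bx_nonneg s))
  rcases le_or_gt 0 s with hs | hs
  · rw [bV_of_nonneg T u k hs, bx_of_nonneg hs]
    exact hF.norm_V₁_le hk hk6 (mem_Omega.2 ⟨hs, le_rfl, hF.pos⟩) i i'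
  · by_cases hT : -T < s
    · rw [bV_of_neg u k hs hT, bx_of_nonpos hs.le, Matrix.neg_apply, norm_neg]
      exact hF.norm_V₂_le hk hk6 (mem_Omega.2 ⟨le_rfl, by linarith, by linarith⟩) i i'
    · rw [bV_of_le hF.pos u k (not_lt.1 hT)]
      simpa using h0

/-- The weight that dominates the boundary kernels. -/
def bWeight (h : ℝ → ℝ) (ε C : ℝ) (s : ℝ) : ℝ := C * (h (bx s) * Real.exp (2 * ε * bx s))

lemma Field.integrableOn_bWeight (hF : Field T u h) {ε : ℝ} (C : ℝ)
    (hε : IntegrableOn (fun x => h x * Real.exp (2 * ε * x)) (Ici 0)) :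
    IntegrableOn (bWeight h ε C) (Ioi (-T)) := by
  unfold bWeight
  refine Integrable.const_mul ?_ C
  have e : Ioi (-T) = Ioo (-T) 0 ∪ Ici 0 := (Ioo_union_Ici_eq_Ioi (by linarith [hF.pos])).symm
  change IntegrableOn (fun s => h (bx s) * Real.exp (2 * ε * bx s)) (Ioi (-T)) volume
  rw [e]
  refine IntegrableOn.union ?_ ?_
  · refine (integrableOn_const (μ := volume) (s := Ioo (-T) 0) (C := h 0) (by simp)).congr_fun
      (fun s hs => ?_) measurableSet_Ioo
    simp [bx_of_nonpos hs.2.le]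
  · exact hε.congr_fun (fun s hs => by simp [bx_of_nonneg hs]) measurableSet_Ici

lemma Field.integrableOn_exp_zero (hF : Field T u h) :
    IntegrableOn (fun x => h x * Real.exp (2 * 0 * x)) (Ici 0) := by
  simpa using hF.int

/-- The sign conditions on the exponents under which the exponentials are bounded along the
contours of the `j`-th column. -/
structure GoodExp (T : ℝ) (n : Fin 18) (j : Fin 3) (ε B : ℝ) (a b : Fin 3 → ℂ) : Prop where
  eps_nonneg : 0 ≤ ε
  bound_nonneg : 0 ≤ B
  re_a : ∀ i, contour n i j ≠ Contour.three → (a i).re ≤ 0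
  re_a_three : ∀ i, contour n i j = Contour.three → -(2 * ε) ≤ (a i).re
  re_a_self : (a j).re ≤ 0
  re_b : ∀ i, contour n i j ≠ Contour.one → (b i).re * T ≤ B
  re_b_one : ∀ i, contour n i j = Contour.one → -B ≤ (b i).re * T

lemma mul_le_of_scaled {β τ T B : ℝ} (hT : 0 < T) (hB : 0 ≤ B) (h : β * T ≤ B) (h0 : 0 ≤ τ)
    (h1 : τ ≤ T) : β * τ ≤ B := by
  rcases le_or_gt β 0 with hβ | hβ
  · nlinarith
  · nlinarith

/-- On each contour the displacements x - x' and t - t' have definite signs, and the conditions on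
Re a and Re b are adapted to them. Only on the contour from infinity may Re a be slightly negative;
this costs the factor exp (2 ε x'), to be absorbed by the weight. -/
lemma GoodExp.norm_exp_le {ε B : ℝ} {a b : Fin 3 → ℂ} (hg : GoodExp T n j ε B a b) (hT : 0 < T)
    (i : Fin 3) {s s' : ℝ} (hs' : -T < s') :
    ‖bo T n j i s s' * Complex.exp (a i * (bx s - bx s' : ℝ) + b i * (bt s - bt s' : ℝ))‖
      ≤ Real.exp B * Real.exp (2 * ε * bx s') := by
  have hpos : 0 ≤ Real.exp B * Real.exp (2 * ε * bx s') := by positivity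
  unfold bo
  split_ifs with hs
  swap
  · simpa using hpos
  have t1 := bt_lt hT hs
  have t2 := bt_lt hT hs'
  have t3 := bt_nonneg s
  have t4 := bt_nonneg s'
  have x3 := bx_nonneg s
  have x4 := bx_nonneg s'
  have key : (a i).re * (bx s - bx s') ≤ 2 * ε * bx s' → (b i).re * (bt s - bt s') ≤ B →
      ‖Complex.exp (a i * (bx s - bx s' : ℝ) + b i * (bt s - bt s' : ℝ))‖
        ≤ Real.exp B * Real.exp (2 * ε * bx s') := by
    intro h1 h2
    rw [Complex.norm_exp, ← Real.exp_add, Real.exp_le_exp, Complex.add_re, Complex.re_mul_ofReal,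
      Complex.re_mul_ofReal]
    linarith
  have hεx : 0 ≤ 2 * ε * bx s' := by have := hg.eps_nonneg; positivity
  cases hc : contour n i j
  · simp only [orient]
    split_ifs with h1
    · rw [one_mul]
      refine key ?_ ?_
      · have := hg.re_a i (by simp [hc])
        have := bx_mono h1
        nlinarith
      · have h2 := mul_le_of_scaled (β := -(b i).re) (τ := bt s' - bt s) hT hg.bound_nonneg
          (by linarith [hg.re_b_one i hc]) (by linarith [bt_anti h1]) (by linarith)
        linarith
    · simpa using hpos
  · simp only [orient]
    have ha := hg.re_a i (by simp [hc])
    have hb := hg.re_b i (by simp [hc])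
    split_ifs with h1 h2
    · rw [one_mul]
      refine key ?_ ?_
      · have := bx_mono h1.2
        nlinarith
      · rw [bt_of_nonneg h1.1, bt_of_nonneg (h1.1.trans h1.2)]
        simpa using hg.bound_nonneg
    · rw [neg_one_mul, norm_neg]
      refine key ?_ ?_
      · rw [bx_of_nonpos h2.2, bx_of_nonpos (h2.1.trans h2.2)]
        simp
      · exact mul_le_of_scaled hT hg.bound_nonneg hb (by linarith [bt_anti h2.1]) (by linarith)
    · simpa using hpos
  · simp only [orient]
    have ha := hg.re_a_three i hc
    have hb := hg.re_b i (by simp [hc])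
    split_ifs with h1
    · rw [neg_one_mul, norm_neg]
      refine key ?_ ?_
      · have := bx_mono h1
        have := hg.eps_nonneg
        nlinarith
      · exact mul_le_of_scaled hT hg.bound_nonneg hb (by linarith [bt_anti h1]) (by linarith)
    · simpa using hpos

lemma GoodExp.norm_col_le {ε B : ℝ} {a b : Fin 3 → ℂ} (hg : GoodExp T n j ε B a b) (hT : 0 < T)
    (p : ℝ × Fin 3) : ‖gCol (Ioi (-T)) a b j p‖ ≤ Real.exp B := by
  unfold gCol
  split_ifs with hp
  · rw [Complex.norm_exp, Real.exp_le_exp, Complex.add_re, Complex.re_mul_ofReal,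
      Complex.re_mul_ofReal, hp.2]
    have h1 : (a j).re * bx p.1 ≤ 0 := mul_nonpos_of_nonpos_of_nonneg hg.re_a_self (bx_nonneg _)
    have h2 := mul_le_of_scaled hT hg.bound_nonneg
      (hg.re_b j (by rw [contour_self]; simp)) (bt_nonneg p.1) (bt_lt hT hp.1).le
    linarith
  · simp only [norm_zero]
    positivity

lemma Field.dom (hF : Field T u h) (hk : k ≠ 0) (hk6 : k ^ 6 ≠ 1) {ε B Cv : ℝ} {a b : Fin 3 → ℂ}
    (hg : GoodExp T n j ε B a b) (hv : vConst (h 0) k ≤ Cv) (p : ℝ × Fin 3) :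
    Dom (fun p => bWeight h ε (Real.exp B * Cv) p.1) (Real.exp B) (gCol (Ioi (-T)) a b j p)
      (gKer (bo T n j) (bV T u k) a b p) (gCol (Ioi (-T)) a b j)
      (gKer (bo T n j) (bV T u k) a b) := by
  refine gDom (measurable_bo T n j) (hF.measurable_bV hk hk6) measurableSet_Ioi ?_
    (hg.norm_col_le hF.pos) p
  intro p p'
  have hh := hF.h_nonneg (bx_nonneg p'.1)
  have hv0 := vConst_nonneg (hF.h_nonneg le_rfl) k
  unfold gKer bWeight
  by_cases hp' : -T < p'.1
  · rw [norm_mul]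
    calc _ ≤ (Real.exp B * Real.exp (2 * ε * bx p'.1)) * (Cv * h (bx p'.1)) := by
          refine mul_le_mul (hg.norm_exp_le hF.pos p.2 hp') ?_ (norm_nonneg _) (by positivity)
          exact (hF.norm_bV_le hk hk6 p'.1 p.2 p'.2).trans (mul_le_mul_of_nonneg_right hv hh)
      _ = _ := by ring
  · rw [bV_of_le hF.pos u k (not_lt.1 hp')]
    have : 0 ≤ Cv := hv0.trans hv
    simp only [Matrix.zero_apply, mul_zero, norm_zero]
    positivity

/-! ### Linear systems of three ordinary differential equations on a half-open interval -/

/-- The set is `[0, R)` or `[0, ∞)`. -/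
def IsRay (I : Set ℝ) : Prop := ∀ x ∈ I, 0 ≤ x ∧ ∃ R, x < R ∧ Icc 0 R ⊆ I

lemma isRay_Ici : IsRay (Ici 0) := fun x hx => ⟨hx, x + 1, by linarith, fun _ hy => hy.1⟩

lemma isRay_Ico (T : ℝ) : IsRay (Ico 0 T) := fun x hx =>
  ⟨hx.1, (x + T) / 2, by linarith [hx.2], fun _ hy => ⟨hy.1, by linarith [hy.2, hx.2]⟩⟩

variable {I : Set ℝ}

lemma IsRay.Icc_subset (hI : IsRay I) {x : ℝ} (hx : x ∈ I) : Icc 0 x ⊆ I := by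
  obtain ⟨-, R, hR, hs⟩ := hI x hx
  exact (Icc_subset_Icc_right hR.le).trans hs

lemma IsRay.Icc_mem (hI : IsRay I) {x R : ℝ} (hR : x < R) : Icc 0 R ∈ 𝓝[I] x := by
  refine mem_of_superset (inter_mem_nhdsWithin I (Iio_mem_nhds hR)) ?_
  exact fun y hy => ⟨(hI y hy.1).1, le_of_lt hy.2⟩

lemma IsRay.mem_nhds (hI : IsRay I) {x : ℝ} (hx : x ∈ I) (h0 : 0 < x) : I ∈ 𝓝 x := by
  obtain ⟨-, R, hR, hs⟩ := hI x hx
  exact mem_of_superset (Ioo_mem_nhds h0 hR) (Ioo_subset_Icc_self.trans hs)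

lemma IsRay.Ioi_of (hI : IsRay I) {x : ℝ} (hx : x ∈ I) : I ∈ 𝓝[≥] x := by
  obtain ⟨h0, R, hR, hs⟩ := hI x hx
  refine mem_of_superset (inter_mem_nhdsWithin _ (Iio_mem_nhds hR)) fun y hy => hs ?_
  exact ⟨h0.trans hy.1, le_of_lt hy.2⟩

lemma IsRay.hasDerivWithinAt_integral (hI : IsRay I) {g : ℝ → ℂ} (hg : ContinuousOn g I) {x : ℝ}
    (hx : x ∈ I) : HasDerivWithinAt (fun y => ∫ s in (0 : ℝ)..y, g s) (g x) I x := by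
  obtain ⟨h0, R, hR, hs⟩ := hI x hx
  -- Clamping to [0, R] extends g to a continuous function on the line without changing it near x
  -- within I, so the derivative of the integral is also available at the end point 0.
  set c : ℝ → ℝ := fun y => max 0 (min y R) with hc
  have hcm : ∀ y, c y ∈ Icc 0 R := fun y =>
    ⟨le_max_left _ _, max_le (h0.trans hR.le) (min_le_right _ _)⟩
  have hceq : ∀ y ∈ Icc 0 R, c y = y := fun y hy => by
    simp only [hc]; rw [min_eq_left hy.2, max_eq_right hy.1]
  have hcont : Continuous fun y => g (c y) := by
    refine (hg.mono hs).comp_continuous ?_ hcm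
    fun_prop
  have h1 : HasDerivAt (fun y => ∫ s in (0 : ℝ)..y, g (c s)) (g (c x)) x :=
    hcont.integral_hasStrictDerivAt 0 x |>.hasDerivAt
  rw [hceq x ⟨h0, hR.le⟩] at h1
  refine h1.hasDerivWithinAt.congr_of_eventuallyEq ?_ ?_
  · filter_upwards [hI.Icc_mem hR] with y hy
    refine intervalIntegral.integral_congr fun s hs' => ?_
    rw [uIcc_of_le hy.1] at hs'
    simp only [hceq s ⟨hs'.1, hs'.2.trans hy.2⟩]
  · refine intervalIntegral.integral_congr fun s hs' => ?_
    rw [uIcc_of_le h0] at hs'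
    simp only [hceq s ⟨hs'.1, hs'.2.trans hR.le⟩]

lemma IsRay.continuousOn_integral (hI : IsRay I) {g : ℝ → ℂ}
    (hg : ∀ x ∈ I, IntervalIntegrable g volume 0 x) :
    ContinuousOn (fun y => ∫ s in (0 : ℝ)..y, g s) I := by
  intro x hx
  obtain ⟨h0, R, hR, hs⟩ := hI x hx
  have hR0 : 0 ≤ R := h0.trans hR.le
  have h1 := intervalIntegral.continuousOn_primitive_interval' (hg R (hs ⟨hR0, le_rfl⟩))
    (left_mem_uIcc)
  rw [uIcc_of_le hR0] at h1
  exact (h1 x ⟨h0, hR.le⟩).mono_of_mem_nhdsWithin (hI.Icc_mem hR)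

/-- The system `f_i' = a_i f_i + ∑ V_ii' f_i'` on `I`. -/
def RowODE (I : Set ℝ) (a : Fin 3 → ℂ) (V : ℝ → Matrix (Fin 3) (Fin 3) ℂ) (f : ℝ → Fin 3 → ℂ) :
    Prop :=
  ∀ x ∈ I, ∀ i, HasDerivWithinAt (fun y => f y i) (a i * f x i + ∑ i', V x i i' * f x i') I x

variable {a : Fin 3 → ℂ} {V : ℝ → Matrix (Fin 3) (Fin 3) ℂ} {f g : ℝ → Fin 3 → ℂ}

lemma RowODE.continuousOn (hf : RowODE I a V f) (i : Fin 3) : ContinuousOn (fun x => f x i) I :=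
  fun x hx => (hf x hx i).continuousWithinAt

lemma continuousOn_source (hV : ∀ i i', ContinuousOn (fun x => V x i i') I)
    (hf : ∀ i, ContinuousOn (fun x => f x i) I) (i : Fin 3) :
    ContinuousOn (fun x : ℝ => Complex.exp (-(a i * x)) * ∑ i', V x i i' * f x i') I := by
  refine ContinuousOn.mul (by fun_prop) ?_
  exact continuousOn_finsetSum _ fun i' _ => (hV i i').mul (hf i')

/-- An integrable solution of the integral equation solves the differential equation. -/
lemma rowODE_of_integral (hI : IsRay I) (hV : ∀ i i', ContinuousOn (fun x => V x i i') I)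
    (c : Fin 3 → ℂ)
    (hInt : ∀ x ∈ I, ∀ i, IntervalIntegrable
      (fun s : ℝ => Complex.exp (-(a i * s)) * ∑ i', V s i i' * f s i') volume 0 x)
    (heq : ∀ x ∈ I, ∀ i, Complex.exp (-(a i * x)) * f x i =
      c i + ∫ s in (0 : ℝ)..x, Complex.exp (-(a i * s)) * ∑ i', V s i i' * f s i') :
    RowODE I a V f := by
  have heq' : ∀ x ∈ I, ∀ i, f x i = Complex.exp (a i * x) *
      (c i + ∫ s in (0 : ℝ)..x, Complex.exp (-(a i * s)) * ∑ i', V s i i' * f s i') := by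
    intro x hx i
    rw [← heq x hx i, ← mul_assoc, ← Complex.exp_add]
    simp
  -- Bootstrap: an integral of an integrable function is continuous, so f is; then the integrand is
  -- continuous and its integral differentiable.
  have hcont : ∀ i, ContinuousOn (fun x => f x i) I := by
    intro i
    refine ContinuousOn.congr ?_ fun x hx => heq' x hx i
    refine ContinuousOn.mul (by fun_prop) (continuousOn_const.add ?_)
    exact hI.continuousOn_integral fun x hx => hInt x hx i
  intro x hx i
  have h1 := hI.hasDerivWithinAt_integral (continuousOn_source (a := a) hV hcont i) hx
  have h2 : HasDerivWithinAt (fun y : ℝ => Complex.exp (a i * y)) (Complex.exp (a i * x) * a i)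
      I x := by
    have h3 : HasDerivAt (fun y : ℝ => a i * (y : ℂ)) (a i) x := by
      simpa using (Complex.ofRealCLM.hasDerivAt (x := x)).const_mul (a i)
    exact (h3.cexp).hasDerivWithinAt
  have h4 := h2.mul (h1.const_add (c i))
  refine (h4.congr (fun y hy => heq' y hy i) (heq' x hx i)).congr_deriv ?_
  rw [heq' x hx i]
  have h5 : Complex.exp (a i * x) * Complex.exp (-(a i * x)) = 1 := by
    rw [← Complex.exp_add]; simp
  linear_combination (∑ i', V x i i' * f x i') * h5

lemma RowODE.hasDerivWithinAt_exp (hf : RowODE I a V f) {x : ℝ} (hx : x ∈ I) (i : Fin 3) :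
    HasDerivWithinAt (fun y : ℝ => Complex.exp (-(a i * y)) * f y i)
      (Complex.exp (-(a i * x)) * ∑ i', V x i i' * f x i') I x := by
  have h3 : HasDerivAt (fun y : ℝ => -(a i * (y : ℂ))) (-(a i)) x := by
    simpa using (Complex.ofRealCLM.hasDerivAt (x := x)).const_mul (-(a i))
  refine ((h3.cexp).hasDerivWithinAt.mul (hf x hx i)).congr_deriv ?_
  ring

lemma RowODE.ftc (hf : RowODE I a V f) (hI : IsRay I)
    (hV : ∀ i i', ContinuousOn (fun x => V x i i') I) {x₀ x₁ : ℝ} (h0 : 0 ≤ x₀) (h01 : x₀ ≤ x₁)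
    (h1 : x₁ ∈ I) (i : Fin 3) :
    ∫ s in x₀..x₁, Complex.exp (-(a i * s)) * ∑ i', V s i i' * f s i' =
      Complex.exp (-(a i * x₁)) * f x₁ i - Complex.exp (-(a i * x₀)) * f x₀ i := by
  have hsub : Icc x₀ x₁ ⊆ I := (Icc_subset_Icc_left h0).trans (hI.Icc_subset h1)
  refine intervalIntegral.integral_eq_sub_of_hasDerivAt_of_le h01
    (f := fun y : ℝ => Complex.exp (-(a i * y)) * f y i) ?_ ?_ ?_
  · exact fun y hy => ((hf.hasDerivWithinAt_exp (hsub hy) i).continuousWithinAt).mono hsub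
  · intro y hy
    exact (hf.hasDerivWithinAt_exp (hsub (Ioo_subset_Icc_self hy)) i).hasDerivAt
      (hI.mem_nhds (hsub (Ioo_subset_Icc_self hy)) (h0.trans_lt hy.1))
  · refine ContinuousOn.intervalIntegrable ?_
    rw [uIcc_of_le h01]
    exact (continuousOn_source hV hf.continuousOn i).mono hsub

lemma RowODE.norm_le (hf : RowODE I a V f) (hI : IsRay I) {α : ℝ} {x : ℝ} (hx : x ∈ I)
    (hα : ∀ y ∈ Icc 0 x, ∀ i, ‖a i‖ + ∑ i', ‖V y i i'‖ ≤ α) :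
    ‖f x‖ ≤ ‖f 0‖ * Real.exp (α * x) := by
  have hsub := hI.Icc_subset hx
  have h0x := (hI x hx).1
  have hd : ∀ y ∈ I, HasDerivWithinAt f (fun i => a i * f y i + ∑ i', V y i i' * f y i') I y :=
    fun y hy => hasDerivWithinAt_pi.2 fun i => hf y hy i
  have h := norm_le_gronwallBound_of_norm_deriv_right_le (f := f)
    (f' := fun y i => a i * f y i + ∑ i', V y i i' * f y i') (δ := ‖f 0‖) (K := α) (ε := 0)
    (a := 0) (b := x) (fun y hy => ((hd y (hsub hy)).continuousWithinAt).mono hsub)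
    (fun y hy => (hd y (hsub (Ico_subset_Icc_self hy))).mono_of_mem_nhdsWithin
      (hI.Ioi_of (hsub (Ico_subset_Icc_self hy)))) le_rfl ?_ x ⟨h0x, le_rfl⟩
  · rwa [gronwallBound_ε0, sub_zero] at h
  · intro y hy
    have hα' := hα y (Ico_subset_Icc_self hy)
    have hα0 : 0 ≤ α := le_trans (by positivity) (hα' 0)
    rw [add_zero]
    refine (pi_norm_le_iff_of_nonneg (by positivity)).2 fun i => ?_
    refine (norm_add_le _ _).trans ?_
    have h1 : ‖∑ i', V y i i' * f y i'‖ ≤ (∑ i', ‖V y i i'‖) * ‖f y‖ := by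
      rw [Finset.sum_mul]
      refine (norm_sum_le _ _).trans (Finset.sum_le_sum fun i' _ => ?_)
      rw [norm_mul]
      exact mul_le_mul_of_nonneg_left (norm_le_pi_norm _ _) (norm_nonneg _)
    have h2 : ‖a i * f y i‖ ≤ ‖a i‖ * ‖f y‖ := by
      rw [norm_mul]
      exact mul_le_mul_of_nonneg_left (norm_le_pi_norm _ _) (norm_nonneg _)
    calc _ ≤ (‖a i‖ + ∑ i', ‖V y i i'‖) * ‖f y‖ := by linarith
      _ ≤ α * ‖f y‖ := mul_le_mul_of_nonneg_right (hα' i) (norm_nonneg _)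

lemma RowODE.sub (hf : RowODE I a V f) (hg : RowODE I a V g) :
    RowODE I a V (fun x i => f x i - g x i) := by
  intro x hx i
  refine ((hf x hx i).sub (hg x hx i)).congr_deriv ?_
  simp only [mul_sub, Finset.sum_sub_distrib]
  ring

lemma RowODE.sum {ι : Type*} (S : Finset ι) {F : ι → ℝ → Fin 3 → ℂ}
    (hF : ∀ c ∈ S, RowODE I a V (F c)) (y : ι → ℂ) :
    RowODE I a V (fun x i => ∑ c ∈ S, F c x i * y c) := by
  intro x hx i
  refine (HasDerivWithinAt.fun_sum fun c hc => (hF c hc x hx i).mul_const (y c)).congr_deriv ?_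
  simp only [add_mul, Finset.sum_add_distrib, Finset.mul_sum, Finset.sum_mul]
  rw [Finset.sum_comm (s := S)]
  congr 1
  · exact Finset.sum_congr rfl fun _ _ => by ring
  · exact Finset.sum_congr rfl fun _ _ => Finset.sum_congr rfl fun _ _ => by ring

lemma RowODE.unique (hf : RowODE I a V f) (hg : RowODE I a V g) (hI : IsRay I)
    (hV : ∀ i i', ContinuousOn (fun x => V x i i') I) (h0 : ∀ i, f 0 i = g 0 i) {x : ℝ}
    (hx : x ∈ I) (i : Fin 3) : f x i = g x i := by
  have hsub := hI.Icc_subset hx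
  have hc : ContinuousOn (fun y => ∑ i, (‖a i‖ + ∑ i', ‖V y i i'‖)) (Icc 0 x) :=
    continuousOn_finsetSum _ fun i _ => continuousOn_const.add
      (continuousOn_finsetSum _ fun i' _ => ((hV i i').mono hsub).norm)
  obtain ⟨α, hα⟩ := isCompact_Icc.bddAbove_image hc
  have h := (hf.sub hg).norm_le hI (α := α) hx fun y hy i => by
    refine le_trans ?_ (hα ⟨y, hy, rfl⟩)
    exact Finset.single_le_sum (f := fun i => ‖a i‖ + ∑ i', ‖V y i i'‖)
      (fun i _ => by positivity) (Finset.mem_univ i)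
  have h2 : (fun i => f 0 i - g 0 i) = 0 := funext fun i => by simp [h0 i]
  rw [h2, norm_zero, zero_mul] at h
  have h3 := norm_le_zero_iff.1 h
  exact sub_eq_zero.1 (congrFun h3 i)

/-! ### The propagator of the `x`-equation -/

open Classical in
/-- The indicator of `0 < s' < s`. -/
def xo (_ : Fin 3) (s s' : ℝ) : ℂ := if 0 < s' ∧ s' < s then 1 else 0

/-- The matrix `V₁` at time `t`, cut off to `x ≥ 0`. -/
def xV (u : ℝ → ℝ → ℝ) (k : ℂ) (t s : ℝ) : Matrix (Fin 3) (Fin 3) ℂ :=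
  if 0 ≤ s then V₁ u k s t else 0

/-- The solution of the `x`-equation of the `j`-th column that is the `c`-th unit vector at
`x = 0`. -/
def propagator (u : ℝ → ℝ → ℝ) (k : ℂ) (t : ℝ) (j c : Fin 3) (x : ℝ) (i : Fin 3) : ℂ :=
  gM (rowMeasure (Ioi 0)) xo (xV u k t) (Ici 0) (lDiff k j) 0 c (x, i)

variable {T : ℝ} {u : ℝ → ℝ → ℝ} {h : ℝ → ℝ} {k : ℂ} {t : ℝ}

lemma measurable_xo (i : Fin 3) : Measurable (Function.uncurry (xo i)) := by
  refine Measurable.ite ?_ measurable_const measurable_const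
  exact (measurableSet_lt measurable_const measurable_snd).inter
    (measurableSet_lt measurable_snd measurable_fst)

lemma Field.measurable_xV (hF : Field T u h) (hk : k ≠ 0) (hk6 : k ^ 6 ≠ 1) (ht : t ∈ Ico 0 T)
    (i i' : Fin 3) : Measurable fun s => xV u k t s i i' := by
  have h1 : ContinuousOn (fun s => V₁ u k s t i i') (Ici 0) :=
    continuousOn_slice_x (hF.continuousOn_V₁ hk hk6 i i') ht
  have e : (fun s => xV u k t s i i') = (Ici 0).piecewise (fun s => V₁ u k s t i i')
      (fun _ => 0) := by
    funext s
    unfold xV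
    by_cases hs : 0 ≤ s <;> simp [hs, piecewise]
  rw [e]
  exact h1.measurable_piecewise continuousOn_const measurableSet_Ici

lemma Field.norm_xV_le (hF : Field T u h) (hk : k ≠ 0) (hk6 : k ^ 6 ≠ 1) (ht : t ∈ Ico 0 T)
    (s : ℝ) (i i' : Fin 3) : ‖xV u k t s i i'‖ ≤ vConst (h 0) k * h (bx s) := by
  unfold xV
  split_ifs with hs
  · rw [bx_of_nonneg hs]
    exact hF.norm_V₁_le hk hk6 (mem_Omega.2 ⟨hs, ht⟩) i i'
  · simpa using mul_nonneg (vConst_nonneg (hF.h_nonneg le_rfl) k) (hF.h_nonneg (bx_nonneg s))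

lemma norm_gKer_xo_le {V : ℝ → Matrix (Fin 3) (Fin 3) ℂ} {a b : Fin 3 → ℂ}
    (ha : ∀ i, (a i).re ≤ 0) (p p' : ℝ × Fin 3) :
    ‖gKer xo V a b p p'‖ ≤ ‖V p'.1 p.2 p'.2‖ := by
  unfold gKer xo
  split_ifs with hp
  · rw [one_mul, norm_mul]
    refine mul_le_of_le_one_left (norm_nonneg _) ?_
    rw [Complex.norm_exp, Real.exp_le_one_iff, Complex.add_re, Complex.re_mul_ofReal,
      Complex.re_mul_ofReal, bt_of_nonneg hp.1.le, bt_of_nonneg (hp.1.trans hp.2).le]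
    have := bx_mono hp.2.le
    have := ha p.2
    nlinarith
  · simp

lemma norm_gCol_Ici_le {a b : Fin 3 → ℂ} (ha : ∀ i, (a i).re ≤ 0) (c : Fin 3) (p : ℝ × Fin 3) :
    ‖gCol (Ici 0) a b c p‖ ≤ 1 := by
  unfold gCol
  split_ifs with hp
  · rw [Complex.norm_exp, Real.exp_le_one_iff, Complex.add_re, Complex.re_mul_ofReal,
      Complex.re_mul_ofReal, bt_of_nonneg hp.1]
    have := mul_nonpos_of_nonpos_of_nonneg (ha p.2) (bx_nonneg p.1)
    linarith
  · simp

lemma Field.integrableOn_weight_Ioi (hF : Field T u h) (C : ℝ) :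
    IntegrableOn (fun s => C * h (bx s)) (Ioi 0) :=
  (hF.int.mono_set Ioi_subset_Ici_self).congr_fun (fun s hs => by simp [bx_of_nonneg (le_of_lt hs)])
    measurableSet_Ioi |>.const_mul C

lemma Field.dom_x (hF : Field T u h) (hk : k ≠ 0) (hk6 : k ^ 6 ≠ 1) (ht : t ∈ Ico 0 T)
    {a b : Fin 3 → ℂ} (ha : ∀ i, (a i).re ≤ 0) {Cv : ℝ} (hv : vConst (h 0) k ≤ Cv) (c : Fin 3)
    (p : ℝ × Fin 3) :
    Dom (fun p => Cv * h (bx p.1)) 1 (gCol (Ici 0) a b c p) (gKer xo (xV u k t) a b p)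
      (gCol (Ici 0) a b c) (gKer xo (xV u k t) a b) :=
  gDom (ρ := fun s => Cv * h (bx s)) measurable_xo (hF.measurable_xV hk hk6 ht) measurableSet_Ici
    (fun p p' => (norm_gKer_xo_le ha p p').trans ((hF.norm_xV_le hk hk6 ht _ _ _).trans
      (mul_le_mul_of_nonneg_right hv (hF.h_nonneg (bx_nonneg _))))) (norm_gCol_Ici_le ha c) p

/-- A Volterra kernel is strictly triangular in x. The Fredholm construction of the propagator
therefore works without exceptional spectral values. -/
lemma fredholmDet_xo (V : ℝ → Matrix (Fin 3) (Fin 3) ℂ) (a b : Fin 3 → ℂ) :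
    fredholmDet (rowMeasure (Ioi 0)) (gKer xo V a b) = 1 := by
  refine fredholmDet_of_strict (fun p => p.1) fun p p' hp => ?_
  by_contra hlt
  apply hp
  unfold gKer xo
  rw [if_neg fun h => hlt h.2]
  simp

/-- A real number that exceeds the real parts of the exponents. -/
def expBound (k : ℂ) (j : Fin 3) : ℝ := ∑ i, ‖lDiff k j i‖

lemma re_sub_expBound (k : ℂ) (j i : Fin 3) {g : ℝ} (hg : expBound k j ≤ g) :
    (lDiff k j i - g).re ≤ 0 := by
  have h1 := Complex.re_le_norm (lDiff k j i)
  have h2 : ‖lDiff k j i‖ ≤ expBound k j :=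
    Finset.single_le_sum (f := fun i => ‖lDiff k j i‖) (fun _ _ => norm_nonneg _)
      (Finset.mem_univ i)
  rw [Complex.sub_re, Complex.ofReal_re]
  linarith

/-- The propagator may grow exponentially, so its own kernel is not dominated. For g at least
`expBound` the shifted exponents have non-positive real parts, and all estimates are made on the
right-hand side. -/
lemma propagator_eq_gM (u : ℝ → ℝ → ℝ) (k : ℂ) (t : ℝ) (j c : Fin 3) (x : ℝ) (i : Fin 3) (g : ℝ) :
    propagator u k t j c x i = Complex.exp (g * (bx x : ℝ)) *
      gM (rowMeasure (Ioi 0)) xo (xV u k t) (Ici 0) (fun i => lDiff k j i - g) 0 c (x, i) := by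
  have h1 := gM_shift (μ := rowMeasure (Ioi 0)) (o := xo) (V := xV u k t) (S := Ici 0)
    (a := lDiff k j) (b := 0) (j := c) (g : ℂ) 0 (x, i)
  have h2 : (fun i : Fin 3 => (0 : Fin 3 → ℂ) i - 0) = 0 := by funext i; simp
  rw [h2] at h1
  rw [h1, ← mul_assoc]
  unfold propagator gauge
  rw [← Complex.exp_add]
  simp

/-- This is `Dom.bSeries_row` with determinant one in the damped gauge, with the factor exp (g x)
restored. -/
lemma Field.propagator_integral (hF : Field T u h) (hk : k ≠ 0) (hk6 : k ^ 6 ≠ 1)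
    (ht : t ∈ Ico 0 T) (j c : Fin 3) {x : ℝ} (hx : 0 ≤ x) (i : Fin 3) :
    IntervalIntegrable (fun s : ℝ => Complex.exp (-(lDiff k j i * s)) *
      ∑ i', V₁ u k s t i i' * propagator u k t j c s i') volume 0 x ∧
    Complex.exp (-(lDiff k j i * x)) * propagator u k t j c x i = (if i = c then 1 else 0) +
      ∫ s in (0 : ℝ)..x, Complex.exp (-(lDiff k j i * s)) *
        ∑ i', V₁ u k s t i i' * propagator u k t j c s i' := by
  set g := expBound k j with hg
  have hre : ∀ i, (lDiff k j i - g).re ≤ 0 := fun i => re_sub_expBound k j i le_rfl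
  have hdom := hF.dom_x hk hk6 ht (b := 0) (a := fun i => lDiff k j i - (g : ℂ)) hre le_rfl c (x, i)
  have hw := integrable_weight (hF.integrableOn_weight_Ioi (vConst (h 0) k))
  obtain ⟨hInt, heq⟩ := hdom.bSeries_row hw
  rw [integral_rowMeasure hInt, fredholmDet_xo, mul_one] at heq
  have hrow := integrable_rowMeasure hInt
  set M : ℝ → Fin 3 → ℂ := fun s i' => gM (rowMeasure (Ioi 0)) xo (xV u k t) (Ici 0)
    (fun i => lDiff k j i - g) 0 c (s, i') with hM
  have hprop : ∀ s, 0 ≤ s → ∀ i', propagator u k t j c s i' = Complex.exp (g * s) * M s i' := by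
    intro s hs i'
    rw [propagator_eq_gM u k t j c s i' g, bx_of_nonneg hs]
  have hterm : ∀ s ∈ Ioo 0 x, ∀ i', gKer xo (xV u k t) (fun i => lDiff k j i - g) 0 (x, i) (s, i')
      * M s i' = Complex.exp ((lDiff k j i - g) * x) * (Complex.exp (-(lDiff k j i * s)) *
        (V₁ u k s t i i' * propagator u k t j c s i')) := by
    intro s hs i'
    rw [hprop s hs.1.le i']
    unfold gKer xo xV
    simp only [Pi.zero_apply, zero_mul, add_zero]
    rw [if_pos ⟨hs.1, hs.2⟩, if_pos hs.1.le, bx_of_nonneg hx, bx_of_nonneg hs.1.le]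
    have e1 : Complex.exp ((lDiff k j i - g) * (x - s : ℝ)) = Complex.exp ((lDiff k j i - g) * x)
        * (Complex.exp (-(lDiff k j i * s)) * Complex.exp (g * s)) := by
      rw [← Complex.exp_add, ← Complex.exp_add]
      congr 1
      push_cast
      ring
    rw [e1]
    ring
  have hout : ∀ s ∈ Ioi 0 \ Ioo 0 x, ∀ i', gKer xo (xV u k t) (fun i => lDiff k j i - g) 0
      (x, i) (s, i') * M s i' = 0 := by
    intro s hs i'
    unfold gKer xo
    rw [if_neg fun hh => hs.2 ⟨hh.1, hh.2⟩]
    simp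
  have hE : Complex.exp ((lDiff k j i - g) * x) ≠ 0 := Complex.exp_ne_zero _
  have hI : ∀ i', IntegrableOn (fun s : ℝ => Complex.exp (-(lDiff k j i * s)) *
      (V₁ u k s t i i' * propagator u k t j c s i')) (Ioo 0 x) := by
    intro i'
    have h1 := (hrow i').mono_set (Ioo_subset_Ioi_self : Ioo 0 x ⊆ Ioi 0)
    have h2 := (h1.congr_fun (fun s hs => hterm s hs i') measurableSet_Ioo).const_mul
      (Complex.exp ((lDiff k j i - g) * x))⁻¹
    refine h2.congr (Eventually.of_forall fun s => ?_)
    simp only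
    rw [← mul_assoc, inv_mul_cancel₀ hE, one_mul]
  have hsum : ∀ s : ℝ, Complex.exp (-(lDiff k j i * s)) *
      ∑ i', V₁ u k s t i i' * propagator u k t j c s i' = ∑ i', Complex.exp (-(lDiff k j i * s)) *
      (V₁ u k s t i i' * propagator u k t j c s i') := fun s => Finset.mul_sum _ _ _
  constructor
  · rw [intervalIntegrable_iff_integrableOn_Ioo_of_le hx]
    simp_rw [hsum]
    exact integrable_finsetSum _ fun i' _ => hI i'
  · have e2 : ∀ i', ∫ s in Ioi 0, gKer xo (xV u k t) (fun i => lDiff k j i - g) 0 (x, i) (s, i')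
        * M s i' = Complex.exp ((lDiff k j i - g) * x) * ∫ s in Ioo 0 x,
          Complex.exp (-(lDiff k j i * s)) * (V₁ u k s t i i' * propagator u k t j c s i') := by
      intro i'
      rw [setIntegral_eq_of_subset_of_forall_sdiff_eq_zero measurableSet_Ioi
        (Ioo_subset_Ioi_self : Ioo 0 x ⊆ Ioi 0) (fun s hs => hout s hs i'),
        setIntegral_congr_fun measurableSet_Ioo (fun s hs => hterm s hs i'), integral_const_mul]
    have e3 : M x i = gCol (Ici 0) (fun i => lDiff k j i - g) 0 c (x, i) +
        ∑ i', ∫ s in Ioi 0, gKer xo (xV u k t) (fun i => lDiff k j i - g) 0 (x, i) (s, i')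
        * M s i' := heq
    simp_rw [e2] at e3
    rw [← Finset.mul_sum, ← integral_finsetSum _ fun i' _ => hI i'] at e3
    simp_rw [← hsum] at e3
    rw [intervalIntegral.integral_of_le hx, integral_Ioc_eq_integral_Ioo, hprop x hx i, e3]
    have e4 : gCol (Ici 0) (fun i => lDiff k j i - g) 0 c (x, i) =
        Complex.exp ((lDiff k j i - g) * x) * (if i = c then 1 else 0) := by
      unfold gCol
      by_cases hic : i = c
      · simp [hic, hx, bx_of_nonneg hx]
      · simp [hic]
    have e5 : Complex.exp (-(lDiff k j i * x)) * (Complex.exp (g * x) *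
        Complex.exp ((lDiff k j i - g) * x)) = 1 := by
      rw [← Complex.exp_add, ← Complex.exp_add, ← Complex.exp_zero]
      congr 1
      ring
    rw [e4]
    linear_combination ((if i = c then 1 else 0) + ∫ s in Ioo 0 x,
      Complex.exp (-(lDiff k j i * s)) * ∑ i', V₁ u k s t i i' * propagator u k t j c s i') * e5

lemma Field.rowODE_propagator (hF : Field T u h) (hk : k ≠ 0) (hk6 : k ^ 6 ≠ 1)
    (ht : t ∈ Ico 0 T) (j c : Fin 3) :
    RowODE (Ici 0) (lDiff k j) (fun x => V₁ u k x t) (propagator u k t j c) :=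
  rowODE_of_integral isRay_Ici
    (fun i i' => continuousOn_slice_x (hF.continuousOn_V₁ hk hk6 i i') ht)
    (fun i => if i = c then 1 else 0)
    (fun _ hx i => (hF.propagator_integral hk hk6 ht j c hx i).1)
    (fun _ hx i => (hF.propagator_integral hk hk6 ht j c hx i).2)

lemma Field.propagator_zero (hF : Field T u h) (hk : k ≠ 0) (hk6 : k ^ 6 ≠ 1)
    (ht : t ∈ Ico 0 T) (j c i : Fin 3) :
    propagator u k t j c 0 i = if i = c then 1 else 0 := by
  simpa using (hF.propagator_integral hk hk6 ht j c le_rfl i).2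

/-- The propagator is continuous in `t`. -/
lemma Field.continuousOn_propagator_t (hF : Field T u h) (hk : k ≠ 0) (hk6 : k ^ 6 ≠ 1)
    (j c : Fin 3) (x : ℝ) (i : Fin 3) :
    ContinuousOn (fun t => propagator u k t j c x i) (Ico 0 T) := by
  intro t ht
  simp_rw [propagator_eq_gM u k _ j c x i (expBound k j)]
  refine Tendsto.const_mul _ ?_
  have hV : ∀ s i i', Tendsto (fun t => xV u k t s i i') (𝓝[Ico 0 T] t) (𝓝 (xV u k t s i i')) := by
    intro s i i'
    unfold xV
    by_cases hs : 0 ≤ s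
    · simp only [if_pos hs]
      exact continuousOn_slice_t (hF.continuousOn_V₁ hk hk6 i i') hs t ht
    · simp only [if_neg hs]
      exact tendsto_const_nhds
  have hK := tendsto_gKer (o := xo) (a := fun i => lDiff k j i - (expBound k j : ℂ))
    (b := 0) (a' := fun _ i => lDiff k j i - (expBound k j : ℂ)) (b' := fun _ => 0) hV
    (fun _ => tendsto_const_nhds) (fun _ => tendsto_const_nhds)
  refine tendsto_bSeries (C := 1)
    (integrable_weight (hF.integrableOn_weight_Ioi (vConst (h 0) k))) ?_
    tendsto_const_nhds (fun q => hK _ q) (fun _ => tendsto_const_nhds) (fun q q' => hK q q')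
  filter_upwards [self_mem_nhdsWithin] with s hs
  exact hF.dom_x hk hk6 hs (fun i => re_sub_expBound k j i le_rfl) le_rfl c (x, i)

/-- The propagator is holomorphic in the spectral parameter. -/
lemma Field.differentiableAt_propagator (hF : Field T u h) (hk : k ≠ 0) (hk6 : k ^ 6 ≠ 1)
    (ht : t ∈ Ico 0 T) (j c : Fin 3) (x : ℝ) (i : Fin 3) :
    DifferentiableAt ℂ (fun k => propagator u k t j c x i) k := by
  have hl : ∀ w, w ≠ 0 → ∀ i, DifferentiableAt ℂ (fun w => lDiff w j i) w := fun w hw i =>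
    (differentiableAt_l hw i).sub (differentiableAt_l hw j)
  -- The constants are enlarged by one so that a single gauge and a single weight serve on a whole
  -- neighborhood of k.
  have hev : ∀ᶠ w in 𝓝 k, w ≠ 0 ∧ w ^ 6 ≠ 1 ∧ vConst (h 0) w ≤ vConst (h 0) k + 1 ∧
      expBound w j ≤ expBound k j + 1 := by
    have h1 : ∀ᶠ w in 𝓝 k, w ≠ 0 := isOpen_ne.mem_nhds hk
    have h2 : ∀ᶠ w in 𝓝 k, w ^ 6 ≠ 1 :=
      ContinuousAt.eventually_ne (by fun_prop : ContinuousAt (fun w : ℂ => w ^ 6) k) hk6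
    have h3 := (continuousAt_vConst (h 0) hk hk6).eventually_le_const
      (lt_add_one (vConst (h 0) k))
    have h4 : ContinuousAt (fun w => expBound w j) k :=
      tendsto_finsetSum _ fun i _ => (hl k hk i).continuousAt.norm
    have h5 := h4.eventually_le_const (lt_add_one (expBound k j))
    filter_upwards [h1, h2, h3, h5] with w a1 a2 a3 a4 using ⟨a1, a2, a3, a4⟩
  obtain ⟨U, hU, hUo, hkU⟩ := eventually_nhds_iff.1 hev
  refine (?_ : DifferentiableOn ℂ (fun k => propagator u k t j c x i) U).differentiableAt
    (hUo.mem_nhds hkU)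
  simp_rw [propagator_eq_gM u _ t j c x i (expBound k j + 1)]
  refine DifferentiableOn.const_mul ?_ _
  have hV : ∀ s i i', DifferentiableOn ℂ (fun w => xV u w t s i i') U := by
    intro s i i'
    unfold xV
    by_cases hs : 0 ≤ s
    · simp only [if_pos hs]
      exact fun w hw => (differentiableAt_V₁ u s t i i' (hU w hw).1
        (hU w hw).2.1).differentiableWithinAt
    · simp only [if_neg hs]
      exact differentiableOn_const _
  have ha : ∀ i, DifferentiableOn ℂ (fun w => lDiff w j i - ((expBound k j + 1 : ℝ) : ℂ)) U :=
    fun i w hw => ((hl w (hU w hw).1 i).sub_const _).differentiableWithinAt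
  have hK := differentiableOn_gKer (o := xo) (b' := fun _ => 0) hV ha
    (fun _ => differentiableOn_const _)
  have hC := differentiableOn_gCol (S := Ici 0) (j := c) (b' := fun _ => 0) ha
    (fun _ => differentiableOn_const _)
  exact differentiableOn_bSeries hUo
    (integrable_weight (hF.integrableOn_weight_Ioi (vConst (h 0) k + 1)))
    (fun w hw => hF.dom_x (hU w hw).1 (hU w hw).2.1 ht
      (fun i => re_sub_expBound w j i (hU w hw).2.2.2) (hU w hw).2.2.1 c (x, i))
    (hC _) (fun q => hK _ q) hC hK

/-! ### Integrals along the boundary -/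

/-- The integral of `g` along the boundary from the base point of the contour to `s`. -/
def orientInt (T : ℝ) (c : Contour) (g : ℝ → ℂ) (s : ℝ) : ℂ :=
  ∫ s' in Ioi (-T), orient c s s' * g s'

section OrientInt

variable {T : ℝ} {c : Contour} {g : ℝ → ℂ}

/-- The base point drops out of the difference: whatever the contour, moving the end point from s₀
to s₁ adds the interval between them. The excluded points are the ends and the junction of the two
pieces of contour two. -/
lemma orient_sub {s₀ s₁ s' : ℝ} (h : s₀ ≤ s₁) (h0 : s' ≠ s₀) (h1 : s' ≠ s₁) (h2 : s' ≠ 0) :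
    orient c s₁ s' - orient c s₀ s' = (Ioc s₀ s₁).indicator 1 s' := by
  classical
  rw [indicator_apply]
  cases c <;> simp only [orient, mem_Ioc, Pi.one_apply] <;> split_ifs <;> grind

lemma norm_orient_one_le {s s' : ℝ} (hs : s ≤ 0) :
    ‖orient Contour.one s s'‖ ≤ ‖orient Contour.one 0 s'‖ := by
  simp only [orient]
  split_ifs <;> first | (exfalso; linarith) | simp

lemma norm_orient_three_le {s s' : ℝ} (hs : 0 ≤ s) :
    ‖orient Contour.three s s'‖ ≤ ‖orient Contour.three 0 s'‖ := by
  simp only [orient]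
  split_ifs <;> first | (exfalso; linarith) | simp

lemma orientInt_sub
    (hg : ∀ s, -T < s → IntegrableOn (fun s' => orient c s s' * g s') (Ioi (-T)))
    {s₀ s₁ : ℝ} (h0 : -T < s₀) (h : s₀ ≤ s₁) :
    IntervalIntegrable g volume s₀ s₁ ∧
    orientInt T c g s₁ - orientInt T c g s₀ = ∫ s in s₀..s₁, g s := by
  have hae : ∀ᵐ s' ∂(volume.restrict (Ioi (-T))), orient c s₁ s' * g s' - orient c s₀ s' * g s' =
      (Ioc s₀ s₁).indicator g s' := by
    have hf : ∀ᵐ s' : ℝ ∂volume, s' ∉ ({s₀, s₁, 0} : Set ℝ) :=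
      (Set.Finite.countable (by simp)).ae_notMem _
    filter_upwards [ae_restrict_of_ae hf] with s' hs'
    simp only [mem_insert_iff, mem_singleton_iff, not_or] at hs'
    rw [← sub_mul, orient_sub h hs'.1 hs'.2.1 hs'.2.2]
    by_cases hm : s' ∈ Ioc s₀ s₁ <;> simp [hm]
  have hi := ((hg s₁ (h0.trans_le h)).sub (hg s₀ h0)).congr hae
  have hsub : Ioc s₀ s₁ ⊆ Ioi (-T) := fun s hs => h0.trans hs.1
  constructor
  · rw [intervalIntegrable_iff_integrableOn_Ioc_of_le h]
    have := (integrable_indicator_iff measurableSet_Ioc).1 hi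
    rw [IntegrableOn, Measure.restrict_restrict measurableSet_Ioc,
      inter_eq_left.2 hsub] at this
    exact this
  · unfold orientInt
    rw [← integral_sub (hg s₁ (h0.trans_le h)) (hg s₀ h0), integral_congr_ae hae,
      intervalIntegral.integral_of_le h, setIntegral_indicator measurableSet_Ioc,
      inter_eq_right.2 hsub]

lemma orientInt_two (T : ℝ) (g : ℝ → ℂ) : orientInt T Contour.two g 0 = 0 := by
  unfold orientInt
  refine (integral_congr_ae ?_).trans (integral_zero _ _)
  -- At s' = 0 itself the indicator of contour two has the value 1, so the integrand vanishes only
  -- almost everywhere.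
  have hf : ∀ᵐ s' : ℝ ∂volume, s' ∉ ({0} : Set ℝ) := (Set.countable_singleton 0).ae_notMem _
  filter_upwards [ae_restrict_of_ae hf] with s' hs'
  have : orient Contour.two 0 s' = 0 := by
    simp only [mem_singleton_iff] at hs'
    simp only [orient]
    split_ifs <;> grind
  rw [this, zero_mul]

lemma tendsto_orientInt_one
    (hg : ∀ s, -T < s → IntegrableOn (fun s' => orient c s s' * g s') (Ioi (-T)))
    (hT : 0 < T) (hc : c = Contour.one) :
    Tendsto (orientInt T c g) (𝓝[>] (-T)) (𝓝 0) := by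
  subst hc
  have h0 : (0 : ℂ) = ∫ _ in Ioi (-T), (0 : ℂ) := by simp
  rw [h0]
  refine tendsto_integral_filter_of_dominated_convergence
    (fun s' => ‖orient Contour.one 0 s' * g s'‖) ?_ ?_ (hg 0 (by linarith)).norm ?_
  · filter_upwards [self_mem_nhdsWithin] with s hs using (hg s hs).aestronglyMeasurable
  · filter_upwards [Ioo_mem_nhdsGT (show -T < 0 by linarith)] with s hs
    refine Eventually.of_forall fun s' => ?_
    rw [norm_mul, norm_mul]
    exact mul_le_mul_of_nonneg_right (norm_orient_one_le hs.2.le) (norm_nonneg _)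
  · filter_upwards [ae_restrict_mem measurableSet_Ioi] with s' hs'
    refine tendsto_const_nhds.congr' ?_
    filter_upwards [Ioo_mem_nhdsGT (mem_Ioi.1 hs')] with s hs
    simp only [orient]
    rw [if_neg (not_le.2 hs.2), zero_mul]

lemma tendsto_orientInt_three
    (hg : ∀ s, -T < s → IntegrableOn (fun s' => orient c s s' * g s') (Ioi (-T)))
    (hT : 0 < T) (hc : c = Contour.three) :
    Tendsto (orientInt T c g) atTop (𝓝 0) := by
  subst hc
  have h0 : (0 : ℂ) = ∫ _ in Ioi (-T), (0 : ℂ) := by simp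
  rw [h0]
  refine tendsto_integral_filter_of_dominated_convergence
    (fun s' => ‖orient Contour.three 0 s' * g s'‖) ?_ ?_ (hg 0 (by linarith)).norm ?_
  · filter_upwards [eventually_gt_atTop (-T)] with s hs using (hg s hs).aestronglyMeasurable
  · filter_upwards [eventually_ge_atTop 0] with s hs
    refine Eventually.of_forall fun s' => ?_
    rw [norm_mul, norm_mul]
    exact mul_le_mul_of_nonneg_right (norm_orient_three_le hs) (norm_nonneg _)
  · refine Eventually.of_forall fun s' => ?_
    refine tendsto_const_nhds.congr' ?_
    filter_upwards [eventually_gt_atTop s'] with s hs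
    simp only [orient]
    rw [if_neg (not_le.2 hs), zero_mul]

/-- A primitive of `g` with the right value at the base point is the integral from there. -/
lemma eq_add_orientInt
    (hg : ∀ s, -T < s → IntegrableOn (fun s' => orient c s s' * g s') (Ioi (-T)))
    (hT : 0 < T) {w : ℝ → ℂ} {β : ℂ}
    (hw : ∀ s₀ s₁, -T < s₀ → s₀ ≤ s₁ → ∫ s in s₀..s₁, g s = w s₁ - w s₀)
    (h1 : c = Contour.one → Tendsto w (𝓝[>] (-T)) (𝓝 β))
    (h2 : c = Contour.two → w 0 = β)
    (h3 : c = Contour.three → Tendsto w atTop (𝓝 β)) {s : ℝ} (hs : -T < s) :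
    w s = β + orientInt T c g s := by
  -- Both functions are primitives of g, so their difference is constant; it is evaluated at the
  -- base point -T, 0 or ∞ of the contour.
  have hconst : ∀ s, -T < s → w s - orientInt T c g s = w 0 - orientInt T c g 0 := by
    intro s hs
    rcases le_total 0 s with h | h
    · have e1 := (orientInt_sub hg (by linarith) h).2
      have e2 := hw 0 s (by linarith) h
      linear_combination -e1 - e2
    · have e1 := (orientInt_sub hg hs h).2
      have e2 := hw s 0 hs h
      linear_combination e1 + e2
  have hβ : w 0 - orientInt T c g 0 = β := by
    cases hc : c
    · refine tendsto_nhds_unique (tendsto_const_nhds.congr' ?_)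
        (by simpa using (h1 hc).sub (tendsto_orientInt_one hg hT hc))
      filter_upwards [self_mem_nhdsWithin] with s hs using hc ▸ (hconst s hs).symm
    · rw [h2 hc, orientInt_two, sub_zero]
    · refine tendsto_nhds_unique (tendsto_const_nhds.congr' ?_)
        (by simpa using (h3 hc).sub (tendsto_orientInt_three hg hT hc))
      filter_upwards [eventually_gt_atTop (-T)] with s hs using hc ▸ (hconst s hs).symm
  linear_combination hconst s hs + hβ

end OrientInt

/-! ### Regular values of the spectral parameter -/

/-- The points at which the integral equation is posed. -/
structure Regular (n : Fin 18) (k : ℂ) : Prop where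
  mem : k ∈ closure (D n)
  ne_zero : k ≠ 0
  pow_six : k ^ 6 ≠ 1
  pow_six' : k ^ 6 ≠ -1

variable {T : ℝ} {u : ℝ → ℝ → ℝ} {h : ℝ → ℝ} {k : ℂ} {n : Fin 18} {j : Fin 3}

lemma precedes_of_contour {i : Fin 3} (h : contour n i j ≠ Contour.three) :
    Precedes (lOrder n) i j := by
  by_contra hn
  exact h (contour_three hn)

lemma precedes_or_eq_of_contour_three {i : Fin 3} (h : contour n i j = Contour.three) :
    i = j ∨ Precedes (lOrder n) j i := by
  by_contra hn
  push Not at hn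
  have h1 := (lOrder_total n i j hn.1).resolve_right hn.2
  by_cases h2 : Precedes (zOrder n) i j
  · rw [contour_two h1 h2] at h
    cases h
  · rw [contour_one h1 h2] at h
    cases h

lemma contour_ne_three_ne {i : Fin 3} (h : contour n i j ≠ Contour.three) : i ≠ j := by
  rintro rfl
  exact h (contour_self n i)

lemma re_lDiff_nonpos (hk : k ∈ closure (D n)) (hk0 : k ≠ 0) {i : Fin 3}
    (h : contour n i j ≠ Contour.three) : (lDiff k j i).re ≤ 0 := by
  have := closure_D_re_l hk hk0 (precedes_of_contour h)
  rw [lDiff, Complex.sub_re]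
  linarith

lemma re_lDiff_nonneg (hk : k ∈ closure (D n)) (hk0 : k ≠ 0) {i : Fin 3}
    (h : contour n i j = Contour.three) : 0 ≤ (lDiff k j i).re := by
  rcases precedes_or_eq_of_contour_three h with rfl | h'
  · simp
  · have := closure_D_re_l hk hk0 h'
    rw [lDiff, Complex.sub_re]
    linarith

/-- A bound for the exponents of the `t`-equation. -/
def zBound (k : ℂ) (j : Fin 3) : ℝ := ∑ i, ‖zDiff k j i‖

lemma norm_zDiff_le (k : ℂ) (j i : Fin 3) : ‖zDiff k j i‖ ≤ zBound k j :=
  Finset.single_le_sum (f := fun i => ‖zDiff k j i‖) (fun _ _ => norm_nonneg _) (Finset.mem_univ i)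

lemma goodExp_of_re {ε B : ℝ} {a b : Fin 3 → ℂ} (hT : 0 < T) (hε : 0 ≤ ε)
    (h1 : ∀ i, contour n i j ≠ Contour.three → (a i).re ≤ 0)
    (h2 : ∀ i, contour n i j = Contour.three → -(2 * ε) ≤ (a i).re) (h3 : (a j).re ≤ 0)
    (hb : ∀ i, ‖b i‖ ≤ B) : GoodExp T n j ε (B * T) a b := by
  have hB : 0 ≤ B := (norm_nonneg _).trans (hb 0)
  refine ⟨hε, by positivity, h1, h2, h3, fun i _ => ?_, fun i _ => ?_⟩
  · exact mul_le_mul_of_nonneg_right ((Complex.re_le_norm _).trans (hb i)) hT.le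
  · have := (abs_le.1 ((Complex.abs_re_le_norm (b i)).trans (hb i))).1
    nlinarith

lemma Regular.goodExp (hk : Regular n k) (hT : 0 < T) (j : Fin 3) :
    GoodExp T n j 0 (zBound k j * T) (lDiff k j) (zDiff k j) :=
  goodExp_of_re hT le_rfl (fun _ h => re_lDiff_nonpos hk.mem hk.ne_zero h)
    (fun _ h => by simpa using re_lDiff_nonneg hk.mem hk.ne_zero h) (by simp) (norm_zDiff_le k j)

lemma Field.dom_regular (hF : Field T u h) (hk : Regular n k) (j : Fin 3) (p : ℝ × Fin 3) :
    Dom (fun p => bWeight h 0 (Real.exp (zBound k j * T) * vConst (h 0) k) p.1)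
      (Real.exp (zBound k j * T)) (gCol (Ioi (-T)) (lDiff k j) (zDiff k j) j p)
      (bKer T u n k j p) (gCol (Ioi (-T)) (lDiff k j) (zDiff k j) j) (bKer T u n k j) :=
  hF.dom hk.ne_zero hk.pow_six (hk.goodExp hF.pos j) le_rfl p

/-! ### The integral equation on the boundary -/

/-- The exponential that removes the diagonal part of the equations along the boundary. -/
def bExp (k : ℂ) (j i : Fin 3) (s : ℝ) : ℂ :=
  Complex.exp (-(lDiff k j i * (bx s : ℝ) + zDiff k j i * (bt s : ℝ)))

/-- The integrand of the `i`-th row. -/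
def bSource (T : ℝ) (u : ℝ → ℝ → ℝ) (k : ℂ) (j : Fin 3) (y : ℝ × Fin 3 → ℂ) (i : Fin 3) (s : ℝ) :
    ℂ :=
  bExp k j i s * ∑ i', bV T u k s i i' * y (s, i')

lemma bExp_ne_zero (k : ℂ) (j i : Fin 3) (s : ℝ) : bExp k j i s ≠ 0 := Complex.exp_ne_zero _

lemma bExp_mul_gCol {s : ℝ} (hs : -T < s) (i : Fin 3) :
    bExp k j i s * gCol (Ioi (-T)) (lDiff k j) (zDiff k j) j (s, i) = if i = j then 1 else 0 := by
  unfold bExp gCol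
  by_cases hij : i = j
  · subst hij
    simp [hs]
  · simp [hij]

/-- After multiplication by `bExp` the evaluation point survives only in the signed indicator. The
integral equation then says that a row is a primitive of its source. -/
lemma bExp_mul_bKer {s : ℝ} (hs : -T < s) (i i' : Fin 3) (s' : ℝ) :
    bExp k j i s * bKer T u n k j (s, i) (s', i') =
      orient (contour n i j) s s' * (bExp k j i s' * bV T u k s' i i') := by
  unfold bExp bKer gKer bo
  rw [if_pos hs]
  have : Complex.exp (-(lDiff k j i * (bx s : ℝ) + zDiff k j i * (bt s : ℝ))) *
      Complex.exp (lDiff k j i * (bx s - bx s' : ℝ) + zDiff k j i * (bt s - bt s' : ℝ)) =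
      Complex.exp (-(lDiff k j i * (bx s' : ℝ) + zDiff k j i * (bt s' : ℝ))) := by
    rw [← Complex.exp_add]
    congr 1
    push_cast
    ring
  linear_combination (orient (contour n i j) s s' * bV T u k s' i i') * this

lemma Field.integrable_bKer_mul (hF : Field T u h) (hk : Regular n k) {y : ℝ × Fin 3 → ℂ} {C : ℝ}
    (hy : Measurable y) (hC : ∀ p, ‖y p‖ ≤ C) (p : ℝ × Fin 3) :
    Integrable (fun q => bKer T u n k j p q * y q) (rowMeasure (Ioi (-T))) := by
  have hd := hF.dom_regular hk j p
  have hw := integrable_weight (hF.integrableOn_bWeight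
    (Real.exp (zBound k j * T) * vConst (h 0) k) hF.integrableOn_exp_zero)
  exact (⟨hC p, hd.norm_row, hC, hd.norm_kernel, hd.meas_row, hy, hd.meas_kernel⟩ :
    Dom _ C (y p) (bKer T u n k j p) y (bKer T u n k j)).integrable_row_mul_col hw

lemma Field.integrableOn_source (hF : Field T u h) (hk : Regular n k) {y : ℝ × Fin 3 → ℂ} {C : ℝ}
    (hy : Measurable y) (hC : ∀ p, ‖y p‖ ≤ C) {s : ℝ} (hs : -T < s) (i : Fin 3) :
    IntegrableOn (fun s' => orient (contour n i j) s s' * bSource T u k j y i s') (Ioi (-T)) ∧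
    bExp k j i s * ∫ q, bKer T u n k j (s, i) q * y q ∂(rowMeasure (Ioi (-T))) =
      orientInt T (contour n i j) (bSource T u k j y i) s := by
  have hI := hF.integrable_bKer_mul hk (j := j) hy hC (s, i)
  have hrow := integrable_rowMeasure hI
  have e : ∀ s', orient (contour n i j) s s' * bSource T u k j y i s' =
      ∑ i', bExp k j i s * (bKer T u n k j (s, i) (s', i') * y (s', i')) := by
    intro s'
    unfold bSource
    rw [Finset.mul_sum, Finset.mul_sum]
    refine Finset.sum_congr rfl fun i' _ => ?_
    linear_combination -y (s', i') * bExp_mul_bKer hs i i' s'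
  constructor
  · simp_rw [e]
    exact integrable_finsetSum _ fun i' _ => (hrow i').const_mul _
  · unfold orientInt
    simp_rw [e]
    rw [integral_finsetSum _ fun i' _ => (hrow i').const_mul _, integral_rowMeasure hI,
      Finset.mul_sum]
    exact Finset.sum_congr rfl fun i' _ => (integral_const_mul _ _).symm

/-- The Fredholm series is measurable in the evaluation point. -/
lemma Dom.measurable_bSeries {X : Type*} [MeasurableSpace X] {μ : Measure X} [SigmaFinite μ]
    {w : X → ℝ} {C : ℝ} {α : ℂ} {r e : X → ℂ} {K : X → X → ℂ} (h : Dom w C α r e K)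
    (hw : Integrable w μ) : Measurable fun q => bSeries μ (e q) (K q) e K := by
  refine measurable_of_tendsto_metrizable (f := fun N q => ∑ m ∈ Finset.range N,
    bTerm μ (e q) (K q) e K m) (fun N => ?_) (tendsto_pi_nhds.2 fun q => ?_)
  · refine Finset.measurable_fun_sum _ fun m _ => ?_
    exact ((h.meas_pointed m).stronglyMeasurable.integral_prod_right
      (ν := Measure.pi fun _ : Fin m => μ)).measurable.const_mul _
  · exact ((h.at_point q).summable hw).hasSum.tendsto_sum_nat

/-- The `j`-th column of an eigenfunction: a bounded solution of the Lax pair with the boundary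
values that correspond to the base points of the contours. -/
structure ColSol (T : ℝ) (u : ℝ → ℝ → ℝ) (n : Fin 18) (k : ℂ) (j : Fin 3)
    (φ : ℝ → ℝ → Fin 3 → ℂ) : Prop where
  x_ode : ∀ t ∈ Ico 0 T, RowODE (Ici 0) (lDiff k j) (fun x => V₁ u k x t) (fun x => φ x t)
  t_ode : ∀ x, 0 ≤ x → RowODE (Ico 0 T) (zDiff k j) (fun t => V₂ u k x t) (fun t => φ x t)
  bdd : ∃ C, ∀ x t, (x, t) ∈ Omega T → ∀ i, ‖φ x t i‖ ≤ C
  one : ∀ i, contour n i j = Contour.one → Tendsto (fun t => φ 0 t i) (𝓝[<] T) (𝓝 0)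
  two : ∀ i, contour n i j = Contour.two → φ 0 0 i = 0
  three : ∀ i, contour n i j = Contour.three → ∀ t ∈ Ico 0 T,
    Tendsto (fun x : ℝ => Complex.exp (-(lDiff k j i * x)) * φ x t i) atTop
      (𝓝 (if i = j then 1 else 0))

/-- The restriction of a function on the domain to the boundary. -/
def bY (T : ℝ) (φ : ℝ → ℝ → Fin 3 → ℂ) (p : ℝ × Fin 3) : ℂ :=
  if 0 ≤ p.1 then φ p.1 0 p.2 else if -T < p.1 then φ 0 (-p.1) p.2 else 0

variable {T : ℝ} {u : ℝ → ℝ → ℝ} {h : ℝ → ℝ} {k : ℂ} {n : Fin 18} {j : Fin 3}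
  {φ : ℝ → ℝ → Fin 3 → ℂ}

lemma bY_of_nonneg {s : ℝ} (hs : 0 ≤ s) (i : Fin 3) : bY T φ (s, i) = φ s 0 i := if_pos hs

lemma bY_neg {t : ℝ} (ht : t ∈ Ico 0 T) (i : Fin 3) : bY T φ (-t, i) = φ 0 t i := by
  unfold bY
  rcases ht.1.eq_or_lt with rfl | h0
  · simp
  · rw [if_neg (by simpa using h0), if_pos (by simpa using ht.2)]
    simp

lemma bExp_of_nonneg {s : ℝ} (hs : 0 ≤ s) (i : Fin 3) :
    bExp k j i s = Complex.exp (-(lDiff k j i * s)) := by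
  unfold bExp
  simp [bx_of_nonneg hs, bt_of_nonneg hs]

lemma bExp_neg {t : ℝ} (ht : 0 ≤ t) (i : Fin 3) :
    bExp k j i (-t) = Complex.exp (-(zDiff k j i * t)) := by
  unfold bExp
  simp [bx_of_nonpos (neg_nonpos.2 ht), bt_of_nonpos (neg_nonpos.2 ht)]

lemma bSource_of_nonneg {y : ℝ × Fin 3 → ℂ} {s : ℝ} (hs : 0 ≤ s) (i : Fin 3) :
    bSource T u k j y i s =
      Complex.exp (-(lDiff k j i * s)) * ∑ i', V₁ u k s 0 i i' * y (s, i') := by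
  unfold bSource
  rw [bExp_of_nonneg hs, bV_of_nonneg T u k hs]

lemma bSource_neg {y : ℝ × Fin 3 → ℂ} {t : ℝ} (ht : t ∈ Ioo 0 T) (i : Fin 3) :
    bSource T u k j y i (-t) =
      -(Complex.exp (-(zDiff k j i * t)) * ∑ i', V₂ u k 0 t i i' * y (-t, i')) := by
  unfold bSource
  rw [bExp_neg ht.1.le, bV_of_neg u k (by linarith [ht.1]) (by linarith [ht.2]), neg_neg]
  simp only [Matrix.neg_apply, neg_mul, Finset.sum_neg_distrib, mul_neg]

lemma integral_bSource_of_nonneg {y : ℝ × Fin 3 → ℂ} {s₀ s₁ : ℝ} (h0 : 0 ≤ s₀) (h : s₀ ≤ s₁)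
    (i : Fin 3) : ∫ s in s₀..s₁, bSource T u k j y i s =
      ∫ s in s₀..s₁, Complex.exp (-(lDiff k j i * s)) * ∑ i', V₁ u k s 0 i i' * y (s, i') := by
  refine intervalIntegral.integral_congr fun s hs => ?_
  rw [uIcc_of_le h] at hs
  exact bSource_of_nonneg (h0.trans hs.1) i

lemma integral_bSource_neg {y : ℝ × Fin 3 → ℂ} {t₀ t₁ : ℝ} (h0 : 0 ≤ t₀) (h : t₀ ≤ t₁)
    (h1 : t₁ < T) (i : Fin 3) : ∫ s in (-t₁)..(-t₀), bSource T u k j y i s =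
      -∫ t in t₀..t₁, Complex.exp (-(zDiff k j i * t)) * ∑ i', V₂ u k 0 t i i' * y (-t, i') := by
  rw [← intervalIntegral.integral_comp_neg, ← intervalIntegral.integral_neg]
  refine intervalIntegral.integral_congr_ae ?_
  have hf : ∀ᵐ s' : ℝ ∂volume, s' ∉ ({0} : Set ℝ) := (Set.countable_singleton 0).ae_notMem _
  filter_upwards [hf] with t ht0 ht
  rw [uIoc_of_le h] at ht
  exact bSource_neg ⟨h0.trans_lt ht.1, ht.2.trans_lt h1⟩ i

lemma continuousOn_V₁_zero (hF : Field T u h) (hk : k ≠ 0) (hk6 : k ^ 6 ≠ 1) {t : ℝ}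
    (ht : t ∈ Ico 0 T) (i i' : Fin 3) : ContinuousOn (fun x => V₁ u k x t i i') (Ici 0) :=
  continuousOn_slice_x (hF.continuousOn_V₁ hk hk6 i i') ht

lemma continuousOn_V₂_zero (hF : Field T u h) (hk : k ≠ 0) (hk6 : k ^ 6 ≠ 1) {x : ℝ}
    (hx : 0 ≤ x) (i i' : Fin 3) : ContinuousOn (fun t => V₂ u k x t i i') (Ico 0 T) :=
  continuousOn_slice_t (hF.continuousOn_V₂ hk hk6 i i') hx

/-- The fundamental theorem of calculus on the two halves of the boundary, joined at the corner s =
0. The sign in -V₂ accounts for the orientation s = -t. -/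
lemma integral_bSource_bY (hF : Field T u h) (hk : k ≠ 0) (hk6 : k ^ 6 ≠ 1)
    (hx : RowODE (Ici 0) (lDiff k j) (fun x => V₁ u k x 0) (fun x => φ x 0))
    (ht : RowODE (Ico 0 T) (zDiff k j) (fun t => V₂ u k 0 t) (fun t => φ 0 t)) (i : Fin 3)
    (hI : ∀ s₀ s₁, -T < s₀ → s₀ ≤ s₁ →
      IntervalIntegrable (bSource T u k j (bY T φ) i) volume s₀ s₁)
    (s₀ s₁ : ℝ) (h0 : -T < s₀) (h01 : s₀ ≤ s₁) :
    ∫ s in s₀..s₁, bSource T u k j (bY T φ) i s =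
      bExp k j i s₁ * bY T φ (s₁, i) - bExp k j i s₀ * bY T φ (s₀, i) := by
  have hpos : ∀ s₀ s₁, 0 ≤ s₀ → s₀ ≤ s₁ → ∫ s in s₀..s₁, bSource T u k j (bY T φ) i s =
      bExp k j i s₁ * bY T φ (s₁, i) - bExp k j i s₀ * bY T φ (s₀, i) := by
    intro s₀ s₁ h0 h01
    rw [integral_bSource_of_nonneg h0 h01, bExp_of_nonneg h0, bExp_of_nonneg (h0.trans h01),
      bY_of_nonneg h0, bY_of_nonneg (h0.trans h01),
      ← hx.ftc isRay_Ici (continuousOn_V₁_zero hF hk hk6 ⟨le_rfl, hF.pos⟩) h0 h01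
        (mem_Ici.2 (h0.trans h01)) i]
    refine intervalIntegral.integral_congr fun s hs => ?_
    rw [uIcc_of_le h01] at hs
    simp only [bY_of_nonneg (h0.trans hs.1)]
  have hneg : ∀ s₀ s₁, -T < s₀ → s₀ ≤ s₁ → s₁ ≤ 0 → ∫ s in s₀..s₁, bSource T u k j (bY T φ) i s =
      bExp k j i s₁ * bY T φ (s₁, i) - bExp k j i s₀ * bY T φ (s₀, i) := by
    intro s₀ s₁ h0 h01 h1
    obtain ⟨t₀, rfl⟩ : ∃ t, s₁ = -t := ⟨-s₁, by simp⟩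
    obtain ⟨t₁, rfl⟩ : ∃ t, s₀ = -t := ⟨-s₀, by simp⟩
    have a0 : 0 ≤ t₀ := by linarith
    have a1 : t₀ ≤ t₁ := by linarith
    have a2 : t₁ < T := by linarith
    rw [integral_bSource_neg a0 a1 a2, bExp_neg a0, bExp_neg (a0.trans a1),
      bY_neg ⟨a0, a1.trans_lt a2⟩, bY_neg ⟨a0.trans a1, a2⟩, ← neg_sub,
      ← ht.ftc (isRay_Ico T) (continuousOn_V₂_zero hF hk hk6 le_rfl) a0 a1 ⟨a0.trans a1, a2⟩ i]
    congr 1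
    refine intervalIntegral.integral_congr fun s hs => ?_
    rw [uIcc_of_le a1] at hs
    simp only [bY_neg (φ := φ) (T := T) ⟨a0.trans hs.1, hs.2.trans_lt a2⟩]
  rcases le_total 0 s₀ with h | h
  · exact hpos s₀ s₁ h h01
  · rcases le_total s₁ 0 with h' | h'
    · exact hneg s₀ s₁ h0 h01 h'
    · rw [← intervalIntegral.integral_add_adjacent_intervals (hI s₀ 0 h0 h)
        (hI 0 s₁ (by linarith [hF.pos]) h'), hneg s₀ 0 h0 h le_rfl, hpos 0 s₁ le_rfl h']
      ring

lemma ColSol.measurable_bY (hφ : ColSol T u n k j φ) (hT : 0 < T) : Measurable (bY T φ) := by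
  refine measurable_of_fin fun i => ?_
  exact measurable_boundary ((hφ.x_ode 0 ⟨le_rfl, hT⟩).continuousOn i)
    ((hφ.t_ode 0 le_rfl).continuousOn i)

lemma ColSol.exists_bound_bY (hφ : ColSol T u n k j φ) (hT : 0 < T) :
    ∃ C, ∀ p, ‖bY T φ p‖ ≤ C := by
  obtain ⟨C, hC⟩ := hφ.bdd
  have h0 : 0 ≤ C := (norm_nonneg _).trans (hC 0 0 (mem_Omega.2 ⟨le_rfl, le_rfl, hT⟩) 0)
  refine ⟨C, fun p => ?_⟩
  unfold bY
  split_ifs with h1 h2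
  · exact hC _ _ (mem_Omega.2 ⟨h1, le_rfl, hT⟩) _
  · exact hC _ _ (mem_Omega.2 ⟨le_rfl, by linarith, by linarith⟩) _
  · simpa using h0

/-- The boundary values of a column satisfy the integral equation on the boundary. -/
lemma ColSol.boundary_eq (hφ : ColSol T u n k j φ) (hF : Field T u h) (hk : Regular n k)
    (p : ℝ × Fin 3) : bY T φ p = gCol (Ioi (-T)) (lDiff k j) (zDiff k j) j p +
      ∫ q, bKer T u n k j p q * bY T φ q ∂(rowMeasure (Ioi (-T))) := by
  obtain ⟨s, i⟩ := p
  have hT := hF.pos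
  obtain ⟨C, hC⟩ := hφ.exists_bound_bY hT
  by_cases hs : -T < s
  · have hInt := fun s hs => (hF.integrableOn_source hk (j := j) (hφ.measurable_bY hT) hC
      (s := s) hs i).1
    have hI := fun s₀ s₁ h0 h01 => (orientInt_sub hInt (s₀ := s₀) (s₁ := s₁) h0 h01).1
    have hw := integral_bSource_bY hF hk.ne_zero hk.pow_six (hφ.x_ode 0 ⟨le_rfl, hT⟩)
      (hφ.t_ode 0 le_rfl) i hI
    have key := eq_add_orientInt hInt hT (w := fun s => bExp k j i s * bY T φ (s, i))
      (β := if i = j then 1 else 0) hw ?_ ?_ ?_ hs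
    · rw [← (hF.integrableOn_source hk (j := j) (hφ.measurable_bY hT) hC hs i).2,
        ← bExp_mul_gCol hs i, ← mul_add] at key
      exact mul_left_cancel₀ (bExp_ne_zero k j i s) key
    · intro hc
      have hij : i ≠ j := contour_ne_three_ne (n := n) (by simp [hc])
      rw [if_neg hij]
      have h1 : Tendsto (fun t : ℝ => Complex.exp (-(zDiff k j i * t)) * φ 0 t i) (𝓝[<] T)
          (𝓝 (Complex.exp (-(zDiff k j i * T)) * 0)) := by
        refine Tendsto.mul ?_ (hφ.one i hc)
        have : Continuous fun t : ℝ => Complex.exp (-(zDiff k j i * t)) := by fun_prop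
        exact this.continuousAt.tendsto.mono_left nhdsWithin_le_nhds
      rw [mul_zero] at h1
      refine (h1.comp (tendsto_neg_nhdsGT_neg (a := T))).congr' ?_
      filter_upwards [Ioo_mem_nhdsGT (show -T < 0 by linarith)] with s hs
      have := bExp_neg (k := k) (j := j) (t := -s) (by linarith [hs.2]) i
      have h3 := bY_neg (φ := φ) (T := T) (t := -s) ⟨by linarith [hs.2], by linarith [hs.1]⟩ i
      rw [neg_neg] at this h3
      simp only [Function.comp]
      rw [this, h3]
    · intro hc
      have hij : i ≠ j := contour_ne_three_ne (n := n) (by simp [hc])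
      rw [if_neg hij, bY_of_nonneg le_rfl, hφ.two i hc, mul_zero]
    · intro hc
      refine (hφ.three i hc 0 ⟨le_rfl, hT⟩).congr' ?_
      filter_upwards [eventually_ge_atTop 0] with s hs
      rw [bExp_of_nonneg hs, bY_of_nonneg hs]
  -- For s ≤ -T both sides vanish by the cut-offs, so the equation holds at every point.
  · have e1 : bY T φ (s, i) = 0 := by
      unfold bY
      simp only
      rw [if_neg (by linarith [not_lt.1 hs]), if_neg hs]
    have e2 : ∀ q, bKer T u n k j (s, i) q = 0 := by
      intro q
      unfold bKer gKer bo
      simp [hs]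
    simp [e1, e2, gCol, hs]

lemma Field.integrable_bWeight_regular (hF : Field T u h) (C : ℝ) :
    Integrable (fun p : ℝ × Fin 3 => bWeight h 0 C p.1) (rowMeasure (Ioi (-T))) :=
  integrable_weight (hF.integrableOn_bWeight C hF.integrableOn_exp_zero)

/-- Fredholm's formula for the boundary values of a column. -/
theorem ColSol.colDet_mul (hφ : ColSol T u n k j φ) (hF : Field T u h) (hk : Regular n k)
    (p : ℝ × Fin 3) : colDet T u n k j * bY T φ p = colM T u n k j p := by
  obtain ⟨C, hC⟩ := hφ.exists_bound_bY hF.pos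
  exact (hF.dom_regular hk j p).fredholmDet_mul_eq (hF.integrable_bWeight_regular _)
    (hφ.measurable_bY hF.pos) hC (hφ.boundary_eq hF hk) p

/-- The solution of the integral equation on the boundary. -/
def colY (T : ℝ) (u : ℝ → ℝ → ℝ) (n : Fin 18) (k : ℂ) (j : Fin 3) (p : ℝ × Fin 3) : ℂ :=
  colM T u n k j p / colDet T u n k j

/-- Fredholm's solution of the integral equation on the boundary solves the differential equations
and has the right boundary values. -/
lemma Field.colY_spec (hF : Field T u h) (hk : Regular n k) (hd : colDet T u n k j ≠ 0) :
    (∃ C, ∀ p, ‖colY T u n k j p‖ ≤ C) ∧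
    RowODE (Ici 0) (lDiff k j) (fun x => V₁ u k x 0) (fun x i => colY T u n k j (x, i)) ∧
    RowODE (Ico 0 T) (zDiff k j) (fun t => V₂ u k 0 t) (fun t i => colY T u n k j (-t, i)) ∧
    (∀ i, contour n i j = Contour.one →
      Tendsto (fun t => colY T u n k j (-t, i)) (𝓝[<] T) (𝓝 0)) ∧
    (∀ i, contour n i j = Contour.two → colY T u n k j (0, i) = 0) ∧
    (∀ i, contour n i j = Contour.three →
      Tendsto (fun x : ℝ => Complex.exp (-(lDiff k j i * x)) * colY T u n k j (x, i)) atTop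
        (𝓝 (if i = j then 1 else 0))) := by
  have hT := hF.pos
  have hw := hF.integrable_bWeight_regular (Real.exp (zBound k j * T) * vConst (h 0) k)
  have hdom := hF.dom_regular hk j
  obtain ⟨C, hC⟩ : ∃ C, ∀ p, ‖colY T u n k j p‖ ≤ C := by
    refine ⟨Real.exp (zBound k j * T) * majorant (∫ p, bWeight h 0
        (Real.exp (zBound k j * T) * vConst (h 0) k) p.1 ∂(rowMeasure (Ioi (-T))))
        / ‖colDet T u n k j‖, fun p => ?_⟩
    unfold colY
    rw [norm_div]
    exact div_le_div_of_nonneg_right ((hdom p).norm_bSeries_le hw) (norm_nonneg _)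
  have hm : Measurable (colY T u n k j) := ((hdom (0, 0)).measurable_bSeries hw).div_const _
  have heq : ∀ p, colY T u n k j p = gCol (Ioi (-T)) (lDiff k j) (zDiff k j) j p +
      ∫ q, bKer T u n k j p q * colY T u n k j q ∂(rowMeasure (Ioi (-T))) := by
    intro p
    have h1 : colM T u n k j p = gCol (Ioi (-T)) (lDiff k j) (zDiff k j) j p * colDet T u n k j +
        ∫ q, bKer T u n k j p q * colM T u n k j q ∂(rowMeasure (Ioi (-T))) :=
      ((hdom p).bSeries_row hw).2
    have h2 : ∫ q, bKer T u n k j p q * colY T u n k j q ∂(rowMeasure (Ioi (-T))) =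
        (∫ q, bKer T u n k j p q * colM T u n k j q ∂(rowMeasure (Ioi (-T))))
          / colDet T u n k j := by
      rw [← integral_div]
      unfold colY
      simp_rw [mul_div_assoc]
    rw [h2]
    conv_lhs => unfold colY
    rw [h1]
    field_simp
  have hInt := fun i s hs => (hF.integrableOn_source hk (j := j) hm hC (s := s) hs i).1
  -- Each row, freed of its exponential, is its base value plus the integral from the base point.
  -- Both differential equations and all three boundary conditions are read off from this identity.
  have hW : ∀ i s, -T < s → bExp k j i s * colY T u n k j (s, i) = (if i = j then 1 else 0) +
      orientInt T (contour n i j) (bSource T u k j (colY T u n k j) i) s := by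
    intro i s hs
    rw [← (hF.integrableOn_source hk (j := j) hm hC hs i).2, ← bExp_mul_gCol hs i, ← mul_add,
      ← heq (s, i)]
  refine ⟨⟨C, hC⟩, ?_, ?_, ?_, ?_, ?_⟩
  · refine rowODE_of_integral isRay_Ici
      (continuousOn_V₁_zero hF hk.ne_zero hk.pow_six ⟨le_rfl, hT⟩)
      (fun i => colY T u n k j (0, i)) (fun x hx i => ?_) (fun x hx i => ?_)
    · refine ((orientInt_sub (hInt i) (s₀ := 0) (by linarith) hx).1).congr fun s hs => ?_
      rw [uIoc_of_le hx] at hs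
      exact bSource_of_nonneg hs.1.le i
    · have h1 := (orientInt_sub (hInt i) (s₀ := 0) (by linarith) hx).2
      rw [integral_bSource_of_nonneg le_rfl hx] at h1
      have h2 := hW i x (by linarith [mem_Ici.1 hx])
      have h3 := hW i 0 (by linarith)
      rw [bExp_of_nonneg hx] at h2
      rw [bExp_of_nonneg le_rfl] at h3
      simp only [Complex.ofReal_zero, mul_zero, neg_zero, Complex.exp_zero, one_mul] at h3
      rw [← h1, h2, h3]
      ring
  · refine rowODE_of_integral (isRay_Ico T)
      (continuousOn_V₂_zero hF hk.ne_zero hk.pow_six le_rfl)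
      (fun i => colY T u n k j (0, i)) (fun t ht i => ?_) (fun t ht i => ?_)
    · have h1 := ((orientInt_sub (hInt i) (s₀ := -t) (s₁ := 0) (by linarith [ht.2])
        (by linarith [ht.1])).1).symm
      have h2 := ((IntervalIntegrable.iff_comp_neg).1 h1).neg
      rw [neg_zero, neg_neg] at h2
      refine h2.congr fun s hs => ?_
      rw [uIoc_of_le ht.1] at hs
      simp only [Pi.neg_apply]
      rw [bSource_neg ⟨hs.1, hs.2.trans_lt ht.2⟩, neg_neg]
    · have h1 := (orientInt_sub (hInt i) (s₀ := -t) (s₁ := 0) (by linarith [ht.2])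
        (by linarith [ht.1])).2
      have h4 := integral_bSource_neg (u := u) (k := k) (j := j) (y := colY T u n k j)
        le_rfl ht.1 ht.2 i
      rw [neg_zero] at h4
      rw [h4] at h1
      have h2 := hW i (-t) (by linarith [ht.2])
      have h3 := hW i 0 (by linarith)
      rw [bExp_neg ht.1] at h2
      rw [bExp_of_nonneg le_rfl] at h3
      simp only [Complex.ofReal_zero, mul_zero, neg_zero, Complex.exp_zero, one_mul] at h3
      rw [h2, h3]
      linear_combination -h1
  · intro i hc
    have hij : i ≠ j := contour_ne_three_ne (n := n) (by simp [hc])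
    have h1 := tendsto_orientInt_one (hInt i) hT hc
    have h2 := h1.comp (tendsto_neg_nhdsLT (a := T))
    have h3 : Tendsto (fun t : ℝ => Complex.exp (zDiff k j i * t)) (𝓝[<] T)
        (𝓝 (Complex.exp (zDiff k j i * T))) := by
      have : Continuous fun t : ℝ => Complex.exp (zDiff k j i * t) := by fun_prop
      exact this.continuousAt.tendsto.mono_left nhdsWithin_le_nhds
    have h4 := h3.mul h2
    rw [mul_zero] at h4
    refine h4.congr' ?_
    filter_upwards [Ioo_mem_nhdsLT hT] with t ht
    have h5 := hW i (-t) (by linarith [ht.2])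
    rw [bExp_neg ht.1.le, if_neg hij, zero_add] at h5
    simp only [Function.comp]
    rw [← h5, ← mul_assoc, ← Complex.exp_add]
    simp
  · intro i hc
    have hij : i ≠ j := contour_ne_three_ne (n := n) (by simp [hc])
    have h3 := hW i 0 (by linarith)
    rw [bExp_of_nonneg le_rfl, hc, orientInt_two, if_neg hij] at h3
    simpa using h3
  · intro i hc
    have h1 := (tendsto_orientInt_three (hInt i) hT hc).const_add
      (if i = j then (1 : ℂ) else 0)
    rw [add_zero] at h1
    refine h1.congr' ?_
    filter_upwards [eventually_ge_atTop 0] with x hx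
    rw [← hW i x (by linarith), bExp_of_nonneg hx]

/-! ### Compatibility of the two equations of the Lax pair -/

variable {T : ℝ}

/-- Near a point with time t the variables can be clamped to x ≥ 0 and 0 ≤ τ ≤ R for some R between
t and T. The clamped integrand is continuous on the plane, where continuity of parametric primitives
is available. -/
lemma continuousOn_primitive {F : ℝ × ℝ → ℂ} (hF : ContinuousOn F (Omega T)) :
    ContinuousOn (fun p : ℝ × ℝ => ∫ τ in (0 : ℝ)..p.2, F (p.1, τ)) (Omega T) := by
  rintro ⟨x, t⟩ hp
  obtain ⟨hx, ht0, htT⟩ := mem_Omega.1 hp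
  set R := (t + T) / 2 with hR
  have hRT : R < T := by linarith
  have htR : t < R := by linarith
  have hcont : Continuous (Function.uncurry fun y τ : ℝ => F (max y 0, max 0 (min τ R))) := by
    refine hF.comp_continuous (by fun_prop) fun p => mem_Omega.2 ⟨le_max_right _ _,
      le_max_left _ _, max_lt (by linarith) ((min_le_right _ _).trans_lt hRT)⟩
  have h1 := intervalIntegral.continuous_parametric_primitive_of_continuous (μ := volume)
    (a₀ := 0) hcont
  refine (h1.continuousAt (x := (x, t))).continuousWithinAt.congr_of_eventuallyEq ?_ ?_
  · have : ∀ᶠ p : ℝ × ℝ in 𝓝[Omega T] (x, t), p.2 < R :=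
      (continuous_snd.tendsto (x, t)).mono_left nhdsWithin_le_nhds |>.eventually_lt_const htR
    filter_upwards [self_mem_nhdsWithin, this] with p hp hpR
    obtain ⟨a1, a2, a3⟩ := mem_Omega.1 (show (p.1, p.2) ∈ Omega T from hp)
    refine intervalIntegral.integral_congr fun s hs => ?_
    rw [uIcc_of_le a2] at hs
    simp only [max_eq_left a1, min_eq_left (hs.2.trans hpR.le), max_eq_right hs.1]
  · refine intervalIntegral.integral_congr fun s hs => ?_
    simp only at hs
    rw [uIcc_of_le ht0] at hs
    simp only [max_eq_left hx, min_eq_left (hs.2.trans htR.le), max_eq_right hs.1]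

lemma rect_subset_Omega {X t : ℝ} (ht : t < T) : Icc 0 X ×ˢ Icc 0 t ⊆ Omega T := fun p hp =>
  (mem_Omega (x := p.1) (t := p.2)).2 ⟨hp.1.1, hp.2.1, hp.2.2.trans_lt ht⟩

lemma integral_swap {F : ℝ × ℝ → ℂ} (hF : ContinuousOn F (Omega T)) {x t : ℝ} (hx : 0 ≤ x)
    (ht : t ∈ Ico 0 T) :
    ∫ τ in (0 : ℝ)..t, ∫ ξ in (0 : ℝ)..x, F (ξ, τ) = ∫ ξ in (0 : ℝ)..x, ∫ τ in (0 : ℝ)..t, F (ξ, τ) := by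
  refine (intervalIntegral_intervalIntegral_swap (F := fun ξ τ => F (ξ, τ)) ?_).symm
  rw [uIoc_of_le hx, uIoc_of_le ht.1]
  have h1 : IntegrableOn F (Icc 0 x ×ˢ Icc 0 t) (volume.prod volume) :=
    (hF.mono (rect_subset_Omega ht.2)).integrableOn_compact (isCompact_Icc.prod isCompact_Icc)
  exact h1.mono_set (prod_mono Ioc_subset_Icc_self Ioc_subset_Icc_self)

section MulVec

variable {M M' : ℝ → Matrix (Fin 3) (Fin 3) ℂ} {v v' : ℝ → Fin 3 → ℂ} {I : Set ℝ} {x : ℝ}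

lemma mulVec_apply' (N : Matrix (Fin 3) (Fin 3) ℂ) (w : Fin 3 → ℂ) (i : Fin 3) :
    N.mulVec w i = ∑ i', N i i' * w i' := rfl

lemma hasDerivWithinAt_mulVec
    (hM : ∀ i i', HasDerivWithinAt (fun y => M y i i') (M' x i i') I x)
    (hv : ∀ i, HasDerivWithinAt (fun y => v y i) (v' x i) I x) (i : Fin 3) :
    HasDerivWithinAt (fun y => (M y).mulVec (v y) i)
      ((M' x).mulVec (v x) i + (M x).mulVec (v' x) i) I x := by
  simp only [mulVec_apply']
  refine (HasDerivWithinAt.fun_sum fun i' _ => (hM i i').mul (hv i')).congr_deriv ?_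
  rw [← Finset.sum_add_distrib]

lemma continuousOn_mulVec {N : ℝ × ℝ → Matrix (Fin 3) (Fin 3) ℂ} {w : ℝ × ℝ → Fin 3 → ℂ}
    {S : Set (ℝ × ℝ)} (hN : ∀ i i', ContinuousOn (fun p => N p i i') S)
    (hw : ∀ i, ContinuousOn (fun p => w p i) S) (i : Fin 3) :
    ContinuousOn (fun p => (N p).mulVec (w p) i) S := by
  simp only [mulVec_apply']
  exact continuousOn_finsetSum _ fun i' _ => (hN i i').mul (hw i')

lemma norm_mulVec_le {N : Matrix (Fin 3) (Fin 3) ℂ} {w : Fin 3 → ℂ} {α β : ℝ}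
    (hN : ∀ i i', ‖N i i'‖ ≤ α) (hw : ∀ i, ‖w i‖ ≤ β) (i : Fin 3) :
    ‖N.mulVec w i‖ ≤ 3 * (α * β) := by
  rw [mulVec_apply']
  refine (norm_sum_le _ _).trans ?_
  have h : ∀ i' ∈ Finset.univ, ‖N i i' * w i'‖ ≤ α * β := fun i' _ => by
    rw [norm_mul]
    exact mul_le_mul (hN i i') (hw i') (norm_nonneg _) ((norm_nonneg _).trans (hN i i'))
  refine (Finset.sum_le_card_nsmul _ _ _ h).trans (le_of_eq ?_)
  simp

end MulVec

/-- The fundamental theorem of calculus on `[0, x]`. -/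
lemma IsRay.integral_eq_sub {I : Set ℝ} (hI : IsRay I) {f f' : ℝ → ℂ}
    (hd : ∀ y ∈ I, HasDerivWithinAt f (f' y) I y) (hc : ContinuousOn f' I) {x : ℝ} (hx : x ∈ I) :
    ∫ s in (0 : ℝ)..x, f' s = f x - f 0 := by
  have hsub := hI.Icc_subset hx
  refine intervalIntegral.integral_eq_sub_of_hasDerivAt_of_le (hI x hx).1
    (fun y hy => ((hd y (hsub hy)).continuousWithinAt).mono hsub)
    (fun y hy => (hd y (hsub (Ioo_subset_Icc_self hy))).hasDerivAt
      (hI.mem_nhds (hsub (Ioo_subset_Icc_self hy)) hy.1)) ?_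
  refine ContinuousOn.intervalIntegrable ?_
  rw [uIcc_of_le (hI x hx).1]
  exact hc.mono hsub

/-- A solution of a homogeneous Volterra inequality vanishes. -/
lemma eq_zero_of_volterra {E : ℝ → ℝ → Fin 3 → ℂ} {X t₀ C M : ℝ}
    (hM : ∀ x ∈ Icc 0 X, ∀ t ∈ Icc 0 t₀, ∀ i, ‖E x t i‖ ≤ M)
    (hE : ∀ b : ℝ → ℝ, Continuous b →
      (∀ x ∈ Icc 0 X, ∀ t ∈ Icc 0 t₀, ∀ i, ‖E x t i‖ ≤ b x) →
      ∀ x ∈ Icc 0 X, ∀ t ∈ Icc 0 t₀, ∀ i, ‖E x t i‖ ≤ ∫ ξ in (0 : ℝ)..x, C * b ξ)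
    {x t : ℝ} (hx : x ∈ Icc 0 X) (ht : t ∈ Icc 0 t₀) (i : Fin 3) : E x t i = 0 := by
  -- Iterating the inequality reproduces the terms of the exponential series of C x, which tend to
  -- zero.
  have key : ∀ m : ℕ, ∀ x ∈ Icc 0 X, ∀ t ∈ Icc 0 t₀, ∀ i,
      ‖E x t i‖ ≤ M * ((C * x) ^ m / m.factorial) := by
    intro m
    induction m with
    | zero => simpa using hM
    | succ m ih =>
      intro x hx t ht i
      refine (hE (fun x => M * ((C * x) ^ m / m.factorial)) (by fun_prop) ih x hx t ht i).trans
        (le_of_eq ?_)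
      have e : ∀ ξ : ℝ, C * (M * ((C * ξ) ^ m / m.factorial)) =
          C ^ (m + 1) * M / m.factorial * ξ ^ m := fun ξ => by
        rw [mul_pow, pow_succ]; ring
      simp_rw [e]
      rw [intervalIntegral.integral_const_mul, integral_pow, Nat.factorial_succ]
      push_cast
      have : (m.factorial : ℝ) ≠ 0 := by positivity
      have : (m : ℝ) + 1 ≠ 0 := by positivity
      field_simp
      ring
  have h1 := (FloorSemiring.tendsto_pow_div_factorial_atTop (C * x)).const_mul M
  rw [mul_zero] at h1
  exact norm_le_zero_iff.1 (ge_of_tendsto' h1 fun m => key m x hx t ht i)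

/-- If the matrices `A`, `B` satisfy the zero curvature equation, a solution of the `x`-equation
that solves the `t`-equation at `x = 0` solves it everywhere. -/
theorem compatibility {A B At Bx : ℝ → ℝ → Matrix (Fin 3) (Fin 3) ℂ} {φ : ℝ → ℝ → Fin 3 → ℂ}
    (cA : ∀ i i', ContinuousOn (fun p : ℝ × ℝ => A p.1 p.2 i i') (Omega T))
    (cB : ∀ i i', ContinuousOn (fun p : ℝ × ℝ => B p.1 p.2 i i') (Omega T))
    (cAt : ∀ i i', ContinuousOn (fun p : ℝ × ℝ => At p.1 p.2 i i') (Omega T))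
    (hAt : ∀ x t, (x, t) ∈ Omega T → ∀ i i',
      HasDerivWithinAt (fun s => A x s i i') (At x t i i') (Ico 0 T) t)
    (hBx : ∀ x t, (x, t) ∈ Omega T → ∀ i i',
      HasDerivWithinAt (fun y => B y t i i') (Bx x t i i') (Ici 0) x)
    (hzero : ∀ x t, (x, t) ∈ Omega T → Bx x t + B x t * A x t = At x t + A x t * B x t)
    (cφ : ∀ i, ContinuousOn (fun p : ℝ × ℝ => φ p.1 p.2 i) (Omega T))
    (hx : ∀ x t, (x, t) ∈ Omega T → ∀ i,
      HasDerivWithinAt (fun y => φ y t i) ((A x t).mulVec (φ x t) i) (Ici 0) x)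
    (h0 : ∀ t ∈ Ico 0 T, ∀ i,
      HasDerivWithinAt (fun s => φ 0 s i) ((B 0 t).mulVec (φ 0 t) i) (Ico 0 T) t)
    {x t : ℝ} (hp : (x, t) ∈ Omega T) (i : Fin 3) :
    HasDerivWithinAt (fun s => φ x s i) ((B x t).mulVec (φ x t) i) (Ico 0 T) t := by
  -- Away from x = 0 differentiability of φ in t is not known and is to be proved. Δ integrates the
  -- t-equation and is differentiable in t by construction; E measures the failure of φ to coincide
  -- with it.
  set Δ : ℝ → ℝ → Fin 3 → ℂ := fun x t i =>
    φ x 0 i + ∫ τ in (0 : ℝ)..t, (B x τ).mulVec (φ x τ) i with hΔ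
  set E : ℝ → ℝ → Fin 3 → ℂ := fun x t i => φ x t i - Δ x t i with hEdef
  have cBφ : ∀ i, ContinuousOn (fun p : ℝ × ℝ => (B p.1 p.2).mulVec (φ p.1 p.2) i) (Omega T) :=
    continuousOn_mulVec cB cφ
  have cΔ : ∀ i, ContinuousOn (fun p : ℝ × ℝ => Δ p.1 p.2 i) (Omega T) := by
    intro i
    refine ContinuousOn.add ?_ (continuousOn_primitive (cBφ i))
    refine (cφ i).comp (f := fun p : ℝ × ℝ => ((p.1, 0) : ℝ × ℝ)) (by fun_prop) fun p hp => ?_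
    have := mem_Omega.1 (show (p.1, p.2) ∈ Omega T from hp)
    exact mem_Omega.2 ⟨this.1, le_rfl, this.2.1.trans_lt this.2.2⟩
  have cE : ∀ i, ContinuousOn (fun p : ℝ × ℝ => E p.1 p.2 i) (Omega T) := fun i =>
    (cφ i).sub (cΔ i)
  have cAtE := continuousOn_mulVec (w := fun p : ℝ × ℝ => E p.1 p.2) cAt cE
  have cAtΔ := continuousOn_mulVec (w := fun p : ℝ × ℝ => Δ p.1 p.2) cAt cΔ
  have cABφ := continuousOn_mulVec (w := fun p : ℝ × ℝ => (B p.1 p.2).mulVec (φ p.1 p.2)) cA cBφ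
  have cAtφ := continuousOn_mulVec (w := fun p : ℝ × ℝ => φ p.1 p.2) cAt cφ
  have cAφ := continuousOn_mulVec (w := fun p : ℝ × ℝ => φ p.1 p.2) cA cφ
  have cAΔ := continuousOn_mulVec (w := fun p : ℝ × ℝ => Δ p.1 p.2) cA cΔ
  have cAE := continuousOn_mulVec (w := fun p : ℝ × ℝ => E p.1 p.2) cA cE
  have hΔt : ∀ x, 0 ≤ x → ∀ t ∈ Ico 0 T, ∀ i,
      HasDerivWithinAt (fun s => Δ x s i) ((B x t).mulVec (φ x t) i) (Ico 0 T) t := by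
    intro x hx t ht i
    exact ((isRay_Ico T).hasDerivWithinAt_integral (continuousOn_slice_t (cBφ i) hx) ht).const_add _
  -- E satisfies a homogeneous Volterra equation. By zero curvature the x-derivative of B φ is A_t φ
  -- + A B φ, and A B φ is removed with the t-derivative A_t Δ + A B φ of A Δ. No derivative of E
  -- enters, and the values at x = 0 cancel by the t-equation there.
  have repr : ∀ x t, (x, t) ∈ Omega T → ∀ i, E x t i = ∫ ξ in (0 : ℝ)..x,
      ((A ξ t).mulVec (E ξ t) i - ∫ τ in (0 : ℝ)..t, (At ξ τ).mulVec (E ξ τ) i) := by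
    intro x t hp i
    obtain ⟨hx0, ht⟩ : 0 ≤ x ∧ t ∈ Ico 0 T := mem_Omega.1 hp
    have hT0 : (0 : ℝ) ∈ Ico 0 T := ⟨le_rfl, ht.1.trans_lt ht.2⟩
    have s1 : ∀ τ ∈ Ico 0 T, (B x τ).mulVec (φ x τ) i = (B 0 τ).mulVec (φ 0 τ) i +
        ∫ ξ in (0 : ℝ)..x, ((At ξ τ).mulVec (φ ξ τ) i
          + (A ξ τ).mulVec ((B ξ τ).mulVec (φ ξ τ)) i) := by
      intro τ hτ
      have hd : ∀ ξ ∈ Ici (0 : ℝ), HasDerivWithinAt (fun y => (B y τ).mulVec (φ y τ) i)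
          ((At ξ τ).mulVec (φ ξ τ) i + (A ξ τ).mulVec ((B ξ τ).mulVec (φ ξ τ)) i) (Ici 0) ξ := by
        intro ξ hξ
        have hm : (ξ, τ) ∈ Omega T := mem_Omega.2 ⟨hξ, hτ⟩
        refine (hasDerivWithinAt_mulVec (M' := fun y => Bx y τ)
          (v' := fun y => (A y τ).mulVec (φ y τ)) (hBx ξ τ hm) (hx ξ τ hm) i).congr_deriv ?_
        have hz := congrFun (congrArg (fun N => N.mulVec (φ ξ τ)) (hzero ξ τ hm)) i
        simpa only [Matrix.add_mulVec, Matrix.mulVec_mulVec, Pi.add_apply] using hz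
      rw [isRay_Ici.integral_eq_sub hd (continuousOn_slice_x ((cAtφ i).add (cABφ i)) hτ)
        (mem_Ici.2 hx0)]
      ring
    have s2 : ∫ τ in (0 : ℝ)..t, (B 0 τ).mulVec (φ 0 τ) i = φ 0 t i - φ 0 0 i :=
      (isRay_Ico T).integral_eq_sub (fun τ hτ => h0 τ hτ i)
        (continuousOn_slice_t (cBφ i) le_rfl) ht
    have s4 : ∀ ξ, 0 ≤ ξ → ∫ τ in (0 : ℝ)..t, ((At ξ τ).mulVec (φ ξ τ) i
          + (A ξ τ).mulVec ((B ξ τ).mulVec (φ ξ τ)) i) =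
        (A ξ t).mulVec (Δ ξ t) i - (A ξ 0).mulVec (φ ξ 0) i
          + ∫ τ in (0 : ℝ)..t, (At ξ τ).mulVec (E ξ τ) i := by
      intro ξ hξ
      have hd : ∀ τ ∈ Ico 0 T, HasDerivWithinAt (fun s => (A ξ s).mulVec (Δ ξ s) i)
          ((At ξ τ).mulVec (Δ ξ τ) i + (A ξ τ).mulVec ((B ξ τ).mulVec (φ ξ τ)) i) (Ico 0 T) τ :=
        fun τ hτ => hasDerivWithinAt_mulVec (M' := fun s => At ξ s)
          (v' := fun s => (B ξ s).mulVec (φ ξ s)) (hAt ξ τ (mem_Omega.2 ⟨hξ, hτ⟩))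
          (hΔt ξ hξ τ hτ) i
      have e1 := (isRay_Ico T).integral_eq_sub hd
        (continuousOn_slice_t ((cAtΔ i).add (cABφ i)) hξ) ht
      have e2 : Δ ξ 0 = φ ξ 0 := by funext i; simp [hΔ]
      rw [e2] at e1
      rw [← e1, ← intervalIntegral.integral_add]
      · refine intervalIntegral.integral_congr fun τ _ => ?_
        have : φ ξ τ = Δ ξ τ + E ξ τ := by funext i; simp [hEdef]
        have e3 : (At ξ τ).mulVec (φ ξ τ) i = (At ξ τ).mulVec (Δ ξ τ) i
            + (At ξ τ).mulVec (E ξ τ) i := by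
          conv_lhs => rw [this, Matrix.mulVec_add]
          rfl
        rw [e3]
        ring
      · refine ContinuousOn.intervalIntegrable ?_
        rw [uIcc_of_le ht.1]
        exact (continuousOn_slice_t ((cAtΔ i).add (cABφ i)) hξ).mono
          ((isRay_Ico T).Icc_subset ht)
      · refine ContinuousOn.intervalIntegrable ?_
        rw [uIcc_of_le ht.1]
        exact (continuousOn_slice_t (cAtE i) hξ).mono ((isRay_Ico T).Icc_subset ht)
    have s5 : ∀ t ∈ Ico 0 T, ∫ ξ in (0 : ℝ)..x, (A ξ t).mulVec (φ ξ t) i = φ x t i - φ 0 t i :=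
      fun t ht => isRay_Ici.integral_eq_sub
        (fun ξ hξ => hx ξ t (mem_Omega.2 ⟨hξ, ht⟩) i) (continuousOn_slice_x (cAφ i) ht)
        (mem_Ici.2 hx0)
    have ii : ∀ {G : ℝ × ℝ → ℂ}, ContinuousOn G (Omega T) → ∀ t ∈ Ico 0 T,
        IntervalIntegrable (fun ξ => G (ξ, t)) volume 0 x := by
      intro G hG t ht
      refine ContinuousOn.intervalIntegrable ?_
      rw [uIcc_of_le hx0]
      exact (continuousOn_slice_x hG ht).mono fun y hy => hy.1
    have s6 : ∫ τ in (0 : ℝ)..t, (B x τ).mulVec (φ x τ) i = φ 0 t i - φ 0 0 i +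
        ∫ ξ in (0 : ℝ)..x, ((A ξ t).mulVec (Δ ξ t) i - (A ξ 0).mulVec (φ ξ 0) i
          + ∫ τ in (0 : ℝ)..t, (At ξ τ).mulVec (E ξ τ) i) := by
      rw [← s2]
      have e1 : ∫ τ in (0 : ℝ)..t, (B x τ).mulVec (φ x τ) i = ∫ τ in (0 : ℝ)..t,
          ((B 0 τ).mulVec (φ 0 τ) i + ∫ ξ in (0 : ℝ)..x, ((At ξ τ).mulVec (φ ξ τ) i
          + (A ξ τ).mulVec ((B ξ τ).mulVec (φ ξ τ)) i)) := by
        refine intervalIntegral.integral_congr fun τ hτ => ?_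
        rw [uIcc_of_le ht.1] at hτ
        exact s1 τ ⟨hτ.1, hτ.2.trans_lt ht.2⟩
      have c1 : IntervalIntegrable (fun τ => (B 0 τ).mulVec (φ 0 τ) i) volume 0 t := by
        refine ContinuousOn.intervalIntegrable ?_
        rw [uIcc_of_le ht.1]
        exact (continuousOn_slice_t (cBφ i) le_rfl).mono ((isRay_Ico T).Icc_subset ht)
      have c2 : IntervalIntegrable (fun τ => (B x τ).mulVec (φ x τ) i) volume 0 t := by
        refine ContinuousOn.intervalIntegrable ?_
        rw [uIcc_of_le ht.1]
        exact (continuousOn_slice_t (cBφ i) hx0).mono ((isRay_Ico T).Icc_subset ht)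
      rw [e1, intervalIntegral.integral_add c1]
      · rw [integral_swap (F := fun p => (At p.1 p.2).mulVec (φ p.1 p.2) i
          + (A p.1 p.2).mulVec ((B p.1 p.2).mulVec (φ p.1 p.2)) i)
          ((cAtφ i).add (cABφ i)) hx0 ht]
        congr 1
        refine intervalIntegral.integral_congr fun ξ hξ => ?_
        rw [uIcc_of_le hx0] at hξ
        exact s4 ξ hξ.1
      · refine (c2.sub c1).congr fun τ hτ => ?_
        rw [uIoc_of_le ht.1] at hτ
        simp only [s1 τ ⟨hτ.1.le, hτ.2.trans_lt ht.2⟩]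
        ring
    have c3 := ii (continuousOn_primitive (cAtE i)) t ht
    have c4 := ii (cAΔ i) t ht
    have c5 := ii (cAφ i) 0 hT0
    have c6 := ii (cAφ i) t ht
    have e7 : ∫ ξ in (0 : ℝ)..x, ((A ξ t).mulVec (E ξ t) i
        - ∫ τ in (0 : ℝ)..t, (At ξ τ).mulVec (E ξ τ) i) =
        ∫ ξ in (0 : ℝ)..x, (((A ξ t).mulVec (φ ξ t) i - (A ξ 0).mulVec (φ ξ 0) i)
          - ((A ξ t).mulVec (Δ ξ t) i - (A ξ 0).mulVec (φ ξ 0) i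
          + ∫ τ in (0 : ℝ)..t, (At ξ τ).mulVec (E ξ τ) i)) := by
      refine intervalIntegral.integral_congr fun ξ _ => ?_
      have : E ξ t = φ ξ t - Δ ξ t := rfl
      have e3 : (A ξ t).mulVec (E ξ t) i = (A ξ t).mulVec (φ ξ t) i - (A ξ t).mulVec (Δ ξ t) i := by
        rw [this, Matrix.mulVec_sub]
        rfl
      rw [e3]
      ring
    rw [e7, intervalIntegral.integral_sub (c6.sub c5) ((c4.sub c5).add c3),
      intervalIntegral.integral_sub c6 c5, s5 t ht, s5 0 hT0]
    change φ x t i - (φ x 0 i + ∫ τ in (0 : ℝ)..t, (B x τ).mulVec (φ x τ) i) = _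
    rw [s6]
    ring
  have hE0 : ∀ x t, (x, t) ∈ Omega T → ∀ i, E x t i = 0 := by
    intro X t₀ hp i
    obtain ⟨hX, ht₀⟩ : 0 ≤ X ∧ t₀ ∈ Ico 0 T := mem_Omega.1 hp
    have hK : IsCompact (Icc 0 X ×ˢ Icc 0 t₀) := isCompact_Icc.prod isCompact_Icc
    have hsub := rect_subset_Omega (X := X) ht₀.2
    have bd : ∀ {G : ℝ × ℝ → ℂ}, ContinuousOn G (Omega T) →
        ∃ C, ∀ p ∈ Icc 0 X ×ˢ Icc 0 t₀, ‖G p‖ ≤ C := fun hG =>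
      hK.exists_bound_of_continuousOn (hG.mono hsub)
    choose cM hcM using fun i => bd (cE i)
    choose cα hcα using fun i i' => bd (cA i i')
    choose cβ hcβ using fun i i' => bd (cAt i i')
    have hz : ((0 : ℝ), (0 : ℝ)) ∈ Icc 0 X ×ˢ Icc 0 t₀ := ⟨⟨le_rfl, hX⟩, ⟨le_rfl, ht₀.1⟩⟩
    have pα : ∀ i i', 0 ≤ cα i i' := fun i i' => (norm_nonneg _).trans (hcα i i' _ hz)
    have pβ : ∀ i i', 0 ≤ cβ i i' := fun i i' => (norm_nonneg _).trans (hcβ i i' _ hz)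
    have pM : ∀ i, 0 ≤ cM i := fun i => (norm_nonneg _).trans (hcM i _ hz)
    set α := ∑ i, ∑ i', cα i i' with hα
    set β := ∑ i, ∑ i', cβ i i' with hβ
    have pα' : 0 ≤ α := Finset.sum_nonneg fun i _ => Finset.sum_nonneg fun i' _ => pα i i'
    have pβ' : 0 ≤ β := Finset.sum_nonneg fun i _ => Finset.sum_nonneg fun i' _ => pβ i i'
    have lα : ∀ i i', cα i i' ≤ α := fun i i' =>
      (Finset.single_le_sum (f := fun i' => cα i i') (fun i' _ => pα i i')
        (Finset.mem_univ i')).trans (Finset.single_le_sum (f := fun i => ∑ i', cα i i')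
          (fun i _ => Finset.sum_nonneg fun i' _ => pα i i') (Finset.mem_univ i))
    have lβ : ∀ i i', cβ i i' ≤ β := fun i i' =>
      (Finset.single_le_sum (f := fun i' => cβ i i') (fun i' _ => pβ i i')
        (Finset.mem_univ i')).trans (Finset.single_le_sum (f := fun i => ∑ i', cβ i i')
          (fun i _ => Finset.sum_nonneg fun i' _ => pβ i i') (Finset.mem_univ i))
    -- Here α and β bound the entries of A and of its t-derivative on the rectangle, 3 counts the
    -- summands of a matrix–vector product, and t₀ bounds the length of the inner integral.
    refine eq_zero_of_volterra (E := E) (X := X) (t₀ := t₀) (C := 3 * α + 3 * β * t₀)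
      (M := ∑ i, cM i) (fun x hx t ht i => ?_)
      (fun b hb hbE x hx t ht i => ?_) ⟨hX, le_rfl⟩ ⟨ht₀.1, le_rfl⟩ i
    · exact (hcM i (x, t) ⟨hx, ht⟩).trans
        (Finset.single_le_sum (f := cM) (fun i _ => pM i) (Finset.mem_univ i))
    · rw [repr x t (hsub ⟨hx, ht⟩) i]
      refine intervalIntegral.norm_integral_le_of_norm_le hx.1
        (Eventually.of_forall fun ξ hξ => ?_)
        ((continuous_const.mul hb).intervalIntegrable _ _)
      have hξ' : ξ ∈ Icc 0 X := ⟨hξ.1.le, hξ.2.trans hx.2⟩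
      have b0 : 0 ≤ b ξ := (norm_nonneg _).trans (hbE ξ hξ' t ht 0)
      refine (norm_sub_le _ _).trans ?_
      have n1 : ‖(A ξ t).mulVec (E ξ t) i‖ ≤ 3 * (α * b ξ) :=
        norm_mulVec_le (fun i i' => (hcα i i' (ξ, t) ⟨hξ', ht⟩).trans (lα i i'))
          (fun i => hbE ξ hξ' t ht i) i
      have n2 : ‖∫ τ in (0 : ℝ)..t, (At ξ τ).mulVec (E ξ τ) i‖ ≤ 3 * (β * b ξ) * |t - 0| := by
        refine intervalIntegral.norm_integral_le_of_norm_le_const fun τ hτ => ?_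
        rw [uIoc_of_le ht.1] at hτ
        have hτ' : τ ∈ Icc 0 t₀ := ⟨hτ.1.le, hτ.2.trans ht.2⟩
        exact norm_mulVec_le (fun i i' => (hcβ i i' (ξ, τ) ⟨hξ', hτ'⟩).trans (lβ i i'))
          (fun i => hbE ξ hξ' τ hτ' i) i
      rw [sub_zero, abs_of_nonneg ht.1] at n2
      have n3 : 3 * (β * b ξ) * t ≤ 3 * (β * b ξ) * t₀ :=
        mul_le_mul_of_nonneg_left ht.2 (by positivity)
      linarith
  obtain ⟨hx0, ht⟩ : 0 ≤ x ∧ t ∈ Ico 0 T := mem_Omega.1 hp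
  refine (hΔt x hx0 t ht i).congr (fun s hs => ?_) ?_
  · exact sub_eq_zero.1 (hE0 x s (mem_Omega.2 ⟨hx0, hs⟩) i)
  · exact sub_eq_zero.1 (hE0 x t hp i)

/-! ### Zero curvature -/

variable {T : ℝ} {u : ℝ → ℝ → ℝ} {h : ℝ → ℝ} {k : ℂ} {n : Fin 18} {j : Fin 3}

lemma hasDerivWithinAt_conj {I : Set ℝ} {x : ℝ} (N N' : Matrix (Fin 3) (Fin 3) ℂ)
    {M : ℝ → Matrix (Fin 3) (Fin 3) ℂ} {M' : Matrix (Fin 3) (Fin 3) ℂ}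
    (hM : ∀ i i', HasDerivWithinAt (fun y => M y i i') (M' i i') I x) (i i' : Fin 3) :
    HasDerivWithinAt (fun y => (N * M y * N') i i') ((N * M' * N') i i') I x := by
  simp only [Matrix.mul_apply]
  exact HasDerivWithinAt.fun_sum fun a _ =>
    (HasDerivWithinAt.fun_sum fun b _ => (hM b a).const_mul (N i b)).mul_const (N' a i')

lemma continuousOn_conj {S : Set (ℝ × ℝ)} (N N' : Matrix (Fin 3) (Fin 3) ℂ)
    {M : ℝ × ℝ → Matrix (Fin 3) (Fin 3) ℂ} (hM : ∀ i i', ContinuousOn (fun p => M p i i') S)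
    (i i' : Fin 3) : ContinuousOn (fun p => (N * M p * N') i i') S := by
  simp only [Matrix.mul_apply]
  exact continuousOn_finsetSum _ fun a _ =>
    (continuousOn_finsetSum _ fun b _ => continuousOn_const.mul (hM b a)).mul continuousOn_const

/-- The companion matrix of the `x`-equation, shifted by `c`. -/
def laxX (μ c q : ℂ) : Matrix (Fin 3) (Fin 3) ℂ := !![-c, 1, 0; 0, -c, 1; μ * q, 1, -c]

/-- The matrix of the `t`-equation, shifted by `d`. -/
def laxT (μ d v v' q : ℂ) : Matrix (Fin 3) (Fin 3) ℂ :=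
  !![v' - 2 / (3 * μ) - d, -v, 1 / μ; 1 + v, 1 / (3 * μ) - d, -v;
    v' - μ * v * q, 1, 1 / (3 * μ) - v' - d]

/-- The derivative of the matrix of the `t`-equation in `x`. -/
def laxTx (μ v v' v'' q q' : ℂ) : Matrix (Fin 3) (Fin 3) ℂ :=
  !![v'', -v', 0; v', 0, -v'; v'' - μ * v' * q - μ * v * q', 0, -v'']

/-- The derivative of the matrix of the `x`-equation in `t`. -/
def laxXt (μ r : ℂ) : Matrix (Fin 3) (Fin 3) ℂ := !![0, 0, 0; 0, 0, 0; μ * r, 0, 0]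

/-- The scalar shifts c and d commute with everything. The time derivative r occurs only in the
lower left entry, where the identity becomes the equation r + v q' + 3 v' q = 0 with q = v - v'' +
1. -/
lemma lax_zero_curvature {μ c d v v' v'' q' r : ℂ} (hμ : μ ≠ 0)
    (heq : r + v * q' + 3 * v' * (v - v'' + 1) = 0) :
    laxTx μ v v' v'' (v - v'' + 1) q' + laxT μ d v v' (v - v'' + 1) * laxX μ c (v - v'' + 1) =
      laxXt μ r + laxX μ c (v - v'' + 1) * laxT μ d v v' (v - v'' + 1) := by
  have hr : r = -(v * q' + 3 * v' * (v - v'' + 1)) := by linear_combination heq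
  subst hr
  ext a b
  fin_cases a <;> fin_cases b <;>
    simp [laxTx, laxT, laxX, laxXt] <;> field_simp <;> ring

/-- The columns (1, l, l²) of `P k` are eigenvectors of the companion matrix, by the cubic equation
for l. -/
lemma diagonal_lDiff (hk : k ≠ 0) (hk6 : k ^ 6 ≠ 1) (j : Fin 3) :
    Matrix.diagonal (lDiff k j) = (P k)⁻¹ * laxX (lam k) (l k j) 1 * P k := by
  have h1 : P k * Matrix.diagonal (lDiff k j) = laxX (lam k) (l k j) 1 * P k := by
    ext a b
    rw [Matrix.mul_diagonal]
    have := l_cube hk b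
    fin_cases a <;> simp [laxX, Matrix.mul_apply, Fin.sum_univ_three, P, lDiff] <;>
      first | linear_combination this | ring
  rw [Matrix.mul_assoc, ← h1, ← Matrix.mul_assoc, P_inv_mul hk hk6, Matrix.one_mul]

/-- The same vectors are eigenvectors of the t-matrix with zero potential. In components this is z λ
= l² - 2/3 together with l z = 1 + l / (3 λ). -/
lemma diagonal_zDiff (hk : k ≠ 0) (hk6 : k ^ 6 ≠ 1) (hK : k ^ 6 ≠ -1) (j : Fin 3) :
    Matrix.diagonal (zDiff k j) = (P k)⁻¹ * laxT (lam k) (z k j) 0 0 1 * P k := by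
  have hlam : lam k ≠ 0 := fun h => hK ((lam_eq_zero_iff hk).1 h)
  have h1 : P k * Matrix.diagonal (zDiff k j) = laxT (lam k) (z k j) 0 0 1 * P k := by
    ext a b
    rw [Matrix.mul_diagonal]
    have h3 := l_cube hk b
    have hz : z k b = (l k b ^ 2 - 2 / 3) / lam k := by
      rw [eq_div_iff hlam, z_mul_lam hk hK]
    have h4 : l k b * z k b = 1 + l k b / (3 * lam k) := by
      rw [hz]
      field_simp
      linear_combination 3 * h3
    fin_cases a <;> simp [laxT, Matrix.mul_apply, Fin.sum_univ_three, P, zDiff]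
    · rw [hz]; field_simp; ring
    · rw [mul_sub, h4]; field_simp; ring
    · rw [mul_sub, pow_two, mul_assoc, h4]; field_simp; ring
  rw [Matrix.mul_assoc, ← h1, ← Matrix.mul_assoc, P_inv_mul hk hk6, Matrix.one_mul]

lemma diagonal_add_V₁ (hk : k ≠ 0) (hk6 : k ^ 6 ≠ 1) (u : ℝ → ℝ → ℝ) (j : Fin 3) (x t : ℝ) :
    Matrix.diagonal (lDiff k j) + V₁ u k x t =
      (P k)⁻¹ * laxX (lam k) (l k j) (u x t - dx (dx u) x t + 1) * P k := by
  rw [diagonal_lDiff hk hk6, V₁, ← Matrix.add_mul, ← Matrix.mul_add]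
  congr 2
  ext a b
  fin_cases a <;> fin_cases b <;> simp [laxX, qCubed]
  ring

lemma diagonal_add_V₂ (hk : k ≠ 0) (hk6 : k ^ 6 ≠ 1) (hK : k ^ 6 ≠ -1) (u : ℝ → ℝ → ℝ)
    (j : Fin 3) (x t : ℝ) :
    Matrix.diagonal (zDiff k j) + V₂ u k x t =
      (P k)⁻¹ * laxT (lam k) (z k j) (u x t) (dx u x t) (u x t - dx (dx u) x t + 1) * P k := by
  rw [diagonal_zDiff hk hk6 hK, V₂, ← Matrix.add_mul, ← Matrix.mul_add]
  congr 2
  ext a b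
  fin_cases a <;> fin_cases b <;> simp [laxT, qCubed] <;> ring

lemma conj_mul_conj (hk : k ≠ 0) (hk6 : k ^ 6 ≠ 1) (M N : Matrix (Fin 3) (Fin 3) ℂ) :
    ((P k)⁻¹ * M * P k) * ((P k)⁻¹ * N * P k) = (P k)⁻¹ * (M * N) * P k := by
  have h := P_mul_inv hk hk6
  calc _ = (P k)⁻¹ * M * (P k * (P k)⁻¹) * N * P k := by simp only [Matrix.mul_assoc]
    _ = _ := by rw [h]; simp only [Matrix.mul_assoc, Matrix.one_mul]

/-- A solution of the `x`-equation that solves the `t`-equation at `x = 0` solves it everywhere. -/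
theorem IsSolution.t_ode (hu : IsSolution T u) (hF : Field T u h) (hk : Regular n k)
    {φ : ℝ → ℝ → Fin 3 → ℂ} (cφ : ∀ i, ContinuousOn (fun p : ℝ × ℝ => φ p.1 p.2 i) (Omega T))
    (hx : ∀ t ∈ Ico 0 T, RowODE (Ici 0) (lDiff k j) (fun x => V₁ u k x t) (fun x => φ x t))
    (h0 : RowODE (Ico 0 T) (zDiff k j) (fun t => V₂ u k 0 t) (fun t => φ 0 t)) {x : ℝ}
    (hx0 : 0 ≤ x) :
    RowODE (Ico 0 T) (zDiff k j) (fun t => V₂ u k x t) (fun t => φ x t) := by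
  obtain ⟨hk0, hk6, hK⟩ := And.intro hk.ne_zero (And.intro hk.pow_six hk.pow_six')
  have hlam : lam k ≠ 0 := fun h => hK ((lam_eq_zero_iff hk0).1 h)
  obtain ⟨d2, d1⟩ := hu.contDiffOn_dx_dx
  have f0 : DifferentiableOn ℝ (fun p : ℝ × ℝ => u p.1 p.2) (Omega T) :=
    hu.smooth.differentiableOn (by norm_num)
  have f1 : DifferentiableOn ℝ (fun p : ℝ × ℝ => dx u p.1 p.2) (Omega T) :=
    d2.differentiableOn (by norm_num)
  have f2 : DifferentiableOn ℝ (fun p : ℝ × ℝ => dx (dx u) p.1 p.2) (Omega T) :=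
    d1.differentiableOn (by norm_num)
  have g1 : ContinuousOn (fun p : ℝ × ℝ => dt T u p.1 p.2) (Omega T) :=
    (contDiffOn_dt (m := 0) (hu.smooth.of_le (by norm_num))).continuousOn
  have g2 : ContinuousOn (fun p : ℝ × ℝ => dt T (dx (dx u)) p.1 p.2) (Omega T) :=
    (contDiffOn_dt (m := 0) (d1.of_le (by norm_num))).continuousOn
  have mv : ∀ (d : Fin 3 → ℂ) (V : Matrix (Fin 3) (Fin 3) ℂ) (v : Fin 3 → ℂ) (i : Fin 3),
      (Matrix.diagonal d + V).mulVec v i = d i * v i + ∑ i', V i i' * v i' := by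
    intro d V v i
    rw [Matrix.add_mulVec, Pi.add_apply, Matrix.mulVec_diagonal]
    rfl
  intro t ht i
  have hp : (x, t) ∈ Omega T := mem_Omega.2 ⟨hx0, ht⟩
  have key := compatibility (T := T) (φ := φ)
    (A := fun x t => Matrix.diagonal (lDiff k j) + V₁ u k x t)
    (B := fun x t => Matrix.diagonal (zDiff k j) + V₂ u k x t)
    (At := fun x t => (P k)⁻¹ * laxXt (lam k) (dt T u x t - dt T (dx (dx u)) x t) * P k)
    (Bx := fun x t => (P k)⁻¹ * laxTx (lam k) (u x t) (dx u x t) (dx (dx u) x t)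
      (u x t - dx (dx u) x t + 1) (dx u x t - dx (dx (dx u)) x t) * P k)
    ?_ ?_ ?_ ?_ ?_ ?_ cφ ?_ ?_ hp i
  · rw [mv] at key
    exact key
  · intro i i'
    exact continuousOn_const.add (hF.continuousOn_V₁ hk0 hk6 i i')
  · intro i i'
    exact continuousOn_const.add (hF.continuousOn_V₂ hk0 hk6 i i')
  · refine continuousOn_conj (M := fun p => laxXt (lam k) (dt T u p.1 p.2
      - dt T (dx (dx u)) p.1 p.2)) _ _ fun a b => ?_
    have c1 : ContinuousOn (fun p : ℝ × ℝ => ((dt T u p.1 p.2 : ℝ) : ℂ)) (Omega T) :=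
      Complex.continuous_ofReal.comp_continuousOn g1
    have c2 : ContinuousOn (fun p : ℝ × ℝ => ((dt T (dx (dx u)) p.1 p.2 : ℝ) : ℂ)) (Omega T) :=
      Complex.continuous_ofReal.comp_continuousOn g2
    fin_cases a <;> fin_cases b <;> simp [laxXt] <;> fun_prop
  · intro x t hp a b
    simp_rw [diagonal_add_V₁ hk0 hk6]
    refine hasDerivWithinAt_conj (M := fun s => laxX (lam k) (l k j)
      (u x s - dx (dx u) x s + 1)) _ _ (fun a b => ?_) a b
    have e1 := (hasDerivWithinAt_dt f0 hp).1.ofReal_comp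
    have e2 := (hasDerivWithinAt_dt f2 hp).1.ofReal_comp
    have e3 := (((e1.sub e2).add_const (1 : ℂ)).const_mul (lam k))
    fin_cases a <;> fin_cases b <;> simp [laxX, laxXt] <;>
      first | exact hasDerivWithinAt_const _ _ _ | exact e3
  · intro x t hp a b
    simp_rw [diagonal_add_V₂ hk0 hk6 hK]
    refine hasDerivWithinAt_conj (M := fun y => laxT (lam k) (z k j) (u y t) (dx u y t)
      (u y t - dx (dx u) y t + 1)) _ _ (fun a b => ?_) a b
    have e1 := (hasDerivWithinAt_dx f0 hp).1.ofReal_comp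
    have e2 := (hasDerivWithinAt_dx f1 hp).1.ofReal_comp
    have e3 := (hasDerivWithinAt_dx f2 hp).1.ofReal_comp
    have e4 := (e1.sub e3).add_const (1 : ℂ)
    have e5 := e2.sub ((e1.const_mul (lam k)).mul e4)
    fin_cases a <;> fin_cases b <;> simp [laxT, laxTx]
    · exact e2
    · exact e1.neg
    · exact hasDerivWithinAt_const _ _ _
    · exact e1
    · exact hasDerivWithinAt_const _ _ _
    · exact e1.neg
    · refine e5.congr_deriv ?_
      simp
      ring
    · exact hasDerivWithinAt_const _ _ _
    · exact e2.const_sub _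
  · intro x t hp
    rw [diagonal_add_V₁ hk0 hk6, diagonal_add_V₂ hk0 hk6 hK, conj_mul_conj hk0 hk6,
      conj_mul_conj hk0 hk6, ← Matrix.add_mul, ← Matrix.mul_add, ← Matrix.add_mul,
      ← Matrix.mul_add, lax_zero_curvature hlam]
    have := hu.equation x t hp
    have h2 : ((dt T u x t - dt T (dx (dx u)) x t + 3 * dx u x t + 4 * u x t * dx u x t
      - 3 * dx u x t * dx (dx u) x t - u x t * dx (dx (dx u)) x t : ℝ) : ℂ) = 0 := by
      rw [this]; simp
    push_cast at h2
    linear_combination h2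
  · intro x t hp i
    rw [mv]
    obtain ⟨a1, a2⟩ : 0 ≤ x ∧ t ∈ Ico 0 T := mem_Omega.1 hp
    exact hx t a2 x a1 i
  · intro t ht i
    rw [mv]
    exact h0 t ht i

/-! ### Existence of the columns -/

variable {T : ℝ} {u : ℝ → ℝ → ℝ} {h : ℝ → ℝ} {k : ℂ} {n : Fin 18} {j : Fin 3}

/-- The `j`-th column of the eigenfunction. -/
def colPhi (T : ℝ) (u : ℝ → ℝ → ℝ) (n : Fin 18) (k : ℂ) (j : Fin 3) (x t : ℝ) (i : Fin 3) : ℂ :=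
  ∑ c, propagator u k t j c x i * colY T u n k j (-t, c)

lemma Field.colPhi_zero (hF : Field T u h) (hk : k ≠ 0) (hk6 : k ^ 6 ≠ 1) {t : ℝ}
    (ht : t ∈ Ico 0 T) (i : Fin 3) : colPhi T u n k j 0 t i = colY T u n k j (-t, i) := by
  unfold colPhi
  simp [hF.propagator_zero hk hk6 ht]

lemma Field.colPhi_x_ode (hF : Field T u h) (hk : k ≠ 0) (hk6 : k ^ 6 ≠ 1) {t : ℝ}
    (ht : t ∈ Ico 0 T) :
    RowODE (Ici 0) (lDiff k j) (fun x => V₁ u k x t) (fun x => colPhi T u n k j x t) :=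
  RowODE.sum Finset.univ (fun c _ => hF.rowODE_propagator hk hk6 ht j c)
    (fun c => colY T u n k j (-t, c))

lemma Field.norm_lDiff_add_le (hF : Field T u h) (hk : k ≠ 0) (hk6 : k ^ 6 ≠ 1) {x t : ℝ}
    (hp : (x, t) ∈ Omega T) (i : Fin 3) :
    ‖lDiff k j i‖ + ∑ i', ‖V₁ u k x t i i'‖ ≤ expBound k j + 3 * (vConst (h 0) k * h 0) := by
  have h1 : ‖lDiff k j i‖ ≤ expBound k j :=
    Finset.single_le_sum (f := fun i => ‖lDiff k j i‖) (fun _ _ => norm_nonneg _)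
      (Finset.mem_univ i)
  have h2 : ∑ i', ‖V₁ u k x t i i'‖ ≤ ∑ _i' : Fin 3, vConst (h 0) k * h 0 :=
    Finset.sum_le_sum fun i' _ => (hF.norm_V₁_le hk hk6 hp i i').trans
      (mul_le_mul_of_nonneg_left (hF.h_le (mem_Omega.1 hp).1)
        (vConst_nonneg (hF.h_nonneg le_rfl) k))
  simp at h2
  linarith

lemma Field.norm_zDiff_add_le (hF : Field T u h) (hk : k ≠ 0) (hk6 : k ^ 6 ≠ 1) {x t : ℝ}
    (hp : (x, t) ∈ Omega T) (i : Fin 3) :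
    ‖zDiff k j i‖ + ∑ i', ‖V₂ u k x t i i'‖ ≤ zBound k j + 3 * (vConst (h 0) k * h 0) := by
  have h1 := norm_zDiff_le k j i
  have h2 : ∑ i', ‖V₂ u k x t i i'‖ ≤ ∑ _i' : Fin 3, vConst (h 0) k * h 0 :=
    Finset.sum_le_sum fun i' _ => (hF.norm_V₂_le hk hk6 hp i i').trans
      (mul_le_mul_of_nonneg_left (hF.h_le (mem_Omega.1 hp).1)
        (vConst_nonneg (hF.h_nonneg le_rfl) k))
  simp at h2
  linarith

/-- A family of solutions of the `x`-equation with continuous and bounded values at `x = 0` that is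
continuous in `t` is jointly continuous. -/
lemma Field.continuousOn_of_x_ode (hF : Field T u h) (hk : k ≠ 0) (hk6 : k ^ 6 ≠ 1)
    {φ : ℝ → ℝ → Fin 3 → ℂ}
    (hx : ∀ t ∈ Ico 0 T, RowODE (Ici 0) (lDiff k j) (fun x => V₁ u k x t) (fun x => φ x t))
    {C : ℝ} (hC : ∀ t ∈ Ico 0 T, ∀ i, ‖φ 0 t i‖ ≤ C)
    (ht : ∀ x, 0 ≤ x → ∀ i, ContinuousOn (fun t => φ x t i) (Ico 0 T)) (i : Fin 3) :
    ContinuousOn (fun p : ℝ × ℝ => φ p.1 p.2 i) (Omega T) := by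
  have hC0 : 0 ≤ C := (norm_nonneg _).trans (hC 0 ⟨le_rfl, hF.pos⟩ 0)
  set α := expBound k j + 3 * (vConst (h 0) k * h 0) with hα
  have hα0 : 0 ≤ α := le_trans (by positivity)
    (hF.norm_lDiff_add_le (j := j) hk hk6 (mem_Omega.2 ⟨le_rfl, le_rfl, hF.pos⟩) 0)
  have hrect : ∀ X, ContinuousOn (fun p : ℝ × ℝ => φ p.1 p.2 i) (Icc 0 X ×ˢ Ico 0 T) := by
    intro X
    have hbd : ∀ x ∈ Icc 0 X, ∀ t ∈ Ico 0 T, ‖φ x t‖ ≤ C * Real.exp (α * X) := by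
      intro x hxX t ht
      have h1 := (hx t ht).norm_le isRay_Ici (α := α) (x := x) hxX.1 fun y hy i =>
        hF.norm_lDiff_add_le hk hk6 (mem_Omega.2 ⟨hy.1, ht⟩) i
      refine h1.trans (mul_le_mul ?_ ?_ (by positivity) hC0)
      · exact (pi_norm_le_iff_of_nonneg hC0).2 fun i => hC t ht i
      · exact Real.exp_le_exp.2 (mul_le_mul_of_nonneg_left hxX.2 hα0)
    -- Separate continuity in t and a Lipschitz bound in x that is uniform in t give joint
    -- continuity. The uniformity comes from Grönwall's inequality with the global bound on V₁.
    refine continuousOn_prod_of_continuousOn_lipschitzOnWith (fun p : ℝ × ℝ => φ p.1 p.2 i)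
      (Real.toNNReal (α * (C * Real.exp (α * X)))) (fun x hx => ht x hx.1 i) fun t ht => ?_
    refine (convex_Icc 0 X).lipschitzOnWith_of_nnnorm_hasDerivWithin_le
      (fun x hxX => ((hx t ht) x hxX.1 i).mono fun y hy => hy.1) fun x hxX => ?_
    rw [← NNReal.coe_le_coe, Real.coe_toNNReal _ (by positivity), coe_nnnorm]
    have h2 := hbd x hxX t ht
    have h3 := hF.norm_lDiff_add_le (j := j) hk hk6 (mem_Omega.2 ⟨hxX.1, ht⟩) i
    refine (norm_add_le _ _).trans ?_
    have h4 : ‖∑ i', V₁ u k x t i i' * φ x t i'‖ ≤ (∑ i', ‖V₁ u k x t i i'‖) * ‖φ x t‖ := by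
      rw [Finset.sum_mul]
      refine (norm_sum_le _ _).trans (Finset.sum_le_sum fun i' _ => ?_)
      rw [norm_mul]
      exact mul_le_mul_of_nonneg_left (norm_le_pi_norm _ _) (norm_nonneg _)
    have h5 : ‖lDiff k j i * φ x t i‖ ≤ ‖lDiff k j i‖ * ‖φ x t‖ := by
      rw [norm_mul]
      exact mul_le_mul_of_nonneg_left (norm_le_pi_norm _ _) (norm_nonneg _)
    calc _ ≤ (‖lDiff k j i‖ + ∑ i', ‖V₁ u k x t i i'‖) * ‖φ x t‖ := by linarith
      _ ≤ α * (C * Real.exp (α * X)) := mul_le_mul h3 h2 (norm_nonneg _) hα0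
  rintro ⟨x, t⟩ hp
  obtain ⟨hx0, ht⟩ : 0 ≤ x ∧ t ∈ Ico 0 T := mem_Omega.1 hp
  refine (hrect (x + 1) (x, t) ⟨⟨hx0, by linarith⟩, ht⟩).mono_of_mem_nhdsWithin ?_
  have : ∀ᶠ p : ℝ × ℝ in 𝓝[Omega T] (x, t), p.1 < x + 1 :=
    (continuous_fst.tendsto (x, t)).mono_left nhdsWithin_le_nhds |>.eventually_lt_const
      (lt_add_one x)
  filter_upwards [self_mem_nhdsWithin, this] with p hp hpx
  exact ⟨⟨hp.1, hpx.le⟩, hp.2⟩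

lemma norm_exp_neg_mul_le_one {a : ℂ} (ha : 0 ≤ a.re) {x : ℝ} (hx : 0 ≤ x) :
    ‖Complex.exp (-(a * x))‖ ≤ 1 := by
  rw [Complex.norm_exp, Real.exp_le_one_iff, Complex.neg_re, Complex.re_mul_ofReal]
  nlinarith

/-- Bounded solutions of the `t`-equation keep their asymptotic behavior as `x → ∞`. -/
lemma Field.tendsto_three (hF : Field T u h) (hk : Regular n k) {φ : ℝ → ℝ → Fin 3 → ℂ}
    (ht : ∀ x, 0 ≤ x → RowODE (Ico 0 T) (zDiff k j) (fun t => V₂ u k x t) (fun t => φ x t))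
    {C : ℝ} (hC : ∀ x t, (x, t) ∈ Omega T → ∀ i, ‖φ x t i‖ ≤ C) {i : Fin 3}
    (hi : contour n i j = Contour.three)
    (h0 : Tendsto (fun x : ℝ => Complex.exp (-(lDiff k j i * x)) * φ x 0 i) atTop
      (𝓝 (if i = j then 1 else 0))) {t : ℝ} (ht' : t ∈ Ico 0 T) :
    Tendsto (fun x : ℝ => Complex.exp (-(lDiff k j i * x)) * φ x t i) atTop
      (𝓝 (if i = j then 1 else 0)) := by
  have hv := vConst_nonneg (hF.h_nonneg le_rfl) k
  have hC0 : 0 ≤ C := (norm_nonneg _).trans (hC 0 0 (mem_Omega.2 ⟨le_rfl, le_rfl, hF.pos⟩) 0)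
  set G := Real.exp (zBound k j * T) * (3 * (vConst (h 0) k * C)) * T with hG
  -- Between times 0 and t the row changes, up to its exponential, by at most a multiple of h x,
  -- since V₂ is bounded by h and φ is bounded. This vanishes as x → ∞, and on contour three exp
  -- (-(l i - l j) x) stays bounded.
  have hdiff : ∀ x, 0 ≤ x → ‖Complex.exp (-(zDiff k j i * t)) * φ x t i - φ x 0 i‖ ≤ G * h x := by
    intro x hx
    have e := (ht x hx).ftc (isRay_Ico T)
      (continuousOn_V₂_zero hF hk.ne_zero hk.pow_six hx) le_rfl ht'.1 ht' i
    simp only [Complex.ofReal_zero, mul_zero, neg_zero, Complex.exp_zero, one_mul] at e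
    rw [← e]
    have hh := hF.h_nonneg hx
    have hb : ∀ τ ∈ uIoc 0 t, ‖Complex.exp (-(zDiff k j i * τ)) * ∑ i', V₂ u k x τ i i' * φ x τ i'‖
        ≤ Real.exp (zBound k j * T) * (3 * (vConst (h 0) k * h x * C)) := by
      intro τ hτ
      rw [uIoc_of_le ht'.1] at hτ
      have hm : (x, τ) ∈ Omega T := mem_Omega.2 ⟨hx, hτ.1.le, hτ.2.trans_lt ht'.2⟩
      rw [norm_mul]
      refine mul_le_mul ?_ ?_ (norm_nonneg _) (by positivity)
      · rw [Complex.norm_exp, Real.exp_le_exp, Complex.neg_re, Complex.re_mul_ofReal]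
        have h1 := (abs_le.1 (Complex.abs_re_le_norm (zDiff k j i))).1
        have h2 := norm_zDiff_le k j i
        have h3 : τ ≤ T := (hτ.2.trans_lt ht'.2).le
        have h4 : 0 ≤ zBound k j := (norm_nonneg _).trans h2
        nlinarith [hτ.1]
      · exact norm_mulVec_le (fun i i' => hF.norm_V₂_le hk.ne_zero hk.pow_six hm i i')
          (fun i => hC x τ hm i) i
    refine (intervalIntegral.norm_integral_le_of_norm_le_const hb).trans ?_
    rw [sub_zero, abs_of_nonneg ht'.1, hG]
    calc _ ≤ Real.exp (zBound k j * T) * (3 * (vConst (h 0) k * h x * C)) * T :=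
          mul_le_mul_of_nonneg_left ht'.2.le (by positivity)
      _ = _ := by ring
  have hlim : Tendsto (fun x : ℝ => Complex.exp (-(lDiff k j i * x)) *
      (Complex.exp (-(zDiff k j i * t)) * φ x t i - φ x 0 i)) atTop (𝓝 0) := by
    refine squeeze_zero_norm' (a := fun x => G * h x) ?_ (by simpa using hF.tendsto_h.const_mul G)
    filter_upwards [eventually_ge_atTop 0] with x hx
    rw [norm_mul]
    exact (mul_le_of_le_one_left (norm_nonneg _)
      (norm_exp_neg_mul_le_one (re_lDiff_nonneg hk.mem hk.ne_zero hi) hx)).trans (hdiff x hx)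
  have hsum := (hlim.add h0).const_mul (Complex.exp (zDiff k j i * t))
  have hval : Complex.exp (zDiff k j i * t) * (0 + if i = j then 1 else 0) =
      if i = j then 1 else 0 := by
    by_cases hij : i = j
    · subst hij; simp
    · simp [hij]
  rw [hval] at hsum
  refine hsum.congr fun x => ?_
  have e2 : Complex.exp (zDiff k j i * t) * Complex.exp (-(zDiff k j i * t)) = 1 := by
    rw [← Complex.exp_add]; simp
  linear_combination (Complex.exp (-(lDiff k j i * x)) * φ x t i) * e2

/-- Off the zeros of the determinant the column exists. -/
theorem IsSolution.colSol (hu : IsSolution T u) (hF : Field T u h) (hk : Regular n k)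
    (hd : colDet T u n k j ≠ 0) : ColSol T u n k j (colPhi T u n k j) := by
  obtain ⟨⟨C, hC⟩, yx, yt, y1, y2, y3⟩ := hF.colY_spec hk hd
  have hT := hF.pos
  have hk0 := hk.ne_zero
  have hk6 := hk.pow_six
  have hx : ∀ t ∈ Ico 0 T, RowODE (Ici 0) (lDiff k j) (fun x => V₁ u k x t)
      (fun x => colPhi T u n k j x t) := fun t ht => hF.colPhi_x_ode hk0 hk6 ht
  have hz : ∀ t ∈ Ico 0 T, ∀ i, colPhi T u n k j 0 t i = colY T u n k j (-t, i) :=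
    fun t ht i => hF.colPhi_zero hk0 hk6 ht i
  have hx0 : ∀ x, 0 ≤ x → ∀ i, colPhi T u n k j x 0 i = colY T u n k j (x, i) := by
    intro x hx0 i
    refine (hx 0 ⟨le_rfl, hT⟩).unique yx isRay_Ici
      (continuousOn_V₁_zero hF hk0 hk6 ⟨le_rfl, hT⟩) (fun i => ?_) (mem_Ici.2 hx0) i
    rw [hz 0 ⟨le_rfl, hT⟩, neg_zero]
  have cφ : ∀ i, ContinuousOn (fun p : ℝ × ℝ => colPhi T u n k j p.1 p.2 i) (Omega T) := by
    refine hF.continuousOn_of_x_ode hk0 hk6 hx (C := C) (fun t ht i => ?_) fun x hx i => ?_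
    · rw [hz t ht]; exact hC _
    · unfold colPhi
      exact continuousOn_finsetSum _ fun c _ =>
        (hF.continuousOn_propagator_t hk0 hk6 j c x i).mul (yt.continuousOn c)
  have h0 : RowODE (Ico 0 T) (zDiff k j) (fun t => V₂ u k 0 t)
      (fun t => colPhi T u n k j 0 t) := by
    intro t ht i
    refine ((yt t ht i).congr (fun s hs => hz s hs i) (hz t ht i)).congr_deriv ?_
    simp only [hz t ht]
  have ht : ∀ x, 0 ≤ x → RowODE (Ico 0 T) (zDiff k j) (fun t => V₂ u k x t)
      (fun t => colPhi T u n k j x t) := fun x hx0 => hu.t_ode hF hk cφ hx h0 hx0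
  set α := zBound k j + 3 * (vConst (h 0) k * h 0) with hα
  have hα0 : 0 ≤ α := le_trans (by positivity)
    (hF.norm_zDiff_add_le (j := j) hk0 hk6 (mem_Omega.2 ⟨le_rfl, le_rfl, hF.pos⟩) 0)
  have hC0 : 0 ≤ C := (norm_nonneg _).trans (hC (0, 0))
  -- The propagator gives no bound uniform in x. The bound comes from the t-equation instead: the
  -- Fredholm solution is bounded on t = 0, and Grönwall's inequality on [0, T) has constants
  -- independent of x.
  have hbd : ∀ x t, (x, t) ∈ Omega T → ∀ i, ‖colPhi T u n k j x t i‖ ≤ C * Real.exp (α * T) := by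
    intro x t hp i
    obtain ⟨a1, a2⟩ : 0 ≤ x ∧ t ∈ Ico 0 T := mem_Omega.1 hp
    have h1 := (ht x a1).norm_le (isRay_Ico T) (α := α) a2 fun y hy i =>
      hF.norm_zDiff_add_le hk0 hk6 (mem_Omega.2 ⟨a1, hy.1, hy.2.trans_lt a2.2⟩) i
    refine (norm_le_pi_norm (colPhi T u n k j x t) i).trans (h1.trans ?_)
    refine mul_le_mul ?_ ?_ (by positivity) hC0
    · exact (pi_norm_le_iff_of_nonneg hC0).2 fun i => by rw [hx0 x a1]; exact hC _
    · exact Real.exp_le_exp.2 (mul_le_mul_of_nonneg_left a2.2.le hα0)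
  refine ⟨hx, ht, ⟨_, hbd⟩, fun i hi => ?_, fun i hi => ?_, fun i hi t ht' => ?_⟩
  · refine (y1 i hi).congr' ?_
    filter_upwards [Ioo_mem_nhdsLT hT] with t ht'
    exact (hz t ⟨ht'.1.le, ht'.2⟩ i).symm
  · rw [hx0 0 le_rfl, y2 i hi]
  · refine hF.tendsto_three hk ht hbd hi ((y3 i hi).congr' ?_) ht'
    filter_upwards [eventually_ge_atTop 0] with x hx
    rw [hx0 x hx]

/-! ### Eigenfunctions and their columns -/

variable {T : ℝ} {u : ℝ → ℝ → ℝ} {h : ℝ → ℝ} {k : ℂ} {n : Fin 18} {j : Fin 3}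
  {Φ : ℝ → ℝ → Matrix (Fin 3) (Fin 3) ℂ} {φ : ℝ → ℝ → Fin 3 → ℂ}

lemma bracket_apply (a : Fin 3 → ℂ) (M : Matrix (Fin 3) (Fin 3) ℂ) (i j : Fin 3) :
    bracket a M i j = (a i - a j) * M i j := by
  unfold bracket
  rw [Matrix.sub_apply, Matrix.diagonal_mul, Matrix.mul_diagonal]
  ring

lemma solvesLax_iff : SolvesLax T u k Φ ↔
    ∀ j, (∀ t ∈ Ico 0 T, RowODE (Ici 0) (lDiff k j) (fun x => V₁ u k x t) (fun x i => Φ x t i j)) ∧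
      (∀ x, 0 ≤ x → RowODE (Ico 0 T) (zDiff k j) (fun t => V₂ u k x t) (fun t i => Φ x t i j)) := by
  constructor
  · intro hΦ j
    refine ⟨fun t ht x hx i => ?_, fun x hx t ht i => ?_⟩
    · have := (hΦ x t (mem_Omega.2 ⟨hx, ht⟩) i j).1
      rwa [Matrix.add_apply, bracket_apply, Matrix.mul_apply] at this
    · have := (hΦ x t (mem_Omega.2 ⟨hx, ht⟩) i j).2
      rwa [Matrix.add_apply, bracket_apply, Matrix.mul_apply] at this
  · intro hΦ x t hp i j
    obtain ⟨hx, ht⟩ : 0 ≤ x ∧ t ∈ Ico 0 T := mem_Omega.1 hp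
    rw [Matrix.add_apply, bracket_apply, Matrix.mul_apply, Matrix.add_apply, bracket_apply,
      Matrix.mul_apply]
    exact ⟨(hΦ j).1 t ht x hx i, (hΦ j).2 x hx t ht i⟩

/-- The integrand of the `x`-integrals at `(x, t)`. -/
lemma conjEntry_x (M : Matrix (Fin 3) (Fin 3) ℂ) (x x' t : ℝ) (i j : Fin 3) :
    conjEntry k (x - x') (t - t) (M * Φ x' t) i j = Complex.exp (lDiff k j i * x) *
      (Complex.exp (-(lDiff k j i * x')) * ∑ i', M i i' * Φ x' t i' j) := by
  unfold conjEntry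
  rw [Matrix.mul_apply, ← mul_assoc, ← Complex.exp_add]
  congr 2
  unfold lDiff
  push_cast
  ring

/-- The integrand of the `t`-integrals at `(x, t)`. -/
lemma conjEntry_t (M : Matrix (Fin 3) (Fin 3) ℂ) (x t t' : ℝ) (i j : Fin 3) :
    conjEntry k (x - 0) (t - t') (M * Φ 0 t') i j = Complex.exp (lDiff k j i * x + zDiff k j i * t) *
      (Complex.exp (-(zDiff k j i * t')) * ∑ i', M i i' * Φ 0 t' i' j) := by
  unfold conjEntry
  rw [Matrix.mul_apply, ← mul_assoc, ← Complex.exp_add]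
  congr 2
  unfold lDiff zDiff
  push_cast
  ring

lemma exp_mul_exp_neg (w : ℂ) : Complex.exp w * Complex.exp (-w) = 1 := by
  rw [← Complex.exp_add]; simp

/-! #### From columns to eigenfunctions -/

lemma ColSol.integrableOn_x (hφ : ColSol T u n k j φ) (hF : Field T u h) (hk : Regular n k)
    {t : ℝ} (ht : t ∈ Ico 0 T) {i : Fin 3} (hi : contour n i j = Contour.three) :
    IntegrableOn (fun x : ℝ => Complex.exp (-(lDiff k j i * x)) * ∑ i', V₁ u k x t i i' * φ x t i')
      (Ioi 0) := by
  obtain ⟨C, hC⟩ := hφ.bdd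
  have hc := continuousOn_source (a := lDiff k j)
    (continuousOn_V₁_zero hF hk.ne_zero hk.pow_six ht) (hφ.x_ode t ht).continuousOn i
  refine Integrable.mono' (g := fun x => 3 * (vConst (h 0) k * h x * C)) ?_
    ((hc.mono Ioi_subset_Ici_self).aestronglyMeasurable measurableSet_Ioi) ?_
  · exact (((hF.int.mono_set Ioi_subset_Ici_self).const_mul _).mul_const _).const_mul _
  · filter_upwards [ae_restrict_mem measurableSet_Ioi] with x hx
    have hx0 : 0 ≤ x := le_of_lt hx
    have hm : (x, t) ∈ Omega T := mem_Omega.2 ⟨hx0, ht⟩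
    rw [norm_mul]
    exact (mul_le_of_le_one_left (norm_nonneg _)
      (norm_exp_neg_mul_le_one (re_lDiff_nonneg hk.mem hk.ne_zero hi) hx0)).trans
      (norm_mulVec_le (fun i i' => hF.norm_V₁_le hk.ne_zero hk.pow_six hm i i')
        (fun i => hC x t hm i) i)

lemma ColSol.integral_Ioi_x (hφ : ColSol T u n k j φ) (hF : Field T u h) (hk : Regular n k)
    {x t : ℝ} (hx : 0 ≤ x) (ht : t ∈ Ico 0 T) {i : Fin 3} (hi : contour n i j = Contour.three) :
    ∫ y in Ioi x, Complex.exp (-(lDiff k j i * y)) * ∑ i', V₁ u k y t i i' * φ y t i' =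
      (if i = j then 1 else 0) - Complex.exp (-(lDiff k j i * x)) * φ x t i := by
  refine integral_Ioi_of_hasDerivAt_of_tendsto (f := fun y : ℝ =>
    Complex.exp (-(lDiff k j i * y)) * φ y t i) ?_ (fun y hy => ?_)
    ((hφ.integrableOn_x hF hk ht hi).mono_set (Ioi_subset_Ioi hx)) (hφ.three i hi t ht)
  · exact (((hφ.x_ode t ht).hasDerivWithinAt_exp (mem_Ici.2 hx) i).continuousWithinAt).mono
      (Ici_subset_Ici.2 hx)
  · exact ((hφ.x_ode t ht).hasDerivWithinAt_exp (mem_Ici.2 (hx.trans (le_of_lt hy))) i).hasDerivAt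
      (Ici_mem_nhds (hx.trans_lt hy))

lemma Field.norm_source_t_le (hF : Field T u h) (hk : Regular n k) {C : ℝ}
    (hC : ∀ x t, (x, t) ∈ Omega T → ∀ i, ‖φ x t i‖ ≤ C) (i : Fin 3) {t : ℝ} (ht : t ∈ Ico 0 T) :
    ‖Complex.exp (-(zDiff k j i * t)) * ∑ i', V₂ u k 0 t i i' * φ 0 t i'‖ ≤
      Real.exp (zBound k j * T) * (3 * (vConst (h 0) k * h 0 * C)) := by
  have hm : ((0 : ℝ), t) ∈ Omega T := mem_Omega.2 ⟨le_rfl, ht⟩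
  rw [norm_mul]
  refine mul_le_mul ?_ ?_ (norm_nonneg _) (by positivity)
  · rw [Complex.norm_exp, Real.exp_le_exp, Complex.neg_re, Complex.re_mul_ofReal]
    have h1 := (abs_le.1 (Complex.abs_re_le_norm (zDiff k j i))).1
    have h2 := norm_zDiff_le k j i
    have h4 : 0 ≤ zBound k j := (norm_nonneg _).trans h2
    nlinarith [ht.1, ht.2]
  · exact norm_mulVec_le (fun i i' => hF.norm_V₂_le hk.ne_zero hk.pow_six hm i i')
      (fun i => hC 0 t hm i) i

lemma Field.intervalIntegrable_t (hF : Field T u h) (hk : Regular n k)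
    (hφt : RowODE (Ico 0 T) (zDiff k j) (fun t => V₂ u k 0 t) (fun t => φ 0 t)) {C : ℝ}
    (hC : ∀ x t, (x, t) ∈ Omega T → ∀ i, ‖φ x t i‖ ≤ C) (i : Fin 3) {t₀ t₁ : ℝ} (h0 : 0 ≤ t₀)
    (h01 : t₀ ≤ t₁) (h1 : t₁ ≤ T) :
    IntervalIntegrable (fun t : ℝ =>
      Complex.exp (-(zDiff k j i * t)) * ∑ i', V₂ u k 0 t i i' * φ 0 t i') volume t₀ t₁ := by
  rw [intervalIntegrable_iff_integrableOn_Ioo_of_le h01]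
  have hsub : Ioo t₀ t₁ ⊆ Ico 0 T := fun t ht => ⟨h0.trans ht.1.le, ht.2.trans_le h1⟩
  have hc := continuousOn_source (a := zDiff k j)
    (continuousOn_V₂_zero hF hk.ne_zero hk.pow_six le_rfl) hφt.continuousOn i
  refine Integrable.mono' (integrableOn_const (C := Real.exp (zBound k j * T) *
    (3 * (vConst (h 0) k * h 0 * C))) (by simp))
    ((hc.mono hsub).aestronglyMeasurable measurableSet_Ioo) ?_
  filter_upwards [ae_restrict_mem measurableSet_Ioo] with t ht
  exact hF.norm_source_t_le hk hC i (hsub ht)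

/-- The column has no value at t = T. The limit zero in `ColSol.one` plays that part, with the
integrand bounded up to T. -/
lemma ColSol.integral_one (hφ : ColSol T u n k j φ) (hF : Field T u h) (hk : Regular n k)
    {t : ℝ} (ht : t ∈ Ico 0 T) {i : Fin 3} (hi : contour n i j = Contour.one) :
    ∫ s in T..t, Complex.exp (-(zDiff k j i * s)) * ∑ i', V₂ u k 0 s i i' * φ 0 s i' =
      Complex.exp (-(zDiff k j i * t)) * φ 0 t i := by
  obtain ⟨C, hC⟩ := hφ.bdd
  have hode := hφ.t_ode 0 le_rfl
  have hfc : ∀ s ∈ Ico 0 T, HasDerivWithinAt (fun y : ℝ =>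
      Complex.exp (-(zDiff k j i * y)) * φ 0 y i) _ (Ico 0 T) s :=
    fun s hs => hode.hasDerivWithinAt_exp hs i
  rw [intervalIntegral.integral_symm]
  have key := intervalIntegral.integral_eq_sub_of_hasDerivAt_of_tendsto ht.2
    (f := fun y : ℝ => Complex.exp (-(zDiff k j i * y)) * φ 0 y i)
    (fa := Complex.exp (-(zDiff k j i * t)) * φ 0 t i) (fb := 0)
    (fun s hs => (hfc s ⟨ht.1.trans hs.1.le, hs.2⟩).hasDerivAt
      (Ico_mem_nhds (ht.1.trans_lt hs.1) hs.2))
    (hF.intervalIntegrable_t hk hode hC i ht.1 ht.2.le le_rfl) ?_ ?_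
  · rw [key]; simp
  · have h1 : Tendsto (fun y : ℝ => Complex.exp (-(zDiff k j i * y)) * φ 0 y i) (𝓝[Ioo t T] t)
        (𝓝 (Complex.exp (-(zDiff k j i * t)) * φ 0 t i)) :=
      ((hfc t ht).continuousWithinAt).mono fun s hs => ⟨ht.1.trans hs.1.le, hs.2⟩
    rwa [nhdsWithin_Ioo_eq_nhdsGT ht.2] at h1
  · have h1 : Tendsto (fun y : ℝ => Complex.exp (-(zDiff k j i * y))) (𝓝[<] T)
        (𝓝 (Complex.exp (-(zDiff k j i * T)))) := by
      have : Continuous fun t : ℝ => Complex.exp (-(zDiff k j i * t)) := by fun_prop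
      exact this.continuousAt.tendsto.mono_left nhdsWithin_le_nhds
    simpa using h1.mul (hφ.one i hi)

/-- A matrix whose columns have the right boundary values is an eigenfunction. -/
theorem isEigenfunction_of_colSol (hF : Field T u h) (hk : Regular n k)
    (hΦ : ∀ j, ColSol T u n k j (fun x t i => Φ x t i j)) : IsEigenfunction T u n k Φ := by
  have hxi : ∀ x t, (x, t) ∈ Omega T → ∀ i j, IntervalIntegrable (fun y : ℝ =>
      Complex.exp (-(lDiff k j i * y)) * ∑ i', V₁ u k y t i i' * Φ y t i' j) volume 0 x := by
    intro x t hp i j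
    obtain ⟨hx, ht⟩ : 0 ≤ x ∧ t ∈ Ico 0 T := mem_Omega.1 hp
    refine ContinuousOn.intervalIntegrable ?_
    rw [uIcc_of_le hx]
    exact (continuousOn_source (a := lDiff k j)
      (continuousOn_V₁_zero hF hk.ne_zero hk.pow_six ht)
      ((hΦ j).x_ode t ht).continuousOn i).mono fun y hy => hy.1
  have hftc : ∀ x t, (x, t) ∈ Omega T → ∀ i j, ∫ y in (0 : ℝ)..x,
      Complex.exp (-(lDiff k j i * y)) * ∑ i', V₁ u k y t i i' * Φ y t i' j =
      Complex.exp (-(lDiff k j i * x)) * Φ x t i j - Φ 0 t i j := by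
    intro x t hp i j
    obtain ⟨hx, ht⟩ : 0 ≤ x ∧ t ∈ Ico 0 T := mem_Omega.1 hp
    have := ((hΦ j).x_ode t ht).ftc isRay_Ici
      (continuousOn_V₁_zero hF hk.ne_zero hk.pow_six ht) le_rfl hx (mem_Ici.2 hx) i
    simpa using this
  refine ⟨solvesLax_iff.2 fun j => ⟨(hΦ j).x_ode, (hΦ j).t_ode⟩, ?_, ?_⟩
  · intro x t hp i j
    obtain ⟨hx, ht⟩ : 0 ≤ x ∧ t ∈ Ico 0 T := mem_Omega.1 hp
    obtain ⟨C, hC⟩ := (hΦ j).bdd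
    cases hc : contour n i j
    · simp only [LineIntegrable, conjEntry_x, conjEntry_t]
      exact ⟨((hF.intervalIntegrable_t hk ((hΦ j).t_ode 0 le_rfl) hC i ht.1 ht.2.le
        le_rfl).symm).const_mul _, (hxi x t hp i j).const_mul _⟩
    · simp only [LineIntegrable, conjEntry_x, conjEntry_t]
      exact ⟨(hF.intervalIntegrable_t hk ((hΦ j).t_ode 0 le_rfl) hC i le_rfl ht.1
        ht.2.le).const_mul _, (hxi x t hp i j).const_mul _⟩
    · simp only [LineIntegrable, conjEntry_x]
      exact (((hΦ j).integrableOn_x hF hk ht hc).mono_set (Ioi_subset_Ioi hx)).const_mul _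
  · intro x t hp i j
    obtain ⟨hx, ht⟩ : 0 ≤ x ∧ t ∈ Ico 0 T := mem_Omega.1 hp
    have ea := exp_mul_exp_neg (lDiff k j i * x)
    have eb := exp_mul_exp_neg (zDiff k j i * t)
    cases hc : contour n i j
    · have hij : i ≠ j := contour_ne_three_ne (n := n) (by simp [hc])
      simp only [lineIntegral, conjEntry_x, conjEntry_t]
      rw [intervalIntegral.integral_const_mul, intervalIntegral.integral_const_mul,
        hftc x t hp, (hΦ j).integral_one hF hk ht hc, Matrix.one_apply_ne hij, Complex.exp_add]
      linear_combination (-Φ x t i j) * ea - Complex.exp (lDiff k j i * x) * Φ 0 t i j * eb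
    · have hij : i ≠ j := contour_ne_three_ne (n := n) (by simp [hc])
      simp only [lineIntegral, conjEntry_x, conjEntry_t]
      have e2 := ((hΦ j).t_ode 0 le_rfl).ftc (isRay_Ico T)
        (continuousOn_V₂_zero hF hk.ne_zero hk.pow_six le_rfl) le_rfl ht.1 ht i
      have e3 := (hΦ j).two i hc
      rw [e3, mul_zero, sub_zero] at e2
      rw [intervalIntegral.integral_const_mul, intervalIntegral.integral_const_mul,
        hftc x t hp, e2, Matrix.one_apply_ne hij, Complex.exp_add]
      linear_combination (-Φ x t i j) * ea - Complex.exp (lDiff k j i * x) * Φ 0 t i j * eb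
    · simp only [lineIntegral, conjEntry_x]
      rw [integral_const_mul, (hΦ j).integral_Ioi_x hF hk hx ht hc, Matrix.one_apply]
      by_cases hij : i = j
      · subst hij
        simp
      · rw [if_neg hij]
        linear_combination (-Φ x t i j) * ea

/-! #### From eigenfunctions to columns -/

/-- V₁ has rank one, and its row index enters only through 1 / `den`. Integrability of the source in
one row therefore passes to all rows. -/
lemma V₁_row (hk : k ≠ 0) (hk6 : k ^ 6 ≠ 1) (x t : ℝ) (i j : Fin 3) (w : Fin 3 → ℂ) :
    ∑ i', V₁ u k x t i i' * w i' = den k j / den k i * ∑ i', V₁ u k x t j i' * w i' := by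
  rw [Finset.mul_sum]
  refine Finset.sum_congr rfl fun i' _ => ?_
  have h1 := den_ne_zero hk hk6 i
  have h2 := den_ne_zero hk hk6 j
  rw [V₁_apply hk hk6, V₁_apply hk hk6]
  field_simp

/-- The columns of an eigenfunction have the right boundary values. -/
theorem IsEigenfunction.colSol (hΦ : IsEigenfunction T u n k Φ) (hF : Field T u h)
    (hk : Regular n k) (j : Fin 3) : ColSol T u n k j (fun x t i => Φ x t i j) := by
  obtain ⟨hx, ht⟩ := solvesLax_iff.1 hΦ.lax j
  have hT := hF.pos
  have hT0 : (0 : ℝ) ∈ Ico 0 T := ⟨le_rfl, hT⟩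
  have hk0 := hk.ne_zero
  have hk6 := hk.pow_six
  -- integrability of the sources
  have hsrc : ∀ i, IntegrableOn (fun x => ∑ i', V₁ u k x 0 i i' * Φ x 0 i' j) (Ioi 0) := by
    intro i
    -- The diagonal entry is always integrated from infinity and carries no exponential, so its
    -- absolute convergence is integrability of the bare source.
    have h1 := hΦ.integrable 0 0 (mem_Omega.2 ⟨le_rfl, hT0⟩) j j
    rw [contour_self] at h1
    simp only [LineIntegrable, conjEntry_x, lDiff_self, zero_mul, neg_zero, Complex.exp_zero,
      one_mul] at h1
    simp_rw [V₁_row hk0 hk6 _ 0 i j]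
    exact h1.const_mul _
  have hthree : ∀ i, contour n i j = Contour.three → ∀ x t, (x, t) ∈ Omega T →
      Complex.exp (-(lDiff k j i * x)) * Φ x t i j = (if i = j then 1 else 0) -
        ∫ y in Ioi x, Complex.exp (-(lDiff k j i * y)) * ∑ i', V₁ u k y t i i' * Φ y t i' j := by
    intro i hi x t hp
    have h1 := hΦ.equation x t hp i j
    rw [hi] at h1
    simp only [lineIntegral, conjEntry_x] at h1
    rw [integral_const_mul, Matrix.one_apply] at h1
    have ea := exp_mul_exp_neg (lDiff k j i * x)
    rw [h1]
    by_cases hij : i = j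
    · subst hij; simp; ring
    · rw [if_neg hij]
      linear_combination (-∫ y in Ioi x, Complex.exp (-(lDiff k j i * y)) *
        ∑ i', V₁ u k y t i i' * Φ y t i' j) * ea
  -- boundedness at the initial time
  have hbd0 : ∀ i, ∃ C, ∀ x, 0 ≤ x → ‖Φ x 0 i j‖ ≤ C := by
    intro i
    -- Boundedness is not part of the definition of an eigenfunction. It follows because, in either
    -- direction of integration, the exponentials have norm at most one and the source is
    -- integrable.
    set N := ∫ y in Ioi 0, ‖∑ i', V₁ u k y 0 i i' * Φ y 0 i' j‖ with hN
    have hle : ∀ S : Set ℝ, MeasurableSet S → S ⊆ Ioi 0 →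
        ∫ y in S, ‖∑ i', V₁ u k y 0 i i' * Φ y 0 i' j‖ ≤ N := fun S hS hsub =>
      setIntegral_mono_set (hsrc i).norm (Eventually.of_forall fun y => norm_nonneg _)
        (Eventually.of_forall hsub)
    by_cases hi : contour n i j = Contour.three
    · refine ⟨1 + N, fun x hx0 => ?_⟩
      have hre := re_lDiff_nonneg hk.mem hk0 hi
      have h1 := hthree i hi x 0 (mem_Omega.2 ⟨hx0, hT0⟩)
      have ea := exp_mul_exp_neg (lDiff k j i * x)
      have h2 : Φ x 0 i j = (if i = j then 1 else 0) - ∫ y in Ioi x, Complex.exp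
          (lDiff k j i * (x - y)) * ∑ i', V₁ u k y 0 i i' * Φ y 0 i' j := by
        have e1 : ∫ y in Ioi x, Complex.exp (lDiff k j i * (x - y)) *
            ∑ i', V₁ u k y 0 i i' * Φ y 0 i' j = Complex.exp (lDiff k j i * x) *
            ∫ y in Ioi x, Complex.exp (-(lDiff k j i * y)) *
            ∑ i', V₁ u k y 0 i i' * Φ y 0 i' j := by
          rw [← integral_const_mul]
          congr 1
          funext y
          rw [← mul_assoc, ← Complex.exp_add]
          ring_nf
        rw [e1]
        by_cases hij : i = j
        · subst hij; simpa using h1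
        · rw [if_neg hij] at h1 ⊢
          linear_combination Complex.exp (lDiff k j i * x) * h1 - Φ x 0 i j * ea
      rw [h2]
      refine (norm_sub_le _ _).trans (add_le_add (by split_ifs <;> simp) ?_)
      refine (norm_integral_le_of_norm_le ((hsrc i).mono_set (Ioi_subset_Ioi hx0)).norm ?_).trans
        (hle _ measurableSet_Ioi (Ioi_subset_Ioi hx0))
      filter_upwards [ae_restrict_mem measurableSet_Ioi] with y hy
      rw [norm_mul]
      refine mul_le_of_le_one_left (norm_nonneg _) ?_
      rw [Complex.norm_exp, Real.exp_le_one_iff, ← Complex.ofReal_sub, Complex.re_mul_ofReal]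
      nlinarith [mem_Ioi.1 hy]
    · refine ⟨‖Φ 0 0 i j‖ + N, fun x hx0 => ?_⟩
      have hre := re_lDiff_nonpos hk.mem hk0 hi
      have h1 := (hx 0 hT0).ftc isRay_Ici (continuousOn_V₁_zero hF hk0 hk6 hT0) le_rfl hx0
        (mem_Ici.2 hx0) i
      have ea := exp_mul_exp_neg (lDiff k j i * x)
      have h2 : Φ x 0 i j = Complex.exp (lDiff k j i * x) * Φ 0 0 i j +
          ∫ y in Ioc 0 x, Complex.exp (lDiff k j i * (x - y)) *
          ∑ i', V₁ u k y 0 i i' * Φ y 0 i' j := by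
        have e1 : ∫ y in Ioc 0 x, Complex.exp (lDiff k j i * (x - y)) *
            ∑ i', V₁ u k y 0 i i' * Φ y 0 i' j = Complex.exp (lDiff k j i * x) *
            ∫ y in (0 : ℝ)..x, Complex.exp (-(lDiff k j i * y)) *
            ∑ i', V₁ u k y 0 i i' * Φ y 0 i' j := by
          rw [intervalIntegral.integral_of_le hx0, ← integral_const_mul]
          congr 1
          funext y
          rw [← mul_assoc, ← Complex.exp_add]
          ring_nf
        rw [e1, h1]
        simp only [Complex.ofReal_zero, mul_zero, neg_zero, Complex.exp_zero, one_mul]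
        linear_combination -Φ x 0 i j * ea
      rw [h2]
      refine (norm_add_le _ _).trans (add_le_add ?_ ?_)
      · rw [norm_mul]
        refine mul_le_of_le_one_left (norm_nonneg _) ?_
        rw [Complex.norm_exp, Real.exp_le_one_iff, Complex.re_mul_ofReal]
        nlinarith
      refine (norm_integral_le_of_norm_le ((hsrc i).mono_set Ioc_subset_Ioi_self).norm ?_).trans
        (hle _ measurableSet_Ioc Ioc_subset_Ioi_self)
      filter_upwards [ae_restrict_mem measurableSet_Ioc] with y hy
      rw [norm_mul]
      refine mul_le_of_le_one_left (norm_nonneg _) ?_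
      rw [Complex.norm_exp, Real.exp_le_one_iff, ← Complex.ofReal_sub, Complex.re_mul_ofReal]
      nlinarith [hy.2]
  choose C hC using hbd0
  have hC0 : ∀ i, 0 ≤ C i := fun i => (norm_nonneg _).trans (hC i 0 le_rfl)
  set α := zBound k j + 3 * (vConst (h 0) k * h 0) with hα
  have hα0 : 0 ≤ α := le_trans (by positivity)
    (hF.norm_zDiff_add_le (j := j) hk0 hk6 (mem_Omega.2 ⟨le_rfl, le_rfl, hF.pos⟩) 0)
  have hbd : ∀ x t, (x, t) ∈ Omega T → ∀ i, ‖Φ x t i j‖ ≤ (∑ i, C i) * Real.exp (α * T) := by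
    intro x t hp i
    obtain ⟨a1, a2⟩ : 0 ≤ x ∧ t ∈ Ico 0 T := mem_Omega.1 hp
    have h1 := (ht x a1).norm_le (isRay_Ico T) (α := α) a2 fun y hy i =>
      hF.norm_zDiff_add_le hk0 hk6 (mem_Omega.2 ⟨a1, hy.1, hy.2.trans_lt a2.2⟩) i
    have hS : 0 ≤ ∑ i, C i := Finset.sum_nonneg fun i _ => hC0 i
    refine (norm_le_pi_norm (fun i => Φ x t i j) i).trans (h1.trans ?_)
    refine mul_le_mul ?_ ?_ (by positivity) hS
    · exact (pi_norm_le_iff_of_nonneg hS).2 fun i => (hC i x a1).trans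
        (Finset.single_le_sum (f := C) (fun i _ => hC0 i) (Finset.mem_univ i))
    · exact Real.exp_le_exp.2 (mul_le_mul_of_nonneg_left a2.2.le hα0)
  refine ⟨hx, ht, ⟨_, hbd⟩, fun i hi => ?_, fun i hi => ?_, fun i hi t ht' => ?_⟩
  · have hij : i ≠ j := contour_ne_three_ne (n := n) (by simp [hi])
    have h1 : ∀ t ∈ Ico 0 T, Φ 0 t i j = Complex.exp (zDiff k j i * t) * ∫ s in T..t,
        Complex.exp (-(zDiff k j i * s)) * ∑ i', V₂ u k 0 s i i' * Φ 0 s i' j := by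
      intro t ht'
      have h2 := hΦ.equation 0 t (mem_Omega.2 ⟨le_rfl, ht'⟩) i j
      rw [hi] at h2
      simp only [lineIntegral, conjEntry_x, conjEntry_t] at h2
      rw [h2, Matrix.one_apply_ne hij, intervalIntegral.integral_const_mul]
      simp
    have h3 : Tendsto (fun t : ℝ => Complex.exp (zDiff k j i * t)) (𝓝[<] T)
        (𝓝 (Complex.exp (zDiff k j i * T))) := by
      have : Continuous fun t : ℝ => Complex.exp (zDiff k j i * t) := by fun_prop
      exact this.continuousAt.tendsto.mono_left nhdsWithin_le_nhds
    set G := Real.exp (zBound k j * T) *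
      (3 * (vConst (h 0) k * h 0 * ((∑ i, C i) * Real.exp (α * T)))) with hG
    have h4 : Tendsto (fun t : ℝ => ∫ s in T..t,
        Complex.exp (-(zDiff k j i * s)) * ∑ i', V₂ u k 0 s i i' * Φ 0 s i' j) (𝓝[<] T) (𝓝 0) := by
      have h5 : Tendsto (fun t : ℝ => G * |t - T|) (𝓝[<] T) (𝓝 0) := by
        have : Continuous fun t : ℝ => G * |t - T| := by fun_prop
        simpa using (this.tendsto T).mono_left (nhdsWithin_le_nhds (s := Iio T))
      refine squeeze_zero_norm' ?_ h5
      filter_upwards [Ioo_mem_nhdsLT hT] with t ht'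
      rw [intervalIntegral.integral_symm, norm_neg, abs_sub_comm]
      refine intervalIntegral.norm_integral_le_of_norm_le_const_ae ?_
      have hf : ∀ᵐ s : ℝ ∂volume, s ∉ ({T} : Set ℝ) := (Set.countable_singleton T).ae_notMem _
      filter_upwards [hf] with s hs hs'
      rw [uIoc_of_le ht'.2.le] at hs'
      exact hF.norm_source_t_le hk (φ := fun x t i => Φ x t i j) hbd i
        ⟨ht'.1.le.trans hs'.1.le, lt_of_le_of_ne hs'.2 hs⟩
    have h6 := h3.mul h4
    rw [mul_zero] at h6
    refine h6.congr' ?_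
    filter_upwards [Ioo_mem_nhdsLT hT] with t ht'
    exact (h1 t ⟨ht'.1.le, ht'.2⟩).symm
  · have hij : i ≠ j := contour_ne_three_ne (n := n) (by simp [hi])
    have h2 := hΦ.equation 0 0 (mem_Omega.2 ⟨le_rfl, hT0⟩) i j
    rw [hi] at h2
    simp only [lineIntegral, intervalIntegral.integral_same, Matrix.one_apply_ne hij] at h2
    simpa using h2
  · have h1 := hΦ.integrable 0 t (mem_Omega.2 ⟨le_rfl, ht'⟩) i j
    rw [hi] at h1
    simp only [LineIntegrable, conjEntry_x, Complex.ofReal_zero, mul_zero, Complex.exp_zero,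
      one_mul] at h1
    have h2 := intervalIntegral_tendsto_integral_Ioi 0 h1 tendsto_id
    have h3 := (tendsto_const_nhds (x := (if i = j then (1 : ℂ) else 0) -
      ∫ y : ℝ in Ioi (0 : ℝ), Complex.exp (-(lDiff k j i * y)) * ∑ i', V₁ u k y t i i' * Φ y t i' j)).add h2
    rw [sub_add_cancel] at h3
    refine h3.congr' ?_
    filter_upwards [eventually_ge_atTop 0] with x hx0
    rw [hthree i hi x t (mem_Omega.2 ⟨hx0, ht'⟩), id, intervalIntegral.integral_of_le hx0]
    have h4 := setIntegral_union (f := fun y : ℝ => Complex.exp (-(lDiff k j i * y)) *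
      ∑ i', V₁ u k y t i i' * Φ y t i' j) (μ := volume) (Ioc_disjoint_Ioi_same (a := 0) (b := x)) measurableSet_Ioi
      (h1.mono_set Ioc_subset_Ioi_self) (h1.mono_set (Ioi_subset_Ioi hx0))
    rw [Ioc_union_Ioi_eq_Ioi hx0] at h4
    rw [h4]
    ring

/-! ### Oscillatory integrals -/

/-- Integration by parts for an integral with an exponential factor. -/
lemma norm_integral_exp_mul_le {a b : ℝ} (hab : a ≤ b) {v : ℝ → ℂ} {A B : ℝ} (hAa : A < a)
    (hbB : b < B) (hv : ContDiffOn ℝ 1 v (Ioo A B)) {ζ c : ℂ} (hζ : ζ ≠ 0) {C : ℝ}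
    (hC : ∀ s ∈ Icc a b, ‖Complex.exp (ζ * s + c)‖ ≤ C) :
    ‖∫ s in a..b, Complex.exp (ζ * s + c) * v s‖ ≤
      C * (‖v b‖ + ‖v a‖ + ∫ s in a..b, ‖deriv v s‖) / ‖ζ‖ := by
  have hsub : Icc a b ⊆ Ioo A B := fun s hs => ⟨hAa.trans_le hs.1, hs.2.trans_lt hbB⟩
  have hd : ∀ s ∈ uIcc a b, HasDerivAt v (deriv v s) s := fun s hs => by
    rw [uIcc_of_le hab] at hs
    exact ((hv.differentiableOn (by simp) s (hsub hs)).differentiableAt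
      (Ioo_mem_nhds (hsub hs).1 (hsub hs).2)).hasDerivAt
  have hcd : ContinuousOn (deriv v) (Icc a b) :=
    (hv.continuousOn_deriv_of_isOpen isOpen_Ioo (by simp)).mono hsub
  have hcv : ContinuousOn v (Icc a b) := hv.continuousOn.mono hsub
  have he : ∀ s ∈ uIcc a b, HasDerivAt (fun s : ℝ => Complex.exp (ζ * s + c) / ζ)
      (Complex.exp (ζ * s + c)) s := fun s _ => by
    have h1 : HasDerivAt (fun s : ℝ => ζ * s + c) ζ s := by
      simpa using ((Complex.ofRealCLM.hasDerivAt (x := s)).const_mul ζ).add_const c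
    have h2 := h1.cexp.div_const ζ
    rwa [mul_div_cancel_right₀ _ hζ] at h2
  have hce : Continuous fun s : ℝ => Complex.exp (ζ * s + c) := by fun_prop
  have key := intervalIntegral.integral_mul_deriv_eq_deriv_mul hd he
    (by rw [← uIcc_of_le hab] at hcd; exact hcd.intervalIntegrable) (hce.intervalIntegrable _ _)
  have e1 : ∫ s in a..b, Complex.exp (ζ * s + c) * v s =
      ∫ s in a..b, v s * Complex.exp (ζ * s + c) := by simp_rw [mul_comm]
  have hn : ∀ s ∈ Icc a b, ‖Complex.exp (ζ * s + c) / ζ‖ ≤ C / ‖ζ‖ := fun s hs => by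
    rw [norm_div]
    exact div_le_div_of_nonneg_right (hC s hs) (norm_nonneg _)
  have h3 : ‖∫ s in a..b, deriv v s * (Complex.exp (ζ * s + c) / ζ)‖ ≤
      (∫ s in a..b, ‖deriv v s‖) * (C / ‖ζ‖) := by
    rw [← intervalIntegral.integral_mul_const]
    refine intervalIntegral.norm_integral_le_of_norm_le hab ?_ ?_
    · refine Eventually.of_forall fun s hs => ?_
      rw [norm_mul]
      exact mul_le_mul_of_nonneg_left (hn s ⟨hs.1.le, hs.2⟩) (norm_nonneg _)
    · rw [← uIcc_of_le hab] at hcd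
      exact hcd.norm.intervalIntegrable.mul_const _
  rw [e1, key]
  have h4 : ‖v b * (Complex.exp (ζ * b + c) / ζ)‖ ≤ ‖v b‖ * (C / ‖ζ‖) := by
    rw [norm_mul]
    exact mul_le_mul_of_nonneg_left (hn b ⟨hab, le_rfl⟩) (norm_nonneg _)
  have h5 : ‖v a * (Complex.exp (ζ * a + c) / ζ)‖ ≤ ‖v a‖ * (C / ‖ζ‖) := by
    rw [norm_mul]
    exact mul_le_mul_of_nonneg_left (hn a ⟨le_rfl, hab⟩) (norm_nonneg _)
  refine (norm_sub_le _ _).trans ((add_le_add (norm_sub_le _ _) le_rfl).trans ?_)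
  calc _ ≤ _ := add_le_add (add_le_add h4 h5) h3
    _ = _ := by ring

/-- A form of the Riemann–Lebesgue lemma: complex frequencies are allowed as long as the exponential
stays bounded on the range of integration. -/
lemma tendsto_integral_exp_mul {ι : Type*} {F : Filter ι} {J : Set ℝ} {A B C M : ℝ}
    (hJ : J.OrdConnected) (hJs : J ⊆ Ioo A B) {v : ℝ → ℂ} (hv : ContDiffOn ℝ 1 v (Ioo A B))
    (hM : ∀ s ∈ Ioo A B, ‖v s‖ ≤ M) {ζ c : ι → ℂ} (hζ : Tendsto (fun w => ‖ζ w‖) F atTop)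
    (hC : ∀ᶠ w in F, ∀ s ∈ J, ‖Complex.exp (ζ w * s + c w)‖ ≤ C) :
    Tendsto (fun w => ∫ s in J, Complex.exp (ζ w * s + c w) * v s) F (𝓝 0) := by
  rcases J.subsingleton_or_nontrivial with hs | hs
  · have : volume J = 0 := hs.measure_zero volume
    simpa [Measure.restrict_eq_zero.2 this] using tendsto_const_nhds
  have hne := hs.nonempty
  have hbb : BddBelow J := ⟨A, fun s hs => (hJs hs).1.le⟩
  have hba : BddAbove J := ⟨B, fun s hs => (hJs hs).2.le⟩
  set a := sInf J with ha
  set b := sSup J with hb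
  have hsub : J ⊆ Icc a b := fun s hs => ⟨csInf_le hbb hs, le_csSup hba hs⟩
  have hsup : Ioo a b ⊆ J := fun s hs => by
    obtain ⟨x, hx, hxs⟩ := exists_lt_of_csInf_lt hne hs.1
    obtain ⟨y, hy, hys⟩ := exists_lt_of_lt_csSup hne hs.2
    exact hJ.out hx hy ⟨hxs.le, hys.le⟩
  have hab : a < b := by
    obtain ⟨x, hx, y, hy, hxy⟩ := hs
    rcases lt_or_gt_of_ne hxy with h | h
    · exact (hsub hx).1.trans_lt (h.trans_le (hsub hy).2)
    · exact (hsub hy).1.trans_lt (h.trans_le (hsub hx).2)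
  have hAa : A ≤ a := le_csInf hne fun s hs => (hJs hs).1.le
  have hbB : b ≤ B := csSup_le hne fun s hs => (hJs hs).2.le
  have hIoo : Ioo a b ⊆ Ioo A B := Ioo_subset_Ioo hAa hbB
  have hJae : J =ᵐ[volume] Ioo a b := by
    refine (Ioo_ae_eq_Icc.trans ?_).symm
    refine (LE.le.eventuallyLE hsub).antisymm ?_ |>.symm
    exact (Ioo_ae_eq_Icc (a := a) (b := b)).symm.le.trans (LE.le.eventuallyLE hsup)
  have e0 : ∀ w, ∫ s in J, Complex.exp (ζ w * s + c w) * v s =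
      ∫ s in a..b, Complex.exp (ζ w * s + c w) * v s := fun w => by
    rw [setIntegral_congr_set hJae, intervalIntegral.integral_of_le hab.le,
      integral_Ioc_eq_integral_Ioo]
  simp_rw [e0]
  have hmid : (a + b) / 2 ∈ Ioo a b := ⟨by linarith, by linarith⟩
  have hM0 : 0 ≤ M := (norm_nonneg _).trans (hM _ (hIoo hmid))
  set C' := max C 0 with hC'
  have hC0 : 0 ≤ C' := le_max_right _ _
  have hcont : ∀ w, ContinuousOn (fun s : ℝ => Complex.exp (ζ w * s + c w) * v s) (Ioo a b) :=
    fun w => (by fun_prop : Continuous fun s : ℝ => Complex.exp (ζ w * s + c w)).continuousOn.mul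
      (hv.continuousOn.mono hIoo)
  rw [Metric.tendsto_nhds]
  intro ε hε
  -- The derivative of v need not be integrable up to the ends. Two end pieces of length η
  -- contribute at most ε/4 each, and integration by parts is confined to the compact middle piece,
  -- whose integral is eventually below ε/2.
  set η := min ((b - a) / 4) (ε / (4 * (C' * M + 1))) with hη
  have hCM : 0 ≤ C' * M := mul_nonneg hC0 hM0
  have hη0 : 0 < η := lt_min (by linarith) (by positivity)
  have hη1 : η ≤ (b - a) / 4 := min_le_left _ _
  have hη2 : C' * M * η ≤ ε / 4 := by
    have h1 : η * (4 * (C' * M + 1)) ≤ ε := (le_div_iff₀ (by positivity)).1 (min_le_right _ _)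
    nlinarith
  have hlim : Tendsto (fun w => C' * (‖v (b - η)‖ + ‖v (a + η)‖ +
      ∫ s in (a + η)..(b - η), ‖deriv v s‖) / ‖ζ w‖) F (𝓝 0) := tendsto_const_nhds.div_atTop hζ
  filter_upwards [hC, hζ.eventually_gt_atTop 0, hlim.eventually (gt_mem_nhds (half_pos hε))] with
    w hCw hζw hlw
  have hb : ∀ s ∈ Ioo a b, ‖Complex.exp (ζ w * s + c w) * v s‖ ≤ C' * M := fun s hs => by
    rw [norm_mul]
    exact mul_le_mul ((hCw s (hsup hs)).trans (le_max_left _ _)) (hM s (hIoo hs)) (norm_nonneg _) hC0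
  have hInt : IntegrableOn (fun s : ℝ => Complex.exp (ζ w * s + c w) * v s) (Ioo a b) := by
    refine Integrable.mono' (integrableOn_const (C := C' * M) (by simp))
      ((hcont w).aestronglyMeasurable measurableSet_Ioo) ?_
    filter_upwards [ae_restrict_mem measurableSet_Ioo] with s hs using hb s hs
  have hii : ∀ x y, a ≤ x → x ≤ y → y ≤ b →
      IntervalIntegrable (fun s : ℝ => Complex.exp (ζ w * s + c w) * v s) volume x y := by
    intro x y hx hxy hy
    rw [intervalIntegrable_iff_integrableOn_Ioo_of_le hxy]
    exact hInt.mono_set (Ioo_subset_Ioo hx hy)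
  have hend : ∀ x y, a ≤ x → x ≤ y → y ≤ b →
      ‖∫ s in x..y, Complex.exp (ζ w * s + c w) * v s‖ ≤ C' * M * (y - x) := by
    intro x y hx hxy hy
    rw [← abs_of_nonneg (sub_nonneg.2 hxy)]
    refine intervalIntegral.norm_integral_le_of_norm_le_const_ae ?_
    filter_upwards [Measure.ae_ne volume y] with s hsy hs
    rw [uIoc_of_le hxy] at hs
    exact hb s ⟨hx.trans_lt hs.1, (lt_of_le_of_ne hs.2 hsy).trans_le hy⟩
  have h1 := hend a (a + η) le_rfl (by linarith) (by linarith)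
  have h2 := hend (b - η) b (by linarith) (by linarith) le_rfl
  have h3 := norm_integral_exp_mul_le (a := a + η) (b := b - η) (by linarith) (A := A) (B := B)
    (by linarith) (by linarith) hv (norm_pos_iff.1 hζw) (c := c w) (C := C')
    (fun s hs => (hCw s (hsup ⟨by linarith [hs.1], by linarith [hs.2]⟩)).trans (le_max_left _ _))
  rw [dist_zero_right, ← intervalIntegral.integral_add_adjacent_intervals
    (hii a (a + η) le_rfl (by linarith) (by linarith))
    (hii (a + η) b (by linarith) (by linarith) le_rfl),
    ← intervalIntegral.integral_add_adjacent_intervals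
    (hii (a + η) (b - η) (by linarith) (by linarith) (by linarith))
    (hii (b - η) b (by linarith) (by linarith) le_rfl)]
  have h4 := norm_add_le (∫ s in a..(a + η), Complex.exp (ζ w * s + c w) * v s)
    ((∫ s in (a + η)..(b - η), Complex.exp (ζ w * s + c w) * v s) +
      ∫ s in (b - η)..b, Complex.exp (ζ w * s + c w) * v s)
  have h5 := norm_add_le (∫ s in (a + η)..(b - η), Complex.exp (ζ w * s + c w) * v s)
      (∫ s in (b - η)..b, Complex.exp (ζ w * s + c w) * v s)
  rw [add_sub_cancel_left] at h1
  rw [sub_sub_cancel] at h2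
  linarith

/-! ### The coefficients at the zeros of `λ` -/

variable {T : ℝ} {u : ℝ → ℝ → ℝ} {h : ℝ → ℝ} {n : Fin 18} {j : Fin 3} {K : ℂ}

lemma ne_zero_of_pow_six (hK : K ^ 6 = -1) : K ≠ 0 := by
  rintro rfl
  norm_num at hK

lemma pow_six_ne_one (hK : K ^ 6 = -1) : K ^ 6 ≠ 1 := by rw [hK]; norm_num

lemma V₁_lamZero (hK : K ^ 6 = -1) (u : ℝ → ℝ → ℝ) (x t : ℝ) : V₁ u K x t = 0 := by
  ext i i'
  rw [V₁_apply (ne_zero_of_pow_six hK) (pow_six_ne_one hK),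
    (lam_eq_zero_iff (ne_zero_of_pow_six hK)).2 hK]
  simp

/-- At a zero of `λ`, the matrix `V₂` only couples the middle row with the two others. -/
lemma V₂_lamZero (hK : K ^ 6 = -1) (hKD : K ∈ closure (D n)) (u : ℝ → ℝ → ℝ) (x t : ℝ)
    {i i' : Fin 3} (hi : i = lOrder n 1 ↔ i' = lOrder n 1) : V₂ u K x t i i' = 0 := by
  obtain ⟨h0, h1, h2⟩ := l_of_pow_six (lamZero_mem_sector hK hKD) hK
  have hlam := (lam_eq_zero_iff (ne_zero_of_pow_six hK)).2 hK
  rw [V₂_apply (ne_zero_of_pow_six hK) (pow_six_ne_one hK), hlam]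
  have hsq : ∀ i, i ≠ lOrder n 1 → l K i ^ 2 = 1 := fun i hi => by
    rcases lOrder_cases n i with rfl | rfl | rfl
    · rw [h0]; norm_num
    · exact absurd rfl hi
    · rw [h2]; norm_num
  by_cases hm : i = lOrder n 1
  · rw [hm, hi.1 hm, h1]
    ring
  · rw [hsq i hm, hsq i' (fun h => hm (hi.2 h))]
    ring

/-- In V₂ the second derivative u_xx carries the factor λ and disappears at its zeros. What remains
involves u and u_x at x = 0, which are C¹ in t, as the integration by parts requires. -/
lemma Field.contDiffOn_V₂_lamZero (hF : Field T u h) (hK : K ^ 6 = -1) (i i' : Fin 3) :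
    ContDiffOn ℝ 1 (fun t => V₂ u K 0 t i i') (Ico 0 T) := by
  have hlam := (lam_eq_zero_iff (ne_zero_of_pow_six hK)).2 hK
  simp_rw [V₂_apply (ne_zero_of_pow_six hK) (pow_six_ne_one hK), hlam]
  have h1 : ContDiffOn ℝ 1 (fun t => (u 0 t : ℂ)) (Ico 0 T) :=
    Complex.ofRealCLM.contDiff.comp_contDiffOn hF.smooth
  have h2 : ContDiffOn ℝ 1 (fun t => (dx u 0 t : ℂ)) (Ico 0 T) :=
    Complex.ofRealCLM.contDiff.comp_contDiffOn hF.smooth_dx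
  simp only [zero_mul, sub_zero]
  fun_prop

lemma tendsto_bV {k : ℂ} (hk : k ≠ 0) (hk6 : k ^ 6 ≠ 1) (S : Set ℂ) (s : ℝ) (i i' : Fin 3) :
    Tendsto (fun w => bV T u w s i i') (𝓝[S] k) (𝓝 (bV T u k s i i')) := by
  refine Tendsto.mono_left ?_ nhdsWithin_le_nhds
  unfold bV
  split_ifs
  · exact (differentiableAt_V₁ u s 0 i i' hk hk6).continuousAt
  · exact ((differentiableAt_V₂ u 0 (-s) i i' hk hk6).continuousAt).neg
  · exact tendsto_const_nhds

/-- A family of functions which on `(-T, 0)` are exponentials cut off to a fixed interval. -/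
def Pulse (T : ℝ) (β : ℂ → ℂ) (f : ℂ → ℝ → ℂ) : Prop :=
  ∃ (ε : ℂ) (J : Set ℝ) (c : ℂ → ℂ), ‖ε‖ = 1 ∧ J.OrdConnected ∧ ∀ w, ∀ s ∈ Ioo (-T) 0,
    f w s = J.indicator (fun s => ε * Complex.exp (β w * s + c w)) s

lemma Pulse.mul {β β' : ℂ → ℂ} {f f' : ℂ → ℝ → ℂ} (hf : Pulse T β f) (hf' : Pulse T β' f') :
    Pulse T (fun w => β w + β' w) (fun w s => f w s * f' w s) := by
  obtain ⟨ε, J, c, hε, hJ, h⟩ := hf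
  obtain ⟨ε', J', c', hε', hJ', h'⟩ := hf'
  refine ⟨ε * ε', J ∩ J', fun w => c w + c' w, by rw [norm_mul, hε, hε', one_mul], hJ.inter hJ',
    fun w s hs => ?_⟩
  simp only
  rw [h w s hs, h' w s hs, ← inter_indicator_mul]
  refine congrFun (congrArg _ ?_) s
  funext s
  rw [show (β w + β' w) * s + (c w + c' w) = (β w * s + c w) + (β' w * s + c' w) by ring,
    Complex.exp_add (β w * s + c w)]
  ring

/-- The coefficient is split into its value at K and a remainder that tends to zero, the remainder
being handled by dominated convergence. At K only the time axis contributes, and only if exactly one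
of i, i' is the middle row; then z i - z i' blows up and `tendsto_integral_exp_mul` applies. -/
lemma Field.tendsto_integral_pulse (hF : Field T u h) (hK : K ^ 6 = -1) (hKD : K ∈ closure (D n))
    {f : ℂ → ℝ → ℂ} {i i' : Fin 3} (hp : Pulse T (fun w => z w i - z w i') f) {C : ℝ}
    (hf : ∀ᶠ w in 𝓝[closure (D n) \ {K}] K, Measurable (f w) ∧ ∀ s, -T < s → ‖f w s‖ ≤ C) :
    Tendsto (fun w => ∫ s in Ioi (-T), f w s * bV T u w s i i') (𝓝[closure (D n) \ {K}] K)
      (𝓝 0) := by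
  have hK0 := ne_zero_of_pow_six hK
  have hK1 := pow_six_ne_one hK
  have hH := hF.h_nonneg le_rfl
  set Cv := vConst (h 0) K + 1 with hCv
  have hev : ∀ᶠ w in 𝓝[closure (D n) \ {K}] K, w ≠ 0 ∧ w ^ 6 ≠ 1 ∧ vConst (h 0) w ≤ Cv := by
    filter_upwards [eventually_pow_six_ne hK (closure (D n)), nhdsWithin_le_nhds
      ((continuousAt_vConst (h 0) hK0 hK1).eventually_lt_const (lt_add_one _))] with w hw hw'
    exact ⟨hw.1, hw.2.1, hw'.le⟩
  have hwt : IntegrableOn (fun s => bWeight h 0 (Cv * C) s) (Ioi (-T)) :=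
    hF.integrableOn_bWeight _ hF.integrableOn_exp_zero
  have hwt' : ∀ D s, bWeight h 0 D s = D * h (bx s) := fun D s => by simp [bWeight]
  have hbd : ∀ w, w ≠ 0 → w ^ 6 ≠ 1 → vConst (h 0) w ≤ Cv → ∀ s i i',
      ‖bV T u w s i i'‖ ≤ Cv * h (bx s) := fun w h0 h1 h2 s i i' =>
    (hF.norm_bV_le h0 h1 s i i').trans
      (mul_le_mul_of_nonneg_right h2 (hF.h_nonneg (bx_nonneg s)))
  have hInt : ∀ᶠ w in 𝓝[closure (D n) \ {K}] K, ∀ k, k ≠ 0 → k ^ 6 ≠ 1 → vConst (h 0) k ≤ Cv →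
      IntegrableOn (fun s => f w s * bV T u k s i i') (Ioi (-T)) := by
    filter_upwards [hf] with w hw k h0 h1 h2
    refine Integrable.mono' hwt
      (hw.1.mul (hF.measurable_bV h0 h1 i i')).aestronglyMeasurable ?_
    filter_upwards [ae_restrict_mem measurableSet_Ioi] with s hs
    rw [hwt', norm_mul]
    calc _ ≤ C * (Cv * h (bx s)) := mul_le_mul (hw.2 s hs) (hbd k h0 h1 h2 s i i')
          (norm_nonneg _) ((norm_nonneg _).trans (hw.2 s hs))
      _ = _ := by ring
  have hdiff : Tendsto (fun w => ∫ s in Ioi (-T), f w s * (bV T u w s i i' - bV T u K s i i'))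
      (𝓝[closure (D n) \ {K}] K) (𝓝 0) := by
    rw [show (0 : ℂ) = ∫ s in Ioi (-T), (0 : ℂ) by simp]
    refine tendsto_integral_filter_of_dominated_convergence
      (fun s => 2 * bWeight h 0 (Cv * C) s) ?_ ?_ (hwt.const_mul 2) ?_
    · filter_upwards [hf, hev] with w hw he
      exact (hw.1.mul ((hF.measurable_bV he.1 he.2.1 i i').sub
        (hF.measurable_bV hK0 hK1 i i'))).aestronglyMeasurable
    · filter_upwards [hf, hev] with w hw he
      filter_upwards [ae_restrict_mem measurableSet_Ioi] with s hs
      rw [hwt', norm_mul]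
      have h1 := hbd w he.1 he.2.1 he.2.2 s i i'
      have h2 := hbd K hK0 hK1 (by linarith) s i i'
      calc _ ≤ C * (Cv * h (bx s) + Cv * h (bx s)) := mul_le_mul (hw.2 s hs)
            ((norm_sub_le _ _).trans (add_le_add h1 h2))
            (norm_nonneg _) ((norm_nonneg _).trans (hw.2 s hs))
        _ = _ := by ring
    · filter_upwards [ae_restrict_mem measurableSet_Ioi] with s hs
      have h1 := ((tendsto_bV (T := T) (u := u) hK0 hK1 (closure (D n) \ {K}) s i i').sub_const
        (bV T u K s i i')).norm.const_mul C
      rw [sub_self, norm_zero, mul_zero] at h1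
      refine squeeze_zero_norm' ?_ h1
      filter_upwards [hf] with w hw
      rw [norm_mul]
      exact mul_le_mul_of_nonneg_right (hw.2 s hs) (norm_nonneg _)
  have hmain : Tendsto (fun w => ∫ s in Ioi (-T), f w s * bV T u K s i i')
      (𝓝[closure (D n) \ {K}] K) (𝓝 0) := by
    have hzero : ∀ w, ∫ s in Ioi (-T), f w s * bV T u K s i i' =
        ∫ s in Ioo (-T) 0, f w s * bV T u K s i i' := fun w => by
      refine (setIntegral_eq_of_subset_of_forall_sdiff_eq_zero measurableSet_Ioi
        Ioo_subset_Ioi_self fun s hs => ?_)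
      have h0 : 0 ≤ s := by
        by_contra hneg
        exact hs.2 ⟨hs.1, not_le.1 hneg⟩
      rw [bV_of_nonneg T u K h0, V₁_lamZero hK]
      simp
    simp_rw [hzero]
    by_cases hm : i = lOrder n 1 ↔ i' = lOrder n 1
    · refine tendsto_const_nhds.congr fun w => ?_
      symm
      rw [← integral_zero ℝ ℂ (μ := volume.restrict (Ioo (-T) 0))]
      refine setIntegral_congr_fun measurableSet_Ioo fun s hs => ?_
      rw [bV_of_neg u K hs.2 hs.1, Matrix.neg_apply, V₂_lamZero hK hKD u 0 (-s) hm, neg_zero,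
        mul_zero]
    · obtain ⟨ε, J, c, hε, hJ, hpJ⟩ := hp
      have hζ : Tendsto (fun w => ‖z w i - z w i'‖) (𝓝[closure (D n) \ {K}] K) atTop := by
        by_cases h1 : i = lOrder n 1
        · have h2 : i' ≠ lOrder n 1 := fun h => hm ⟨fun _ => h, fun _ => h1⟩
          rw [h1]
          simp_rw [norm_sub_rev]
          exact tendsto_norm_z_sub hK hKD h2
        · have h2 : i' = lOrder n 1 := by
            by_contra h
            exact hm ⟨fun h' => absurd h' h1, fun h' => absurd h' h⟩
          rw [h2]
          exact tendsto_norm_z_sub hK hKD h1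
      have hmap : MapsTo (fun s : ℝ => -s) (Ioo (-T) 0) (Ico 0 T) := fun s hs =>
        ⟨by linarith [hs.2], by linarith [hs.1]⟩
      have hv : ContDiffOn ℝ 1 (fun s : ℝ => -V₂ u K 0 (-s) i i') (Ioo (-T) 0) :=
        ((hF.contDiffOn_V₂_lamZero hK i i').comp (by fun_prop) hmap).neg
      have hJ' : (J ∩ Ioo (-T) 0).OrdConnected := hJ.inter ordConnected_Ioo
      have key := (tendsto_integral_exp_mul hJ' inter_subset_right hv
        (M := vConst (h 0) K * h 0) (fun s hs => ?_) (c := c) (C := C) hζ ?_).const_mul ε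
      · rw [mul_zero] at key
        refine key.congr fun w => ?_
        rw [← integral_const_mul, inter_comm, ← setIntegral_indicator hJ.measurableSet]
        refine setIntegral_congr_fun measurableSet_Ioo fun s hs => ?_
        rw [hpJ w s hs, bV_of_neg u K hs.2 hs.1, Matrix.neg_apply]
        by_cases hsJ : s ∈ J
        · simp only [indicator_of_mem hsJ]
          ring
        · simp only [indicator_of_notMem hsJ, zero_mul]
      · rw [norm_neg]
        exact hF.norm_V₂_le hK0 hK1 (mem_Omega.2 ⟨le_rfl, hmap hs⟩) i i'
      · filter_upwards [hf] with w hw s hs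
        have h1 := hw.2 s hs.2.1
        rw [hpJ w s hs.2, indicator_of_mem hs.1, norm_mul, hε, one_mul] at h1
        exact h1
  have hsum := hdiff.add hmain
  rw [add_zero] at hsum
  refine hsum.congr' ?_
  filter_upwards [hInt, hev] with w hw he
  have i1 := hw w he.1 he.2.1 he.2.2
  have i2 := hw K hK0 hK1 (by linarith)
  rw [← integral_add ((i1.sub i2).congr (ae_of_all _ fun s => by simp [mul_sub])) i2]
  congr 1
  funext s
  ring

/-! ### The limit of the Fredholm series at the zeros of `λ` -/

variable {T : ℝ} {u : ℝ → ℝ → ℝ} {h : ℝ → ℝ} {n : Fin 18} {j : Fin 3} {K : ℂ}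

lemma bo_snd_eq (T : ℝ) (n : Fin 18) (j i : Fin 3) (s : ℝ) : ∃ (ε : ℂ) (J : Set ℝ), ‖ε‖ = 1 ∧
    J.OrdConnected ∧ ∀ s' ∈ Ioo (-T) 0, bo T n j i s s' = J.indicator (fun _ => ε) s' := by
  by_cases hs : -T < s
  · cases hc : contour n i j
    · refine ⟨1, Iic s, by simp, ordConnected_Iic, fun s' _ => ?_⟩
      simp only [bo, if_pos hs, hc, orient, indicator, mem_Iic]
    · refine ⟨-1, Ici s, by simp, ordConnected_Ici, fun s' hs' => ?_⟩
      simp only [bo, if_pos hs, hc, orient, indicator, mem_Ici, hs'.2.le, and_true]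
      rw [if_neg (fun h => absurd h.1 (not_le.2 hs'.2))]
    · refine ⟨-1, Ici s, by simp, ordConnected_Ici, fun s' _ => ?_⟩
      simp only [bo, if_pos hs, hc, orient, indicator, mem_Ici]
  · refine ⟨1, ∅, by simp, ordConnected_empty, fun s' _ => ?_⟩
    simp [bo, hs]

lemma bo_fst_eq (T : ℝ) (n : Fin 18) (j i : Fin 3) (s : ℝ) : ∃ (ε : ℂ) (J : Set ℝ), ‖ε‖ = 1 ∧
    J.OrdConnected ∧ ∀ s' ∈ Ioo (-T) 0, bo T n j i s' s = J.indicator (fun _ => ε) s' := by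
  cases hc : contour n i j
  · refine ⟨1, Ici s, by simp, ordConnected_Ici, fun s' hs' => ?_⟩
    simp only [bo, if_pos hs'.1, hc, orient, indicator, mem_Ici]
  · by_cases hs : s ≤ 0
    · refine ⟨-1, Iic s, by simp, ordConnected_Iic, fun s' hs' => ?_⟩
      simp only [bo, if_pos hs'.1, hc, orient, indicator, mem_Iic, hs, and_true]
      rw [if_neg (fun h => absurd (h.1.trans h.2) (not_le.2 hs'.2))]
    · refine ⟨1, ∅, by simp, ordConnected_empty, fun s' hs' => ?_⟩
      simp only [bo, if_pos hs'.1, hc, orient, indicator, hs, and_false, if_false, mem_empty_iff_false]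
      rw [if_neg (fun h => absurd (h.1.trans h.2) (not_le.2 hs'.2))]
  · refine ⟨-1, Iic s, by simp, ordConnected_Iic, fun s' hs' => ?_⟩
    simp only [bo, if_pos hs'.1, hc, orient, indicator, mem_Iic]

variable (a b : ℂ → Fin 3 → ℂ)

lemma pulse_row (T : ℝ) (n : Fin 18) (j i : Fin 3) (s : ℝ) : Pulse T (fun w => b w i)
    (fun w s' => bo T n j i s s' *
      Complex.exp (a w i * (bx s - bx s' : ℝ) + b w i * (bt s - bt s' : ℝ))) := by
  obtain ⟨ε, J, hε, hJ, h⟩ := bo_snd_eq T n j i s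
  refine ⟨ε, J, fun w => a w i * bx s + b w i * bt s, hε, hJ, fun w s' hs' => ?_⟩
  simp only
  rw [h s' hs', bx_of_nonpos hs'.2.le, bt_of_nonpos hs'.2.le]
  by_cases hm : s' ∈ J
  · rw [indicator_of_mem hm, indicator_of_mem hm]
    congr 2
    push_cast
    ring
  · rw [indicator_of_notMem hm, indicator_of_notMem hm, zero_mul]

/-- As the integration variable is now the evaluation point of the kernel, its exponent has the
opposite sign to that in `pulse_row`. Composing rows i and i' therefore produces the frequency b i -
b i'. -/
lemma pulse_col (T : ℝ) (n : Fin 18) (j i : Fin 3) (s : ℝ) : Pulse T (fun w => -b w i)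
    (fun w s' => bo T n j i s' s *
      Complex.exp (a w i * (bx s' - bx s : ℝ) + b w i * (bt s' - bt s : ℝ))) := by
  obtain ⟨ε, J, hε, hJ, h⟩ := bo_fst_eq T n j i s
  refine ⟨ε, J, fun w => -(a w i * bx s + b w i * bt s), hε, hJ, fun w s' hs' => ?_⟩
  simp only
  rw [h s' hs', bx_of_nonpos hs'.2.le, bt_of_nonpos hs'.2.le]
  by_cases hm : s' ∈ J
  · rw [indicator_of_mem hm, indicator_of_mem hm]
    congr 2
    push_cast
    ring
  · rw [indicator_of_notMem hm, indicator_of_notMem hm, zero_mul]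

lemma pulse_source (T : ℝ) (i : Fin 3) : Pulse T (fun w => -b w i)
    (fun w s' => Complex.exp (a w i * (bx s' : ℝ) + b w i * (bt s' : ℝ))) := by
  refine ⟨1, univ, fun _ => 0, by simp, ordConnected_univ, fun w s' hs' => ?_⟩
  simp only
  rw [bx_of_nonpos hs'.2.le, bt_of_nonpos hs'.2.le, indicator_of_mem (mem_univ _), one_mul]
  congr 1
  push_cast
  ring

lemma pulse_diag (T : ℝ) (n : Fin 18) (j i : Fin 3) :
    Pulse T (fun _ => 0) (fun _ s => bo T n j i s s) := by
  cases hc : contour n i j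
  · refine ⟨1, univ, fun _ => 0, by simp, ordConnected_univ, fun w s hs => ?_⟩
    simp [bo, hs.1, hc, orient]
  · refine ⟨-1, univ, fun _ => 0, by simp, ordConnected_univ, fun w s hs => ?_⟩
    simp [bo, hs.1, hc, orient, hs.2.le, not_le.2 hs.2]
  · refine ⟨-1, univ, fun _ => 0, by simp, ordConnected_univ, fun w s hs => ?_⟩
    simp [bo, hs.1, hc, orient]

/-- The kernel without its coefficient matrix. -/
def rowExp (T : ℝ) (n : Fin 18) (j : Fin 3) (a b : Fin 3 → ℂ) (i : Fin 3) (s s' : ℝ) : ℂ :=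
  bo T n j i s s' * Complex.exp (a i * (bx s - bx s' : ℝ) + b i * (bt s - bt s' : ℝ))

lemma measurable_rowExp (T : ℝ) (n : Fin 18) (j : Fin 3) (a b : Fin 3 → ℂ) (i : Fin 3) :
    Measurable (Function.uncurry (rowExp T n j a b i)) := by
  have h1 : Continuous fun q : ℝ × ℝ => Complex.exp (a i * (bx q.1 - bx q.2 : ℝ)
      + b i * (bt q.1 - bt q.2 : ℝ)) := by
    have := continuous_bx
    have := continuous_bt
    fun_prop
  exact (measurable_bo T n j i).mul h1.measurable

lemma GoodExp.norm_rowExp_le {B : ℝ} {a b : Fin 3 → ℂ} (hg : GoodExp T n j 0 B a b) (hT : 0 < T)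
    (i : Fin 3) {s s' : ℝ} (hs' : -T < s') : ‖rowExp T n j a b i s s'‖ ≤ Real.exp B := by
  simpa [rowExp] using hg.norm_exp_le hT i (s := s) hs'

variable {a b}

/-- In a gauge in which the exponentials stay bounded, the Fredholm series reduce to their corners
at the zeros of `λ`. -/
lemma Field.tendsto_series_lamZero (hF : Field T u h) (hK : K ^ 6 = -1) (hKD : K ∈ closure (D n))
    {B : ℝ} (hg : ∀ᶠ w in 𝓝[closure (D n) \ {K}] K, GoodExp T n j 0 B (a w) (b w))
    (hb : ∀ w i i', b w i - b w i' = z w i - z w i') :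
    Tendsto (fun w => fredholmDet (rowMeasure (Ioi (-T)))
      (gKer (bo T n j) (bV T u w) (a w) (b w))) (𝓝[closure (D n) \ {K}] K) (𝓝 1) ∧
    ∀ p, Tendsto (fun w => gM (rowMeasure (Ioi (-T))) (bo T n j) (bV T u w) (Ioi (-T)) (a w) (b w)
      j p - gCol (Ioi (-T)) (a w) (b w) j p) (𝓝[closure (D n) \ {K}] K) (𝓝 0) := by
  have hT := hF.pos
  have hK0 := ne_zero_of_pow_six hK
  have hK1 := pow_six_ne_one hK
  set Cv := vConst (h 0) K + 1 with hCv
  set W : ℝ × Fin 3 → ℝ := fun p => bWeight h 0 (Real.exp B * Cv) p.1 with hW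
  have hw : Integrable W (rowMeasure (Ioi (-T))) := hF.integrable_bWeight_regular _
  have hdom : ∀ p, ∀ᶠ w in 𝓝[closure (D n) \ {K}] K, Dom W (Real.exp B)
      (gCol (Ioi (-T)) (a w) (b w) j p) (gKer (bo T n j) (bV T u w) (a w) (b w) p)
      (gCol (Ioi (-T)) (a w) (b w) j) (gKer (bo T n j) (bV T u w) (a w) (b w)) := fun p => by
    filter_upwards [hg, eventually_pow_six_ne hK (closure (D n)), nhdsWithin_le_nhds
      ((continuousAt_vConst (h 0) hK0 hK1).eventually_lt_const (lt_add_one _))] with w hw h6 hv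
    exact hF.dom h6.1 h6.2.1 hw hv.le p
  have hbe : ∀ i i', (fun w => b w i + -b w i') = fun w => z w i - z w i' := fun i i' => by
    funext w
    rw [← hb, sub_eq_add_neg]
  -- In every pairing the exponentials of two rows i, i' combine to the frequency z i - z i', and
  -- the coefficient at the integration point is the entry (i, i'). This matching of indices is what
  -- `Field.tendsto_integral_pulse` needs.
  have H1 : ∀ p, Tendsto (fun w => ∫ q, gKer (bo T n j) (bV T u w) (a w) (b w) p q *
      gCol (Ioi (-T)) (a w) (b w) j q ∂(rowMeasure (Ioi (-T)))) (𝓝[closure (D n) \ {K}] K)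
      (𝓝 0) := by
    intro p
    have h1 := (hF.tendsto_integral_pulse (C := Real.exp B * Real.exp B) hK hKD
      (hbe p.2 j ▸ (pulse_row a b T n j p.2 p.1).mul (pulse_source a b T j)) ?_)
    · refine h1.congr' ?_
      filter_upwards [hdom p] with w hd
      rw [integral_rowMeasure (hd.integrable_row_mul_col hw), Finset.sum_eq_single j]
      · refine setIntegral_congr_fun measurableSet_Ioi fun s hs => ?_
        simp only [gKer, gCol]
        rw [if_pos ⟨hs, trivial⟩]
        ring
      · intro i _ hi
        rw [← integral_zero ℝ ℂ (μ := volume.restrict (Ioi (-T)))]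
        congr 1
        funext s
        simp [gCol, hi]
      · simp
    · filter_upwards [hg] with w hw
      constructor
      · have hc : Continuous fun s : ℝ => Complex.exp (a w j * (bx s : ℝ) + b w j * (bt s : ℝ)) := by
          have := continuous_bx
          have := continuous_bt
          fun_prop
        exact ((measurable_rowExp T n j (a w) (b w) p.2).comp measurable_prodMk_left).mul
          hc.measurable
      · intro s hs
        rw [norm_mul]
        refine mul_le_mul (hw.norm_rowExp_le hT p.2 hs) ?_ (norm_nonneg _) (Real.exp_pos _).le
        have := hw.norm_col_le hT (s, j)
        rwa [gCol, if_pos ⟨hs, rfl⟩] at this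
  have H2 : ∀ p y, Tendsto (fun w => ∫ q, gKer (bo T n j) (bV T u w) (a w) (b w) p q *
      gKer (bo T n j) (bV T u w) (a w) (b w) q y ∂(rowMeasure (Ioi (-T))))
      (𝓝[closure (D n) \ {K}] K) (𝓝 0) := by
    intro p y
    by_cases hy : -T < y.1
    swap
    · refine tendsto_const_nhds.congr fun w => ?_
      symm
      rw [← integral_zero (ℝ × Fin 3) ℂ (μ := rowMeasure (Ioi (-T)))]
      congr 1
      funext q
      simp [gKer, bV_of_le hT u w (not_lt.1 hy)]
    have h1 : ∀ i', Tendsto (fun w => ∫ s in Ioi (-T), (rowExp T n j (a w) (b w) p.2 p.1 s *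
        rowExp T n j (a w) (b w) i' s y.1) * bV T u w s p.2 i') (𝓝[closure (D n) \ {K}] K)
        (𝓝 0) := fun i' => by
      refine (hF.tendsto_integral_pulse (C := Real.exp B * Real.exp B) hK hKD
        (hbe p.2 i' ▸ (pulse_row a b T n j p.2 p.1).mul (pulse_col a b T n j i' y.1)) ?_)
      filter_upwards [hg] with w hw
      constructor
      · exact ((measurable_rowExp T n j (a w) (b w) p.2).comp measurable_prodMk_left).mul
          ((measurable_rowExp T n j (a w) (b w) i').comp measurable_prodMk_right)
      · intro s hs
        rw [norm_mul]
        exact mul_le_mul (hw.norm_rowExp_le hT p.2 hs) (hw.norm_rowExp_le hT i' hy)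
          (norm_nonneg _) (Real.exp_pos _).le
    have h2 := tendsto_finsetSum Finset.univ fun i' (_ : i' ∈ Finset.univ) =>
      (h1 i').mul (tendsto_bV (T := T) (u := u) hK0 hK1 (closure (D n) \ {K}) y.1 i' y.2)
    simp only [zero_mul, Finset.sum_const_zero] at h2
    refine h2.congr' ?_
    filter_upwards [hdom p] with w hd
    rw [integral_rowMeasure]
    · refine Finset.sum_congr rfl fun i' _ => ?_
      rw [← integral_mul_const]
      congr 1
      funext s
      simp only [gKer, rowExp]
      ring
    · refine Integrable.mono' (hw.mul_const (W y)) (hd.meas_row.mul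
        (hd.meas_kernel.comp measurable_prodMk_right)).aestronglyMeasurable (ae_of_all _ fun q => ?_)
      rw [norm_mul]
      exact mul_le_mul (hd.norm_row q) (hd.norm_kernel q y) (norm_nonneg _)
        ((norm_nonneg _).trans (hd.norm_row q))
  -- On the diagonal there is no oscillation, but the diagonal entries of both coefficient matrices
  -- vanish at K.
  have H3 : Tendsto (fun w => ∫ q, gKer (bo T n j) (bV T u w) (a w) (b w) q q
      ∂(rowMeasure (Ioi (-T)))) (𝓝[closure (D n) \ {K}] K) (𝓝 0) := by
    have h1 : ∀ i, Tendsto (fun w => ∫ s in Ioi (-T), bo T n j i s s * bV T u w s i i)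
        (𝓝[closure (D n) \ {K}] K) (𝓝 0) := fun i => by
      refine hF.tendsto_integral_pulse (C := 1) hK hKD
        (f := fun _ s => bo T n j i s s) (by simpa using pulse_diag T n j i) ?_
      refine Eventually.of_forall fun w => ⟨(measurable_bo T n j i).comp
        (measurable_id.prodMk measurable_id), fun s _ => ?_⟩
      unfold bo
      split_ifs
      cases contour n i j <;> simp only [orient] <;> split_ifs <;> simp
    have h2 := tendsto_finsetSum Finset.univ fun i' (_ : i' ∈ Finset.univ) => h1 i'
    simp only [Finset.sum_const_zero] at h2
    refine h2.congr' ?_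
    filter_upwards [hdom (0, 0)] with w hd
    rw [integral_rowMeasure]
    · refine Finset.sum_congr rfl fun i' _ => ?_
      congr 1
      funext s
      simp [gKer]
    · exact Integrable.mono' hw (hd.meas_kernel.comp
        (measurable_id.prodMk measurable_id)).aestronglyMeasurable
        (ae_of_all _ fun q => hd.norm_kernel q q)
  constructor
  · have h1 := tendsto_bSeries_sub_corner (μ := rowMeasure (Ioi (-T))) hw
      ((hdom (0, 0)).mono fun w hd => hd.trivial_border)
      (by simpa using tendsto_const_nhds) (by simpa using tendsto_const_nhds)
      (by simpa using tendsto_const_nhds) H2 H3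
    simp_rw [← fredholmDet_eq_bSeries] at h1
    simpa using h1.add_const 1
  · intro p
    exact tendsto_bSeries_sub_corner (μ := rowMeasure (Ioi (-T))) hw (hdom p) (H1 p) (H2 p) H1 H2 H3

/-! ### The columns at the zeros of `λ` -/

variable {T : ℝ} {u : ℝ → ℝ → ℝ} {h : ℝ → ℝ} {n : Fin 18} {j : Fin 3} {K : ℂ}

lemma eventually_regular (hK : K ^ 6 = -1) :
    ∀ᶠ w in 𝓝[closure (D n) \ {K}] K, Regular n w := by
  filter_upwards [eventually_pow_six_ne hK (closure (D n)), self_mem_nhdsWithin] with w hw hm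
  exact ⟨hm.1, hw.1, hw.2.1, hw.2.2⟩

lemma contour_eq_one_iff {i : Fin 3} : contour n i j = Contour.one ↔
    Precedes (lOrder n) i j ∧ ¬Precedes (zOrder n) i j := by
  unfold contour
  split_ifs with h1 h2 <;> simp [*]

lemma contour_eq_two_iff {i : Fin 3} : contour n i j = Contour.two ↔
    Precedes (lOrder n) i j ∧ Precedes (zOrder n) i j := by
  unfold contour
  split_ifs with h1 h2 <;> simp [*]

/-- Near a zero of `λ`, the exponentials stay bounded in the gauge of the reference row. -/
lemma eventually_goodExp (hT : 0 < T) (hK : K ^ 6 = -1) (hKD : K ∈ closure (D n)) {c : Fin 3}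
    (h1 : ∀ i, contour n i j ≠ Contour.one → Precedes (zOrder n) i c ∨ Near n i c)
    (h2 : ∀ i, contour n i j = Contour.one → Precedes (zOrder n) c i ∨ Near n i c) :
    ∀ᶠ w in 𝓝[closure (D n) \ {K}] K, GoodExp T n j 0 (3 * T) (fun i => lDiff w j i - 0)
      (fun i => zDiff w j i - (z w c - z w j)) := by
  filter_upwards [eventually_regular hK, eventually_near hK hKD] with w hw hnear
  have hre : ∀ i, (zDiff w j i - (z w c - z w j)).re = (z w i).re - (z w c).re := fun i => by
    unfold zDiff
    simp
  refine ⟨le_rfl, by positivity, fun i hi => ?_, fun i hi => ?_, by simp, fun i hi => ?_,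
    fun i hi => ?_⟩
  · simpa using re_lDiff_nonpos hw.mem hw.ne_zero hi
  · simpa using re_lDiff_nonneg hw.mem hw.ne_zero hi
  · rw [hre]
    refine mul_le_mul_of_nonneg_right ?_ hT.le
    rcases h1 i hi with h | h
    · linarith [closure_D_re_z hw.mem hw.ne_zero hw.pow_six' h]
    · exact (abs_le.1 (hnear i c h)).2
  · rw [hre, ← neg_mul]
    refine mul_le_mul_of_nonneg_right ?_ hT.le
    rcases h2 i hi with h | h
    · linarith [closure_D_re_z hw.mem hw.ne_zero hw.pow_six' h]
    · exact (abs_le.1 (hnear i c h)).1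

lemma exists_reference_contour (n : Fin 18) (j : Fin 3) : ∃ c : Fin 3,
    (∀ i, contour n i j ≠ Contour.one → Precedes (zOrder n) i c ∨ Near n i c) ∧
    (∀ i, contour n i j = Contour.one → Precedes (zOrder n) c i ∨ Near n i c) ∧
    ((∀ i, contour n i j ≠ Contour.two) ∨ Near n j c) := by
  obtain ⟨c, h1, h2, h3⟩ := exists_reference n j
  refine ⟨c, fun i hi => h1 i fun h => hi (contour_eq_one_iff.2 h), fun i hi => ?_,
    h3.imp_left fun h i hi => h i (contour_eq_two_iff.1 hi)⟩
  obtain ⟨a, b⟩ := contour_eq_one_iff.1 hi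
  exact h2 i a b

/-- The Fredholm series at the zeros of `λ`. -/
lemma Field.tendsto_colDet_lamZero (hF : Field T u h) (hK : K ^ 6 = -1)
    (hKD : K ∈ closure (D n)) :
    Tendsto (fun w => colDet T u n w j) (𝓝[closure (D n) \ {K}] K) (𝓝 1) ∧
    ∀ t ∈ Ico 0 T, ((∀ i, contour n i j ≠ Contour.two) → t = 0) → ∀ i,
      Tendsto (fun w => colM T u n w j (-t, i)) (𝓝[closure (D n) \ {K}] K)
        (𝓝 (if i = j then 1 else 0)) := by
  obtain ⟨c, h1, h2, h3⟩ := exists_reference_contour n j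
  have hg := eventually_goodExp hF.pos hK hKD h1 h2
  obtain ⟨hdet, hM⟩ := hF.tendsto_series_lamZero hK hKD hg (fun w i i' => by unfold zDiff; ring)
  constructor
  · refine hdet.congr fun w => ?_
    exact fredholmDet_shift _ _
  · intro t ht h0 i
    have h4 := hM (-t, i)
    simp_rw [gM_shift, gCol_shift, ← mul_sub] at h4
    have hcol : ∀ w, gCol (Ioi (-T)) (lDiff w j) (zDiff w j) j (-t, i) = if i = j then 1 else 0 := by
      intro w
      unfold gCol
      by_cases hij : i = j
      · rw [if_pos ⟨neg_lt_neg ht.2, hij⟩, if_pos hij]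
        simp [hij]
      · rw [if_neg (fun h => hij h.2), if_neg hij]
    simp_rw [hcol] at h4
    rw [tendsto_iff_norm_sub_tendsto_zero]
    have h5 := (h4.norm.const_mul (Real.exp (3 * T)))
    rw [norm_zero, mul_zero] at h5
    refine squeeze_zero' (Eventually.of_forall fun _ => norm_nonneg _) ?_ h5
    filter_upwards [eventually_near hK hKD] with w hw
    rw [norm_mul, ← mul_assoc]
    refine le_mul_of_one_le_left (norm_nonneg _) ?_
    -- To undo the gauge its factor must not become small: it is 1 at t = 0, and if rows j and c are
    -- near, its norm is at least exp (-3 T).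
    unfold gauge
    rw [Complex.norm_exp, ← Real.exp_add, Real.one_le_exp_iff]
    have hbt : bt (-t) = t := by rw [bt_of_nonpos (by linarith [ht.1]), neg_neg]
    simp only [zero_mul, zero_add, Complex.neg_re, Complex.re_mul_ofReal, hbt, Complex.sub_re]
    have hT := hF.pos
    rcases h3 with h3 | h3
    · rw [h0 h3]
      simpa using hT.le
    · have h6 := (abs_le.1 (hw j c h3)).1
      nlinarith [ht.1, ht.2]

/-- For a column without contours from `(0, 0)`, the notion of solution is invariant under time
shifts. -/
lemma ColSol.shift {k : ℂ} {φ : ℝ → ℝ → Fin 3 → ℂ} (hφ : ColSol T u n k j φ) {τ : ℝ}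
    (hτ : τ ∈ Ico 0 T) (hn : ∀ i, contour n i j ≠ Contour.two) :
    ColSol (T - τ) (fun x t => u x (t + τ)) n k j (fun x t => φ x (t + τ)) := by
  have hm : ∀ t ∈ Ico 0 (T - τ), t + τ ∈ Ico 0 T := fun t ht =>
    ⟨add_nonneg ht.1 hτ.1, by linarith [ht.2]⟩
  obtain ⟨C, hC⟩ := hφ.bdd
  refine ⟨fun t ht => hφ.x_ode (t + τ) (hm t ht), fun x hx t ht i => ?_,
    ⟨C, fun x t hp i => hC x (t + τ) (mem_Omega.2 ⟨(mem_Omega.1 hp).1, hm t (mem_Omega.1 hp).2⟩) i⟩,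
    fun i hi => ?_, fun i hi => absurd hi (hn i), fun i hi t ht => hφ.three i hi (t + τ) (hm t ht)⟩
  · have h1 := hφ.t_ode x hx (t + τ) (hm t ht) i
    have h2 : HasDerivWithinAt (fun s : ℝ => s + τ) 1 (Ico 0 (T - τ)) t :=
      ((hasDerivAt_id t).add_const τ).hasDerivWithinAt
    have h3 := HasDerivWithinAt.scomp t h1 h2 hm
    rw [one_smul] at h3
    exact h3
  · refine (hφ.one i hi).comp (tendsto_nhdsWithin_iff.2 ⟨?_, ?_⟩)
    · have : Tendsto (fun t : ℝ => t + τ) (𝓝 (T - τ)) (𝓝 (T - τ + τ)) :=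
        (continuous_id.add continuous_const).tendsto _
      rw [sub_add_cancel] at this
      exact this.mono_left nhdsWithin_le_nhds
    · filter_upwards [self_mem_nhdsWithin] with t ht
      exact lt_sub_iff_add_lt.1 (mem_Iio.1 ht)

/-- If the column has a contour from (0, 0), the gauge controls all times directly. Otherwise the
column seen from time t on is a column for the shifted field, and Fredholm's formula identifies its
value at time zero with the value sought. At time zero the gauge is trivial. -/
lemma IsSolution.tendsto_colY_lamZero (hu : IsSolution T u) (hF : Field T u h) (hK : K ^ 6 = -1)
    (hKD : K ∈ closure (D n)) {t : ℝ} (ht : t ∈ Ico 0 T) (i : Fin 3) :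
    Tendsto (fun w => colY T u n w j (-t, i)) (𝓝[closure (D n) \ {K}] K)
      (𝓝 (if i = j then 1 else 0)) := by
  obtain ⟨hd, hM⟩ := hF.tendsto_colDet_lamZero (j := j) hK hKD
  by_cases hn : ∀ i, contour n i j ≠ Contour.two
  · have hF' := hF.shift ht.1 ht.2
    obtain ⟨hd', hM'⟩ := hF'.tendsto_colDet_lamZero (j := j) hK hKD
    have h1 := (hM' 0 ⟨le_rfl, hF'.pos⟩ (fun _ => rfl) i).div hd' one_ne_zero
    rw [div_one] at h1
    refine h1.congr' ?_
    filter_upwards [hd.eventually_ne one_ne_zero, hd'.eventually_ne one_ne_zero,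
      eventually_regular hK] with w hw hw' hr
    have h2 := ((hu.colSol hF hr hw).shift ht hn).colDet_mul hF' hr (-0, i)
    rw [bY_neg ⟨le_rfl, hF'.pos⟩, zero_add, hF.colPhi_zero hr.ne_zero hr.pow_six ht] at h2
    simp only [Pi.div_apply]
    rw [← h2, mul_div_cancel_left₀ _ hw']
  · have h1 := (hM t ht (fun h => absurd h hn) i).div hd one_ne_zero
    rwa [div_one] at h1

/-- At a zero of `λ`, the propagator is diagonal. -/
lemma Field.propagator_lamZero (hF : Field T u h) (hK : K ^ 6 = -1) {x t : ℝ} (hx : 0 ≤ x)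
    (ht : t ∈ Ico 0 T) (i : Fin 3) : propagator u K t j j x i = if i = j then 1 else 0 := by
  have hK0 := ne_zero_of_pow_six hK
  have hK1 := pow_six_ne_one hK
  refine (hF.rowODE_propagator hK0 hK1 ht j j).unique (g := fun _ i => if i = j then 1 else 0)
    (fun y _ i => ?_) isRay_Ici (continuousOn_V₁_zero hF hK0 hK1 ht) (fun i => ?_)
    (mem_Ici.2 hx) i
  · have h0 : lDiff K j i * (if i = j then 1 else 0) +
        ∑ i', V₁ u K y t i i' * (if i' = j then (1 : ℂ) else 0) = 0 := by
      rw [V₁_lamZero hK]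
      by_cases hij : i = j
      · simp [hij]
      · simp [hij]
    rw [h0]
    exact hasDerivWithinAt_const y (Ici (0 : ℝ)) (if i = j then (1 : ℂ) else 0)
  · exact hF.propagator_zero hK0 hK1 ht j j i

/-- The propagator is holomorphic at K even though z is not, as it involves only the x-equation. The
limit of the boundary values selects c = j, and at K this column of the propagator is constant. -/
theorem IsSolution.tendsto_colPhi_lamZero (hu : IsSolution T u) (hF : Field T u h)
    (hK : K ^ 6 = -1) (hKD : K ∈ closure (D n)) {x t : ℝ} (hp : (x, t) ∈ Omega T) (i : Fin 3) :
    Tendsto (fun w => colPhi T u n w j x t i) (𝓝[closure (D n) \ {K}] K)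
      (𝓝 (if i = j then 1 else 0)) := by
  obtain ⟨hx, ht⟩ := mem_Omega.1 hp
  have h1 := tendsto_finsetSum Finset.univ fun c (_ : c ∈ Finset.univ) =>
    ((hF.differentiableAt_propagator (ne_zero_of_pow_six hK) (pow_six_ne_one hK) ht j c x
      i).continuousAt.tendsto.mono_left (nhdsWithin_le_nhds (s := closure (D n) \ {K}))).mul
    (hu.tendsto_colY_lamZero (j := j) hF hK hKD ht c)
  simp only [mul_ite, mul_one, mul_zero, Finset.sum_ite_eq', Finset.mem_univ, if_true,
    hF.propagator_lamZero hK hx ht] at h1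
  exact h1

/-! ### Dependence of the columns on the spectral parameter -/

variable {T : ℝ} {u : ℝ → ℝ → ℝ} {h : ℝ → ℝ} {n : Fin 18} {j : Fin 3} {k : ℂ}

lemma differentiableAt_lDiff (hk : k ≠ 0) (j i : Fin 3) :
    DifferentiableAt ℂ (fun w => lDiff w j i) k :=
  (differentiableAt_l hk i).sub (differentiableAt_l hk j)

lemma differentiableAt_zDiff (hk : k ≠ 0) (hk6 : k ^ 6 ≠ -1) (j i : Fin 3) :
    DifferentiableAt ℂ (fun w => zDiff w j i) k :=
  (differentiableAt_z hk hk6 i).sub (differentiableAt_z hk hk6 j)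

lemma differentiableAt_bV (hk : k ≠ 0) (hk6 : k ^ 6 ≠ 1) (s : ℝ) (i i' : Fin 3) :
    DifferentiableAt ℂ (fun w => bV T u w s i i') k := by
  unfold bV
  split_ifs
  · exact differentiableAt_V₁ u s 0 i i' hk hk6
  · exact (differentiableAt_V₂ u 0 (-s) i i' hk hk6).neg
  · exact differentiableAt_const _

lemma eventually_pow_six (h0 : k ≠ 0) (h1 : k ^ 6 ≠ 1) (h2 : k ^ 6 ≠ -1) :
    ∀ᶠ w in 𝓝 k, w ≠ 0 ∧ w ^ 6 ≠ 1 ∧ w ^ 6 ≠ -1 := by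
  have hc : ContinuousAt (fun w : ℂ => w ^ 6) k := by fun_prop
  filter_upwards [isOpen_ne.mem_nhds h0, hc.eventually_ne h1, hc.eventually_ne h2] with w a b c
  exact ⟨a, b, c⟩

lemma eventually_vConst (H : ℝ) (h0 : k ≠ 0) (h1 : k ^ 6 ≠ 1) :
    ∀ᶠ w in 𝓝 k, vConst H w ≤ vConst H k + 1 :=
  ((continuousAt_vConst H h0 h1).eventually_lt_const (lt_add_one _)).mono fun _ h => h.le

lemma eventually_norm_zDiff (h0 : k ≠ 0) (h2 : k ^ 6 ≠ -1) (j : Fin 3) :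
    ∀ᶠ w in 𝓝 k, ∀ i, ‖zDiff w j i‖ ≤ zBound k j + 1 := by
  rw [eventually_all]
  intro i
  have hc := (differentiableAt_zDiff h0 h2 j i).continuousAt.norm
  exact (hc.eventually_lt_const (lt_of_le_of_lt (norm_zDiff_le k j i) (lt_add_one _))).mono
    fun _ h => h.le

/-- Where the exponentials are locally bounded, the Fredholm series are analytic. -/
lemma Field.analyticAt_series (hF : Field T u h) (h0 : k ≠ 0) (h1 : k ^ 6 ≠ 1) (h2 : k ^ 6 ≠ -1)
    {ε B : ℝ} {g : ℂ} (hε : IntegrableOn (fun x => h x * Real.exp (2 * ε * x)) (Ici 0))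
    (hg : ∀ᶠ w in 𝓝 k, GoodExp T n j ε B (fun i => lDiff w j i - g) (fun i => zDiff w j i - 0)) :
    AnalyticAt ℂ (fun w => colDet T u n w j) k ∧
      ∀ p, AnalyticAt ℂ (fun w => colM T u n w j p) k := by
  obtain ⟨U, hU, hUo, hkU⟩ := eventually_nhds_iff.1
    (hg.and ((eventually_pow_six h0 h1 h2).and (eventually_vConst (h 0) h0 h1)))
  have hw : Integrable (fun p : ℝ × Fin 3 => bWeight h ε (Real.exp B * (vConst (h 0) k + 1)) p.1)
      (rowMeasure (Ioi (-T))) := integrable_weight (hF.integrableOn_bWeight _ hε)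
  have hdom := fun p w (hw : w ∈ U) =>
    hF.dom (hU w hw).2.1.1 (hU w hw).2.1.2.1 (hU w hw).1 (hU w hw).2.2 p
  have ha : ∀ i, DifferentiableOn ℂ (fun w => lDiff w j i - g) U := fun i w hw =>
    ((differentiableAt_lDiff (hU w hw).2.1.1 j i).sub_const g).differentiableWithinAt
  have hb : ∀ i, DifferentiableOn ℂ (fun w => zDiff w j i - 0) U := fun i w hw =>
    ((differentiableAt_zDiff (hU w hw).2.1.1 (hU w hw).2.1.2.2 j i).sub_const
      0).differentiableWithinAt
  have hV : ∀ s i i', DifferentiableOn ℂ (fun w => bV T u w s i i') U := fun s i i' w hw =>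
    (differentiableAt_bV (hU w hw).2.1.1 (hU w hw).2.1.2.1 s i i').differentiableWithinAt
  constructor
  · have hd := differentiableOn_bSeries hUo hw (fun w hw => (hdom (0, 0) w hw).trivial_border)
      (differentiableOn_const _) (fun _ => differentiableOn_const _)
      (fun _ => differentiableOn_const _) (differentiableOn_gKer hV ha hb)
    simp_rw [← fredholmDet_eq_bSeries, fredholmDet_shift] at hd
    exact hd.analyticAt (hUo.mem_nhds hkU)
  · intro p
    have hd := differentiableOn_bSeries hUo hw (hdom p) (differentiableOn_gCol ha hb p)
      (differentiableOn_gKer hV ha hb p) (differentiableOn_gCol ha hb)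
      (differentiableOn_gKer hV ha hb)
    -- The gauge is a fixed number at p, independent of w, so it affects no analyticity.
    have e : (fun w => colM T u n w j p) = fun w => (gauge g 0 p)⁻¹ *
        gM (rowMeasure (Ioi (-T))) (bo T n j) (bV T u w) (Ioi (-T)) (fun i => lDiff w j i - g)
          (fun i => zDiff w j i - 0) j p := by
      funext w
      rw [gM_shift, inv_mul_cancel_left₀ (gauge_ne_zero _ _ _)]
      rfl
    rw [e]
    exact (hd.const_mul _).analyticAt (hUo.mem_nhds hkU)

/-- The Fredholm series are analytic off the rays on which two of the `Re l`'s coincide. -/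
lemma Field.analyticAt_of_sector (hF : Field T u h) (hk : k ∈ sector n) (h2 : k ^ 6 ≠ -1)
    (j : Fin 3) : AnalyticAt ℂ (fun w => colDet T u n w j) k ∧
      ∀ p, AnalyticAt ℂ (fun w => colM T u n w j p) k := by
  have h0 := sector_ne_zero hk
  refine hF.analyticAt_series (g := 0) (B := (zBound k j + 1) * T) h0 (sector_pow_six hk) h2
    hF.integrableOn_exp_zero ?_
  filter_upwards [(isOpen_sector n).mem_nhds hk, eventually_norm_zDiff h0 h2 j] with w hw hz
  refine goodExp_of_re hF.pos le_rfl (fun i hi => ?_) (fun i hi => ?_) (by simp) (by simpa using hz)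
  · have := hw i j (precedes_of_contour hi)
    simp only [lDiff, sub_zero, Complex.sub_re]
    linarith
  · simp only [lDiff, sub_zero, Complex.sub_re, mul_zero, neg_zero]
    rcases precedes_or_eq_of_contour_three hi with h | h
    · rw [h]; simp
    · linarith [hw j i h]

/-- For exponentially decaying solutions the Fredholm determinant is analytic across the rays. -/
lemma Field.analyticAt_of_expDecay {C δ : ℝ} (hδ : 0 < δ)
    (hF : Field T u (fun x => C * Real.exp (-δ * x))) (hk : Regular n k) (j : Fin 3) :
    AnalyticAt ℂ (fun w => colDet T u n w j) k := by
  have h0 := hk.ne_zero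
  -- Near k the real parts drift by less than δ/4. Lowering them by δ/4 keeps them non-positive on
  -- contours one and two and above -δ/2 = -2 ε on contour three. The weight becomes C exp (-δ x /
  -- 2), which is still integrable.
  refine (hF.analyticAt_series (ε := δ / 4) (g := (δ / 4 : ℝ)) (B := (zBound k j + 1) * T) h0
    hk.pow_six hk.pow_six' ?_ ?_).1
  · have h1 := ((integrableOn_Ici_iff_integrableOn_Ioi (b := (0 : ℝ))).2
      (integrableOn_exp_mul_Ioi (a := -(δ / 2)) (by linarith) 0)).const_mul C
    refine h1.congr (ae_of_all _ fun x => ?_)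
    simp only
    rw [mul_assoc, ← Real.exp_add]
    congr 2
    ring
  · have hl : ∀ᶠ w in 𝓝 k, ∀ i, |(lDiff w j i).re - (lDiff k j i).re| < δ / 4 := by
      rw [eventually_all]
      intro i
      have hc : ContinuousAt (fun w => (lDiff w j i).re) k :=
        Complex.continuous_re.continuousAt.comp (differentiableAt_lDiff h0 j i).continuousAt
      exact Metric.tendsto_nhds.1 hc.tendsto (δ / 4) (by linarith)
    filter_upwards [hl, eventually_norm_zDiff h0 hk.pow_six' j] with w hw hz
    refine goodExp_of_re hF.pos (by linarith) (fun i hi => ?_) (fun i hi => ?_) ?_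
      (by simpa using hz)
    · have h1 := re_lDiff_nonpos hk.mem h0 hi
      have h2 := (abs_lt.1 (hw i)).2
      rw [Complex.sub_re, Complex.ofReal_re]
      linarith
    · have h1 := re_lDiff_nonneg hk.mem h0 hi
      have h2 := (abs_lt.1 (hw i)).1
      rw [Complex.sub_re, Complex.ofReal_re]
      linarith
    · rw [lDiff_self, Complex.sub_re, Complex.ofReal_re, Complex.zero_re]
      linarith

/-- The Fredholm series are continuous on the closure of `D n`. -/
lemma Field.continuousWithinAt_series (hF : Field T u h) (hk : Regular n k) (j : Fin 3) :
    ContinuousWithinAt (fun w => colDet T u n w j) (closure (D n)) k ∧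
      ∀ p, ContinuousWithinAt (fun w => colM T u n w j p) (closure (D n)) k := by
  have h0 := hk.ne_zero
  have h1 := hk.pow_six
  have h2 := hk.pow_six'
  have hw : Integrable (fun p : ℝ × Fin 3 => bWeight h 0
      (Real.exp ((zBound k j + 1) * T) * (vConst (h 0) k + 1)) p.1) (rowMeasure (Ioi (-T))) :=
    hF.integrable_bWeight_regular _
  have hdom : ∀ p, ∀ᶠ w in 𝓝[closure (D n)] k, Dom (fun p : ℝ × Fin 3 => bWeight h 0
      (Real.exp ((zBound k j + 1) * T) * (vConst (h 0) k + 1)) p.1)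
      (Real.exp ((zBound k j + 1) * T))
      (gCol (Ioi (-T)) (lDiff w j) (zDiff w j) j p) (bKer T u n w j p)
      (gCol (Ioi (-T)) (lDiff w j) (zDiff w j) j) (bKer T u n w j) := fun p => by
    filter_upwards [self_mem_nhdsWithin, nhdsWithin_le_nhds (eventually_pow_six h0 h1 h2),
      nhdsWithin_le_nhds (eventually_vConst (h 0) h0 h1),
      nhdsWithin_le_nhds (eventually_norm_zDiff h0 h2 j)] with w hD h6 hv hz
    exact hF.dom h6.1 h6.2.1 (goodExp_of_re hF.pos le_rfl
      (fun i hi => re_lDiff_nonpos hD h6.1 hi)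
      (fun i hi => by simpa using re_lDiff_nonneg hD h6.1 hi) (by simp) hz) hv p
  have ha : ∀ i, Tendsto (fun w => lDiff w j i) (𝓝[closure (D n)] k) (𝓝 (lDiff k j i)) := fun i =>
    (differentiableAt_lDiff h0 j i).continuousAt.continuousWithinAt
  have hb : ∀ i, Tendsto (fun w => zDiff w j i) (𝓝[closure (D n)] k) (𝓝 (zDiff k j i)) := fun i =>
    (differentiableAt_zDiff h0 h2 j i).continuousAt.continuousWithinAt
  have hV := tendsto_bV (T := T) (u := u) h0 h1 (closure (D n))
  constructor
  · have ht := tendsto_bSeries hw ((hdom (0, 0)).mono fun w hw => hw.trivial_border)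
      tendsto_const_nhds (fun _ => tendsto_const_nhds) (fun _ => tendsto_const_nhds)
      (tendsto_gKer hV ha hb)
    simp_rw [← fredholmDet_eq_bSeries] at ht
    exact ht
  · intro p
    exact tendsto_bSeries hw (hdom p) (tendsto_gCol ha hb p) (tendsto_gKer hV ha hb p)
      (tendsto_gCol ha hb) (tendsto_gKer hV ha hb)

/-! ### The zeros of the Fredholm determinant -/

lemma Field.tendsto_eigenDet_lamZero {K : ℂ} (hF : Field T u h) (hK : K ^ 6 = -1)
    (hKD : K ∈ closure (D n)) :
    Tendsto (eigenDet T u n) (𝓝[closure (D n) \ {K}] K) (𝓝 1) := by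
  have h1 := tendsto_finsetProd Finset.univ fun j (_ : j ∈ Finset.univ) =>
    (hF.tendsto_colDet_lamZero (j := j) hK hKD).1
  simp only [Finset.prod_const_one] at h1
  exact h1.congr fun w => (eigenDet_eq T u n w).symm

lemma eigenDet_ne_zero_iff : eigenDet T u n k ≠ 0 ↔ ∀ j, colDet T u n k j ≠ 0 := by
  rw [eigenDet_eq, Finset.prod_ne_zero_iff]
  simp

lemma Field.analyticAt_eigenDet (hF : Field T u h) (hk : k ∈ sector n) (h2 : k ^ 6 ≠ -1) :
    AnalyticAt ℂ (eigenDet T u n) k := by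
  rw [show eigenDet T u n = fun w => ∏ j, colDet T u n w j from funext (eigenDet_eq T u n)]
  exact Finset.univ.analyticAt_fun_prod fun j _ => (hF.analyticAt_of_sector hk h2 j).1

/-- The Fredholm determinant does not vanish identically. -/
lemma Field.not_eventually_eigenDet_eq_zero (hF : Field T u h) (hk : k ∈ sector n)
    (h2 : k ^ 6 ≠ -1) : ¬∀ᶠ w in 𝓝 k, eigenDet T u n w = 0 := by
  intro hz
  obtain ⟨K, hK, hKD⟩ := exists_lamZero n
  have hKs := lamZero_mem_sector hK hKD
  have hmem : ∀ w ∈ sector n \ {K}, w ^ 6 ≠ -1 := fun w hw h6 =>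
    hw.2 (eq_of_pow_six hw.1 h6 hKs hK)
  have han : AnalyticOnNhd ℂ (eigenDet T u n) (sector n \ {K}) := fun w hw =>
    hF.analyticAt_eigenDet hw.1 (hmem w hw)
  -- By the identity theorem local vanishing would spread over the sector punctured at K,
  -- contradicting the limit 1 along `D n` at K.
  have hzero := han.eqOn_zero_of_preconnected_of_eventuallyEq_zero
    (isPreconnected_convex_diff_singleton (convex_sector n) (isOpen_sector n) hKs)
    ⟨hk, by rintro rfl; exact h2 hK⟩ hz
  have hKn : K ∉ D n := fun h => D_pow_six h hK
  have hsub : D n ⊆ closure (D n) \ {K} := fun w hw =>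
    ⟨subset_closure hw, by rintro rfl; exact hKn hw⟩
  have hne : (𝓝[D n] K).NeBot := mem_closure_iff_nhdsWithin_neBot.1 hKD
  have h1 := ((hF.tendsto_eigenDet_lamZero hK hKD).mono_left
    (nhdsWithin_mono K hsub)).eventually_ne one_ne_zero
  obtain ⟨w, hw, hwD⟩ := (h1.and self_mem_nhdsWithin).exists
  exact hw (hzero ⟨D_subset_sector n hwD, (hsub hwD).2⟩)

lemma Field.eventually_notMem_of_pow_six (hF : Field T u h) (hk : k ∈ closure (D n))
    (h2 : k ^ 6 = -1) : ∀ᶠ w in 𝓝[≠] k, w ∉ detZeros T u n := by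
  have h1 := (hF.tendsto_eigenDet_lamZero h2 hk).eventually_ne one_ne_zero
  rw [eventually_nhdsWithin_iff] at h1 ⊢
  filter_upwards [h1] with w hw hne hz
  exact hw ⟨hz.1, hne⟩ hz.2.2.2

lemma Field.eventually_notMem_detZeros (hF : Field T u h) (hk : k ∈ closure (D n))
    (him : (k ^ 3).im ≠ 0) : ∀ᶠ w in 𝓝[≠] k, w ∉ detZeros T u n := by
  by_cases h2 : k ^ 6 = -1
  · exact hF.eventually_notMem_of_pow_six hk h2
  have hs := mem_sector_of_closure hk him
  rcases (hF.analyticAt_eigenDet hs h2).eventually_eq_zero_or_eventually_ne_zero with h | h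
  · exact absurd h (hF.not_eventually_eigenDet_eq_zero hs h2)
  · exact h.mono fun w hw hz => hw hz.2.2.2

lemma Field.eventually_notMem_detZeros_of_expDecay {C δ : ℝ} (hδ : 0 < δ)
    (hF : Field T u (fun x => C * Real.exp (-δ * x))) (hk : k ∈ closure (D n) \ exceptional) :
    ∀ᶠ w in 𝓝[≠] k, w ∉ detZeros T u n := by
  by_cases h2 : k ^ 6 = -1
  · exact hF.eventually_notMem_of_pow_six hk.1 h2
  have hr : Regular n k := ⟨hk.1, fun h => hk.2 (Or.inl h), fun h => hk.2 (Or.inr h), h2⟩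
  have han : AnalyticAt ℂ (eigenDet T u n) k := by
    rw [show eigenDet T u n = fun w => ∏ j, colDet T u n w j from funext (eigenDet_eq T u n)]
    exact Finset.univ.analyticAt_fun_prod fun j _ => hF.analyticAt_of_expDecay hδ hr j
  rcases han.eventually_eq_zero_or_eventually_ne_zero with h | h
  -- The point k may lie on a ray outside the sector. Vanishing near k would however include
  -- vanishing near a point of `D n`, which is already excluded.
  · obtain ⟨U, hU, hUo, hkU⟩ := eventually_nhds_iff.1 h
    obtain ⟨d, hdU, hdD⟩ := mem_closure_iff.1 hk.1 U hUo hkU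
    exact absurd (eventually_nhds_iff.2 ⟨U, hU, hUo, hdU⟩)
      (hF.not_eventually_eigenDet_eq_zero (D_subset_sector n hdD) (D_pow_six hdD))
  · exact h.mono fun w hw hz => hw hz.2.2.2

lemma Field.eventually_notMem_of_notMem (hF : Field T u h)
    (hk : k ∈ closure (D n) \ (exceptional ∪ detZeros T u n)) :
    ∀ᶠ w in 𝓝 k, w ∉ detZeros T u n := by
  have hkn : k ∉ detZeros T u n := fun h => hk.2 (Or.inr h)
  by_cases h2 : k ^ 6 = -1
  · have h1 := hF.eventually_notMem_of_pow_six hk.1 h2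
    rw [eventually_nhdsWithin_iff] at h1
    filter_upwards [h1] with w hw
    by_cases hwk : w = k
    · rwa [hwk]
    · exact hw hwk
  have hr : Regular n k := ⟨hk.1, fun h => hk.2 (Or.inl (Or.inl h)),
    fun h => hk.2 (Or.inl (Or.inr h)), h2⟩
  have hf : eigenDet T u n k ≠ 0 := fun hz => hkn ⟨hk.1, fun h => hk.2 (Or.inl h), h2, hz⟩
  have hc : ContinuousWithinAt (eigenDet T u n) (closure (D n)) k := by
    rw [show eigenDet T u n = fun w => ∏ j, colDet T u n w j from funext (eigenDet_eq T u n)]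
    exact tendsto_finsetProd Finset.univ fun j _ => (hF.continuousWithinAt_series hr j).1
  have h1 := hc.eventually_ne hf
  rw [eventually_nhdsWithin_iff] at h1
  filter_upwards [h1] with w hw hz
  exact hw hz.1 hz.2.2.2

/-! ### The eigenfunctions -/

variable {T : ℝ} {u : ℝ → ℝ → ℝ} {h : ℝ → ℝ} {n : Fin 18} {k : ℂ}

lemma Field.expDecay (hT : 0 < T) (hu : IsSolution T u) {C δ : ℝ} (hδ : 0 < δ)
    (hb : BoundedBy T u (fun x => C * Real.exp (-δ * x))) :
    Field T u (fun x => C * Real.exp (-δ * x)) := by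
  have hC : 0 ≤ C := by
    have := (abs_nonneg _).trans (hb 0 0 (mem_Omega.2 ⟨le_rfl, le_rfl, hT⟩)).1
    simpa using this
  refine hu.field hT hb (fun x _ y _ hxy => ?_) ?_
  · refine mul_le_mul_of_nonneg_left (Real.exp_le_exp.2 ?_) hC
    nlinarith
  · exact ((integrableOn_Ici_iff_integrableOn_Ioi (b := (0 : ℝ))).2
      (integrableOn_exp_mul_Ioi (a := -δ) (by linarith) 0)).const_mul C

lemma regular_of_notMem
    (hk : k ∈ closure (D n) \ (exceptional ∪ lamZeros ∪ detZeros T u n)) : Regular n k :=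
  ⟨hk.1, fun h => hk.2 (Or.inl (Or.inl (Or.inl h))), fun h => hk.2 (Or.inl (Or.inl (Or.inr h))),
    fun h => hk.2 (Or.inl (Or.inr h))⟩

lemma Regular.colDet_ne_zero (hk : Regular n k) (hz : k ∉ detZeros T u n) (j : Fin 3) :
    colDet T u n k j ≠ 0 :=
  eigenDet_ne_zero_iff.1 (fun h0 => hz ⟨hk.mem, fun h => h.elim hk.ne_zero hk.pow_six,
    hk.pow_six', h0⟩) j

theorem IsEigenfunction.unique {Φ Ψ : ℝ → ℝ → Matrix (Fin 3) (Fin 3) ℂ} (hF : Field T u h)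
    (hk : Regular n k) (hz : k ∉ detZeros T u n) (hΦ : IsEigenfunction T u n k Φ)
    (hΨ : IsEigenfunction T u n k Ψ) {x t : ℝ} (hp : (x, t) ∈ Omega T) : Φ x t = Ψ x t := by
  obtain ⟨hx, ht⟩ := mem_Omega.1 hp
  ext i j
  have h1 := hΦ.colSol hF hk j
  have h2 := hΨ.colSol hF hk j
  refine (h1.x_ode t ht).unique (h2.x_ode t ht) isRay_Ici
    (continuousOn_V₁_zero hF hk.ne_zero hk.pow_six ht) (fun i => ?_) (mem_Ici.2 hx) i
  have e1 := h1.colDet_mul hF hk (-t, i)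
  have e2 := h2.colDet_mul hF hk (-t, i)
  rw [bY_neg ht] at e1 e2
  exact mul_left_cancel₀ (hk.colDet_ne_zero hz j) (e1.trans e2.symm)

open Classical in
/-- The eigenfunction, continued by its limit to the zeros of `λ`. -/
def eigenfunction (T : ℝ) (u : ℝ → ℝ → ℝ) (n : Fin 18) (k : ℂ) (x t : ℝ) :
    Matrix (Fin 3) (Fin 3) ℂ :=
  if k ^ 6 = -1 then 1 else Matrix.of fun i j => colPhi T u n k j x t i

lemma eigenfunction_apply (hk : k ^ 6 ≠ -1) (x t : ℝ) (i j : Fin 3) :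
    eigenfunction T u n k x t i j = colPhi T u n k j x t i := by
  rw [eigenfunction, if_neg hk, Matrix.of_apply]

theorem IsSolution.isEigenfunction (hu : IsSolution T u) (hF : Field T u h) (hk : Regular n k)
    (hz : k ∉ detZeros T u n) : IsEigenfunction T u n k (eigenfunction T u n k) := by
  refine isEigenfunction_of_colSol hF hk fun j => ?_
  simp_rw [eigenfunction_apply hk.pow_six']
  exact hu.colSol hF hk (hk.colDet_ne_zero hz j)

lemma eventually_eigenfunction_eq (hk : k ^ 6 ≠ -1) (x t : ℝ) (i j : Fin 3) :
    (fun w => eigenfunction T u n w x t i j) =ᶠ[𝓝 k] fun w => colPhi T u n w j x t i := by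
  have hc : ContinuousAt (fun w : ℂ => w ^ 6) k := by fun_prop
  filter_upwards [hc.eventually_ne hk] with w hw
  exact eigenfunction_apply hw x t i j

lemma Field.analyticAt_eigenfunction (hF : Field T u h) (hk : k ∈ D n)
    (hz : k ∉ detZeros T u n) {x t : ℝ} (hp : (x, t) ∈ Omega T) (i j : Fin 3) :
    AnalyticAt ℂ (fun w => eigenfunction T u n w x t i j) k := by
  have hs := D_subset_sector n hk
  have h0 := sector_ne_zero hs
  have h1 := sector_pow_six hs
  have h2 := D_pow_six hk
  have hr : Regular n k := ⟨subset_closure hk, h0, h1, h2⟩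
  obtain ⟨hd, hM⟩ := hF.analyticAt_of_sector hs h2 j
  rw [analyticAt_congr (eventually_eigenfunction_eq h2 x t i j)]
  refine Finset.univ.analyticAt_fun_sum fun c _ => AnalyticAt.mul ?_
    ((hM (-t, c)).div hd (hr.colDet_ne_zero hz j))
  rw [Complex.analyticAt_iff_eventually_differentiableAt]
  filter_upwards [eventually_pow_six h0 h1 h2] with w hw
  exact hF.differentiableAt_propagator hw.1 hw.2.1 (mem_Omega.1 hp).2 j c x i

/-- At a zero of λ the value assigned by definition is the limit found in
`IsSolution.tendsto_colPhi_lamZero`. At the other points numerator and determinant are continuous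
along the closure and the determinant is nonzero. -/
lemma IsSolution.continuousOn_eigenfunction (hu : IsSolution T u) (hF : Field T u h) {x t : ℝ}
    (hp : (x, t) ∈ Omega T) (i j : Fin 3) :
    ContinuousOn (fun w => eigenfunction T u n w x t i j)
      (closure (D n) \ (exceptional ∪ detZeros T u n)) := by
  intro k hk
  by_cases h2 : k ^ 6 = -1
  · rw [← continuousWithinAt_sdiff_self]
    have h1 := (hu.tendsto_colPhi_lamZero (j := j) hF h2 hk.1 hp i).mono_left
      (nhdsWithin_mono k (sdiff_subset_sdiff_left (t := {k})
        (sdiff_subset (s := closure (D n)) (t := exceptional ∪ detZeros T u n))))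
    have e : eigenfunction T u n k x t i j = if i = j then 1 else 0 := by
      rw [eigenfunction, if_pos h2, Matrix.one_apply]
    unfold ContinuousWithinAt
    simp only [e]
    refine h1.congr' ?_
    filter_upwards [eventually_pow_six_ne h2 _] with w hw
    exact (eigenfunction_apply hw.2.2 x t i j).symm
  · have hr : Regular n k := ⟨hk.1, fun h => hk.2 (Or.inl (Or.inl h)),
      fun h => hk.2 (Or.inl (Or.inr h)), h2⟩
    have hz : k ∉ detZeros T u n := fun h => hk.2 (Or.inr h)
    obtain ⟨hd, hM⟩ := hF.continuousWithinAt_series hr j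
    have hc : ContinuousWithinAt (fun w => colPhi T u n w j x t i) (closure (D n)) k := by
      refine tendsto_finsetSum Finset.univ fun c _ => Tendsto.mul ?_
        ((hM (-t, c)).div hd (hr.colDet_ne_zero hz j))
      exact (hF.differentiableAt_propagator hr.ne_zero hr.pow_six (mem_Omega.1 hp).2 j c x
        i).continuousAt.continuousWithinAt
    refine (hc.mono sdiff_subset).congr_of_eventuallyEq
      (nhdsWithin_le_nhds (eventually_eigenfunction_eq h2 x t i j)) ?_
    exact eigenfunction_apply h2 x t i j

end DP

end

/-- The four parts: (1) the zeros of the Fredholm determinant do not accumulate at any point of the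
closure of `D_n` off the rays `k³ ∈ ℝ` (these rays contain no point of `D_n`), nor anywhere in that
closure away from `0` and the sixth roots of unity if the decay is exponential, and they always form
a relatively closed set; (2) uniqueness and (3) existence of `Φ_n`; (4) its properties in `k`, with
the continuous extension to the points `K_j` at which the integral equation itself is singular. -/
theorem mainTheorem5 (T : ℝ) (hT : 0 < T) (u : ℝ → ℝ → ℝ) (hu : DP.IsSolution T u) (n : Fin 18) :
    ((∀ k ∈ closure (DP.D n), (k ^ 3).im ≠ 0 →
        ∀ᶠ w in 𝓝[≠] k, w ∉ DP.detZeros T u n) ∧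
      (DP.ExpDecay T u → ∀ k ∈ closure (DP.D n) \ DP.exceptional,
        ∀ᶠ w in 𝓝[≠] k, w ∉ DP.detZeros T u n) ∧
      (∀ k ∈ closure (DP.D n) \ (DP.exceptional ∪ DP.detZeros T u n),
        ∀ᶠ w in 𝓝 k, w ∉ DP.detZeros T u n)) ∧
    (∀ k ∈ closure (DP.D n) \ (DP.exceptional ∪ DP.lamZeros ∪ DP.detZeros T u n),
      ∀ Φ Ψ : ℝ → ℝ → Matrix (Fin 3) (Fin 3) ℂ,
        DP.IsEigenfunction T u n k Φ → DP.IsEigenfunction T u n k Ψ →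
          ∀ x t, (x, t) ∈ DP.Omega T → Φ x t = Ψ x t) ∧
    ∃ Φ : ℂ → ℝ → ℝ → Matrix (Fin 3) (Fin 3) ℂ,
      (∀ k ∈ closure (DP.D n) \ (DP.exceptional ∪ DP.lamZeros ∪ DP.detZeros T u n),
        DP.IsEigenfunction T u n k (Φ k)) ∧
      ∀ x t, (x, t) ∈ DP.Omega T → ∀ i j,
        AnalyticOnNhd ℂ (fun k => Φ k x t i j) (DP.D n \ DP.detZeros T u n) ∧
        ContinuousOn (fun k => Φ k x t i j)
          (closure (DP.D n) \ (DP.exceptional ∪ DP.detZeros T u n)) ∧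
        (∀ S : Set ℂ, IsCompact S →
          S ⊆ closure (DP.D n) \ (DP.exceptional ∪ DP.detZeros T u n) →
          ∃ C : ℝ, ∀ k ∈ S, ‖Φ k x t i j‖ ≤ C) := by
  obtain ⟨h, ha, hi, hb⟩ := hu.decay
  have hF := hu.field hT hb ha hi
  refine ⟨⟨fun k hk him => hF.eventually_notMem_detZeros hk him, ?_,
    fun k hk => hF.eventually_notMem_of_notMem hk⟩, fun k hk Φ Ψ hΦ hΨ x t hp =>
      hΦ.unique hF (DP.regular_of_notMem hk) (fun hz => hk.2 (Or.inr hz)) hΨ hp,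
    DP.eigenfunction T u n, fun k hk => hu.isEigenfunction hF (DP.regular_of_notMem hk)
      (fun hz => hk.2 (Or.inr hz)), fun x t hp i j => ?_⟩
  · rintro ⟨C, δ, hδ, hE⟩ k hk
    exact (DP.Field.expDecay hT hu hδ hE).eventually_notMem_detZeros_of_expDecay hδ hk
  · have hc := hu.continuousOn_eigenfunction (n := n) hF hp i j
    exact ⟨fun k hk => hF.analyticAt_eigenfunction hk.1 hk.2 hp i j, hc,
      fun S hS hsub => hS.exists_bound_of_continuousOn (hc.mono hsub)⟩
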